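/- **Setting.** Let $G$ be a simple biconnected plane graph (given with the counter-clockwise cyclic order of the edges around each vertex), and let $\mathcal R=(\phi,F_{\mathsf c},F_{\mathsf o})$ be an ortho-radial representation of $G$: $\phi$ assigns an angle in $\{90^\circ,180^\circ,270^\circ\}$ to each corner, and $F_{\mathsf c}$, $F_{\mathsf o}$ are faces designated as the central and the outer face. Assume that the angles around each vertex sum to $360^\circ$, and that the angles of a face with $k$ corners sum to $(k+2)\cdot180^\circ$ if it is both central and outer, to $k\cdot180^\circ$ if it is exactly one of them, and to $(k-2)\cdot180^\circ$ otherwise. The facial cycle $C_F$ of a face $F$ is the traversal of its contour with $F$ on the right. Let $e^\star$ be a reference edge on the reversal $\overline{C_{F_{\mathsf o}}}$. Declaring that $e^\star$ points east (clockwise around the origin), and turning at each vertex as prescribed by $\phi$, gives each directed edge one of the directions east, south (towards the origin), west, north (away from the origin). Let $E_{\mathsf h}$ be the set of edges directed east and $E_{\mathsf v}$ the set of edges directed north. A horizontal segment is a connected component $S=(v_1,\dots,v_t)$ of the graph formed by $E_{\mathsf h}$, listed from west to east; it is a path or a cycle. $\mathcal N_{\mathsf{north}}(S)$ is the set of edges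 $(x,y)\in E_{\mathsf v}$ with $x\in S$, ordered (circularly if $S$ is a cycle) by the position of $x$ in $S$. For a sequence $A=(S_1,\dots,S_k)$ of horizontal segments, let $G_i$ be the subgraph formed by the edges of $S_1,\dots,S_i$ and all vertical edges with both endpoints in these segments. Subgraphs inherit embedding, angles, central face and outer face. Let $\mathcal N_{\mathsf{south}}(S_1,\dots,S_i)$ be the set of edges $(x,y)\in E_{\mathsf v}$ such that $y$ is on the facial cycle of the central face of $G_i$ and $x$ is not a vertex of $G_i$. Let $G_i^+$ be $G_i$ together with these edges; they are circularly ordered by the position of $x$ along the facial cycle of the central face of $G_i^+$. The sequence $A$ is *good* if $k\ge1$ and * (S1) $S_1=\overline{C_{F_{\mathsf o}}}$; * (S2) for each $1<i\le k$, $\mathcal N_{\mathsf{north}}(S_i)\neq\emptyset$; if $S_i$ is a path, then $\mathcal N_{\mathsf{north}}(S_i)$ is a contiguous subsequence of the circular order $\mathcal N_{\mathsf{south}}(S_1,\dots,S_{i-1})$; if $S_i$ is a cycle, then $\mathcal N_{\mathsf{north}}(S_i)=\mathcal N_{\mathsf{south}}(S_1,\dots,S_{i-1})$ as circular orders. An ortho-radial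 drawing of $G_k$ with zero bends is a planar drawing in which no vertex and no edge meets the origin, each edge of $E_{\mathsf h}$ is a clockwise arc of a circle centred at the origin, each edge of $E_{\mathsf v}$ is a radial segment directed away from the origin, the embedding and all inherited angles are realized, the central face contains the origin, the outer face is unbounded, and $e^\star$ lies on the outermost circle. It is *good* if moreover * (D1) for each $(x,y)\in\mathcal N_{\mathsf{south}}(S_1,\dots,S_k)$, where $y$ has polar coordinates $(r_y,\theta_y)$, the drawing uses no point $(r,\theta_y)$ with $0\le r<r_y$. **Statement.** There is an algorithm (a fixed program for a unit-cost random access machine with exact rational arithmetic) which, given such $G$, $\phi$ and a good sequence $A=(S_1,\dots,S_k)$, computes in time $O\left(\sum_{i=1}^k|S_i|\right)$, where $|S_i|$ is the number of vertices of $S_i$ and the implied constant is absolute, polar coordinates (angles measured in full turns) of the vertices of a good drawing of $G_k$. In this drawing each $S_i$ lies on a circle centred at the origin, and the radii of these circles are strictly decreasing in $i$. -/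

import Mathlib

noncomputable section

namespace OrthoRadial

/-! ## Plane graphs and ortho-radial representations -/

/-- A connected simple plane graph on the vertices `0, …, n - 1`: a graph together with the
counter-clockwise cyclic order of the edges around each vertex.  A dart is a directed edge, and
`rot d` is the dart that follows `d` in the counter-clockwise order around the tail of `d`.
Planarity of the combinatorial embedding is Euler's formula, where the faces are the orbits of
`d ↦ rot d.symm`. -/
structure PlaneGraph (n : ℕ) where
  G : SimpleGraph (Fin n)
  rot : Equiv.Perm G.Dart
  rot_fst : ∀ d, (rot d).fst = d.fst
  rot_cyclic : ∀ d d' : G.Dart, d.fst = d'.fst → rot.SameCycle d d'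
  connected : G.Connected
  euler : (n : ℤ) - (G.edgeSet.ncard : ℤ)
    + (Nat.card (Quotient (Equiv.Perm.SameCycle.setoid
        (rot * SimpleGraph.Dart.symm_involutive.toPerm))) : ℤ) = 2

variable {n : ℕ}

namespace PlaneGraph

/-- The next dart on the boundary of the face to the right of `d`: traverse `d`, then turn to the
edge that follows it counter-clockwise around its head.  The orbits of this permutation are the
facial cycles `C_F`, i.e. the clockwise traversals of the contours of the faces `F`. -/
def faceNext (P : PlaneGraph n) : Equiv.Perm P.G.Dart :=
  P.rot * SimpleGraph.Dart.symm_involutive.toPerm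

/-- Two darts have the same face on their right. -/
def SameFace (P : PlaneGraph n) (d d' : P.G.Dart) : Prop := P.faceNext.SameCycle d d'

/-- No vertex is a cut vertex. -/
def Biconnected (P : PlaneGraph n) : Prop :=
  3 ≤ n ∧ ∀ v : Fin n, (P.G.induce ({v}ᶜ : Set (Fin n))).Connected

end PlaneGraph

/-- An ortho-radial representation with a reference edge.  `angle d` is the angle, in units of
90 degrees, of the corner from `d` counter-clockwise to `rot d`.  The central and the outer face
are designated by darts that have them on their right; `ref` is the reference edge. -/
structure Rep (P : PlaneGraph n) where
  angle : P.G.Dart → ℕ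
  angle_mem : ∀ d, angle d = 1 ∨ angle d = 2 ∨ angle d = 3
  central : P.G.Dart
  outer : P.G.Dart
  ref : P.G.Dart

namespace Rep

variable {P : PlaneGraph n} (R : Rep P)

open Classical in
/-- The number of corners of the face to the right of `d`. -/
def faceCorners (d : P.G.Dart) : ℕ :=
  (Finset.univ.filter fun d' => P.SameFace d d').card

open Classical in
/-- The sum of the angles of the face to the right of `d`; the corner of that face at the head
of `d'` is the one from `d'.symm` to `faceNext d' = rot d'.symm`. -/
def faceAngleSum (d : P.G.Dart) : ℕ :=
  ∑ d' ∈ Finset.univ.filter (fun d' => P.SameFace d d'), R.angle d'.symm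

open Classical in
/-- The angles around each vertex sum to 360 degrees; the angles of a face with `k` corners sum to
`(k + 2) · 180` degrees if it is both central and outer, `k · 180` if it is exactly one of them, and
`(k - 2) · 180` if it is regular; the reference edge lies on the reversal of the facial cycle of the
outer face. -/
structure Valid : Prop where
  vertex_sum : ∀ v : Fin n, ∑ d ∈ Finset.univ.filter (fun d : P.G.Dart => d.fst = v), R.angle d = 4
  face_both : ∀ d, P.SameFace R.central d → P.SameFace R.outer d →
    R.faceAngleSum d = 2 * (faceCorners d + 2)
  face_one : ∀ d, (P.SameFace R.central d ↔ ¬ P.SameFace R.outer d) →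
    R.faceAngleSum d = 2 * faceCorners d
  face_regular : ∀ d, ¬ P.SameFace R.central d → ¬ P.SameFace R.outer d →
    R.faceAngleSum d + 4 = 2 * faceCorners d
  ref_outer : P.SameFace R.outer R.ref.symm

/-- `R.HasDir d a`: the dart `d` points in direction `a`, where `0, 1, 2, 3` stand for east
(clockwise), south (towards the origin), west, north (away from the origin).  The reference edge
points east; reversing an edge is a turn by 180 degrees; passing counter-clockwise over a corner
is a left turn by its angle.  Hence along every path from the reference edge to `d` the direction
changes by the combinatorial rotation of the path modulo 4. -/
inductive HasDir : P.G.Dart → ZMod 4 → Prop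
  | ref : HasDir R.ref 0
  | symm {d : P.G.Dart} {a : ZMod 4} : HasDir d a → HasDir d.symm (a + 2)
  | rot {d : P.G.Dart} {a : ZMod 4} : HasDir d a → HasDir (P.rot d) (a - (R.angle d : ZMod 4))

/-- The set `E_h` of horizontal edges, directed east. -/
def East (d : P.G.Dart) : Prop := R.HasDir d 0

/-- The set `E_v` of vertical edges, directed north. -/
def North (d : P.G.Dart) : Prop := R.HasDir d 3

/-! ## Horizontal segments and good sequences -/

/-- The list of vertices `S` closes up to a cycle by an east edge from its last to its first
vertex. -/
def IsCyc (S : List (Fin n)) : Prop :=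
  ∃ d : P.G.Dart, R.East d ∧ S.getLast? = some d.fst ∧ S.head? = some d.snd

/-- A horizontal segment: a connected component of the graph with edge set `E_h`, which is a cycle
or a path, as the list of its vertices from west to east. -/
structure IsSegment (S : List (Fin n)) : Prop where
  two_le : 2 ≤ S.length
  nodup : S.Nodup
  chain : S.IsChain (fun u v => ∃ d : P.G.Dart, R.East d ∧ d.fst = u ∧ d.snd = v)
  cycle_or_path : R.IsCyc S ∨
    ∀ d : P.G.Dart, R.East d → S.getLast? ≠ some d.fst ∧ S.head? ≠ some d.snd

/-- The vertices of the segments of `A`, i.e. the vertex set of the graph of `A`. -/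
def verts (A : List (List (Fin n))) : Set (Fin n) := {v | ∃ S ∈ A, v ∈ S}

/-- The graph `G_i` of a sequence `A = (S₁, …, S_i)`, as a set of darts closed under reversal:
the horizontal edges in the segments and all vertical edges with both endpoints in segments. -/
def sub (A : List (List (Fin n))) : Set P.G.Dart :=
  {d | ((R.East d ∨ R.East d.symm) ∧ ∃ S ∈ A, d.fst ∈ S ∧ d.snd ∈ S) ∨
    ((R.North d ∨ R.North d.symm) ∧ d.fst ∈ verts A ∧ d.snd ∈ verts A)}

/-- The dart `d` of `G` has, on its right, a face of `G` that is contained in the central face of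
the subgraph `H`: it is reached from the central face of `G` by crossing edges not in `H`. -/
def InCentral (H : Set P.G.Dart) (d : P.G.Dart) : Prop :=
  Relation.EqvGen (fun d₁ d₂ => d₂ = P.faceNext d₁ ∨ (d₁ ∉ H ∧ d₂ = d₁.symm)) R.central d

/-- `d'` is the dart of `H` that follows `d` counter-clockwise around the tail of `d` in the
embedding that the subgraph `H` inherits, `m` steps later in `G`. -/
def NextAround (H : Set P.G.Dart) (d d' : P.G.Dart) (m : ℕ) : Prop :=
  0 < m ∧ d' = (P.rot ^ m) d ∧ d' ∈ H ∧ ∀ i, 0 < i → i < m → (P.rot ^ i) d ∉ H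

/-- The list `w` of darts is the facial cycle of the central face of the subgraph `H`, starting
anywhere. -/
structure IsCentralCycle (H : Set P.G.Dart) (w : List P.G.Dart) : Prop where
  ne_nil : w ≠ []
  nodup : w.Nodup
  mem : ∀ d ∈ w, d ∈ H ∧ R.InCentral H d
  next : ∀ i d d', w[i]? = some d → w[(i + 1) % w.length]? = some d' →
    ∃ m, NextAround H d.symm d' m

/-- `N_south(A)`: the vertical edges `(x, y)`, directed north, such that `y` is on the facial cycle
of the central face of the graph of `A` and `x` is not a vertex of that graph. -/
def south (A : List (List (Fin n))) : Set P.G.Dart :=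
  {e | R.North e ∧ e.fst ∉ verts A ∧
    ∃ d ∈ R.sub A, R.InCentral (R.sub A) d ∧ d.fst = e.snd}

/-- The graph `G_i⁺`: the graph of `A` together with the edges `N_south(A)`. -/
def subPlus (A : List (List (Fin n))) : Set P.G.Dart :=
  {d | d ∈ R.sub A ∨ d ∈ R.south A ∨ d.symm ∈ R.south A}

open Classical in
/-- `l` lists `N_south(A)` in its circular order, which is the order along the facial cycle of the
central face of `G_i⁺`, starting anywhere. -/
def IsSouthOrder (A : List (List (Fin n))) (l : List P.G.Dart) : Prop :=
  ∃ w, R.IsCentralCycle (R.subPlus A) w ∧ l = w.filter (fun d => d ∈ R.south A)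

/-- `l` lists `N_north(S)`, the vertical edges `(x, y)` directed north with `x ∈ S`, in the order
of their endpoints in `S`. -/
def IsNorthOrder (S : List (Fin n)) (l : List P.G.Dart) : Prop :=
  (∀ d : P.G.Dart, d ∈ l ↔ R.North d ∧ d.fst ∈ S) ∧ (l.map (fun d => d.fst)).Sublist S

/-- A good sequence of horizontal segments. -/
structure IsGood (A : List (List (Fin n))) : Prop where
  segment : ∀ S ∈ A, R.IsSegment S
  /-- `A` is non-empty and its first segment is the reversal of the facial cycle of the outer
  face. -/
  first : ∃ S B, A = S :: B ∧
    ∀ d : P.G.Dart, (R.East d ∧ d.fst ∈ S) ↔ P.SameFace R.outer d.symm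
  /-- For every later segment, `N_north(S)` is non-empty; it is a contiguous part of the circular
  order `N_south(B)` if `S` is a path, and all of it if `S` is a cycle, where `B` consists of the
  earlier segments. -/
  later : ∀ B S B', A = B ++ S :: B' → B ≠ [] →
    ∃ l s, R.IsNorthOrder S l ∧ l ≠ [] ∧ R.IsSouthOrder B s ∧
      (R.IsCyc S → l = s) ∧ (¬ R.IsCyc S → l <+: s)

/-! ## Drawings -/

/-- The point with polar coordinates `p = (r, θ)`. -/
def pt (p : ℝ × ℝ) : ℂ := (p.1 : ℂ) * Complex.exp ((p.2 : ℂ) * Complex.I)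

/-- The length in `(0, 2π]` of the clockwise turn from the angle `α` to the angle `β`. -/
def cwGap (α β : ℝ) : ℝ := toIocMod Real.two_pi_pos 0 (α - β)

variable (pos : Fin n → ℝ × ℝ)

/-- The drawing of an edge, given the polar coordinates of the vertices: an east edge is drawn as
the clockwise arc around the origin from its tail to its head, and a north edge as the
radial line segment between its endpoints. -/
def curve (d : P.G.Dart) : Set ℂ :=
  {z | (R.East d ∧ ∃ t ∈ Set.Icc 0 (cwGap (pos d.fst).2 (pos d.snd).2),
      z = pt ((pos d.fst).1, (pos d.fst).2 - t)) ∨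
    (R.North d ∧ ∃ r ∈ Set.Icc (pos d.fst).1 (pos d.snd).1, z = pt (r, (pos d.fst).2))}

/-- All points used by the drawing of the subgraph `H`. -/
def image (H : Set P.G.Dart) : Set ℂ := {z | ∃ d ∈ H, z ∈ R.curve pos d}

open Classical in
/-- The angle in the plane of the direction in which the drawing of `d` leaves its tail. -/
def heading (d : P.G.Dart) : ℝ :=
  if R.East d then (pos d.fst).2 - Real.pi / 2
  else if R.North d then (pos d.fst).2
  else if R.East d.symm then (pos d.fst).2 + Real.pi / 2
  else (pos d.fst).2 + Real.pi

open Classical in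
/-- The point at distance `ε` to the right of the middle of the drawing of `d` (at angular distance
`ε` if `d` is vertical). -/
def rightPt (d : P.G.Dart) (ε : ℝ) : ℂ :=
  if R.East d then
    pt ((pos d.fst).1 - ε, (pos d.fst).2 - cwGap (pos d.fst).2 (pos d.snd).2 / 2)
  else if R.North d then pt (((pos d.fst).1 + (pos d.snd).1) / 2, (pos d.fst).2 - ε)
  else if R.East d.symm then
    pt ((pos d.snd).1 + ε, (pos d.snd).2 - cwGap (pos d.snd).2 (pos d.fst).2 / 2)
  else pt (((pos d.fst).1 + (pos d.snd).1) / 2, (pos d.fst).2 + ε)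

/-- The point `z` lies in the face of the drawing of `H` that is to the right of `d`. -/
def InRightFace (H : Set P.G.Dart) (d : P.G.Dart) (z : ℂ) : Prop :=
  ∃ ε₀ > 0, ∀ ε, 0 < ε → ε < ε₀ → JoinedIn (R.image pos H)ᶜ (R.rightPt pos d ε) z

/-- The polar coordinates `pos` give an ortho-radial drawing with zero bends of the subgraph `H`
(a connected set of edges without isolated vertices, with vertex set `W`) that realizes the
representation and reference edge inherited from `R`. -/
structure IsDrawing (W : Set (Fin n)) (H : Set P.G.Dart) : Prop where
  /-- No vertex is drawn on the origin, and vertices are drawn on distinct points. -/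
  radius_pos : ∀ v ∈ W, 0 < (pos v).1
  inj : ∀ u ∈ W, ∀ v ∈ W, pt (pos u) = pt (pos v) → u = v
  /-- Horizontal edges lie on circles around the origin, and vertical edges on lines through the
  origin, with the prescribed direction. -/
  east : ∀ d ∈ H, R.East d → (pos d.fst).1 = (pos d.snd).1
  north : ∀ d ∈ H, R.North d →
    (pos d.fst).1 < (pos d.snd).1 ∧ ((pos d.fst).2 : Real.Angle) = ((pos d.snd).2 : Real.Angle)
  /-- The drawing is planar: an edge contains no vertices but its endpoints, and two edges meet in
  common endpoints only. -/
  vertex_edge : ∀ v ∈ W, ∀ d ∈ H, pt (pos v) ∈ R.curve pos d → v = d.fst ∨ v = d.snd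
  edge_edge : ∀ d ∈ H, ∀ d' ∈ H, d ≠ d' → ∀ z ∈ R.curve pos d, z ∈ R.curve pos d' →
    ∃ v, (v = d.fst ∨ v = d.snd) ∧ (v = d'.fst ∨ v = d'.snd) ∧ z = pt (pos v)
  /-- The combinatorial embedding is preserved and the angles of the corners are realized: the
  counter-clockwise turn from an edge to the next one around a vertex is the inherited angle. -/
  angles : ∀ d ∈ H, ∀ d' m, NextAround H d d' m →
    toIocMod Real.two_pi_pos 0 (R.heading pos d' - R.heading pos d) =
      ((∑ i ∈ Finset.range m, R.angle ((P.rot ^ i) d) : ℕ) : ℝ) * (Real.pi / 2)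
  /-- The face bounded by the facial cycle of the central face contains the origin. -/
  central : ∃ d ∈ H, R.InCentral H d ∧ R.InRightFace pos H d 0
  /-- The face bounded by the facial cycle of the outer face is unbounded. -/
  outer : ∃ d ∈ H, P.SameFace R.outer d ∧ ∀ B : ℝ, ∃ z : ℂ, B < ‖z‖ ∧ R.InRightFace pos H d z
  /-- The reference edge is drawn on the outermost circle. -/
  ref_outermost : ∀ v ∈ W, (pos v).1 ≤ (pos R.ref.fst).1

/-- A good drawing of the graph `G_k` of `A`: an ortho-radial drawing with zero bends such that,
for each edge `(x, y)` in `N_south(A)`, the points below `y` on the ray from the origin through `y`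
are not used. -/
structure IsGoodDrawing (A : List (List (Fin n))) : Prop where
  drawing : R.IsDrawing pos (verts A) (R.sub A)
  free_rays : ∀ e ∈ R.south A, ∀ r, 0 ≤ r → r < (pos e.snd).1 →
    pt (r, (pos e.snd).2) ∉ R.image pos (R.sub A)

end Rep

/-- Each segment of `A` lies on a circle around the origin, and later segments lie on strictly
smaller circles. -/
def Concentric (pos : Fin n → ℝ × ℝ) (A : List (List (Fin n))) : Prop :=
  (∀ S ∈ A, ∀ u ∈ S, ∀ v ∈ S, (pos u).1 = (pos v).1) ∧
    A.Pairwise (fun S T => ∀ u ∈ S, ∀ v ∈ T, (pos v).1 < (pos u).1)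

/-! ## A random access machine with exact rational arithmetic -/

/-- A memory state: arrays of natural numbers and arrays of rational numbers. -/
structure State where
  nat : ℕ → ℕ → ℕ
  rat : ℕ → ℕ → ℚ

/-- Write `x` to index `i` of array `a`. -/
def State.setNat (s : State) (a i x : ℕ) : State where
  nat := Function.update s.nat a (Function.update (s.nat a) i x)
  rat := s.rat

/-- Write `x` to index `i` of array `a`. -/
def State.setRat (s : State) (a i : ℕ) (x : ℚ) : State where
  nat := s.nat
  rat := Function.update s.rat a (Function.update (s.rat a) i x)

/-- Expressions over natural numbers: constants, `arr a e` (the entry of array `a` at index `e`),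
sums and truncated differences. -/
inductive NExpr
  | lit (k : ℕ)
  | arr (a : ℕ) (e : NExpr)
  | add (e f : NExpr)
  | sub (e f : NExpr)

/-- Expressions over rational numbers. -/
inductive QExpr
  | lit (q : ℚ)
  | arr (a : ℕ) (e : NExpr)
  | ofNat (e : NExpr)
  | add (e f : QExpr)
  | sub (e f : QExpr)
  | mul (e f : QExpr)
  | div (e f : QExpr)

/-- Comparisons. -/
inductive Test
  | nlt (e f : NExpr)
  | neq (e f : NExpr)
  | qlt (e f : QExpr)
  | not (t : Test)

/-- Programs. `nset a i e` and `qset a i e` write the value of `e` to index `i` of array `a`. -/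
inductive Prog
  | skip
  | nset (a : ℕ) (i e : NExpr)
  | qset (a : ℕ) (i : NExpr) (e : QExpr)
  | seq (p q : Prog)
  | cond (t : Test) (p q : Prog)
  | loop (t : Test) (p : Prog)

def NExpr.eval (s : State) : NExpr → ℕ
  | .lit k => k
  | .arr a e => s.nat a (e.eval s)
  | .add e f => e.eval s + f.eval s
  | .sub e f => e.eval s - f.eval s

/-- The number of elementary operations needed to evaluate an expression. -/
def NExpr.cost : NExpr → ℕ
  | .lit _ => 1
  | .arr _ e => e.cost + 1
  | .add e f => e.cost + f.cost + 1
  | .sub e f => e.cost + f.cost + 1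

def QExpr.eval (s : State) : QExpr → ℚ
  | .lit q => q
  | .arr a e => s.rat a (e.eval s)
  | .ofNat e => (e.eval s : ℚ)
  | .add e f => e.eval s + f.eval s
  | .sub e f => e.eval s - f.eval s
  | .mul e f => e.eval s * f.eval s
  | .div e f => e.eval s / f.eval s

def QExpr.cost : QExpr → ℕ
  | .lit _ => 1
  | .arr _ e => e.cost + 1
  | .ofNat e => e.cost + 1
  | .add e f => e.cost + f.cost + 1
  | .sub e f => e.cost + f.cost + 1
  | .mul e f => e.cost + f.cost + 1
  | .div e f => e.cost + f.cost + 1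

def Test.Holds (s : State) : Test → Prop
  | .nlt e f => e.eval s < f.eval s
  | .neq e f => e.eval s = f.eval s
  | .qlt e f => e.eval s < f.eval s
  | .not t => ¬ t.Holds s

def Test.cost : Test → ℕ
  | .nlt e f => e.cost + f.cost + 1
  | .neq e f => e.cost + f.cost + 1
  | .qlt e f => e.cost + f.cost + 1
  | .not t => t.cost + 1

/-- `Exec p s s' t`: started in the state `s`, the program `p` halts in the state `s'` after `t`
elementary steps. -/
inductive Exec : Prog → State → State → ℕ → Prop
  | skip (s : State) : Exec .skip s s 1
  | nset (s : State) (a : ℕ) (i e : NExpr) :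
      Exec (.nset a i e) s
        (s.setNat a (i.eval s) (e.eval s))
        (i.cost + e.cost + 1)
  | qset (s : State) (a : ℕ) (i : NExpr) (e : QExpr) :
      Exec (.qset a i e) s
        (s.setRat a (i.eval s) (e.eval s))
        (i.cost + e.cost + 1)
  | seq {p q : Prog} {s₁ s₂ s₃ : State} {t u : ℕ} :
      Exec p s₁ s₂ t → Exec q s₂ s₃ u → Exec (.seq p q) s₁ s₃ (t + u)
  | cond_true {b : Test} {p q : Prog} {s s' : State} {t : ℕ} :
      b.Holds s → Exec p s s' t → Exec (.cond b p q) s s' (b.cost + t)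
  | cond_false {b : Test} {p q : Prog} {s s' : State} {t : ℕ} :
      ¬ b.Holds s → Exec q s s' t → Exec (.cond b p q) s s' (b.cost + t)
  | loop_true {b : Test} {p : Prog} {s₁ s₂ s₃ : State} {t u : ℕ} :
      b.Holds s₁ → Exec p s₁ s₂ t → Exec (.loop b p) s₂ s₃ u →
        Exec (.loop b p) s₁ s₃ (b.cost + t + u)
  | loop_false {b : Test} {p : Prog} {s : State} :
      ¬ b.Holds s → Exec (.loop b p) s s b.cost

/-- The memory state `s` holds the input: the length of `A` (array 0), the lengths of its segments
(array 1), the concatenation of its segments (array 2), the vertex degrees (array 3), for each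
vertex `v` its neighbours in counter-clockwise order, starting with any one of them, at indices
`4v, 4v + 1, …` of array 4, and the angles of the corners that follow them at the same indices of
array 5.  The remaining arrays are zero. -/
structure Encodes {P : PlaneGraph n} (R : Rep P) (A : List (List (Fin n))) (s : State) :
    Prop where
  length : s.nat 0 0 = A.length
  lengths : ∀ (i : ℕ) (hi : i < A.length), s.nat 1 i = (A[i]).length
  segments : ∀ (i : ℕ) (hi : i < A.flatten.length), s.nat 2 i = (A.flatten[i]).val
  degree : ∀ v : Fin n, s.nat 3 v = (P.G.neighborSet v).ncard
  neighbours : ∀ (v : Fin n) (i : ℕ), i < s.nat 3 v → ∃ d : P.G.Dart, d.fst = v ∧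
    s.nat 4 (4 * v + i) = d.snd ∧ s.nat 5 (4 * v + i) = R.angle d ∧
    s.nat 4 (4 * v + (i + 1) % s.nat 3 v) = (P.rot d).snd
  nat_zero : ∀ a i, 6 ≤ a → s.nat a i = 0
  rat_zero : ∀ a i, s.rat a i = 0

/-- The polar coordinates that the memory state `s` holds as output: for each vertex the radius in
array 0 and the angle, in units of a full turn, in array 1. -/
def State.output (s : State) (n : ℕ) (v : Fin n) : ℝ × ℝ :=
  ((s.rat 0 v : ℝ), 2 * Real.pi * (s.rat 1 v : ℝ))

end OrthoRadial

end

/-!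
# Drawing good sequences of horizontal segments in linear time

**Directions.** Turning as the angles prescribe defines the directions of the edges only along walks.
That they do not depend on the walk comes from the conditions on the angle sums: around a vertex and
around a face the turning vanishes modulo 4, and a plane graph has no cohomology
(`PlaneGraph.exists_potential`, which rests on the Jordan curve property
`PlaneGraph.not_cls_symm_of_linked`, a consequence of Euler's formula). This gives the direction
`Rep.dir` of each edge as an element of `ZMod 4`.

**The central face.** Adding edges one by one, the angle sums of the faces of the whole graph yield
those of the faces of each connected subgraph (`Rep.sum_gb`). In particular the total turning of the
central face of a subgraph is zero, unless this face is also the outer one (`Rep.sum_turn`). So if the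
directions along the central face are lifted from `ZMod 4` to the integers in such a way that the lift
never increases by more than the turning, then it increases exactly by the turning
(`Rep.turn_eq_of_le`): there are no positive defects. When a segment `S` is attached below consecutive
south edges, the obvious new lift (`Rep.newLift`) has this property, and its potential defects are just
at the places where the boundary of the central face would enter the region between `S` and the
older segments. Hence the new central face is bounded by a single cycle, which runs around `S` on the
south side. The new circular order of the south edges is the old one with the north edges of `S`
replaced by the south edges at `S`, and the invariant `Rep.Inv` is preserved (`Rep.Attach.outcome`).

**The drawing.** The `i`-th of `k` segments, counted from `0`, is put on the circle of radius `k - i`.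
A vertex with a north edge goes below the head of this edge, and the other vertices follow in steps of
`δ`, which is the product of the `1 / |S_j|` over the segments `S_j` up to the present one. If the south
edges of the preceding segments have gaps of `|S| δ` in clockwise order, there is room for these steps
(`exists_steps`), and the new south edges have gaps of `δ` (`Rep.Attach.exists_lift`). By induction,
each segment proceeds clockwise within a single turn, and the edges that pass it on their way to the
origin miss it (`Rep.IsGood.exists_lift`). Two edges then meet just at common endpoints, and the rays
below the south edges are free (`Rep.Layout.edge_edge`, `Rep.Layout.free_ray`,
`Rep.IsGood.drawing`).

**The algorithm.** A vertex has at most four edges, so its north edge is found in constant time: starting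
from the edge to a neighbour on the segment, the angles are added up around the vertex
(`does_findNorth`). One loop over the segment places the vertices from the first north edge on, and a
second one runs back from there to place the vertices before it (`runs_placeSegment`). The radii, the
angles and the steps are kept as exact rational numbers, so each arithmetic operation is one step and
the running time is linear (`runs_drawProg`).
-/

noncomputable section
namespace OrthoRadial

/-! ### Equivalence relations enlarged by one pair -/

/-- Adding the pair `(a, b)` to a relation merges the classes of `a` and `b` of the equivalence
relation it generates. -/
theorem eqvGen_add_pair_iff {α : Type*} {r r' : α → α → Prop} {a b : α}
    (hle : ∀ x y, r x y → r' x y)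
    (hge : ∀ x y, r' x y → r x y ∨ (x = a ∧ y = b) ∨ (x = b ∧ y = a))
    (hab : Relation.EqvGen r' a b) (x y : α) :
    Relation.EqvGen r' x y ↔ Relation.EqvGen r x y ∨
      (Relation.EqvGen r x a ∧ Relation.EqvGen r y b) ∨
      (Relation.EqvGen r x b ∧ Relation.EqvGen r y a) := by
  have S : ∀ {x y}, Relation.EqvGen r x y → Relation.EqvGen r y x := fun h => h.symm
  have T : ∀ {x y z}, Relation.EqvGen r x y → Relation.EqvGen r y z → Relation.EqvGen r x z :=
    fun h h' => h.trans _ _ _ h'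
  constructor
  · intro h
    induction h with
    | rel x y h =>
      rcases hge x y h with h | ⟨rfl, rfl⟩ | ⟨rfl, rfl⟩
      · exact Or.inl (.rel _ _ h)
      · exact Or.inr (Or.inl ⟨.refl _, .refl _⟩)
      · exact Or.inr (Or.inr ⟨.refl _, .refl _⟩)
    | refl x => exact Or.inl (.refl _)
    | symm x y _ ih => have := @S; tauto
    | trans x y z _ _ ih1 ih2 =>
      rcases ih1 with h1 | ⟨h1, h1'⟩ | ⟨h1, h1'⟩ <;> rcases ih2 with h2 | ⟨h2, h2'⟩ | ⟨h2, h2'⟩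
      · exact Or.inl (T h1 h2)
      · exact Or.inr (Or.inl ⟨T h1 h2, h2'⟩)
      · exact Or.inr (Or.inr ⟨T h1 h2, h2'⟩)
      · exact Or.inr (Or.inl ⟨h1, T (S h2) h1'⟩)
      · exact Or.inr (Or.inl ⟨h1, h2'⟩)
      · exact Or.inl (T h1 (S h2'))
      · exact Or.inr (Or.inr ⟨h1, T (S h2) h1'⟩)
      · exact Or.inl (T h1 (S h2'))
      · exact Or.inr (Or.inr ⟨h1, h2'⟩)
  · have M : ∀ {x y}, Relation.EqvGen r x y → Relation.EqvGen r' x y :=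
      fun h => Relation.EqvGen.mono hle _ _ h
    rintro (h | ⟨h, h'⟩ | ⟨h, h'⟩)
    · exact M h
    · exact ((M h).trans _ _ _ hab).trans _ _ _ (M h').symm
    · exact ((M h).trans _ _ _ hab.symm).trans _ _ _ (M h').symm

/-- Merging the classes of `a` and `b` lowers the number of classes by one, unless they already
coincide. -/
theorem card_quotient_add_pair {α : Type*} [Finite α] {r s : Setoid α} {a b : α}
    (h : ∀ x y, s x y ↔ r x y ∨ (r x a ∧ r y b) ∨ (r x b ∧ r y a)) :
    (r a b → Nat.card (Quotient s) = Nat.card (Quotient r)) ∧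
      (¬ r a b → Nat.card (Quotient r) = Nat.card (Quotient s) + 1) := by
  constructor
  · intro hab
    have : s = r := by
      ext x y
      rw [h]
      constructor
      · rintro (h | ⟨h, h'⟩ | ⟨h, h'⟩)
        · exact h
        · exact r.trans (r.trans h hab) (r.symm h')
        · exact r.trans (r.trans h (r.symm hab)) (r.symm h')
      · exact Or.inl
    rw [this]
  · intro hab
    -- leaving out the class of `a` makes the projection of quotients a bijection
    let x₀ : Quotient r := Quotient.mk r a
    let f : {q : Quotient r // q ≠ x₀} → Quotient s := fun q =>
      Quotient.map' (s₁ := r) (s₂ := s) id (fun x y hxy => (h x y).2 (Or.inl hxy)) q.1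
    have hf : Function.Bijective f := by
      constructor
      · rintro ⟨q, hq⟩ ⟨q', hq'⟩ hqq
        induction q using Quotient.inductionOn with | _ x =>
        induction q' using Quotient.inductionOn with | _ y =>
        have h1 : s x y := Quotient.exact hqq
        have hx : ¬ r x a := fun h => hq (Quotient.sound h)
        have hy : ¬ r y a := fun h => hq' (Quotient.sound h)
        have h2 := (h x y).1 h1
        have : r x y := by tauto
        exact Subtype.ext (Quotient.sound this)
      · intro q
        induction q using Quotient.inductionOn with | _ x =>
        by_cases hx : r x a
        · refine ⟨⟨Quotient.mk r b, fun hb => hab (r.symm (Quotient.exact hb))⟩, ?_⟩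
          exact Quotient.sound ((h _ _).2 (Or.inr (Or.inr ⟨r.refl _, hx⟩)))
        · exact ⟨⟨Quotient.mk r x, fun hb => hx (Quotient.exact hb)⟩, rfl⟩
    have h1 := Nat.card_congr (Equiv.ofBijective f hf)
    have h2 : Nat.card (Quotient r) = Nat.card {q : Quotient r // q ≠ x₀} + 1 := by
      classical
      have e := Nat.card_congr (Equiv.optionSubtypeNe x₀)
      rw [← e, Finite.card_option]
    rw [h2, h1]

/-! ### Faces of subgraphs of a plane graph -/

namespace PlaneGraph

variable {n : ℕ} (P : PlaneGraph n)

/-- One step between darts whose right faces lie in a common face of the subgraph `H`: move along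
the face, or cross an edge that is not in `H`. -/
def CrossStep (H : Set P.G.Dart) (d d' : P.G.Dart) : Prop :=
  d' = P.faceNext d ∨ (d ∉ H ∧ d' = d.symm)

/-- The right faces of `d` and `d'` lie in a common face of the subgraph `H`. -/
def Cls (H : Set P.G.Dart) : P.G.Dart → P.G.Dart → Prop := Relation.EqvGen (P.CrossStep H)

/-- The vertices `u` and `v` are connected by edges of `H`. -/
def Linked (H : Set P.G.Dart) : Fin n → Fin n → Prop :=
  Relation.EqvGen fun u v => ∃ d ∈ H, d.fst = u ∧ d.snd = v

/-- The subgraph `H` with the edge of `e` added. -/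
def addEdge (H : Set P.G.Dart) (e : P.G.Dart) : Set P.G.Dart := {d | d ∈ H ∨ d = e ∨ d = e.symm}

/-- A set of darts that is closed under reversal. -/
def IsSym (H : Set P.G.Dart) : Prop := ∀ d ∈ H, d.symm ∈ H

variable {P} {H : Set P.G.Dart}

instance finite_dart (P : PlaneGraph n) : Finite P.G.Dart := by
  classical infer_instance

theorem faceNext_apply (d : P.G.Dart) : P.faceNext d = P.rot d.symm := rfl

theorem faceNext_fst (d : P.G.Dart) : (P.faceNext d).fst = d.snd := P.rot_fst d.symm

theorem IsSym.not_mem {d : P.G.Dart} (hH : P.IsSym H) (h : d ∉ H) : d.symm ∉ H := fun h' =>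
  h (by simpa using hH _ h')

theorem IsSym.addEdge {e : P.G.Dart} (hH : P.IsSym H) : P.IsSym (P.addEdge H e) := by
  rintro d (h | rfl | rfl)
  · exact Or.inl (hH d h)
  · exact Or.inr (Or.inr rfl)
  · exact Or.inr (Or.inl (by simp))

theorem Cls.refl (d : P.G.Dart) : P.Cls H d d := Relation.EqvGen.refl d

theorem Cls.symm {d d' : P.G.Dart} (h : P.Cls H d d') : P.Cls H d' d := Relation.EqvGen.symm _ _ h

theorem Cls.trans {d d' d'' : P.G.Dart} (h : P.Cls H d d') (h' : P.Cls H d' d'') :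
    P.Cls H d d'' := Relation.EqvGen.trans _ _ _ h h'

theorem Cls.faceNext (d : P.G.Dart) : P.Cls H d (P.faceNext d) := .rel _ _ (Or.inl rfl)

theorem Cls.cross {d : P.G.Dart} (h : d ∉ H) : P.Cls H d d.symm := .rel _ _ (Or.inr ⟨h, rfl⟩)

theorem Cls.mono {H' : Set P.G.Dart} (hH : H' ⊆ H) {d d' : P.G.Dart} (h : P.Cls H d d') :
    P.Cls H' d d' :=
  Relation.EqvGen.mono (fun _ _ h => Or.imp id (fun h => ⟨fun h' => h.1 (hH h'), h.2⟩) h) _ _ h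

theorem Linked.mono {H' : Set P.G.Dart} (hH : H ⊆ H') {u v : Fin n} (h : P.Linked H u v) :
    P.Linked H' u v :=
  Relation.EqvGen.mono (fun _ _ ⟨d, hd, h⟩ => ⟨d, hH hd, h⟩) _ _ h

theorem Linked.trans {u v w : Fin n} (h : P.Linked H u v) (h' : P.Linked H v w) : P.Linked H u w :=
  Relation.EqvGen.trans _ _ _ h h'

theorem Linked.symm {u v : Fin n} (h : P.Linked H u v) : P.Linked H v u :=
  Relation.EqvGen.symm _ _ h

theorem Linked.dart {d : P.G.Dart} (h : d ∈ H) : P.Linked H d.fst d.snd := .rel _ _ ⟨d, h, rfl, rfl⟩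

theorem SameFace.cls {d d' : P.G.Dart} (h : P.SameFace d d') : P.Cls H d d' := by
  obtain ⟨k, rfl⟩ := Equiv.Perm.SameCycle.exists_nat_pow_eq h
  clear h
  induction k with
  | zero => exact Cls.refl _
  | succ k ih => rw [pow_succ']; exact ih.trans (Cls.faceNext _)

theorem subset_addEdge (e : P.G.Dart) : H ⊆ P.addEdge H e := fun _ h => Or.inl h

/-- Removing the edge of `e` merges the faces on its two sides. -/
theorem cls_addEdge {e : P.G.Dart} (he : e ∉ H) (x y : P.G.Dart) :
    P.Cls H x y ↔ P.Cls (P.addEdge H e) x y ∨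
      (P.Cls (P.addEdge H e) x e ∧ P.Cls (P.addEdge H e) y e.symm) ∨
      (P.Cls (P.addEdge H e) x e.symm ∧ P.Cls (P.addEdge H e) y e) := by
  refine eqvGen_add_pair_iff ?_ ?_ (Cls.cross he) x y
  · exact fun x y h => h.imp id fun h => ⟨fun h' => h.1 (Or.inl h'), h.2⟩
  · rintro x y (h | ⟨h, rfl⟩)
    · exact Or.inl (Or.inl h)
    · by_cases h1 : x = e
      · subst h1; exact Or.inr (Or.inl ⟨rfl, rfl⟩)
      by_cases h2 : x = e.symm
      · subst h2; exact Or.inr (Or.inr ⟨rfl, by simp⟩)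
      · refine Or.inl (Or.inr ⟨?_, rfl⟩)
        rintro (h' | h' | h') <;> contradiction

theorem linked_addEdge (e : P.G.Dart) (u v : Fin n) :
    P.Linked (P.addEdge H e) u v ↔ P.Linked H u v ∨
      (P.Linked H u e.fst ∧ P.Linked H v e.snd) ∨ (P.Linked H u e.snd ∧ P.Linked H v e.fst) := by
  refine eqvGen_add_pair_iff ?_ ?_ (Linked.dart (H := P.addEdge H e) (Or.inr (Or.inl rfl))) u v
  · rintro x y ⟨d, hd, h⟩
    exact ⟨d, Or.inl hd, h⟩
  · rintro x y ⟨d, hd | rfl | rfl, rfl, rfl⟩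
    · exact Or.inl ⟨d, hd, rfl, rfl⟩
    · exact Or.inr (Or.inl ⟨rfl, rfl⟩)
    · exact Or.inr (Or.inr ⟨rfl, rfl⟩)

open Classical in
/-- The boundary of a union of faces of `H` is a cycle: it pairs to zero with every coboundary. -/
theorem sum_boundary_coboundary {A : Type*} [AddCommGroup A] (hH : P.IsSym H) (d₀ : P.G.Dart)
    (p : Fin n → A) :
    ∑ d ∈ Finset.univ.filter (fun d => P.Cls H d₀ d ∧ d ∈ H), (p d.fst - p d.snd) = 0 := by
  -- over all darts of the face the sum telescopes, since `faceNext` starts at the head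
  have h1 : ∑ d ∈ Finset.univ.filter (fun d => P.Cls H d₀ d), (p d.fst - p d.snd) = 0 := by
    rw [Finset.sum_sub_distrib, sub_eq_zero]
    symm
    refine Finset.sum_bij (fun d _ => P.faceNext d) ?_ ?_ ?_ ?_
    · intro d hd
      simp only [Finset.mem_filter, Finset.mem_univ, true_and] at hd ⊢
      exact hd.trans (Cls.faceNext d)
    · intro d _ d' _ h; exact P.faceNext.injective h
    · intro d hd
      simp only [Finset.mem_filter, Finset.mem_univ, true_and] at hd ⊢
      refine ⟨P.faceNext.symm d, hd.trans ?_, by simp⟩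
      have := Cls.faceNext (H := H) (P.faceNext.symm d)
      rw [Equiv.apply_symm_apply] at this
      exact this.symm
    · intro d _; rw [faceNext_fst]
  -- the darts outside of `H` cancel with their reversals, which lie in the same face
  have h2 : ∑ d ∈ Finset.univ.filter (fun d => P.Cls H d₀ d ∧ d ∉ H), (p d.fst - p d.snd) = 0 := by
    refine Finset.sum_involution (fun d _ => d.symm) ?_ ?_ ?_ ?_
    · intro d _; simp
    · intro d _ _; exact d.symm_ne
    · intro d hd
      simp only [Finset.mem_filter, Finset.mem_univ, true_and] at hd ⊢
      exact ⟨hd.1.trans (Cls.cross hd.2), hH.not_mem hd.2⟩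
    · intro d _; simp
  rw [← h1, ← Finset.sum_filter_add_sum_filter_not (Finset.univ.filter (fun d => P.Cls H d₀ d))
    (fun d => d ∈ H), Finset.filter_filter, Finset.filter_filter, h2, add_zero]

open Classical in
/-- Stokes' theorem for a cochain with vanishing sums around all faces. -/
theorem sum_boundary_closed {A : Type*} [AddCommGroup A] (hH : P.IsSym H) (d₀ : P.G.Dart)
    (t : P.G.Dart → A) (ht : ∀ d, t d.symm = - t d)
    (hf : ∀ d₁, ∑ d ∈ Finset.univ.filter (fun d => P.SameFace d₁ d), t d = 0) :
    ∑ d ∈ Finset.univ.filter (fun d => P.Cls H d₀ d ∧ d ∈ H), t d = 0 := by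
  have h1 : ∑ d ∈ Finset.univ.filter (fun d => P.Cls H d₀ d), t d = 0 := by
    let s := Equiv.Perm.SameCycle.setoid P.faceNext
    rw [← Finset.sum_fiberwise (g := fun d => Quotient.mk s d)]
    refine Finset.sum_eq_zero fun q _ => ?_
    induction q using Quotient.inductionOn with | _ d₁ =>
    rw [Finset.filter_filter]
    by_cases h : P.Cls H d₀ d₁
    · rw [← hf d₁]
      refine Finset.sum_congr (Finset.filter_congr fun d _ => ?_) fun _ _ => rfl
      have : (Quotient.mk s d = Quotient.mk s d₁) ↔ P.SameFace d₁ d :=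
        Quotient.eq.trans ⟨fun h => Equiv.Perm.SameCycle.symm h,
          fun h => Equiv.Perm.SameCycle.symm h⟩
      rw [this]
      exact ⟨fun h => h.2, fun h' => ⟨h.trans h'.cls, h'⟩⟩
    · refine Finset.sum_eq_zero fun d hd => absurd ?_ h
      simp only [Finset.mem_filter, Finset.mem_univ, true_and] at hd
      have h' : P.SameFace d d₁ := Quotient.exact hd.2
      exact hd.1.trans h'.cls
  have h2 : ∑ d ∈ Finset.univ.filter (fun d => P.Cls H d₀ d ∧ d ∉ H), t d = 0 := by
    refine Finset.sum_involution (fun d _ => d.symm) ?_ ?_ ?_ ?_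
    · intro d _; simp [ht]
    · intro d _ _; exact d.symm_ne
    · intro d hd
      simp only [Finset.mem_filter, Finset.mem_univ, true_and] at hd ⊢
      exact ⟨hd.1.trans (Cls.cross hd.2), hH.not_mem hd.2⟩
    · intro d _; simp
  rw [← h1, ← Finset.sum_filter_add_sum_filter_not (Finset.univ.filter (fun d => P.Cls H d₀ d))
    (fun d => d ∈ H), Finset.filter_filter, Finset.filter_filter, h2, add_zero]

end PlaneGraph

namespace PlaneGraph
variable {n : ℕ} {P : PlaneGraph n} {H : Set P.G.Dart}

/-! ### Euler's formula separates the two sides of a chord -/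

/-- An edge that joins two components of `H` has the same face of the enlarged graph on both
sides: the boundary of a face cannot leave a component along a single edge. -/
theorem cls_symm_of_not_linked {e : P.G.Dart} (hH : P.IsSym H)
    (h : ¬ P.Linked H e.fst e.snd) : P.Cls (P.addEdge H e) e e.symm := by
  classical
  by_contra hc
  -- the coboundary of the indicator of the component of `e.snd` is nonzero on `e` and `e.symm` only
  have h1 := sum_boundary_coboundary (hH.addEdge (e := e)) e
    (fun v => if P.Linked H v e.snd then (1 : ℤ) else 0)
  rw [Finset.sum_eq_single e] at h1
  · have h2 : P.Linked H e.snd e.snd := Relation.EqvGen.refl _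
    simp [h, h2] at h1
  · intro d hd hde
    simp only [Finset.mem_filter, Finset.mem_univ, true_and] at hd
    rcases hd with ⟨hd, h' | h' | h'⟩
    · have : P.Linked H d.fst e.snd ↔ P.Linked H d.snd e.snd :=
        ⟨fun h => (Linked.dart h').symm.trans h, fun h => (Linked.dart h').trans h⟩
      simp [this]
    · contradiction
    · subst h'; contradiction
  · intro h'
    exact absurd (Finset.mem_filter.2 ⟨Finset.mem_univ _, Cls.refl e, Or.inr (Or.inl rfl)⟩) h'

/-- The number of faces of `H`. -/
def numFaces (H : Set P.G.Dart) : ℕ := Nat.card (Quotient (Relation.EqvGen.setoid (P.CrossStep H)))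

/-- The number of connected components of the spanning subgraph with edge set `H`. -/
def numComps (H : Set P.G.Dart) : ℕ :=
  Nat.card (Quotient (Relation.EqvGen.setoid fun u v => ∃ d ∈ H, d.fst = u ∧ d.snd = v))

theorem numFaces_addEdge {e : P.G.Dart} (he : e ∉ H) :
    (P.Cls (P.addEdge H e) e e.symm → numFaces H = numFaces (P.addEdge H e)) ∧
      (¬ P.Cls (P.addEdge H e) e e.symm → numFaces (P.addEdge H e) = numFaces H + 1) :=
  card_quotient_add_pair (r := Relation.EqvGen.setoid (P.CrossStep (P.addEdge H e)))
    (s := Relation.EqvGen.setoid (P.CrossStep H)) (cls_addEdge he)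

theorem numComps_addEdge (e : P.G.Dart) :
    (P.Linked H e.fst e.snd → numComps (P.addEdge H e) = numComps H) ∧
      (¬ P.Linked H e.fst e.snd → numComps H = numComps (P.addEdge H e) + 1) :=
  card_quotient_add_pair (r := Relation.EqvGen.setoid fun u v => ∃ d ∈ H, d.fst = u ∧ d.snd = v)
    (s := Relation.EqvGen.setoid fun u v => ∃ d ∈ P.addEdge H e, d.fst = u ∧ d.snd = v)
    (linked_addEdge e)

theorem ncard_addEdge {e : P.G.Dart} (hH : P.IsSym H) (he : e ∉ H) :
    (P.addEdge H e).ncard = H.ncard + 2 := by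
  have : P.addEdge H e = insert e (insert e.symm H) := by
    ext d; simp only [addEdge, Set.mem_ofPred_eq, Set.mem_insert_iff]; tauto
  rw [this, Set.ncard_insert_of_notMem _ (Set.toFinite _),
    Set.ncard_insert_of_notMem (hH.not_mem he) (Set.toFinite _)]
  rintro (h | h)
  · exact e.symm_ne h.symm
  · exact he h

theorem addEdge_subset {H₁ : Set P.G.Dart} {e : P.G.Dart} (h : H ⊆ H₁) (h₁ : P.IsSym H₁)
    (he : e ∈ H₁) : P.addEdge H e ⊆ H₁ := by
  rintro d (hd | rfl | rfl)
  · exact h hd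
  · exact he
  · exact h₁ _ he

/-- Induction along the addition of edges. -/
theorem addEdge_induction {motive : Set P.G.Dart → Prop} {H₁ : Set P.G.Dart}
    (hH : P.IsSym H) (h₁ : P.IsSym H₁) (hle : H ⊆ H₁) (h₀ : motive H)
    (step : ∀ X e, P.IsSym X → e ∉ X → motive X → motive (P.addEdge X e)) : motive H₁ := by
  generalize hk : (H₁ \ H).ncard = k
  induction k using Nat.strong_induction_on generalizing H with
  | _ k ih =>
    by_cases h : H₁ ⊆ H
    · rwa [← hle.antisymm h]
    · obtain ⟨e, he₁, he⟩ := Set.not_subset.1 h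
      refine ih _ ?_ hH.addEdge (addEdge_subset hle h₁ he₁) (step H e hH he h₀) rfl
      rw [← hk]
      refine Set.ncard_lt_ncard ⟨Set.sdiff_subset_sdiff_right (subset_addEdge e), ?_⟩ (Set.toFinite _)
      intro h'
      exact (h' ⟨he₁, he⟩).2 (Or.inr (Or.inl rfl))

theorem euler_step {e : P.G.Dart} (hH : P.IsSym H) (he : e ∉ H) :
    numFaces (P.addEdge H e) + numComps H ≤ numFaces H + numComps (P.addEdge H e) + 1 := by
  have h1 := numFaces_addEdge he
  have h2 := numComps_addEdge (H := H) e
  have h3 := cls_symm_of_not_linked (e := e) hH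
  by_cases a : P.Cls (P.addEdge H e) e e.symm <;> by_cases b : P.Linked H e.fst e.snd
  · have := h1.1 a; have := h2.1 b; omega
  · have := h1.1 a; have := h2.2 b; omega
  · have := h1.2 a; have := h2.1 b; omega
  · exact absurd (h3 b) a

theorem euler_le {H₁ : Set P.G.Dart} (hH : P.IsSym H) (h₁ : P.IsSym H₁) (hle : H ⊆ H₁) :
    2 * numFaces H₁ + 2 * numComps H + H.ncard ≤ 2 * numFaces H + 2 * numComps H₁ + H₁.ncard := by
  refine addEdge_induction (motive := fun X => 2 * numFaces X + 2 * numComps H + H.ncard ≤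
    2 * numFaces H + 2 * numComps X + X.ncard) hH h₁ hle le_rfl ?_
  intro X e hX he h
  have := euler_step hX he
  have := ncard_addEdge hX he
  omega

/-- Around a vertex that `H` does not touch, all darts belong to one face of `H`. -/
theorem cls_of_fst_eq {v : Fin n} (hv : ∀ d ∈ H, d.fst ≠ v) {d d' : P.G.Dart}
    (hd : d.fst = v) (hd' : d'.fst = v) : P.Cls H d d' := by
  obtain ⟨k, rfl⟩ := Equiv.Perm.SameCycle.exists_nat_pow_eq (P.rot_cyclic d d' (hd.trans hd'.symm))
  clear hd'
  induction k with
  | zero => exact Cls.refl _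
  | succ k ih =>
    rw [pow_succ']
    refine ih.trans ?_
    have h1 : ∀ j, ((P.rot ^ j) d).fst = v := by
      intro j
      induction j with
      | zero => exact hd
      | succ j ihj => rw [pow_succ', Equiv.Perm.mul_apply, P.rot_fst, ihj]
    have h2 : (P.rot ^ k) d ∉ H := fun h => hv _ h (h1 k)
    have h3 := (Cls.cross h2).trans (Cls.faceNext _)
    rwa [faceNext_apply, SimpleGraph.Dart.symm_symm] at h3

/-- The graph without edges has a single face, since `G` is connected. -/
theorem cls_empty (d d' : P.G.Dart) : P.Cls ∅ d d' := by
  have key : ∀ u v, P.G.Reachable u v → ∀ d d' : P.G.Dart, d.fst = u → d'.fst = v →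
      P.Cls ∅ d d' := by
    rintro u v ⟨w⟩
    induction w with
    | nil =>
      intro d d' h h'
      exact cls_of_fst_eq (fun _ h => h.elim) h h'
    | @cons a b c hab w ih =>
      intro d d' h h'
      let e : P.G.Dart := ⟨(a, b), hab⟩
      have h1 : P.Cls ∅ d e := cls_of_fst_eq (fun _ h => h.elim) h rfl
      exact (h1.trans (Cls.cross (fun h => h.elim))).trans (ih e.symm d' rfl h')
  exact key _ _ (P.connected.preconnected _ _) d d' rfl rfl

theorem linked_univ (u v : Fin n) : P.Linked Set.univ u v := by
  obtain ⟨w⟩ := P.connected.preconnected u v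
  induction w with
  | nil => exact Relation.EqvGen.refl _
  | @cons a b c hab w ih =>
    exact (Linked.dart (d := ⟨(a, b), hab⟩) (Set.mem_univ _)).trans ih

theorem cls_univ {d d' : P.G.Dart} : P.Cls Set.univ d d' ↔ P.SameFace d d' := by
  refine ⟨fun h => ?_, SameFace.cls⟩
  induction h with
  | rel x y h =>
    rcases h with rfl | ⟨h, -⟩
    · exact Equiv.Perm.sameCycle_apply_right.2 (Equiv.Perm.SameCycle.refl _ _)
    · exact absurd (Set.mem_univ _) h
  | refl x => exact Equiv.Perm.SameCycle.refl _ _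
  | symm x y _ ih => exact Equiv.Perm.SameCycle.symm ih
  | trans x y z _ _ h h' => exact Equiv.Perm.SameCycle.trans h h'

theorem eq_of_linked_empty {u v : Fin n} (h : P.Linked ∅ u v) : u = v := by
  induction h with
  | rel x y h => obtain ⟨d, hd, -⟩ := h; exact hd.elim
  | refl => rfl
  | symm x y _ ih => exact ih.symm
  | trans x y z _ _ ih ih' => exact ih.trans ih'

/-- In a plane graph, an edge whose endpoints are connected in `H` has different faces of the
enlarged graph on its two sides. -/
theorem not_cls_symm_of_linked {e : P.G.Dart} (hH : P.IsSym H) (he : e ∉ H)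
    (h : P.Linked H e.fst e.snd) : ¬ P.Cls (P.addEdge H e) e e.symm := by
  classical
  intro hc
  have h1 := (numFaces_addEdge he).1 hc
  have h2 := (numComps_addEdge (H := H) e).1 h
  have h3 := ncard_addEdge hH he
  -- Euler's inequality from the empty graph to `H`, and from `H + e` to `G`: if `e` did not
  -- separate faces, then Euler's formula for `G` would fail
  have h4 := euler_le (H := ∅) (fun _ h => h.elim) hH (Set.empty_subset H)
  have h5 := euler_le hH.addEdge (H₁ := Set.univ) (fun _ _ => Set.mem_univ _)
    (Set.subset_univ (P.addEdge H e))
  have c0 : numFaces (∅ : Set P.G.Dart) = 1 := by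
    have : Subsingleton (Quotient (Relation.EqvGen.setoid (P.CrossStep ∅))) := by
      refine ⟨fun q q' => ?_⟩
      induction q using Quotient.inductionOn with | _ x =>
      induction q' using Quotient.inductionOn with | _ y =>
      exact Quotient.sound (cls_empty x y)
    exact Nat.card_eq_one_iff_unique.2 ⟨this, ⟨Quotient.mk _ e⟩⟩
  have k0 : numComps (∅ : Set P.G.Dart) = n := by
    have hb : Function.Bijective (Quotient.mk (Relation.EqvGen.setoid fun u v : Fin n =>
        ∃ d ∈ (∅ : Set P.G.Dart), d.fst = u ∧ d.snd = v)) := by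
      refine ⟨fun x y h => ?_, Quotient.mk_surjective⟩
      exact eq_of_linked_empty (Quotient.exact h)
    rw [numComps, ← Nat.card_congr (Equiv.ofBijective _ hb), Nat.card_fin]
  have c1 : numFaces (Set.univ : Set P.G.Dart) =
      Nat.card (Quotient (Equiv.Perm.SameCycle.setoid P.faceNext)) :=
    Nat.card_congr (Quotient.congr (Equiv.refl _) fun x y => cls_univ)
  have k1 : numComps (Set.univ : Set P.G.Dart) = 1 := by
    refine Nat.card_eq_one_iff_unique.2 ⟨⟨fun q q' => ?_⟩, ⟨Quotient.mk _ e.fst⟩⟩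
    induction q using Quotient.inductionOn with | _ x =>
    induction q' using Quotient.inductionOn with | _ y =>
    exact Quotient.sound (linked_univ x y)
  have hE : (Set.univ : Set P.G.Dart).ncard = 2 * P.G.edgeSet.ncard := by
    rw [Set.ncard_univ, Nat.card_eq_fintype_card, SimpleGraph.dart_card_eq_twice_card_edges,
      ← SimpleGraph.coe_edgeFinset, Set.ncard_coe_finset]
  have he := P.euler
  change (n : ℤ) - _ + ((Nat.card (Quotient (Equiv.Perm.SameCycle.setoid P.faceNext)) : ℕ) : ℤ)
    = 2 at he
  rw [Set.ncard_empty] at h4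
  omega

open Classical in
/-- The first cohomology of a plane graph vanishes: an antisymmetric function on darts whose sum
around every face is zero is the coboundary of a function on vertices. -/
theorem exists_potential {A : Type*} [AddCommGroup A] (t : P.G.Dart → A)
    (ht : ∀ d, t d.symm = - t d)
    (hf : ∀ d₁, ∑ d ∈ Finset.univ.filter (fun d => P.SameFace d₁ d), t d = 0) :
    ∃ p : Fin n → A, ∀ d, t d = p d.fst - p d.snd := by
  suffices h : ∃ p : Fin n → A, ∀ d ∈ (Set.univ : Set P.G.Dart), t d = p d.fst - p d.snd by
    obtain ⟨p, hp⟩ := h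
    exact ⟨p, fun d => hp d (Set.mem_univ d)⟩
  refine addEdge_induction (motive := fun H => ∃ p : Fin n → A, ∀ d ∈ H, t d = p d.fst - p d.snd)
    (H := ∅) (fun _ h => h.elim) (fun _ _ => Set.mem_univ _) (Set.empty_subset _)
    ⟨fun _ => 0, fun _ h => h.elim⟩ ?_
  rintro H e hH he ⟨p, hp⟩
  -- an edge within a component closes a cycle, around which `t` and the coboundary of `p` agree by
  -- Stokes' theorem; an edge between two components is accommodated by a shift of one of them
  by_cases hl : P.Linked H e.fst e.snd
  · refine ⟨p, ?_⟩
    have hc := not_cls_symm_of_linked hH he hl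
    have h1 := sum_boundary_closed (hH.addEdge (e := e)) e t ht hf
    have h2 := sum_boundary_coboundary (hH.addEdge (e := e)) e p
    have h3 : t e - (p e.fst - p e.snd) = 0 := by
      have h4 := h1.trans h2.symm
      rw [← sub_eq_zero, ← Finset.sum_sub_distrib, Finset.sum_eq_single e] at h4
      · exact h4
      · intro d hd hde
        simp only [Finset.mem_filter, Finset.mem_univ, true_and] at hd
        rcases hd with ⟨hd, h' | h' | h'⟩
        · rw [hp d h', sub_self]
        · contradiction
        · subst h'; contradiction
      · intro h'
        exact absurd (Finset.mem_filter.2 ⟨Finset.mem_univ _, Cls.refl e, Or.inr (Or.inl rfl)⟩) h'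
    rw [sub_eq_zero] at h3
    rintro d (hd | rfl | rfl)
    · exact hp d hd
    · exact h3
    · rw [ht, h3]; simp
  · let c := t e - (p e.fst - p e.snd)
    refine ⟨fun v => if P.Linked H e.snd v then p v - c else p v, ?_⟩
    have h0 : ¬ P.Linked H e.snd e.fst := fun h => hl h.symm
    have h1 : P.Linked H e.snd e.snd := Relation.EqvGen.refl _
    rintro d (hd | rfl | rfl)
    · have : P.Linked H e.snd d.fst ↔ P.Linked H e.snd d.snd :=
        ⟨fun h => h.trans (Linked.dart hd), fun h => h.trans (Linked.dart hd).symm⟩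
      by_cases h : P.Linked H e.snd d.snd
      · simp only [this, h, if_true]; rw [hp d hd]; abel
      · simp only [this, h, if_false]; rw [hp d hd]
    · simp only [h0, h1, if_true, if_false, c]; abel
    · simp only [SimpleGraph.Dart.symm_toProd, Prod.fst_swap, Prod.snd_swap, h0, h1, if_true,
        if_false, c, ht]
      abel

end PlaneGraph

open PlaneGraph
namespace Rep
variable {n : ℕ} {P : PlaneGraph n} {H : Set P.G.Dart} {R : Rep P}

/-! ### The Gauss-Bonnet formula for connected subgraphs -/

open Classical in
/-- The contribution of the dart `d` to the total turning of the boundary of its face in `H`: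
every dart of `H` contributes `2` (in units of 90 degrees), every corner at a vertex of `H`
subtracts its angle, and the central and the outer face of the whole graph add `4` each. -/
def gb (R : Rep P) (H : Set P.G.Dart) (d : P.G.Dart) : ℤ :=
  (if d ∈ H then 2 else 0) - (if ∃ g ∈ H, g.fst = d.snd then (R.angle d.symm : ℤ) else 0)
    + (if d = R.central then 4 else 0) + (if d = R.outer then 4 else 0)

open Classical in
/-- The faces of the whole graph satisfy the formula by the conditions on the angle sums. -/
theorem sum_gb_univ (hV : R.Valid) (x : P.G.Dart) :
    ∑ d ∈ Finset.univ.filter (fun d => P.SameFace x d), gb R Set.univ d = 4 := by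
  have h0 : ∀ d : P.G.Dart, gb R Set.univ d = 2 - (R.angle d.symm : ℤ)
      + (if d = R.central then 4 else 0) + (if d = R.outer then 4 else 0) := by
    intro d
    rw [gb, if_pos (Set.mem_univ d), if_pos ⟨d.symm, Set.mem_univ _, rfl⟩]
  have hA : (R.faceAngleSum x : ℤ) =
      ∑ d ∈ Finset.univ.filter (fun d => P.SameFace x d), (R.angle d.symm : ℤ) := by
    rw [faceAngleSum]; push_cast; rfl
  have hC : ∀ z : P.G.Dart, ∑ d ∈ Finset.univ.filter (fun d => P.SameFace x d),
      (if d = z then (4 : ℤ) else 0) = if P.SameFace x z then 4 else 0 := by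
    intro z
    rw [Finset.sum_ite_eq']
    simp
  rw [Finset.sum_congr rfl fun d _ => h0 d, Finset.sum_add_distrib, Finset.sum_add_distrib,
    Finset.sum_sub_distrib, ← hA, hC, hC, Finset.sum_const]
  change (faceCorners x) • (2 : ℤ) - _ + _ + _ = 4
  have sy : ∀ z : P.G.Dart, P.SameFace x z ↔ P.SameFace z x := fun z =>
    ⟨fun h => Equiv.Perm.SameCycle.symm h, fun h => Equiv.Perm.SameCycle.symm h⟩
  rw [nsmul_eq_mul, sy, sy]
  have := hV.face_both x
  have := hV.face_one x
  have := hV.face_regular x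
  by_cases hc : P.SameFace R.central x <;> by_cases ho : P.SameFace R.outer x <;>
    simp only [hc, ho, if_true, if_false, not_true, not_false_iff, iff_true, iff_false, true_imp_iff,
      false_imp_iff] at * <;> omega

open Classical in
theorem gb_addEdge_chord {e : P.G.Dart} (he : e ∉ H) (he' : e.symm ∉ H)
    (h₁ : ∃ g ∈ H, g.fst = e.fst) (h₂ : ∃ g ∈ H, g.fst = e.snd) (d : P.G.Dart) :
    gb R (P.addEdge H e) d =
      gb R H d + (if d = e then 2 else 0) + (if d = e.symm then 2 else 0) := by
  have hv : (∃ g ∈ P.addEdge H e, g.fst = d.snd) ↔ ∃ g ∈ H, g.fst = d.snd := by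
    constructor
    · rintro ⟨g, hg | rfl | rfl, h⟩
      · exact ⟨g, hg, h⟩
      · rw [← h]; exact h₁
      · rw [← h]; exact h₂
    · rintro ⟨g, hg, h⟩
      exact ⟨g, Or.inl hg, h⟩
  have hm : (if d ∈ P.addEdge H e then (2 : ℤ) else 0) =
      (if d ∈ H then 2 else 0) + (if d = e then 2 else 0) + (if d = e.symm then 2 else 0) := by
    by_cases h1 : d = e
    · subst h1
      have : d ≠ d.symm := fun h => d.symm_ne h.symm
      simp [addEdge, he, this]
    · by_cases h2 : d = e.symm
      · subst h2; simp [addEdge, he', e.symm_ne]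
      · simp [addEdge, h1, h2]
  rw [gb, gb, hm]
  simp only [hv]
  ring

open Classical in
theorem gb_addEdge_leaf {e : P.G.Dart} (he : e ∉ H) (he' : e.symm ∉ H)
    (h₁ : ∃ g ∈ H, g.fst = e.fst) (h₂ : ¬ ∃ g ∈ H, g.fst = e.snd) (d : P.G.Dart) :
    gb R (P.addEdge H e) d =
      gb R H d + (if d = e then 2 else 0) + (if d = e.symm then 2 else 0)
        - (if d.snd = e.snd then (R.angle d.symm : ℤ) else 0) := by
  have hv : (∃ g ∈ P.addEdge H e, g.fst = d.snd) ↔ (∃ g ∈ H, g.fst = d.snd) ∨ d.snd = e.snd := by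
    constructor
    · rintro ⟨g, hg | rfl | rfl, h⟩
      · exact Or.inl ⟨g, hg, h⟩
      · rw [← h]; exact Or.inl h₁
      · exact Or.inr h.symm
    · rintro (⟨g, hg, h⟩ | h)
      · exact ⟨g, Or.inl hg, h⟩
      · exact ⟨e.symm, Or.inr (Or.inr rfl), h.symm⟩
  have hm : (if d ∈ P.addEdge H e then (2 : ℤ) else 0) =
      (if d ∈ H then 2 else 0) + (if d = e then 2 else 0) + (if d = e.symm then 2 else 0) := by
    by_cases h1 : d = e
    · subst h1
      have : d ≠ d.symm := fun h => d.symm_ne h.symm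
      simp [addEdge, he, this]
    · by_cases h2 : d = e.symm
      · subst h2; simp [addEdge, he', e.symm_ne]
      · simp [addEdge, h1, h2]
  have ha : (if ∃ g ∈ P.addEdge H e, g.fst = d.snd then (R.angle d.symm : ℤ) else 0) =
      (if ∃ g ∈ H, g.fst = d.snd then (R.angle d.symm : ℤ) else 0)
        + (if d.snd = e.snd then (R.angle d.symm : ℤ) else 0) := by
    simp only [hv]
    by_cases h : d.snd = e.snd
    · rw [h]; simp [h₂]
    · simp [h]
  rw [gb, gb, hm, ha]
  ring

open Classical in
/-- The Gauss-Bonnet formula: for a connected subgraph `H`, the total turning of the boundary of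
each face of `H` is that of a disc, up to the corrections for the central and the outer face. -/
theorem sum_gb (hV : R.Valid) (hH : P.IsSym H) (hne : H.Nonempty)
    (hl : ∀ d ∈ H, ∀ d' ∈ H, P.Linked H d.fst d'.fst) (x : P.G.Dart) :
    ∑ d ∈ Finset.univ.filter (fun d => P.Cls H x d), gb R H d = 4 := by
  generalize hk : (Hᶜ).ncard = k
  induction k using Nat.strong_induction_on generalizing H x with
  | _ k ih =>
  by_cases huniv : H = Set.univ
  · subst huniv
    simp only [cls_univ]
    exact sum_gb_univ hV x
  -- a missing edge with a tail in the subgraph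
  obtain ⟨e, he, g₁, hg₁, hge⟩ : ∃ e, e ∉ H ∧ ∃ g ∈ H, g.fst = e.fst := by
    by_contra hcon
    push Not at hcon
    apply huniv
    obtain ⟨g, hg⟩ := hne
    have hall : ∀ v, ∃ g ∈ H, g.fst = v := by
      intro v
      have h0 : ∃ g' ∈ H, g'.fst = g.fst := ⟨g, hg, rfl⟩
      obtain ⟨w⟩ := P.connected.preconnected g.fst v
      generalize g.fst = u at h0 w
      induction w with
      | nil => exact h0
      | @cons a b c hab w ihw =>
        apply ihw
        obtain ⟨g', hg', h'⟩ := h0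
        let e : P.G.Dart := ⟨(a, b), hab⟩
        have : e ∈ H := by
          by_contra he
          exact hcon e he g' hg' h'
        exact ⟨e.symm, hH _ this, rfl⟩
    ext d
    simp only [Set.mem_univ, iff_true]
    by_contra hd
    obtain ⟨g', hg', h'⟩ := hall d.fst
    exact hcon d hd g' hg' h'
  have he' := hH.not_mem he
  have hH' := hH.addEdge (e := e)
  have hlt : ((P.addEdge H e)ᶜ).ncard < k := by
    rw [← hk]
    refine Set.ncard_lt_ncard ⟨Set.compl_subset_compl.2 (subset_addEdge e), ?_⟩ (Set.toFinite _)
    intro h'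
    exact h' he (Or.inr (Or.inl rfl))
  have hl' : ∀ d ∈ P.addEdge H e, P.Linked (P.addEdge H e) e.fst d.fst := by
    have h1 : P.Linked (P.addEdge H e) e.fst e.snd := Linked.dart (Or.inr (Or.inl rfl))
    rintro d (hd | rfl | rfl)
    · exact (hge ▸ hl g₁ hg₁ d hd).mono (subset_addEdge e)
    · exact Relation.EqvGen.refl _
    · exact h1
  have ih' := fun y => ih _ hlt hH' (hne.mono (subset_addEdge e))
    (fun d hd d' hd' => (hl' d hd).symm.trans (hl' d' hd')) y rfl
  by_cases hs : ∃ g ∈ H, g.fst = e.snd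
  -- a chord splits a face of `H` in two, and adds `2` to each of them
  · obtain ⟨g₂, hg₂, hge₂⟩ := hs
    have hgb := gb_addEdge_chord (R := R) he he' ⟨g₁, hg₁, hge⟩ ⟨g₂, hg₂, hge₂⟩
    have hc : ¬ P.Cls (P.addEdge H e) e e.symm :=
      not_cls_symm_of_linked hH he (by rw [← hge, ← hge₂]; exact hl _ hg₁ _ hg₂)
    have hc' : ¬ P.Cls (P.addEdge H e) e.symm e := fun h => hc h.symm
    by_cases hx : P.Cls H x e
    · have hcl : ∀ d, P.Cls H x d ↔ (P.Cls (P.addEdge H e) e d ∨ P.Cls (P.addEdge H e) e.symm d) := by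
        intro d
        constructor
        · intro h
          rcases (cls_addEdge he e d).1 (hx.symm.trans h) with h | ⟨-, h⟩ | ⟨h, -⟩
          · exact Or.inl h
          · exact Or.inr h.symm
          · exact absurd h hc
        · rintro (h | h)
          · exact hx.trans (h.mono (subset_addEdge e))
          · exact hx.trans ((Cls.cross he).trans (h.mono (subset_addEdge e)))
      have e1 : Finset.univ.filter (fun d => P.Cls H x d) =
          Finset.univ.filter (fun d => P.Cls (P.addEdge H e) e d) ∪
            Finset.univ.filter (fun d => P.Cls (P.addEdge H e) e.symm d) := by
        rw [← Finset.filter_or]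
        exact Finset.filter_congr fun d _ => hcl d
      rw [e1, Finset.sum_union]
      · have i1 := ih' e
        have i2 := ih' e.symm
        rw [Finset.sum_congr rfl fun d _ => hgb d, Finset.sum_add_distrib, Finset.sum_add_distrib,
          Finset.sum_ite_eq', Finset.sum_ite_eq'] at i1 i2
        simp only [Finset.mem_filter, Finset.mem_univ, true_and, hc, hc', Cls.refl, if_true,
          if_false] at i1 i2
        omega
      · rw [Finset.disjoint_left]
        intro d h1 h2
        simp only [Finset.mem_filter, Finset.mem_univ, true_and] at h1 h2
        exact hc (h1.trans h2.symm)
    · have hcl : ∀ d, P.Cls H x d ↔ P.Cls (P.addEdge H e) x d := by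
        intro d
        constructor
        · intro h
          rcases (cls_addEdge he x d).1 h with h | ⟨h, -⟩ | ⟨h, -⟩
          · exact h
          · exact absurd (h.mono (subset_addEdge e)) hx
          · exact absurd ((h.mono (subset_addEdge e)).trans (Cls.cross he).symm) hx
        · exact fun h => h.mono (subset_addEdge e)
      have hxs : ¬ P.Cls H x e.symm := fun h => hx (h.trans (Cls.cross he).symm)
      rw [← ih' x, Finset.filter_congr fun d _ => hcl d]
      refine Finset.sum_congr rfl fun d hd => ?_
      simp only [Finset.mem_filter, Finset.mem_univ, true_and, ← hcl] at hd
      have n1 : d ≠ e := fun h => hx (h ▸ hd)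
      have n2 : d ≠ e.symm := fun h => hxs (h ▸ hd)
      rw [hgb]; simp [n1, n2]
  -- a pendant edge adds `4` to its face, which the angles around the new vertex compensate
  · have hgb := gb_addEdge_leaf (R := R) he he' ⟨g₁, hg₁, hge⟩ hs
    have hnl : ¬ P.Linked H e.fst e.snd := by
      have : ∀ u v, P.Linked H u v → ((∃ g ∈ H, g.fst = u) ↔ ∃ g ∈ H, g.fst = v) := by
        intro u v h
        induction h with
        | rel u v h =>
          obtain ⟨d, hd, rfl, rfl⟩ := h
          exact ⟨fun _ => ⟨d.symm, hH d hd, rfl⟩, fun _ => ⟨d, hd, rfl⟩⟩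
        | refl => rfl
        | symm _ _ _ ih => exact ih.symm
        | trans _ _ _ _ _ ih ih' => exact ih.trans ih'
      intro h
      exact hs ((this _ _ h).1 ⟨g₁, hg₁, hge⟩)
    have hc := cls_symm_of_not_linked (e := e) hH hnl
    have hcl : ∀ d, P.Cls H x d ↔ P.Cls (P.addEdge H e) x d := by
      intro d
      constructor
      · intro h
        rcases (cls_addEdge he x d).1 h with h | ⟨h, h'⟩ | ⟨h, h'⟩
        · exact h
        · exact (h.trans hc).trans h'.symm
        · exact (h.trans hc.symm).trans h'.symm
      · exact fun h => h.mono (subset_addEdge e)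
    -- all darts into the new vertex lie in the face that contains the new edge
    have hin : ∀ d : P.G.Dart, d.snd = e.snd → (P.Cls H x d ↔ P.Cls H x e) := by
      intro d hd
      have hz : ∀ d' ∈ H, d'.fst ≠ e.snd := fun d' hd' h => hs ⟨d', hd', h⟩
      have h1 : P.Cls H d.symm e.symm := cls_of_fst_eq hz hd rfl
      have hdH : d ∉ H := fun h => hz _ (hH d h) hd
      have h2 : P.Cls H d e := ((Cls.cross hdH).trans h1).trans (Cls.cross he).symm
      exact ⟨fun h => h.trans h2, fun h => h.trans h2.symm⟩
    have i1 := ih' x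
    rw [← Finset.filter_congr fun d _ => hcl d, Finset.sum_congr rfl fun d _ => hgb d,
      Finset.sum_sub_distrib, Finset.sum_add_distrib, Finset.sum_add_distrib,
      Finset.sum_ite_eq', Finset.sum_ite_eq'] at i1
    simp only [Finset.mem_filter, Finset.mem_univ, true_and] at i1
    have hs1 : P.Cls H x e.symm ↔ P.Cls H x e :=
      ⟨fun h => h.trans (Cls.cross he).symm, fun h => h.trans (Cls.cross he)⟩
    have i2 : ∑ d ∈ Finset.univ.filter (fun d => P.Cls H x d),
        (if d.snd = e.snd then (R.angle d.symm : ℤ) else 0) = if P.Cls H x e then 4 else 0 := by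
      rw [← Finset.sum_filter, Finset.filter_filter]
      by_cases hxe : P.Cls H x e
      · rw [if_pos hxe]
        have := hV.vertex_sum e.snd
        zify at this
        rw [← this]
        refine Finset.sum_bij (fun d _ => d.symm) ?_ ?_ ?_ ?_
        · intro d hd
          simp only [Finset.mem_filter, Finset.mem_univ, true_and] at hd ⊢
          exact hd.2
        · intro d _ d' _ h
          exact SimpleGraph.Dart.symm_involutive.injective h
        · intro d hd
          simp only [Finset.mem_filter, Finset.mem_univ, true_and] at hd ⊢
          exact ⟨d.symm, ⟨(hin d.symm hd).2 hxe, hd⟩, by simp⟩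
        · intro d _; rfl
      · rw [if_neg hxe]
        refine Finset.sum_eq_zero fun d hd => absurd ?_ hxe
        simp only [Finset.mem_filter, Finset.mem_univ, true_and] at hd
        exact (hin d hd.2).1 hd.1
    rw [i2] at i1
    simp only [hs1] at i1
    by_cases hxe : P.Cls H x e
    · simp only [hxe, if_true] at i1; linarith
    · simp only [hxe, if_false] at i1; linarith

end Rep

namespace Rep
variable {n : ℕ} {P : PlaneGraph n} {R : Rep P}

/-! ### Directions of darts -/

open Classical in
/-- The darts with tail `v`. -/
def dartsAt (P : PlaneGraph n) (v : Fin n) : Finset P.G.Dart :=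
  Finset.univ.filter fun d => d.fst = v

/-- The sum of the angles of the first `m` corners counter-clockwise from `d`. -/
def rsum (R : Rep P) (d : P.G.Dart) (m : ℕ) : ℕ := ∑ i ∈ Finset.range m, R.angle ((P.rot ^ i) d)

theorem mem_dartsAt {v : Fin n} {d : P.G.Dart} : d ∈ dartsAt P v ↔ d.fst = v := by
  simp [dartsAt]

theorem rot_pow_fst (d : P.G.Dart) (k : ℕ) : ((P.rot ^ k) d).fst = d.fst := by
  induction k with
  | zero => rfl
  | succ j ihj => rw [pow_succ', Equiv.Perm.mul_apply, P.rot_fst, ihj]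

theorem isCycleOn_dartsAt (v : Fin n) : P.rot.IsCycleOn (dartsAt P v : Set P.G.Dart) := by
  refine ⟨⟨fun d hd => ?_, P.rot.injective.injOn, fun d hd => ?_⟩, fun d hd d' hd' => ?_⟩
  · simp only [Finset.mem_coe, mem_dartsAt] at hd ⊢
    rw [P.rot_fst, hd]
  · simp only [Finset.mem_coe, mem_dartsAt] at hd
    refine ⟨P.rot.symm d, ?_, by simp⟩
    simp only [Finset.mem_coe, mem_dartsAt]
    rw [← P.rot_fst, Equiv.apply_symm_apply, hd]
  · simp only [Finset.mem_coe, mem_dartsAt] at hd hd'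
    exact P.rot_cyclic d d' (hd.trans hd'.symm)

theorem angle_pos (R : Rep P) (d : P.G.Dart) : 1 ≤ R.angle d := by
  have := R.angle_mem d; omega

theorem rsum_add (d : P.G.Dart) (a b : ℕ) :
    R.rsum d (a + b) = R.rsum d a + R.rsum ((P.rot ^ a) d) b := by
  rw [rsum, rsum, rsum, Finset.sum_range_add]
  congr 1
  refine Finset.sum_congr rfl fun i _ => ?_
  rw [← Equiv.Perm.mul_apply, ← pow_add, add_comm i a]

theorem le_rsum (d : P.G.Dart) (m : ℕ) : m ≤ R.rsum d m := by
  have := Finset.card_nsmul_le_sum (Finset.range m) (fun i => R.angle ((P.rot ^ i) d)) 1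
    (fun i _ => R.angle_pos _)
  simpa [rsum] using this

theorem rsum_card (hV : R.Valid) (d : P.G.Dart) : R.rsum d (dartsAt P d.fst).card = 4 := by
  classical
  have hc := isCycleOn_dartsAt (P := P) d.fst
  have hd : d ∈ dartsAt P d.fst := mem_dartsAt.2 rfl
  rw [← hV.vertex_sum d.fst, rsum]
  refine Finset.sum_nbij (fun i => (P.rot ^ i) d) ?_ ?_ ?_ ?_
  · intro i _
    simp [rot_pow_fst]
  · intro i hi j hj h
    have := (hc.pow_apply_eq_pow_apply hd).1 h
    rw [Finset.coe_range, Set.mem_Iio] at hi hj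
    exact Nat.ModEq.eq_of_lt_of_lt this hi hj
  · intro x hx
    have hx' : x ∈ dartsAt P d.fst := by simpa [dartsAt] using hx
    obtain ⟨k, hk, h⟩ := hc.exists_pow_eq hd hx'
    exact ⟨k, by simpa using hk, h⟩
  · intro i _; rfl

theorem rot_pow_card (d : P.G.Dart) : (P.rot ^ (dartsAt P d.fst).card) d = d :=
  (isCycleOn_dartsAt (P := P) d.fst).pow_card_apply (mem_dartsAt.2 rfl)

theorem exists_rot_pow {d d' : P.G.Dart} (h : d'.fst = d.fst) :
    ∃ k < (dartsAt P d.fst).card, (P.rot ^ k) d = d' :=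
  (isCycleOn_dartsAt (P := P) d.fst).exists_pow_eq (mem_dartsAt.2 rfl) (mem_dartsAt.2 h)

theorem rsum_lt (hV : R.Valid) {d : P.G.Dart} {k : ℕ} (hk : k < (dartsAt P d.fst).card) :
    R.rsum d k < 4 := by
  obtain ⟨j, hj⟩ := Nat.exists_eq_add_of_lt hk
  have h := rsum_card hV d
  rw [hj, add_assoc, rsum_add] at h
  have := le_rsum (R := R) ((P.rot ^ k) d) (j + 1)
  omega

theorem rsum_mod_congr (hV : R.Valid) {d : P.G.Dart} {a b : ℕ}
    (h : (P.rot ^ a) d = (P.rot ^ b) d) : (R.rsum d a : ZMod 4) = R.rsum d b := by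
  wlog hab : a ≤ b generalizing a b
  · exact (this h.symm (le_of_not_ge hab)).symm
  have hm := ((isCycleOn_dartsAt (P := P) d.fst).pow_apply_eq_pow_apply (mem_dartsAt.2 rfl)).1 h
  obtain ⟨c, hc⟩ := (Nat.modEq_iff_dvd' hab).1 hm
  obtain rfl : b = a + (dartsAt P d.fst).card * c := by omega
  clear hc hm h hab
  have h4 : ((4 : ℕ) : ZMod 4) = 0 := by decide
  induction c with
  | zero => simp
  | succ c ih =>
    rw [Nat.mul_succ, ← add_assoc, rsum_add, Nat.cast_add, ← ih]
    have h1 := rsum_card hV ((P.rot ^ (a + (dartsAt P d.fst).card * c)) d)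
    rw [rot_pow_fst] at h1
    rw [h1, h4, add_zero]

/-- A function assigning directions to the darts at each vertex, up to a rotation at the vertex. -/
theorem exists_local_dir (hV : R.Valid) :
    ∃ loc : P.G.Dart → ZMod 4, ∀ d, loc (P.rot d) = loc d - (R.angle d : ZMod 4) := by
  have hb : ∀ v : Fin n, ∃ b : P.G.Dart → Prop, (∀ d, b d → d.fst = v) ∧
      (∀ d d', b d → b d' → d = d') ∧ ∀ d : P.G.Dart, d.fst = v → ∃ d', b d' := by
    intro v
    by_cases h : ∃ d : P.G.Dart, d.fst = v
    · obtain ⟨d, hd⟩ := h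
      exact ⟨fun x => x = d, by rintro _ rfl; exact hd, by rintro _ _ rfl rfl; rfl,
        fun _ _ => ⟨d, rfl⟩⟩
    · exact ⟨fun _ => False, fun _ h => h.elim, fun _ _ h => h.elim, fun d hd => (h ⟨d, hd⟩).elim⟩
  choose b hb1 hb2 hb3 using hb
  have h1 : ∀ d : P.G.Dart, ∃ x : P.G.Dart × ℕ, b d.fst x.1 ∧ (P.rot ^ x.2) x.1 = d := by
    intro d
    obtain ⟨d', hd'⟩ := hb3 d.fst d rfl
    obtain ⟨k, -, hk⟩ := exists_rot_pow (d := d') (d' := d) (hb1 _ _ hd').symm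
    exact ⟨(d', k), hd', hk⟩
  choose f hf1 hf2 using h1
  refine ⟨fun d => - (R.rsum (f d).1 (f d).2 : ZMod 4), fun d => ?_⟩
  have h2 : (f (P.rot d)).1 = (f d).1 := by
    apply hb2 d.fst _ _ _ (hf1 d)
    have := hf1 (P.rot d)
    rwa [P.rot_fst] at this
  have h3 : (P.rot ^ (f (P.rot d)).2) (f d).1 = (P.rot ^ ((f d).2 + 1)) (f d).1 := by
    rw [← h2, hf2, h2, pow_succ', Equiv.Perm.mul_apply, hf2]
  have h4 := rsum_mod_congr hV h3
  beta_reduce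
  rw [h2, h4, rsum_add, hf2]
  simp [rsum]
  ring

/-- Directions are consistent: the curvature of an ortho-radial representation vanishes modulo
four full right angles at every vertex and face, and a plane graph has no further cycles. -/
theorem exists_dir (hV : R.Valid) : ∃ dir : P.G.Dart → ZMod 4, dir R.ref = 0 ∧
    (∀ d, dir d.symm = dir d + 2) ∧ ∀ d, dir (P.rot d) = dir d - (R.angle d : ZMod 4) := by
  classical
  obtain ⟨loc, hloc⟩ := exists_local_dir hV
  -- the local choices of directions disagree along the edges by a cocycle, which is a coboundary
  have h4 : (4 : ZMod 4) = 0 := by decide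
  obtain ⟨p, hp⟩ := exists_potential (P := P) (fun d => loc d.symm - loc d - 2)
    (fun d => by
      simp only [SimpleGraph.Dart.symm_symm]
      linear_combination (-1 : ZMod 4) * h4)
    (fun d₁ => by
      rw [Finset.sum_sub_distrib, Finset.sum_sub_distrib]
      have e1 : ∑ d ∈ Finset.univ.filter (fun d => P.SameFace d₁ d), loc d =
          ∑ d ∈ Finset.univ.filter (fun d => P.SameFace d₁ d), loc (P.faceNext d) := by
        symm
        refine Finset.sum_bij (fun d _ => P.faceNext d) ?_ ?_ ?_ ?_
        · intro d hd
          simp only [Finset.mem_filter, Finset.mem_univ, true_and] at hd ⊢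
          exact Equiv.Perm.sameCycle_apply_right.2 hd
        · intro d _ d' _ h; exact P.faceNext.injective h
        · intro d hd
          simp only [Finset.mem_filter, Finset.mem_univ, true_and] at hd ⊢
          exact ⟨P.faceNext.symm d, Equiv.Perm.sameCycle_apply_right.1 (by rw [Equiv.apply_symm_apply]; exact hd), by simp⟩
        · intro d _; rfl
      have e2 : ∑ d ∈ Finset.univ.filter (fun d => P.SameFace d₁ d), loc (P.faceNext d) =
          ∑ d ∈ Finset.univ.filter (fun d => P.SameFace d₁ d), loc d.symm
            - (R.faceAngleSum d₁ : ZMod 4) := by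
        rw [faceAngleSum, Nat.cast_sum, ← Finset.sum_sub_distrib]
        exact Finset.sum_congr rfl fun d _ => hloc d.symm
      rw [e1, e2, Finset.sum_const, nsmul_eq_mul]
      -- modulo 4, all kinds of faces have the same angle sum
      have e3 : (R.faceAngleSum d₁ : ZMod 4) = ((2 * faceCorners d₁ : ℕ) : ZMod 4) := by
        by_cases hc : P.SameFace R.central d₁ <;> by_cases ho : P.SameFace R.outer d₁
        · rw [hV.face_both _ hc ho]; push_cast; linear_combination h4
        · rw [hV.face_one _ (by tauto)]
        · rw [hV.face_one _ (by tauto)]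
        · rw [← hV.face_regular _ hc ho]; push_cast; linear_combination -h4
      rw [e3]
      push_cast
      rw [faceCorners]
      ring)
  refine ⟨fun d => (loc d + p d.fst) - (loc R.ref + p R.ref.fst), by ring, fun d => ?_, fun d => ?_⟩
  · have := hp d
    simp only [SimpleGraph.Dart.symm_toProd, Prod.fst_swap]
    linear_combination this
  · simp only [hloc, P.rot_fst]; ring

/-- Every dart has a direction, since the graph is connected. -/
theorem exists_hasDir (R : Rep P) (d : P.G.Dart) : ∃ a, R.HasDir d a := by
  have hpow : ∀ (x : P.G.Dart) (k : ℕ), (∃ a, R.HasDir x a) → ∃ a, R.HasDir ((P.rot ^ k) x) a := by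
    intro x k h
    induction k with
    | zero => exact h
    | succ k ih =>
      obtain ⟨a, ha⟩ := ih
      rw [pow_succ']
      exact ⟨_, ha.rot⟩
  have key : ∀ u v, P.G.Reachable u v → ∀ d d' : P.G.Dart, d.fst = u → d'.fst = v →
      (∃ a, R.HasDir d a) → ∃ a, R.HasDir d' a := by
    rintro u v ⟨w⟩
    induction w with
    | nil =>
      intro d d' h h' hd
      obtain ⟨k, -, rfl⟩ := exists_rot_pow (h'.trans h.symm)
      exact hpow d k hd
    | @cons a b c hab w ih =>
      intro d d' h h' hd
      let e : P.G.Dart := ⟨(a, b), hab⟩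
      obtain ⟨k, -, hk⟩ := exists_rot_pow (d := d) (d' := e) h.symm
      obtain ⟨x, hx⟩ := hpow d k hd
      rw [hk] at hx
      exact ih e.symm d' rfl h' ⟨_, hx.symm⟩
  exact key _ _ (P.connected.preconnected _ _) R.ref d rfl rfl ⟨_, .ref⟩

open Classical in
/-- The direction of a dart: `0, 1, 2, 3` stand for east, south, west, north. -/
def dir (R : Rep P) (d : P.G.Dart) : ZMod 4 := if h : ∃ a, R.HasDir d a then h.choose else 0

theorem hasDir_iff (hV : R.Valid) {d : P.G.Dart} {a : ZMod 4} : R.HasDir d a ↔ R.dir d = a := by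
  obtain ⟨f, f0, f1, f2⟩ := exists_dir hV
  have h1 : ∀ d a, R.HasDir d a → f d = a := by
    intro d a h
    induction h with
    | ref => exact f0
    | symm _ ih => rw [f1, ih]
    | rot _ ih => rw [f2, ih]
  have h2 : R.HasDir d (R.dir d) := by
    have h := exists_hasDir R d
    rw [dir, dif_pos h]
    exact h.choose_spec
  exact ⟨fun h => (h1 _ _ h2).symm.trans (h1 _ _ h), fun h => h ▸ h2⟩

theorem dir_symm (hV : R.Valid) (d : P.G.Dart) : R.dir d.symm = R.dir d + 2 :=
  (hasDir_iff hV).1 ((hasDir_iff hV).2 rfl).symm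

theorem dir_rot (hV : R.Valid) (d : P.G.Dart) : R.dir (P.rot d) = R.dir d - (R.angle d : ZMod 4) :=
  (hasDir_iff hV).1 ((hasDir_iff hV).2 rfl).rot

theorem east_iff (hV : R.Valid) {d : P.G.Dart} : R.East d ↔ R.dir d = 0 := hasDir_iff hV

theorem north_iff (hV : R.Valid) {d : P.G.Dart} : R.North d ↔ R.dir d = 3 := hasDir_iff hV

theorem dir_rot_pow (hV : R.Valid) (d : P.G.Dart) (k : ℕ) :
    R.dir ((P.rot ^ k) d) = R.dir d - (R.rsum d k : ZMod 4) := by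
  induction k with
  | zero => simp [rsum]
  | succ k ih =>
    rw [pow_succ', Equiv.Perm.mul_apply, dir_rot hV, ih, rsum_add]
    simp [rsum]
    ring

/-- At each vertex there is at most one dart in each direction. -/
theorem eq_of_dir_eq (hV : R.Valid) {d d' : P.G.Dart} (h : d'.fst = d.fst)
    (hd : R.dir d' = R.dir d) : d' = d := by
  obtain ⟨k, hk, rfl⟩ := exists_rot_pow h
  rw [dir_rot_pow hV] at hd
  have h1 : ((R.rsum d k : ℕ) : ZMod 4) = 0 := by linear_combination -hd
  rw [ZMod.natCast_eq_zero_iff] at h1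
  have h2 := rsum_lt hV hk
  have h3 := le_rsum (R := R) d k
  have : k = 0 := by omega
  subst this; rfl

/-- The dart following `d` counter-clockwise is the one in the first direction, counted from that
of `d`, in which there is a dart. -/
theorem rot_eq_of_dir (hV : R.Valid) {d x : P.G.Dart} (hx : x.fst = d.fst) {j : ℕ} (hj : 1 ≤ j)
    (hj4 : j ≤ 4) (hd : R.dir x = R.dir d - (j : ZMod 4))
    (hno : ∀ i : ℕ, 0 < i → i < j → ∀ y : P.G.Dart, y.fst = d.fst → R.dir y ≠ R.dir d - (i : ZMod 4)) :
    P.rot d = x ∧ R.angle d = j := by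
  have ha := R.angle_mem d
  rcases lt_trichotomy (R.angle d) j with h | h | h
  · exact absurd (dir_rot hV d) (hno _ (R.angle_pos d) h _ (P.rot_fst d))
  · refine ⟨(eq_of_dir_eq hV (hx.trans (P.rot_fst d).symm) ?_).symm, h⟩
    rw [hd, dir_rot hV, h]
  · exfalso
    obtain ⟨k, hk, rfl⟩ := exists_rot_pow hx
    rw [dir_rot_pow hV] at hd
    have h1 : ((R.rsum d k : ℕ) : ZMod 4) = ((j : ℕ) : ZMod 4) := by linear_combination -hd
    rw [ZMod.natCast_eq_natCast_iff] at h1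
    have h2 := rsum_lt hV hk
    have h3 : R.rsum d k = j := by
      unfold Nat.ModEq at h1
      omega
    rcases k with _ | k
    · simp [rsum] at h3; omega
    · rw [Nat.add_comm, rsum_add] at h3
      have : R.rsum d 1 = R.angle d := by simp [rsum]
      omega

/-- The total angle between consecutive darts of a subgraph around a vertex lies between 90 and
360 degrees. -/
theorem rsum_of_nextAround (hV : R.Valid) {H : Set P.G.Dart} {d d' : P.G.Dart} {m : ℕ} (hd : d ∈ H)
    (h : NextAround H d d' m) : 1 ≤ R.rsum d m ∧ R.rsum d m ≤ 4 ∧ d'.fst = d.fst ∧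
      R.dir d' = R.dir d - (R.rsum d m : ZMod 4) := by
  obtain ⟨hm, rfl, -, hno⟩ := h
  refine ⟨hm.trans_le (le_rsum d m), ?_, rot_pow_fst d m, dir_rot_pow hV d m⟩
  have hL : m ≤ (dartsAt P d.fst).card := by
    by_contra hlt
    refine hno _ ?_ (not_le.1 hlt) (by rwa [rot_pow_card])
    exact Finset.card_pos.2 ⟨d, mem_dartsAt.2 rfl⟩
  rw [← rsum_card hV d]
  obtain ⟨j, hj⟩ := Nat.exists_eq_add_of_le hL
  rw [hj, rsum_add]
  omega

end Rep

namespace Rep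
variable {n : ℕ} {P : PlaneGraph n} {R : Rep P} {W W' : Set (Fin n)}

/-! ### The central face of an induced subgraph -/

/-- The edges of the subgraph induced by `W`. -/
def indSet (P : PlaneGraph n) (W : Set (Fin n)) : Set P.G.Dart := {d | d.fst ∈ W ∧ d.snd ∈ W}

/-- The edges that touch `W`. -/
def starSet (P : PlaneGraph n) (W : Set (Fin n)) : Set P.G.Dart := {d | d.fst ∈ W ∨ d.snd ∈ W}

/-- The right face of `d` lies in the central face of the subgraph induced by `W`. -/
def Cen (R : Rep P) (W : Set (Fin n)) (d : P.G.Dart) : Prop := P.Cls (indSet P W) R.central d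

/-- The vertical edges, directed north, that leave `W` towards the origin. -/
def Down (R : Rep P) (W : Set (Fin n)) : Set P.G.Dart := {e | R.dir e = 3 ∧ e.snd ∈ W ∧ e.fst ∉ W}

open Classical in
/-- The successor of a dart on its facial cycle in the subgraph of the edges that touch `W`, where
vertices outside of `W` are leaves. -/
def phi (W : Set (Fin n)) (d : P.G.Dart) : P.G.Dart := if d.snd ∈ W then P.faceNext d else d.symm

open Classical in
/-- The right turn, in units of 90 degrees, from `d` to `phi W d`. -/
def turn (R : Rep P) (W : Set (Fin n)) (d : P.G.Dart) : ℤ :=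
  if d.snd ∈ W then 2 - (R.angle d.symm : ℤ) else -2

theorem isSym_indSet : P.IsSym (indSet P W) := fun _ h => ⟨h.2, h.1⟩

theorem indSet_subset_starSet : indSet P W ⊆ starSet P W := fun _ h => Or.inl h.1

theorem indSet_mono (h : W ⊆ W') : indSet P W ⊆ indSet P W' := fun _ hd => ⟨h hd.1, h hd.2⟩

theorem starSet_symm {d : P.G.Dart} (h : d ∈ starSet P W) : d.symm ∈ starSet P W := Or.symm h

theorem Cen.mono (h : W ⊆ W') {d : P.G.Dart} (hd : R.Cen W' d) : R.Cen W d :=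
  Cls.mono (indSet_mono h) hd

theorem Cen.symm {d : P.G.Dart} (hd : R.Cen W d) (h : d ∉ indSet P W) : R.Cen W d.symm :=
  Cls.trans hd (Cls.cross h)

theorem phi_of_mem {d : P.G.Dart} (h : d.snd ∈ W) : phi W d = P.rot d.symm := if_pos h

theorem phi_of_not_mem {d : P.G.Dart} (h : d.snd ∉ W) : phi W d = d.symm := if_neg h

theorem turn_of_mem {d : P.G.Dart} (h : d.snd ∈ W) : R.turn W d = 2 - (R.angle d.symm : ℤ) :=
  if_pos h

theorem turn_of_not_mem {d : P.G.Dart} (h : d.snd ∉ W) : R.turn W d = -2 := if_neg h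

theorem Cen.phi {d : P.G.Dart} (hd : R.Cen W d) : R.Cen W (phi W d) := by
  by_cases h : d.snd ∈ W
  · rw [phi_of_mem h]; exact Cls.trans hd (Cls.faceNext d)
  · rw [phi_of_not_mem h]; exact hd.symm fun h' => h h'.2

theorem phi_fst {d : P.G.Dart} : (phi W d).fst = d.snd := by
  by_cases h : d.snd ∈ W
  · rw [phi_of_mem h]; exact P.rot_fst _
  · rw [phi_of_not_mem h]; rfl

theorem phi_mem_starSet {d : P.G.Dart} (hd : d ∈ starSet P W) : phi W d ∈ starSet P W := by
  by_cases h : d.snd ∈ W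
  · left; rwa [phi_fst]
  · rw [phi_of_not_mem h]; exact starSet_symm hd

theorem phi_injective : Function.Injective (phi (P := P) W) := by
  intro d d' h
  have h1 : d.snd = d'.snd := by rw [← phi_fst (W := W), h, phi_fst]
  by_cases hd : d.snd ∈ W
  · rw [phi_of_mem hd, phi_of_mem (h1 ▸ hd)] at h
    exact SimpleGraph.Dart.symm_involutive.injective (P.rot.injective h)
  · rw [phi_of_not_mem hd, phi_of_not_mem (h1 ▸ hd)] at h
    exact SimpleGraph.Dart.symm_involutive.injective h

theorem Cen.phi_iterate {d : P.G.Dart} (hd : R.Cen W d) (k : ℕ) :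
    R.Cen W ((Rep.phi W)^[k] d) := by
  induction k with
  | zero => exact hd
  | succ k ih => rw [Function.iterate_succ_apply']; exact ih.phi

/-- The central face of the induced subgraph touches `W`: otherwise it would contain all darts. -/
theorem exists_cen (hW : W.Nonempty) : ∃ d ∈ starSet P W, R.Cen W d := by
  by_contra hcon
  push Not at hcon
  have hall : ∀ d d', P.Cls ∅ d d' → (R.Cen W d ↔ R.Cen W d') := by
    intro d d' h
    induction h with
    | rel x y h =>
      rcases h with rfl | ⟨-, rfl⟩
      · exact ⟨fun h => Cls.trans h (Cls.faceNext _), fun h => Cls.trans h (Cls.faceNext _).symm⟩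
      · constructor
        · exact fun h => h.symm fun h' => hcon x (indSet_subset_starSet h') h
        · intro h
          have := h.symm fun h' => hcon _ (indSet_subset_starSet h') h
          rwa [SimpleGraph.Dart.symm_symm] at this
    | refl => rfl
    | symm _ _ _ ih => exact ih.symm
    | trans _ _ _ _ _ ih ih' => exact ih.trans ih'
  obtain ⟨v, hv⟩ := hW
  obtain ⟨w⟩ := P.connected.preconnected v R.central.fst
  have h0 : R.Cen W R.central := Cls.refl _
  have : ∃ d : P.G.Dart, d.fst ∈ W := by
    cases w with
    | nil => exact ⟨R.central, hv⟩
    | @cons _ b _ hab _ => exact ⟨⟨(v, b), hab⟩, hv⟩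
  obtain ⟨d, hd⟩ := this
  exact hcon d (Or.inl hd) ((hall _ _ (cls_empty _ _)).1 h0)

open Classical in
/-- The central face of a connected induced subgraph has total turning zero. -/
theorem sum_turn (hV : R.Valid) (hne : W.Nonempty) (hdeg : ∀ v ∈ W, ∃ d ∈ indSet P W, d.fst = v)
    (hl : ∀ u ∈ W, ∀ v ∈ W, P.Linked (indSet P W) u v) (ho : ¬ R.Cen W R.outer) :
    ∑ d ∈ Finset.univ.filter (fun d => R.Cen W d ∧ d ∈ starSet P W), R.turn W d = 0 := by
  obtain ⟨v, hv⟩ := hne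
  obtain ⟨d₀, hd₀, -⟩ := hdeg v hv
  have h1 := sum_gb hV (isSym_indSet (P := P) (W := W)) ⟨d₀, hd₀⟩
    (fun d hd d' hd' => hl _ hd.1 _ hd'.1) R.central
  -- `turn` differs from `gb` by `±2` on the edges that leave `W`, which cancel in pairs
  have h2 : ∀ d : P.G.Dart, gb R (indSet P W) d = (if d ∈ starSet P W then R.turn W d else 0)
      + (if d.fst ∈ W then (if d.snd ∈ W then 0 else 2) else (if d.snd ∈ W then -2 else 0))
      + (if d = R.central then 4 else 0) + (if d = R.outer then 4 else 0) := by
    intro d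
    have hv : (∃ g ∈ indSet P W, g.fst = d.snd) ↔ d.snd ∈ W := by
      constructor
      · rintro ⟨g, hg, h⟩; exact h ▸ hg.1
      · exact hdeg _
    rw [gb]
    simp only [hv]
    congr 2
    by_cases hf : d.fst ∈ W <;> by_cases hs : d.snd ∈ W <;>
      simp [indSet, starSet, turn, hf, hs]
    ring
  have h3 : ∑ d ∈ Finset.univ.filter (fun d => P.Cls (indSet P W) R.central d),
      (if d.fst ∈ W then (if d.snd ∈ W then (0 : ℤ) else 2) else (if d.snd ∈ W then -2 else 0))
        = 0 := by
    rw [← Finset.sum_filter_add_sum_filter_not _ (fun d => d ∈ indSet P W),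
      Finset.filter_filter, Finset.filter_filter]
    have e1 : ∑ d ∈ Finset.univ.filter (fun d => P.Cls (indSet P W) R.central d ∧ d ∈ indSet P W),
        (if d.fst ∈ W then (if d.snd ∈ W then (0 : ℤ) else 2) else (if d.snd ∈ W then -2 else 0))
        = 0 := by
      refine Finset.sum_eq_zero fun d hd => ?_
      simp only [Finset.mem_filter, Finset.mem_univ, true_and] at hd
      simp [hd.2.1, hd.2.2]
    rw [e1, zero_add]
    refine Finset.sum_involution (fun d _ => d.symm) ?_ ?_ ?_ ?_
    · intro d _
      by_cases hf : d.fst ∈ W <;> by_cases hs : d.snd ∈ W <;> simp [hf, hs]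
    · intro d _ _; exact d.symm_ne
    · intro d hd
      simp only [Finset.mem_filter, Finset.mem_univ, true_and] at hd ⊢
      exact ⟨hd.1.trans (Cls.cross hd.2), isSym_indSet.not_mem hd.2⟩
    · intro d _; simp
  rw [Finset.sum_congr rfl fun d _ => h2 d, Finset.sum_add_distrib, Finset.sum_add_distrib,
    Finset.sum_add_distrib, h3, Finset.sum_ite_eq', Finset.sum_ite_eq'] at h1
  rw [← Finset.filter_filter, Finset.sum_filter]
  have ho' : ¬ P.Cls (indSet P W) R.central R.outer := ho
  simp only [Finset.mem_filter, Finset.mem_univ, true_and, Cls.refl, if_true, ho', if_false] at h1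
  have : ∑ d ∈ Finset.univ.filter (fun d => R.Cen W d),
      (if d ∈ starSet P W then R.turn W d else 0) = 0 := by
    have h4 : ∀ a : ℤ, a + 0 + 4 + 0 = 4 → a = 0 := by intro a; omega
    exact h4 _ h1
  exact this

/-- A function that never exceeds the turning along the central facial cycle realizes it: there is
no room for a positive defect, since the total turning is zero. -/
theorem turn_eq_of_le (hV : R.Valid) (hne : W.Nonempty)
    (hdeg : ∀ v ∈ W, ∃ d ∈ indSet P W, d.fst = v)
    (hl : ∀ u ∈ W, ∀ v ∈ W, P.Linked (indSet P W) u v) (ho : ¬ R.Cen W R.outer)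
    {h : P.G.Dart → ℤ}
    (hle : ∀ d ∈ starSet P W, R.Cen W d → h (phi W d) ≤ h d + R.turn W d)
    {d : P.G.Dart} (hd : d ∈ starSet P W) (hd' : R.Cen W d) :
    h (phi W d) = h d + R.turn W d := by
  classical
  have h1 := sum_turn hV hne hdeg hl ho
  let s := Finset.univ.filter (fun d => R.Cen W d ∧ d ∈ starSet P W)
  have hs : ∀ d, d ∈ s ↔ R.Cen W d ∧ d ∈ starSet P W := by simp [s]
  have himg : s.image (phi W) = s := by
    refine Finset.eq_of_subset_of_card_le ?_ ?_
    · intro x hx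
      obtain ⟨d, hd, rfl⟩ := Finset.mem_image.1 hx
      rw [hs] at hd ⊢
      exact ⟨hd.1.phi, phi_mem_starSet hd.2⟩
    · rw [Finset.card_image_of_injective _ phi_injective]
  have h2 : ∑ d ∈ s, h (phi W d) = ∑ d ∈ s, h d := by
    conv_rhs => rw [← himg]
    rw [Finset.sum_image phi_injective.injOn]
  have h3 : ∑ d ∈ s, (h d + R.turn W d - h (phi W d)) = 0 := by
    rw [Finset.sum_sub_distrib, Finset.sum_add_distrib, h2]
    have : ∑ d ∈ s, R.turn W d = 0 := h1
    rw [this]; ring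
  have h4 := (Finset.sum_eq_zero_iff_of_nonneg (fun d hd => by
    rw [hs] at hd
    have := hle d hd.2 hd.1
    omega)).1 h3 d ((hs d).2 ⟨hd', hd⟩)
  omega

/-! ### Horizontal segments -/

section segment
variable {S : List (Fin n)}

theorem isSegment_east (hV : R.Valid) (hS : R.IsSegment S) {i : ℕ} (hi : i + 1 < S.length) :
    ∃ d : P.G.Dart, R.dir d = 0 ∧ d.fst = S[i] ∧ d.snd = S[i + 1] := by
  obtain ⟨d, h1, h2, h3⟩ := List.isChain_iff_getElem.1 hS.chain i hi
  exact ⟨d, (east_iff hV).1 h1, h2, h3⟩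

theorem isCyc_iff (hV : R.Valid) (hS : R.IsSegment S) :
    R.IsCyc S ↔ ∃ d : P.G.Dart, R.dir d = 0 ∧
      d.fst = S[S.length - 1]'(by have := hS.two_le; omega) ∧
      d.snd = S[0]'(by have := hS.two_le; omega) := by
  have := hS.two_le
  have h0 : S ≠ [] := by rintro rfl; simp at this
  unfold IsCyc
  simp only [east_iff hV, List.getLast?_eq_some_getLast h0, List.head?_eq_some_head h0,
    Option.some.injEq, List.getLast_eq_getElem, List.head_eq_getElem]
  constructor <;> rintro ⟨d, h1, h2, h3⟩ <;> exact ⟨d, h1, h2.symm, h3.symm⟩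

theorem isSegment_path (hV : R.Valid) (hS : R.IsSegment S) (hc : ¬ R.IsCyc S) (d : P.G.Dart)
    (hd : R.dir d = 0) : d.fst ≠ S[S.length - 1]'(by have := hS.two_le; omega) ∧
      d.snd ≠ S[0]'(by have := hS.two_le; omega) := by
  have := hS.two_le
  have h0 : S ≠ [] := by rintro rfl; simp at this
  have h1 := (hS.cycle_or_path.resolve_left hc) d ((east_iff hV).2 hd)
  simp only [List.getLast?_eq_some_getLast h0, List.head?_eq_some_head h0, ne_eq,
    Option.some.injEq, List.getLast_eq_getElem, List.head_eq_getElem] at h1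
  exact ⟨fun h => h1.1 h.symm, fun h => h1.2 h.symm⟩

/-- Where an east edge at a vertex of a segment leads. -/
theorem isSegment_of_east (hV : R.Valid) (hS : R.IsSegment S) {d : P.G.Dart} (hd : R.dir d = 0)
    {i : ℕ} (hi : i < S.length) (hf : d.fst = S[i]) :
    (∃ h : i + 1 < S.length, d.snd = S[i + 1]) ∨
      (R.IsCyc S ∧ i + 1 = S.length ∧ d.snd = S[0]'(by omega)) := by
  by_cases h : i + 1 < S.length
  · obtain ⟨g, g0, g1, g2⟩ := isSegment_east hV hS h
    obtain rfl : d = g := eq_of_dir_eq hV (hf.trans g1.symm) (hd.trans g0.symm)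
    exact Or.inl ⟨h, g2⟩
  · obtain rfl : i = S.length - 1 := by omega
    by_cases hc : R.IsCyc S
    · obtain ⟨g, g0, g1, g2⟩ := (isCyc_iff hV hS).1 hc
      obtain rfl : d = g := eq_of_dir_eq hV (hf.trans g1.symm) (hd.trans g0.symm)
      exact Or.inr ⟨hc, by omega, g2⟩
    · exact absurd hf (isSegment_path hV hS hc d hd).1

/-- Where a west edge at a vertex of a segment leads. -/
theorem isSegment_of_west (hV : R.Valid) (hS : R.IsSegment S) {d : P.G.Dart} (hd : R.dir d = 2)
    {i : ℕ} (hi : i < S.length) (hf : d.fst = S[i]) :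
    (∃ h : 0 < i, d.snd = S[i - 1]) ∨
      (R.IsCyc S ∧ i = 0 ∧ d.snd = S[S.length - 1]'(by omega)) := by
  have hw : ∀ g : P.G.Dart, R.dir g = 0 → g.snd = S[i] → d = g.symm := by
    intro g g0 g1
    refine eq_of_dir_eq hV (hf.trans g1.symm) ?_
    rw [hd, dir_symm hV, g0]; rfl
  rcases i with _ | i
  · by_cases hc : R.IsCyc S
    · obtain ⟨g, g0, g1, g2⟩ := (isCyc_iff hV hS).1 hc
      refine Or.inr ⟨hc, rfl, ?_⟩
      rw [hw g g0 g2]; exact g1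
    · refine absurd hf (isSegment_path hV hS hc d.symm ?_).2
      rw [dir_symm hV, hd]; rfl
  · obtain ⟨g, g0, g1, g2⟩ := isSegment_east hV hS hi
    refine Or.inl ⟨Nat.succ_pos i, ?_⟩
    rw [hw g g0 g2]; exact g1

/-- A segment contains both endpoints of its horizontal edges. -/
theorem isSegment_closed (hV : R.Valid) (hS : R.IsSegment S) {d : P.G.Dart}
    (hd : R.dir d = 0 ∨ R.dir d = 2) (hf : d.fst ∈ S) : d.snd ∈ S := by
  obtain ⟨i, hi, h⟩ := List.getElem_of_mem hf
  rcases hd with hd | hd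
  · rcases isSegment_of_east hV hS hd hi h.symm with ⟨_, h⟩ | ⟨_, _, h⟩ <;>
      · rw [h]; exact List.getElem_mem _
  · rcases isSegment_of_west hV hS hd hi h.symm with ⟨_, h⟩ | ⟨_, _, h⟩ <;>
      · rw [h]; exact List.getElem_mem _

end segment

/-! ### Vertex sets that arise from good sequences -/

/-- The properties of the vertex set `W` of a good sequence on which the construction rests.
Through `lift`, every south edge is met by the central facial cycle in the same integral
rotation. -/
structure Inv (R : Rep P) (W : Set (Fin n)) : Prop where
  ne : W.Nonempty
  deg : ∀ v ∈ W, ∃ d ∈ indSet P W, d.fst = v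
  linked : ∀ u ∈ W, ∀ v ∈ W, P.Linked (indSet P W) u v
  outer : ¬ R.Cen W R.outer
  /-- Edges that leave `W` point towards the origin. -/
  closed : ∀ d : P.G.Dart, d.fst ∈ W → R.dir d ≠ 1 → d.snd ∈ W
  down_cen : ∀ e ∈ R.Down W, R.Cen W e
  orbit : ∀ d ∈ starSet P W, ∀ d' ∈ starSet P W, R.Cen W d → R.Cen W d' →
    ∃ k, (phi W)^[k] d = d'
  lift : ∃ h : P.G.Dart → ℤ,
    (∀ d ∈ starSet P W, R.Cen W d → h (phi W d) = h d + R.turn W d) ∧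
      ∀ e ∈ R.Down W, h e = -1 ∧ h e.symm = 1

theorem Down.symm_dir (hV : R.Valid) {e : P.G.Dart} (he : e ∈ R.Down W) : R.dir e.symm = 1 := by
  rw [dir_symm hV, he.1]; rfl

/-- An edge into `W` from outside is directed north. -/
theorem mem_down (hV : R.Valid) (hc : ∀ d : P.G.Dart, d.fst ∈ W → R.dir d ≠ 1 → d.snd ∈ W)
    {d : P.G.Dart} (hs : d.snd ∈ W) (hf : d.fst ∉ W) : d ∈ R.Down W := by
  refine ⟨?_, hs, hf⟩
  by_contra hd
  refine hf (hc d.symm hs fun h => hd ?_)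
  rw [dir_symm hV] at h
  have : R.dir d = 1 - 2 := by rw [← h]; ring
  rw [this]; rfl

theorem rot_dir_ne (hV : R.Valid) (d : P.G.Dart) : R.dir (P.rot d) ≠ R.dir d := by
  rw [dir_rot hV]
  intro h
  have h1 : ((R.angle d : ℕ) : ZMod 4) = 0 := by linear_combination -h
  rw [ZMod.natCast_eq_zero_iff] at h1
  have := R.angle_mem d
  omega

/-- After a south edge, the central facial cycle enters the induced subgraph. -/
theorem phi_down (hV : R.Valid) (hc : ∀ d : P.G.Dart, d.fst ∈ W → R.dir d ≠ 1 → d.snd ∈ W)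
    {e : P.G.Dart} (he : e ∈ R.Down W) : phi W e ∈ indSet P W := by
  have h1 : (phi W e).fst ∈ W := by rw [phi_fst]; exact he.2.1
  refine ⟨h1, hc _ h1 ?_⟩
  rw [phi_of_mem he.2.1]
  have := rot_dir_ne hV e.symm
  rwa [Down.symm_dir hV he] at this

theorem phi_symm_down {e : P.G.Dart} (he : e ∈ R.Down W) : phi W e.symm = e := by
  have : e.symm.snd ∉ W := he.2.2
  rw [phi_of_not_mem this, SimpleGraph.Dart.symm_symm]

section sequence
variable {A : List (List (Fin n))}

theorem dir_cases (R : Rep P) (d : P.G.Dart) :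
    R.dir d = 0 ∨ R.dir d = 1 ∨ R.dir d = 2 ∨ R.dir d = 3 := by
  generalize R.dir d = a
  revert a
  decide

theorem sub_eq (hV : R.Valid) (hS : ∀ S ∈ A, R.IsSegment S) :
    R.sub A = indSet P (verts A) := by
  ext d
  have e1 : R.East d.symm ↔ R.dir d = 2 := by
    rw [east_iff hV, dir_symm hV]; generalize R.dir d = a; revert a; decide
  have e2 : R.North d.symm ↔ R.dir d = 1 := by
    rw [north_iff hV, dir_symm hV]; generalize R.dir d = a; revert a; decide
  constructor
  · rintro (⟨-, S, hS, h1, h2⟩ | ⟨-, h1, h2⟩)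
    · exact ⟨⟨S, hS, h1⟩, ⟨S, hS, h2⟩⟩
    · exact ⟨h1, h2⟩
  · rintro ⟨⟨S, hSA, h1⟩, h2⟩
    rcases dir_cases R d with h | h | h | h
    · exact Or.inl ⟨Or.inl ((east_iff hV).2 h), S, hSA, h1,
        isSegment_closed hV (hS S hSA) (Or.inl h) h1⟩
    · exact Or.inr ⟨Or.inr (e2.2 h), ⟨S, hSA, h1⟩, h2⟩
    · exact Or.inl ⟨Or.inr (e1.2 h), S, hSA, h1,
        isSegment_closed hV (hS S hSA) (Or.inr h) h1⟩
    · exact Or.inr ⟨Or.inl ((north_iff hV).2 h), ⟨S, hSA, h1⟩, h2⟩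

theorem south_eq (hV : R.Valid) (hS : ∀ S ∈ A, R.IsSegment S) (hI : R.Inv (verts A)) :
    R.south A = R.Down (verts A) := by
  ext e
  rw [south, sub_eq hV hS]
  constructor
  · rintro ⟨h1, h2, d, hd, -, h⟩
    exact ⟨(north_iff hV).1 h1, h ▸ hd.1, h2⟩
  · intro he
    exact ⟨(north_iff hV).2 he.1, he.2.2, phi (verts A) e, phi_down hV hI.closed he,
      (hI.down_cen e he).phi, phi_fst⟩

theorem subPlus_eq (hV : R.Valid) (hS : ∀ S ∈ A, R.IsSegment S) (hI : R.Inv (verts A)) :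
    R.subPlus A = starSet P (verts A) := by
  ext d
  rw [subPlus, south_eq hV hS hI, sub_eq hV hS]
  constructor
  · rintro (h | h | h)
    · exact indSet_subset_starSet h
    · exact Or.inr h.2.1
    · exact Or.inl h.2.1
  · intro h
    by_cases hf : d.fst ∈ verts A <;> by_cases hs : d.snd ∈ verts A
    · exact Or.inl ⟨hf, hs⟩
    · exact Or.inr (Or.inr (mem_down hV hI.closed (d := d.symm) hf hs))
    · exact Or.inr (Or.inl (mem_down hV hI.closed hs hf))
    · exact absurd h (not_or.2 ⟨hf, hs⟩)

/-- On the edges that touch `W`, the successor in the inherited embedding is `phi`. -/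
theorem eq_phi_of_nextAround (hV : R.Valid) (hI : R.Inv W) {d d' : P.G.Dart} {m : ℕ}
    (hd : d ∈ starSet P W) (h : NextAround (starSet P W) d.symm d' m) : d' = phi W d := by
  obtain ⟨hm, rfl, hd', hno⟩ := h
  by_cases hs : d.snd ∈ W
  · rw [phi_of_mem hs]
    rcases Nat.lt_or_ge 1 m with h1 | h1
    · exact absurd (Or.inl ((rot_pow_fst d.symm 1).symm ▸ hs)) (hno 1 one_pos h1)
    · obtain rfl : m = 1 := by omega
      rw [pow_one]
  · rw [phi_of_not_mem hs]
    have hf : d.symm.snd ∈ W := hd.resolve_right hs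
    have h1 : ((P.rot ^ m) d.symm).fst = d.snd := rot_pow_fst d.symm m
    have h2 := mem_down hV hI.closed (d := (P.rot ^ m) d.symm)
      (hd'.resolve_left (by rw [h1]; exact hs)) (by rw [h1]; exact hs)
    have h3 := mem_down hV hI.closed (d := d.symm) hf hs
    exact eq_of_dir_eq hV h1 (h2.1.trans h3.1.symm)

end sequence

end Rep

/-! ### Traces of a map through a set -/

/-- `Trace f Z a L b`: iterating `f` from `a` leads to `b`, and `L` lists the elements of `Z` that
are visited on the way, including `a` and excluding `b`. -/
inductive Trace {α : Type*} (f : α → α) (Z : Set α) : α → List α → α → Prop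
  | nil (a : α) : Trace f Z a [] a
  | skip {a b : α} {L : List α} : a ∉ Z → Trace f Z (f a) L b → Trace f Z a L b
  | visit {a b : α} {L : List α} : a ∈ Z → Trace f Z (f a) L b → Trace f Z a (a :: L) b

namespace Trace
variable {α : Type*} {f : α → α} {Z : Set α} {a b c : α} {L M : List α}

theorem trans (h : Trace f Z a L b) (h' : Trace f Z b M c) : Trace f Z a (L ++ M) c := by
  induction h with
  | nil => exact h'
  | skip ha _ ih => exact skip ha (ih h')
  | visit ha _ ih => exact visit ha (ih h')

theorem exists_iterate (h : Trace f Z a L b) : ∃ k, f^[k] a = b := by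
  induction h with
  | nil a => exact ⟨0, rfl⟩
  | skip _ _ ih => obtain ⟨k, hk⟩ := ih; exact ⟨k + 1, hk⟩
  | visit _ _ ih => obtain ⟨k, hk⟩ := ih; exact ⟨k + 1, hk⟩

theorem of_cons {z : α} (h : Trace f Z a (z :: L) b) :
    Trace f Z a [] z ∧ z ∈ Z ∧ Trace f Z (f z) L b := by
  generalize hM : z :: L = M at h
  induction h with
  | nil => exact absurd hM (by simp)
  | skip ha _ ih => exact ⟨skip ha (ih hM).1, (ih hM).2⟩
  | visit ha h _ =>
    obtain ⟨rfl, rfl⟩ := List.cons.inj hM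
    exact ⟨nil _, ha, h⟩

theorem of_append (h : Trace f Z a (L ++ M) b) : ∃ c, Trace f Z a L c ∧ Trace f Z c M b := by
  induction L generalizing a with
  | nil => exact ⟨a, nil a, h⟩
  | cons z L ih =>
    obtain ⟨h1, h2, h3⟩ := of_cons h
    obtain ⟨c, h4, h5⟩ := ih h3
    exact ⟨c, h1.trans (visit h2 h4), h5⟩

theorem mem_of_mem (h : Trace f Z a L b) {z : α} (hz : z ∈ L) : z ∈ Z := by
  induction h with
  | nil => simp at hz
  | skip _ _ ih => exact ih hz
  | visit ha _ ih =>
    rcases List.mem_cons.1 hz with rfl | hz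
    · exact ha
    · exact ih hz

theorem exists_iterate_of_mem (h : Trace f Z a L b) {z : α} (hz : z ∈ L) : ∃ k, f^[k] a = z := by
  obtain ⟨L₁, L₂, rfl⟩ := List.append_of_mem hz
  obtain ⟨c, h1, h2⟩ := of_append h
  exact (h1.trans h2.of_cons.1).exists_iterate

theorem eq_of_not_mem {z : α} (h : Trace f Z a L z) (h' : Trace f Z a M z) (hz : z ∈ Z)
    (hL : z ∉ L) (hM : z ∉ M) : L = M := by
  induction h generalizing M with
  | nil a =>
    cases h' with
    | nil => rfl
    | skip h _ => exact absurd hz h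
    | visit _ _ => simp at hM
  | skip ha _ ih =>
    cases h' with
    | nil => exact absurd hz ha
    | skip _ h => exact ih h hz hL hM
    | visit h _ => exact absurd h ha
  | visit ha _ ih =>
    cases h' with
    | nil => simp at hL
    | skip h _ => exact absurd ha h
    | visit _ h =>
      rw [ih h hz (fun h => hL (List.mem_cons_of_mem _ h)) (fun h => hM (List.mem_cons_of_mem _ h))]

theorem rotate_to {z : α} (h : Trace f Z a (L ++ z :: M) a) : Trace f Z (f z) (M ++ L) z := by
  obtain ⟨c, h1, h2⟩ := of_append h
  obtain ⟨h3, -, h4⟩ := of_cons h2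
  have := (h4.trans h1).trans h3
  rwa [List.append_nil] at this

/-- Two closed traces without repetitions that share a point agree up to rotation. -/
theorem isRotated (h : Trace f Z a L a) (h' : Trace f Z b M b) (hL : L.Nodup) (hM : M.Nodup)
    {z : α} (hz : z ∈ L) (hz' : z ∈ M) : L ~r M := by
  obtain ⟨L₁, L₂, rfl⟩ := List.append_of_mem hz
  obtain ⟨M₁, M₂, rfl⟩ := List.append_of_mem hz'
  have hr : ∀ X Y : List α, (X ++ z :: Y) ~r (z :: (Y ++ X)) := fun X Y =>
    ⟨X.length, by simp [List.rotate_append_length_eq]⟩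
  have hn : ∀ X Y : List α, (X ++ z :: Y).Nodup → z ∉ Y ++ X := by
    intro X Y h
    exact (List.nodup_cons.1 ((hr X Y).nodup_iff.1 h)).1
  have := eq_of_not_mem (rotate_to h) (rotate_to h') (mem_of_mem h hz) (hn _ _ hL) (hn _ _ hM)
  refine (hr L₁ L₂).trans (List.IsRotated.trans ?_ (hr M₁ M₂).symm)
  rw [this]

theorem of_isChain (p : α → Bool) (hp : ∀ x, p x = true ↔ x ∈ Z) (h : (a :: L).IsChain (fun x y => y = f x)) :
    Trace f Z a ((a :: L).filter p) (f ((a :: L).getLast (List.cons_ne_nil _ _))) := by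
  induction L generalizing a with
  | nil =>
    by_cases ha : a ∈ Z
    · rw [List.filter_cons_of_pos ((hp a).2 ha)]
      exact visit ha (nil _)
    · rw [List.filter_cons_of_neg (by rwa [hp])]
      exact skip ha (nil _)
  | cons b L ih =>
    rw [List.isChain_cons_cons] at h
    obtain ⟨rfl, h⟩ := h
    have h1 := ih h
    rw [List.getLast_cons (List.cons_ne_nil _ _)]
    by_cases ha : a ∈ Z
    · rw [List.filter_cons_of_pos ((hp a).2 ha)]
      exact visit ha h1
    · rw [List.filter_cons_of_neg (by rwa [hp])]
      exact skip ha h1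

end Trace

namespace Rep
variable {n : ℕ} {P : PlaneGraph n} {R : Rep P} {W : Set (Fin n)}

/-- The circular order of the south edges is the order in which the successor map visits them, and
it contains all edges that leave the vertex set towards the origin. -/
theorem isSouthOrder_trace (hV : R.Valid) {A : List (List (Fin n))} (hS : ∀ S ∈ A, R.IsSegment S)
    (hI : R.Inv (verts A)) {s : List P.G.Dart} (hs : R.IsSouthOrder A s) :
    s.Nodup ∧ (∃ z, Trace (phi (verts A)) (R.Down (verts A)) z s z) ∧
      ∀ d, d ∈ s ↔ d ∈ R.Down (verts A) := by
  classical
  obtain ⟨w, hw, rfl⟩ := hs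
  have hpos : 0 < w.length := List.length_pos_iff.2 hw.ne_nil
  have hst : ∀ d ∈ w, d ∈ starSet P (verts A) := fun d hd => by
    rw [← subPlus_eq hV hS hI]; exact (hw.mem d hd).1
  have hcen : ∀ d ∈ w, R.Cen (verts A) d := fun d hd => by
    refine Cls.mono ?_ (hw.mem d hd).2
    rw [subPlus_eq hV hS hI]; exact indSet_subset_starSet
  -- consecutive darts of the facial cycle are related by `phi`
  have hnext : ∀ (i : ℕ) (hi : i < w.length),
      w[(i + 1) % w.length]'(Nat.mod_lt _ hpos) = phi (verts A) w[i] := by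
    intro i hi
    obtain ⟨m, hm⟩ := hw.next i w[i] (w[(i + 1) % w.length]'(Nat.mod_lt _ hpos))
      (List.getElem?_eq_getElem hi) (List.getElem?_eq_getElem _)
    rw [subPlus_eq hV hS hI] at hm
    exact eq_phi_of_nextAround hV hI (hst _ (List.getElem_mem _)) hm
  refine ⟨hw.nodup.filter _, ?_, ?_⟩
  · rcases w with _ | ⟨a, L⟩
    · exact absurd rfl hw.ne_nil
    refine ⟨a, ?_⟩
    have h1 := Trace.of_isChain (f := phi (verts A)) (Z := R.Down (verts A)) (a := a) (L := L)
      (fun d => decide (d ∈ R.south A)) (by intro x; rw [decide_eq_true_iff, south_eq hV hS hI]) (by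
        rw [List.isChain_iff_getElem]
        intro i hi
        rw [← hnext i (by omega)]
        congr 1
        rw [Nat.mod_eq_of_lt hi])
    have h2 : phi (verts A) ((a :: L).getLast (List.cons_ne_nil _ _)) = a := by
      rw [List.getLast_eq_getElem, ← hnext _ (by omega)]
      have : ((a :: L).length - 1 + 1) % (a :: L).length = 0 := by
        rw [Nat.sub_add_cancel hpos, Nat.mod_self]
      simp only [this, List.getElem_cons_zero]
    rwa [h2] at h1
  · intro d
    rw [List.mem_filter, decide_eq_true_iff, south_eq hV hS hI]
    refine ⟨fun h => h.2, fun h => ⟨?_, h⟩⟩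
    -- the facial cycle is a full orbit of `phi`, and the central darts form a single orbit
    obtain ⟨k, rfl⟩ := hI.orbit w[0] (hst _ (List.getElem_mem _)) d (Or.inr h.2.1)
      (hcen _ (List.getElem_mem _)) (hI.down_cen d h)
    clear h
    induction k with
    | zero => exact List.getElem_mem _
    | succ k ih =>
      obtain ⟨i, hi, h⟩ := List.getElem_of_mem ih
      rw [Function.iterate_succ_apply', ← h, ← hnext i hi]
      exact List.getElem_mem _

open Classical in
/-- The edge that leaves `W` towards the origin at `v`, if there is one. -/
def downAt (R : Rep P) (W : Set (Fin n)) (v : Fin n) : Option P.G.Dart :=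
  if h : ∃ e ∈ R.Down W, e.snd = v then some h.choose else none

/-- The edges that leave `W` towards the origin at the vertices of a list. -/
def downs (R : Rep P) (W : Set (Fin n)) (L : List (Fin n)) : List P.G.Dart :=
  L.filterMap (R.downAt W)

theorem downAt_eq_some (hV : R.Valid) {v : Fin n} {e : P.G.Dart} :
    R.downAt W v = some e ↔ e ∈ R.Down W ∧ e.snd = v := by
  unfold downAt
  split_ifs with h
  · obtain ⟨h1, h2⟩ := h.choose_spec
    rw [Option.some.injEq]
    constructor
    · rintro rfl; exact ⟨h1, h2⟩
    · rintro ⟨h3, h4⟩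
      have := eq_of_dir_eq hV (d := e.symm) (d' := h.choose.symm) (h2.trans h4.symm)
        (by rw [Down.symm_dir hV h1, Down.symm_dir hV h3])
      exact SimpleGraph.Dart.symm_involutive.injective this
  · simp only [false_iff]
    rintro ⟨h1, h2⟩
    exact h ⟨e, h1, h2⟩

theorem downAt_eq_none {v : Fin n} : R.downAt W v = none ↔ ∀ e ∈ R.Down W, e.snd ≠ v := by
  unfold downAt
  split_ifs with h
  · simp only [false_iff]
    obtain ⟨e, h1, h2⟩ := h
    exact fun h => h e h1 h2
  · simp only [true_iff]
    exact fun e h1 h2 => h ⟨e, h1, h2⟩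

theorem mem_downs (hV : R.Valid) {L : List (Fin n)} {e : P.G.Dart} :
    e ∈ R.downs W L ↔ e ∈ R.Down W ∧ e.snd ∈ L := by
  rw [downs, List.mem_filterMap]
  constructor
  · rintro ⟨v, hv, h⟩
    rw [downAt_eq_some hV] at h
    exact ⟨h.1, h.2 ▸ hv⟩
  · rintro ⟨h1, h2⟩
    exact ⟨e.snd, h2, (downAt_eq_some hV).2 ⟨h1, rfl⟩⟩

theorem downs_nodup (hV : R.Valid) {L : List (Fin n)} (hL : L.Nodup) : (R.downs W L).Nodup := by
  refine List.Nodup.filterMap ?_ hL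
  intro v v' e h h'
  rw [Option.mem_def, downAt_eq_some hV] at h h'
  exact h.2.symm.trans h'.2

/-! ### Walking along a segment -/

/-- The vertices of `S` belong to `W`, and their south edges leave `W`. -/
structure Bottom (R : Rep P) (W : Set (Fin n)) (S : List (Fin n)) : Prop where
  mem : ∀ v ∈ S, v ∈ W
  out : ∀ g : P.G.Dart, g.fst ∈ S → R.dir g = 1 → g.snd ∉ W

section walk
variable {S : List (Fin n)}

theorem not_down_of_dir {d : P.G.Dart} (h : R.dir d ≠ 3) : d ∉ R.Down W := fun h' => h h'.1

/-- The successor of `d` is `x` if `x` is the dart at the head of `d` that comes first after a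
right turn by `2 - j`. -/
theorem phi_eq_of_dir (hV : R.Valid) {d x : P.G.Dart} (hd : d.snd ∈ W) (hx : x.fst = d.snd) {j : ℕ}
    (hj : 1 ≤ j) (hj4 : j ≤ 4) (hdir : R.dir x = R.dir d + 2 - (j : ZMod 4))
    (hno : ∀ i : ℕ, 0 < i → i < j → ∀ y : P.G.Dart, y.fst = d.snd →
      R.dir y ≠ R.dir d + 2 - (i : ZMod 4)) :
    phi W d = x := by
  rw [phi_of_mem hd]
  refine (rot_eq_of_dir hV (d := d.symm) hx hj hj4 ?_ ?_).1
  · rw [dir_symm hV, hdir]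
  · rw [dir_symm hV]; exact hno

/-- A south edge at a vertex of `S` is followed by its reversal. -/
theorem Bottom.down (hV : R.Valid) (hB : R.Bottom W S) {g : P.G.Dart} (hg : g.fst ∈ S)
    (hd : R.dir g = 1) : g.symm ∈ R.Down W ∧ phi W g = g.symm := by
  refine ⟨⟨?_, hB.mem _ hg, hB.out g hg hd⟩, phi_of_not_mem (hB.out g hg hd)⟩
  rw [dir_symm hV, hd]; rfl

/-- If the cycle turns at `v` from `d` to the south edge, or to `x` if there is no south edge,
and from the south edge to `x`, then it visits just the south edge of `v` between `d` and `x`. -/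
theorem Bottom.trace_corner (hV : R.Valid) (hB : R.Bottom W S) {d x : P.G.Dart} (hd : d.snd ∈ S)
    (hd3 : R.dir d ≠ 3) (h₁ : ∀ g : P.G.Dart, g.fst = d.snd → R.dir g = 1 → phi W d = g)
    (h₂ : (∀ g : P.G.Dart, g.fst = d.snd → R.dir g ≠ 1) → phi W d = x)
    (h₃ : ∀ e : P.G.Dart, e.snd = d.snd → R.dir e = 3 → phi W e = x) :
    Trace (phi W) (R.Down W) d (R.downs W [d.snd]) x := by
  by_cases hg : ∃ g : P.G.Dart, g.fst = d.snd ∧ R.dir g = 1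
  · obtain ⟨g, hg1, hg2⟩ := hg
    obtain ⟨h4, h5⟩ := hB.down hV (hg1 ▸ hd) hg2
    have h6 : R.downAt W d.snd = some g.symm := (downAt_eq_some hV).2 ⟨h4, hg1⟩
    rw [downs, List.filterMap_cons_some h6, List.filterMap_nil]
    refine Trace.skip (not_down_of_dir hd3) ?_
    rw [h₁ g hg1 hg2]
    refine Trace.skip (not_down_of_dir (by rw [hg2]; decide)) ?_
    rw [h5]
    refine Trace.visit h4 ?_
    rw [h₃ g.symm hg1 h4.1]
    exact Trace.nil _
  · push Not at hg
    have h6 : R.downAt W d.snd = none := by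
      rw [downAt_eq_none]
      intro e he h
      exact hg e.symm h (Down.symm_dir hV he)
    rw [downs, List.filterMap_cons_none h6, List.filterMap_nil]
    refine Trace.skip (not_down_of_dir hd3) ?_
    rw [h₂ hg]
    exact Trace.nil _

/-- Arriving at a vertex of `S` such that nothing lies between the arriving edge and the south
direction, the cycle proceeds along the south edge and then east. -/
theorem Bottom.trace_to_east (hV : R.Valid) (hB : R.Bottom W S) {d x : P.G.Dart} (hd : d.snd ∈ S)
    (hx : x.fst = d.snd) (hx0 : R.dir x = 0)
    (h : R.dir d = 0 ∨ (R.dir d = 1 ∧ ∀ y : P.G.Dart, y.fst = d.snd → R.dir y ≠ 2) ∨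
      (R.dir d = 2 ∧ ∀ y : P.G.Dart, y.fst = d.snd → R.dir y ≠ 2 ∧ R.dir y ≠ 3)) :
    Trace (phi W) (R.Down W) d (R.downs W [d.snd]) x := by
  have hW := hB.mem _ hd
  refine hB.trace_corner hV hd ?_ ?_ ?_ ?_
  · rcases h with h | ⟨h, -⟩ | ⟨h, -⟩ <;> rw [h] <;> decide
  · intro g hg hg1
    rcases h with h | ⟨h, h'⟩ | ⟨h, h'⟩
    · refine phi_eq_of_dir hV hW hg (j := 1) le_rfl (by norm_num) (by rw [h, hg1]; decide) ?_
      intro i hi hi'; omega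
    · refine phi_eq_of_dir hV hW hg (j := 2) (by norm_num) (by norm_num)
        (by rw [h, hg1]; decide) ?_
      intro i hi hi' y hy
      obtain rfl : i = 1 := by omega
      rw [h]; exact h' y hy
    · refine phi_eq_of_dir hV hW hg (j := 3) (by norm_num) (by norm_num)
        (by rw [h, hg1]; decide) ?_
      intro i hi hi' y hy
      rw [h]
      have : i = 1 ∨ i = 2 := by omega
      rcases this with rfl | rfl
      · exact (h' y hy).2
      · exact (h' y hy).1
  · intro hg
    rcases h with h | ⟨h, h'⟩ | ⟨h, h'⟩
    · refine phi_eq_of_dir hV hW hx (j := 2) (by norm_num) (by norm_num)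
        (by rw [h, hx0]; decide) ?_
      intro i hi hi' y hy
      obtain rfl : i = 1 := by omega
      rw [h]; exact hg y hy
    · refine phi_eq_of_dir hV hW hx (j := 3) (by norm_num) (by norm_num)
        (by rw [h, hx0]; decide) ?_
      intro i hi hi' y hy
      rw [h]
      have : i = 1 ∨ i = 2 := by omega
      rcases this with rfl | rfl
      · exact h' y hy
      · exact hg y hy
    · refine phi_eq_of_dir hV hW hx (j := 4) (by norm_num) (by norm_num)
        (by rw [h, hx0]; decide) ?_
      intro i hi hi' y hy
      rw [h]
      have : i = 1 ∨ i = 2 ∨ i = 3 := by omega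
      rcases this with rfl | rfl | rfl
      · exact (h' y hy).2
      · exact (h' y hy).1
      · exact hg y hy
  · intro e he he3
    refine phi_eq_of_dir hV (by rw [he]; exact hW) (hx.trans he.symm) (j := 1) le_rfl (by norm_num)
      (by rw [he3, hx0]; decide) ?_
    intro i hi hi'; omega

/-- The cycle runs east along the bottom of a segment. -/
theorem Bottom.trace_east_run (hV : R.Valid) (hS : R.IsSegment S) (hB : R.Bottom W S)
    {a x₀ : P.G.Dart} (hx₀ : R.dir x₀ = 0) (hf₀ : x₀.fst = S[0]'(by have := hS.two_le; omega))
    (ha : Trace (phi W) (R.Down W) a (R.downs W (S.take 1)) x₀) {i : ℕ} (hi : i < S.length)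
    {x : P.G.Dart} (hx : R.dir x = 0) (hf : x.fst = S[i]) :
    Trace (phi W) (R.Down W) a (R.downs W (S.take (i + 1))) x := by
  induction i generalizing x with
  | zero =>
    obtain rfl : x = x₀ := eq_of_dir_eq hV (hf.trans hf₀.symm) (hx.trans hx₀.symm)
    exact ha
  | succ i ih =>
    obtain ⟨d, h0, h1, h2⟩ := isSegment_east hV hS hi
    have h3 := ih (by omega) h0 h1
    have h4 : d.snd ∈ S := by rw [h2]; exact List.getElem_mem _
    have h5 := hB.trace_to_east hV h4 (hf.trans h2.symm) hx (Or.inl h0)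
    have h6 := h3.trans h5
    rwa [downs, downs, ← List.filterMap_append, h2, List.take_append_getElem] at h6

/-- The cycle runs west along the top of a segment until it meets a north edge. -/
theorem Bottom.trace_west_run (hV : R.Valid) (hS : R.IsSegment S) (hB : R.Bottom W S)
    {i j : ℕ} (hij : j < i) (hi : i < S.length)
    (hno : ∀ (k : ℕ) (_ : j < k) (hk : k < i) (y : P.G.Dart), y.fst = S[k] → R.dir y ≠ 3)
    {d : P.G.Dart} (hd : R.dir d = 2) (hf : d.fst = S[i]) :
    ∃ d' : P.G.Dart, R.dir d' = 2 ∧ d'.fst = S[j + 1] ∧ d'.snd = S[j] ∧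
      Trace (phi W) (R.Down W) d [] d' := by
  induction i generalizing d with
  | zero => omega
  | succ i ih =>
    have hs : d.snd = S[i] := by
      rcases isSegment_of_west hV hS hd hi hf with ⟨h, h'⟩ | ⟨-, h, -⟩
      · exact h'
      · omega
    rcases Nat.lt_or_ge j i with h | h
    · obtain ⟨g, g0, g1, g2⟩ := isSegment_east hV hS (i := i - 1) (by omega)
      have e : i - 1 + 1 = i := by omega
      simp only [e] at g2
      have hg2 : R.dir g.symm = 2 := by rw [dir_symm hV, g0]; decide
      obtain ⟨d', h1, h2, h3, h4⟩ := ih h (by omega) (fun k hk hk' => hno k hk (by omega)) hg2 g2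
      refine ⟨d', h1, h2, h3, Trace.skip (not_down_of_dir (by rw [hd]; decide)) ?_⟩
      rwa [phi_eq_of_dir hV (d := d) (x := g.symm) (j := 2)
        (by rw [hs]; exact hB.mem _ (List.getElem_mem _)) (by rw [hs]; exact g2) (by norm_num)
        (by norm_num) (by rw [hd, hg2]; decide)]
      intro k hk hk' y hy
      obtain rfl : k = 1 := by omega
      rw [hd]
      exact hno i h (by omega) y (hy.trans hs)
    · obtain rfl : i = j := by omega
      exact ⟨d, hd, hf, hs, Trace.nil _⟩

/-- The bottom of a cyclic segment is a facial cycle. -/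
theorem Bottom.trace_cycle (hV : R.Valid) (hS : R.IsSegment S) (hB : R.Bottom W S)
    {x : P.G.Dart} (hx : R.dir x = 0) (hf : x.fst = S[S.length - 1]'(by have := hS.two_le; omega))
    (hs : x.snd = S[0]'(by have := hS.two_le; omega)) :
    Trace (phi W) (R.Down W) x (R.downs W S) x := by
  have h2 := hS.two_le
  obtain ⟨x₀, h0, h1, -⟩ := isSegment_east hV hS (i := 0) (by omega)
  have h3 := hB.trace_to_east hV (d := x) (x := x₀) (by rw [hs]; exact List.getElem_mem _)
    (h1.trans hs.symm) h0 (Or.inl hx)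
  have h4 : S.take 1 = [x.snd] := by rw [hs, List.take_one, List.head?_eq_getElem?,
    List.getElem?_eq_getElem (by omega)]; rfl
  rw [← h4] at h3
  have h5 := hB.trace_east_run hV hS h0 h1 h3 (i := S.length - 1) (by omega) hx hf
  rwa [Nat.sub_add_cancel (by omega), List.take_length] at h5

end walk

end Rep

namespace Rep
variable {n : ℕ} {P : PlaneGraph n} {R : Rep P} {W : Set (Fin n)} {S : List (Fin n)}

/-! ### Attaching a segment -/

theorem phi_iterate_symm {a b : P.G.Dart} (h : ∃ k, (phi W)^[k] a = b) :
    ∃ k, (phi W)^[k] b = a := by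
  obtain ⟨k, rfl⟩ := h
  obtain ⟨m, hm, hp⟩ := phi_injective.mem_periodicPts (f := phi (P := P) W) a
  refine ⟨m * k - k, ?_⟩
  rw [← Function.iterate_add_apply, Nat.sub_add_cancel (Nat.le_mul_of_pos_left k hm)]
  exact hp.mul_const k

theorem phi_iterate_trans {a b c : P.G.Dart} (h : ∃ k, (phi W)^[k] a = b)
    (h' : ∃ k, (phi W)^[k] b = c) : ∃ k, (phi W)^[k] a = c := by
  obtain ⟨k, rfl⟩ := h
  obtain ⟨m, rfl⟩ := h'
  exact ⟨m + k, Function.iterate_add_apply _ _ _ _⟩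

theorem Cen.of_orbit {a b : P.G.Dart} (ha : R.Cen W a) (h : ∃ k, (Rep.phi W)^[k] a = b) :
    R.Cen W b := by
  obtain ⟨k, rfl⟩ := h
  exact ha.phi_iterate k

/-- If the central face of a graph has only darts below a cyclic segment, then it is bounded by the
bottom of the segment. -/
theorem Bottom.cycle_closes (hV : R.Valid) (hS : R.IsSegment S) (hB : R.Bottom W S)
    (hc : R.IsCyc S) (hne : W.Nonempty)
    (hbot : ∀ d ∈ starSet P W, R.Cen W d → (R.dir d = 0 ∨ R.dir d = 1) ∧ d.fst ∈ S ∨ d ∈ R.Down W)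
    (hdown : ∀ e ∈ R.Down W, e.snd ∈ S) :
    ∃ x, Trace (phi W) (R.Down W) x (R.downs W S) x ∧ R.Cen W x ∧
      (∀ d ∈ R.Down W, ∃ k, (phi W)^[k] x = d) ∧
      (∀ d : P.G.Dart, R.dir d = 0 → d.fst ∈ S → ∃ k, (phi W)^[k] x = d) ∧
      ∀ d ∈ starSet P W, R.Cen W d → ∃ k, (phi W)^[k] x = d := by
  have h2 := hS.two_le
  obtain ⟨x, hx, hf, hs⟩ := (isCyc_iff hV hS).1 hc
  have htr := hB.trace_cycle hV hS hx hf hs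
  have hD : ∀ d ∈ R.Down W, ∃ k, (phi W)^[k] x = d := fun d hd =>
    htr.exists_iterate_of_mem ((mem_downs hV).2 ⟨hd, hdown d hd⟩)
  have hE : ∀ d : P.G.Dart, R.dir d = 0 → d.fst ∈ S → ∃ k, (phi W)^[k] x = d := by
    intro d hd hdS
    obtain ⟨i, hi, h⟩ := List.getElem_of_mem hdS
    obtain ⟨x₀, h0, h1, -⟩ := isSegment_east hV hS (i := 0) (by omega)
    have h3 := hB.trace_to_east hV (d := x) (x := x₀) (by rw [hs]; exact List.getElem_mem _)
      (h1.trans hs.symm) h0 (Or.inl hx)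
    have h4 : S.take 1 = [x.snd] := by rw [hs, List.take_one, List.head?_eq_getElem?,
      List.getElem?_eq_getElem (by omega)]; rfl
    rw [← h4] at h3
    exact (hB.trace_east_run hV hS h0 h1 h3 hi hd h.symm).exists_iterate
  have hall : ∀ d ∈ starSet P W, R.Cen W d → ∃ k, (phi W)^[k] x = d := by
    intro d hd hcd
    rcases hbot d hd hcd with ⟨h | h, hdS⟩ | h
    · exact hE d h hdS
    · obtain ⟨h5, h6⟩ := hB.down hV hdS h
      refine phi_iterate_trans (hD _ h5) (phi_iterate_symm ⟨1, h6⟩)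
    · exact hD d h
  obtain ⟨d, hd, hcd⟩ := exists_cen (R := R) hne
  exact ⟨x, htr, hcd.of_orbit (phi_iterate_symm (hall d hd hcd)), hD, hE, hall⟩

theorem orbit_of_reach {x : P.G.Dart}
    (h : ∀ d ∈ starSet P W, R.Cen W d → ∃ k, (phi W)^[k] x = d) :
    ∀ d ∈ starSet P W, ∀ d' ∈ starSet P W, R.Cen W d → R.Cen W d' → ∃ k, (phi W)^[k] d = d' :=
  fun d hd d' hd' hc hc' => phi_iterate_trans (phi_iterate_symm (h d hd hc)) (h d' hd' hc')

theorem linked_segment (hV : R.Valid) (hS : R.IsSegment S) (hSW : ∀ v ∈ S, v ∈ W) {u v : Fin n}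
    (hu : u ∈ S) (hv : v ∈ S) : P.Linked (indSet P W) u v := by
  have h2 := hS.two_le
  have key : ∀ (i : ℕ) (hi : i < S.length), P.Linked (indSet P W) (S[0]'(by omega)) S[i] := by
    intro i hi
    induction i with
    | zero => exact Relation.EqvGen.refl _
    | succ i ih =>
      obtain ⟨d, -, h1, h2⟩ := isSegment_east hV hS hi
      refine (ih (by omega)).trans ?_
      rw [← h1, ← h2]
      refine Linked.dart ⟨hSW _ ?_, hSW _ ?_⟩
      · rw [h1]; exact List.getElem_mem _
      · rw [h2]; exact List.getElem_mem _
  obtain ⟨i, hi, rfl⟩ := List.getElem_of_mem hu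
  obtain ⟨j, hj, rfl⟩ := List.getElem_of_mem hv
  exact (key i hi).symm.trans (key j hj)

theorem deg_segment (hV : R.Valid) (hS : R.IsSegment S) (hSW : ∀ v ∈ S, v ∈ W) {v : Fin n}
    (hv : v ∈ S) : ∃ d ∈ indSet P W, d.fst = v := by
  have h2 := hS.two_le
  obtain ⟨i, hi, rfl⟩ := List.getElem_of_mem hv
  rcases Nat.lt_or_ge (i + 1) S.length with h | h
  · obtain ⟨d, -, h1, h2⟩ := isSegment_east hV hS h
    refine ⟨d, ⟨hSW _ ?_, hSW _ ?_⟩, h1⟩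
    · rw [h1]; exact List.getElem_mem _
    · rw [h2]; exact List.getElem_mem _
  · obtain ⟨d, -, h1, h2⟩ := isSegment_east hV hS (i := i - 1) (by omega)
    have e : i - 1 + 1 = i := by omega
    simp only [e] at h2
    refine ⟨d.symm, ⟨hSW _ ?_, hSW _ ?_⟩, h2⟩
    · change d.snd ∈ S; rw [h2]; exact List.getElem_mem _
    · change d.fst ∈ S; rw [h1]; exact List.getElem_mem _

/-- The situation in which the segment `S` is attached to a good sequence with vertex set `W`: the
north edges `l` of `S` are a part of the circular order `l ++ rest` of the south edges. -/
structure Attach (R : Rep P) (W : Set (Fin n)) (S : List (Fin n)) (l rest : List P.G.Dart) :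
    Prop where
  inv : R.Inv W
  seg : R.IsSegment S
  north : ∀ d : P.G.Dart, d ∈ l ↔ R.dir d = 3 ∧ d.fst ∈ S
  sub : (l.map (fun d => d.fst)).Sublist S
  ne : l ≠ []
  nodup : (l ++ rest).Nodup
  mem : ∀ d, d ∈ l ++ rest ↔ d ∈ R.Down W
  tr : ∃ z, Trace (phi W) (R.Down W) z (l ++ rest) z
  cyc : R.IsCyc S → rest = []

/-- The vertex set enlarged by the vertices of a segment. -/
def adjoin (W : Set (Fin n)) (S : List (Fin n)) : Set (Fin n) := {v | v ∈ W ∨ v ∈ S}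

/-- The vertex `v` lies on a path `S` east of all north edges of `S`. -/
def Far (R : Rep P) (S : List (Fin n)) (v : Fin n) : Prop :=
  ¬ R.IsCyc S ∧ ∃ (i : ℕ) (hi : i < S.length), S[i] = v ∧
    ∀ (j : ℕ) (hj : j < S.length), i ≤ j → ∀ y : P.G.Dart, y.fst = S[j] → R.dir y ≠ 3

namespace Attach
variable {l rest : List P.G.Dart}

theorem down_of_mem (h : R.Attach W S l rest) {e : P.G.Dart} (he : e ∈ l) : e ∈ R.Down W :=
  (h.mem e).1 (List.mem_append_left _ he)

/-- A segment is disjoint from `W`: it is connected by horizontal edges, which do not leave `W`, and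
it contains the tail of a south edge of `W`. -/
theorem disjoint (hV : R.Valid) (h : R.Attach W S l rest) {v : Fin n} (hv : v ∈ S) : v ∉ W := by
  intro hvW
  have h2 := h.seg.two_le
  obtain ⟨i, hi, rfl⟩ := List.getElem_of_mem hv
  have up : ∀ (j : ℕ) (hj : j + 1 < S.length), S[j] ∈ W ↔ S[j + 1] ∈ W := by
    intro j hj
    obtain ⟨d, h0, h1, h2⟩ := isSegment_east hV h.seg hj
    constructor
    · intro hW
      have := h.inv.closed d (h1 ▸ hW) (by rw [h0]; decide)
      rwa [h2] at this
    · intro hW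
      have := h.inv.closed d.symm (by change d.snd ∈ W; rwa [h2]) (by rw [dir_symm hV, h0]; decide)
      change d.fst ∈ W at this
      rwa [h1] at this
  have hz : ∀ (j : ℕ) (hj : j < S.length), S[j] ∈ W ↔ S[0]'(by omega) ∈ W := by
    intro j hj
    induction j with
    | zero => rfl
    | succ j ih => rw [← up j hj]; exact ih (by omega)
  obtain ⟨e, he⟩ := List.exists_mem_of_ne_nil _ h.ne
  have h3 := (h.north e).1 he
  have h4 := h.down_of_mem he
  obtain ⟨k, hk, hek⟩ := List.getElem_of_mem h3.2
  apply h4.2.2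
  rw [← hek, hz k hk, ← hz i hi]
  exact hvW

theorem closed (hV : R.Valid) (h : R.Attach W S l rest) (d : P.G.Dart)
    (hf : d.fst ∈ adjoin W S) (hd : R.dir d ≠ 1) : d.snd ∈ adjoin W S := by
  rcases hf with hf | hf
  · exact Or.inl (h.inv.closed d hf hd)
  · rcases dir_cases R d with h0 | h0 | h0 | h0
    · exact Or.inr (isSegment_closed hV h.seg (Or.inl h0) hf)
    · exact absurd h0 hd
    · exact Or.inr (isSegment_closed hV h.seg (Or.inr h0) hf)
    · exact Or.inl (h.down_of_mem ((h.north d).2 ⟨h0, hf⟩)).2.1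

/-- The south edges of the new segment leave the enlarged vertex set. -/
theorem bottom (hV : R.Valid) (h : R.Attach W S l rest) : R.Bottom (adjoin W S) S := by
  refine ⟨fun v hv => Or.inr hv, fun g hg hd => ?_⟩
  have hd3 : R.dir g.symm = 3 := by rw [dir_symm hV, hd]; rfl
  rintro (h1 | h1)
  · exact h.disjoint hV hg (h.inv.closed g.symm h1 (by rw [hd3]; decide))
  · exact h.disjoint hV hg (h.down_of_mem ((h.north g.symm).2 ⟨hd3, h1⟩)).2.1

theorem subset_adjoin : W ⊆ adjoin W S := fun _ h => Or.inl h

theorem exists_north (h : R.Attach W S l rest) : ∃ e ∈ l, R.dir e = 3 ∧ e.fst ∈ S ∧ e.snd ∈ W := by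
  obtain ⟨e, he⟩ := List.exists_mem_of_ne_nil _ h.ne
  exact ⟨e, he, ((h.north e).1 he).1, ((h.north e).1 he).2, (h.down_of_mem he).2.1⟩

theorem linked (hV : R.Valid) (h : R.Attach W S l rest) (u : Fin n) (hu : u ∈ adjoin W S)
    (v : Fin n) (hv : v ∈ adjoin W S) : P.Linked (indSet P (adjoin W S)) u v := by
  obtain ⟨e, -, -, he2, he3⟩ := h.exists_north
  have key : ∀ w ∈ adjoin W S, P.Linked (indSet P (adjoin W S)) e.snd w := by
    rintro w (hw | hw)
    · exact (h.inv.linked _ he3 _ hw).mono (indSet_mono subset_adjoin)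
    · exact (Linked.dart (d := e) (H := indSet P (adjoin W S)) ⟨Or.inr he2, Or.inl he3⟩).symm.trans
        (linked_segment hV h.seg (fun _ h => Or.inr h) he2 hw)
  exact (key u hu).symm.trans (key v hv)

theorem deg (hV : R.Valid) (h : R.Attach W S l rest) (v : Fin n) (hv : v ∈ adjoin W S) :
    ∃ d ∈ indSet P (adjoin W S), d.fst = v := by
  rcases hv with hv | hv
  · obtain ⟨d, hd, h'⟩ := h.inv.deg v hv
    exact ⟨d, indSet_mono subset_adjoin hd, h'⟩
  · exact deg_segment hV h.seg (fun _ h => Or.inr h) hv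

theorem outer (h : R.Attach W S l rest) : ¬ R.Cen (adjoin W S) R.outer := fun h' =>
  h.inv.outer (h'.mono subset_adjoin)

/-- An edge that touches the segment and points south into it is the reversal of a north edge. -/
theorem symm_mem (hV : R.Valid) (h : R.Attach W S l rest) {d : P.G.Dart} (hs : d.snd ∈ S)
    (hd : R.dir d = 1) : d.symm ∈ l :=
  (h.north _).2 ⟨by rw [dir_symm hV, hd]; rfl, hs⟩

/-- The new darts are those of the segment and those on its south side. -/
theorem mem_star_cases (hV : R.Valid) (h : R.Attach W S l rest) {d : P.G.Dart}
    (hd : d ∈ starSet P (adjoin W S)) : d ∈ starSet P W ∨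
      ((R.dir d = 0 ∨ R.dir d = 2) ∧ d.fst ∈ S ∧ d.snd ∈ S) ∨
      (R.dir d = 1 ∧ d.fst ∈ S) ∨ (R.dir d = 3 ∧ d.snd ∈ S ∧ d ∈ R.Down (adjoin W S)) := by
  by_cases hW : d ∈ starSet P W
  · exact Or.inl hW
  right
  have hf : d.fst ∉ W := fun h => hW (Or.inl h)
  have hs : d.snd ∉ W := fun h => hW (Or.inr h)
  have hfs : d.fst ∈ S ∨ d.snd ∈ S := hd.imp (fun h => h.resolve_left hf) fun h => h.resolve_left hs
  rcases dir_cases R d with h0 | h0 | h0 | h0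
  · left
    refine ⟨Or.inl h0, ?_⟩
    rcases hfs with h1 | h1
    · exact ⟨h1, isSegment_closed hV h.seg (Or.inl h0) h1⟩
    · exact ⟨isSegment_closed hV h.seg (d := d.symm) (Or.inr (by rw [dir_symm hV, h0]; rfl)) h1, h1⟩
  · right; left
    refine ⟨h0, hfs.resolve_right fun h1 => ?_⟩
    exact hf (h.down_of_mem (h.symm_mem hV h1 h0)).2.1
  · left
    refine ⟨Or.inr h0, ?_⟩
    rcases hfs with h1 | h1
    · exact ⟨h1, isSegment_closed hV h.seg (Or.inr h0) h1⟩
    · exact ⟨isSegment_closed hV h.seg (d := d.symm) (Or.inl (by rw [dir_symm hV, h0]; rfl)) h1, h1⟩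
  · right; right
    have h1 : d.fst ∉ S := fun h1 => hs (h.down_of_mem ((h.north d).2 ⟨h0, h1⟩)).2.1
    have h2 := hfs.resolve_left h1
    exact ⟨h0, h2, h0, Or.inr h2, fun h' => h'.elim hf h1⟩

/-- The successor map changes only at the heads of the darts into the segment. -/
theorem phi_adjoin (hV : R.Valid) (h : R.Attach W S l rest) {d : P.G.Dart} (hd : d ∈ starSet P W)
    (hl : d.symm ∉ l) : phi (adjoin W S) d = phi W d ∧ R.turn (adjoin W S) d = R.turn W d := by
  by_cases hs : d.snd ∈ W
  · rw [phi_of_mem hs, phi_of_mem (Or.inl hs : d.snd ∈ adjoin W S), turn_of_mem hs,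
      turn_of_mem (Or.inl hs : d.snd ∈ adjoin W S)]
    exact ⟨rfl, rfl⟩
  · have hs' : d.snd ∉ adjoin W S := by
      rintro (h1 | h1)
      · exact hs h1
      · have h2 := mem_down hV h.inv.closed (d := d.symm) (hd.resolve_right hs) hs
        exact hl ((h.north _).2 ⟨h2.1, h1⟩)
    rw [phi_of_not_mem hs, phi_of_not_mem hs', turn_of_not_mem hs, turn_of_not_mem hs']
    exact ⟨rfl, rfl⟩

theorem not_star_of_south (hV : R.Valid) (h : R.Attach W S l rest) {d : P.G.Dart} (hf : d.fst ∈ S)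
    (hd : R.dir d = 1) : d ∉ starSet P W := by
  rintro (h1 | h1)
  · exact h.disjoint hV hf h1
  · exact (h.bottom hV).out d hf hd (Or.inl h1)

theorem not_star_of_hor (hV : R.Valid) (h : R.Attach W S l rest) {d : P.G.Dart} (hf : d.fst ∈ S)
    (hd : R.dir d = 0 ∨ R.dir d = 2) : d ∉ starSet P W := by
  rintro (h1 | h1)
  · exact h.disjoint hV hf h1
  · exact h.disjoint hV (isSegment_closed hV h.seg hd hf) h1

/-- The next dart of a facial cycle at a vertex of the graph is a turn to the right, straight on or
to the left. -/
theorem _root_.OrthoRadial.Rep.phi_corner (hV : R.Valid) {d : P.G.Dart} (hs : d.snd ∈ W) :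
    (R.dir (phi W d) = R.dir d + 1 ∧ R.turn W d = 1) ∨
    (R.dir (phi W d) = R.dir d ∧ R.turn W d = 0 ∧
      ∀ y : P.G.Dart, y.fst = d.snd → R.dir y ≠ R.dir d + 1) ∨
    (R.dir (phi W d) = R.dir d + 3 ∧ R.turn W d = -1 ∧
      ∀ y : P.G.Dart, y.fst = d.snd → R.dir y ≠ R.dir d + 1 ∧ R.dir y ≠ R.dir d) := by
  rw [phi_of_mem hs, turn_of_mem hs, dir_rot hV, dir_symm hV]
  have key : ∀ y : P.G.Dart, y.fst = d.snd → ∀ j : ℕ, 1 ≤ j → j < R.angle d.symm →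
      R.dir y ≠ R.dir d + 2 - (j : ZMod 4) := by
    intro y hy j hj hja hdir
    have hy' : y.fst = d.symm.fst := hy
    obtain ⟨k, hk, hk'⟩ := exists_rot_pow hy'
    have h1 := dir_rot_pow hV d.symm k
    rw [hk', hdir, dir_symm hV] at h1
    have h2 : ((R.rsum d.symm k : ℕ) : ZMod 4) = ((j : ℕ) : ZMod 4) := by linear_combination h1
    rw [ZMod.natCast_eq_natCast_iff] at h2
    have h3 := rsum_lt hV hk
    have h4 := R.angle_mem d.symm
    unfold Nat.ModEq at h2
    have h5 : R.rsum d.symm k = j := by omega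
    rcases k with _ | k
    · simp [rsum] at h5; omega
    · rw [Nat.add_comm, rsum_add] at h5
      have : R.rsum d.symm 1 = R.angle d.symm := by simp [rsum]
      omega
  rcases R.angle_mem d.symm with ha | ha | ha <;> rw [ha] at key ⊢
  · left
    exact ⟨by push_cast; ring, by norm_num⟩
  · right; left
    refine ⟨by push_cast; ring, by norm_num, fun y hy h' => key y hy 1 le_rfl (by norm_num) ?_⟩
    rw [h']; push_cast; ring
  · right; right
    refine ⟨by push_cast; linear_combination -(by decide : (4 : ZMod 4) = 0), by norm_num,
      fun y hy => ⟨fun h' => key y hy 1 le_rfl (by norm_num) ?_,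
        fun h' => key y hy 2 (by norm_num) (by norm_num) ?_⟩⟩
    · rw [h']; push_cast; ring
    · rw [h']; push_cast; ring

open Classical in
/-- The lift of the directions after the segment `S` is attached. West edges above `S` have the
rotation of a right turn off the south edges that end at `S`, except east of all of them. -/
def newLift (R : Rep P) (W : Set (Fin n)) (S : List (Fin n)) (h : P.G.Dart → ℤ) (d : P.G.Dart) : ℤ :=
  if d ∈ starSet P W then h d else
    if R.dir d = 0 then 0 else if R.dir d = 1 then 1 else if R.dir d = 3 then -1 else
      if R.Far S d.fst then -2 else 2

/-- The new lift never increases by more than the turning. At the corners of the segment this is a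
check of all pairs of directions. The corners above the segment that may have a defect turn out not
to lie in the central face. -/
theorem newLift_le (hV : R.Valid) (h : R.Attach W S l rest) {f : P.G.Dart → ℤ}
    (hf : ∀ d ∈ starSet P W, R.Cen W d → f (phi W d) = f d + R.turn W d)
    (hfd : ∀ e ∈ R.Down W, f e = -1 ∧ f e.symm = 1) (d : P.G.Dart)
    (hd : d ∈ starSet P (adjoin W S)) (hc : R.Cen (adjoin W S) d) :
    newLift R W S f (phi (adjoin W S) d) ≤ newLift R W S f d + R.turn (adjoin W S) d := by
  have hB := h.bottom hV
  have h2 := h.seg.two_le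
  -- the values of the lift at the edges of the segment
  have v0 : ∀ g : P.G.Dart, g.fst ∈ S → R.dir g = 0 → newLift R W S f g = 0 := by
    intro g hg h0
    rw [newLift, if_neg (h.not_star_of_hor hV hg (Or.inl h0)), if_pos h0]
  have v1 : ∀ g : P.G.Dart, g.fst ∈ S → R.dir g = 1 → newLift R W S f g = 1 := by
    intro g hg h0
    rw [newLift, if_neg (h.not_star_of_south hV hg h0), if_neg (by rw [h0]; decide), if_pos h0]
  have v2 : ∀ g : P.G.Dart, g.fst ∈ S → R.dir g = 2 →
      (R.Far S g.fst ∧ newLift R W S f g = -2) ∨ (¬ R.Far S g.fst ∧ newLift R W S f g = 2) := by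
    intro g hg h0
    rw [newLift, if_neg (h.not_star_of_hor hV hg (Or.inr h0)), if_neg (by rw [h0]; decide),
      if_neg (by rw [h0]; decide), if_neg (by rw [h0]; decide)]
    by_cases hfar : R.Far S g.fst
    · exact Or.inl ⟨hfar, if_pos hfar⟩
    · exact Or.inr ⟨hfar, if_neg hfar⟩
  have v3 : ∀ g : P.G.Dart, g.fst ∈ S → R.dir g = 3 → newLift R W S f g = -1 := by
    intro g hg h0
    have := h.down_of_mem ((h.north g).2 ⟨h0, hg⟩)
    rw [newLift, if_pos (show g ∈ starSet P W from Or.inr this.2.1), (hfd g this).1]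
  by_cases hs : d.snd ∈ S
  · have hs' : d.snd ∈ adjoin W S := Or.inr hs
    have hg : (phi (adjoin W S) d).fst ∈ S := by rw [phi_fst]; exact hs
    have hgf : (phi (adjoin W S) d).fst = d.snd := phi_fst
    have hcor := phi_corner hV hs'
    generalize phi (adjoin W S) d = g at hg hgf hcor
    rcases h.mem_star_cases hV hd with hst | ⟨h0 | h0, hfS, -⟩ | ⟨h0, hfS⟩ | ⟨h0, -, hdn⟩
    · -- an edge from the old graph into the segment
      have hsW : d.snd ∉ W := h.disjoint hV hs
      have h3 := mem_down hV h.inv.closed (d := d.symm) (hst.resolve_right hsW) hsW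
      have h1 : R.dir d = 1 := by
        have := Down.symm_dir hV h3
        rwa [SimpleGraph.Dart.symm_symm] at this
      have hval : newLift R W S f d = 1 := by
        rw [newLift, if_pos hst]
        have := (hfd _ h3).2
        rwa [SimpleGraph.Dart.symm_symm] at this
      rw [h1] at hcor
      rcases hcor with ⟨a, b⟩ | ⟨a, b, -⟩ | ⟨a, b, -⟩
      · rw [hval, b]
        rcases v2 g hg a with ⟨hfar, -⟩ | ⟨-, e⟩
        · obtain ⟨-, i, hi, hiv, hno⟩ := hfar
          exact absurd h3.1 (hno i hi le_rfl d.symm (by rw [hiv, hgf]; rfl))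
        · rw [e]; norm_num
      · rw [hval, b, v1 g hg a]; norm_num
      · rw [hval, b, v0 g hg a]; norm_num
    · rw [h0] at hcor
      -- an edge that runs east
      rw [v0 d hfS h0]
      rcases hcor with ⟨a, b⟩ | ⟨a, b, -⟩ | ⟨a, b, -⟩
      · rw [v1 g hg a, b]; norm_num
      · rw [v0 g hg a, b]; norm_num
      · rw [v3 g hg a, b]; norm_num
    · rw [h0] at hcor
      obtain ⟨i, hi, hiv⟩ := List.getElem_of_mem hfS
      -- the edge runs west, to the preceding vertex if `S` is a path
      have hpath : R.Far S d.fst → (∀ y : P.G.Dart, y.fst = d.snd → R.dir y ≠ 3) →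
          ∃ i, ∃ hi : i < S.length, S[i] = d.snd ∧ ∀ (j : ℕ) (hj : j < S.length), i ≤ j →
            ∀ y : P.G.Dart, y.fst = S[j] → R.dir y ≠ 3 := by
        rintro ⟨hnc, i', hi', hiv', hno⟩ hv
        rcases isSegment_of_west hV h.seg h0 hi' hiv'.symm with ⟨h1, h3⟩ | ⟨h1, -⟩
        · refine ⟨i' - 1, by omega, h3.symm, fun j hj hij y hy => ?_⟩
          rcases Nat.eq_or_lt_of_le hij with rfl | hlt
          · exact hv y (hy.trans h3.symm)
          · exact hno j hj (by omega) y hy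
        · exact absurd h1 hnc
      rcases hcor with ⟨a, b⟩ | ⟨a, b, hno⟩ | ⟨a, b, hno⟩
      · rw [v3 g hg a, b]
        rcases v2 d hfS h0 with ⟨-, e⟩ | ⟨-, e⟩ <;> rw [e] <;> norm_num
      · rw [b]
        rcases v2 d hfS h0 with ⟨hfar, e⟩ | ⟨-, e⟩
        · rcases v2 g hg a with ⟨-, e'⟩ | ⟨hnf, e'⟩
          · rw [e, e']; norm_num
          · obtain ⟨i, hi, hiv, hi'⟩ := hpath hfar hno
            exact absurd ⟨hfar.1, i, hi, hiv.trans hgf.symm, hi'⟩ hnf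
        · rw [e]
          rcases v2 g hg a with ⟨-, e'⟩ | ⟨-, e'⟩ <;> rw [e'] <;> norm_num
      · rw [b, v1 g hg a]
        rcases v2 d hfS h0 with ⟨hfar, e⟩ | ⟨-, e⟩
        · exfalso
          obtain ⟨i, hi, hiv, hi'⟩ := hpath hfar fun y hy => (hno y hy).1
          rcases Nat.eq_zero_or_pos i with rfl | hpos
          · obtain ⟨e, -, he3, heS, -⟩ := h.exists_north
            obtain ⟨k, hk, hek⟩ := List.getElem_of_mem heS
            exact hi' k hk (Nat.zero_le _) e hek.symm he3
          · obtain ⟨w, w0, w1, w2⟩ := isSegment_east hV h.seg (i := i - 1) (by omega)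
            have e1 : i - 1 + 1 = i := by omega
            simp only [e1] at w2
            exact (hno w.symm (w2.trans hiv)).2 (by rw [dir_symm hV, w0]; rfl)
        · rw [e]; norm_num
    · exact absurd hs' (hB.out d hfS h0)
    · have hval : newLift R W S f d = -1 := by
        -- an edge into the segment from below
        have hst : d ∉ starSet P W := by
          rintro (h1 | h1)
          · exact hdn.2.2 (Or.inl h1)
          · exact h.disjoint hV hs h1
        rw [newLift, if_neg hst, if_neg (by rw [h0]; decide), if_neg (by rw [h0]; decide), if_pos h0]
      rw [h0] at hcor
      rw [hval]
      rcases hcor with ⟨a, b⟩ | ⟨a, b, -⟩ | ⟨a, b, hno⟩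
      · rw [v0 g hg a, b]; norm_num
      · rw [v3 g hg a, b]; norm_num
      · rw [b]
        rcases v2 g hg a with ⟨-, e⟩ | ⟨hnf, -⟩
        · rw [e]; norm_num
        · exfalso
          apply hnf
          obtain ⟨i, hi, hiv⟩ := List.getElem_of_mem hs
          have hlast : ¬ i + 1 < S.length := by
            intro hlt
            obtain ⟨w, w0, w1, -⟩ := isSegment_east hV h.seg hlt
            exact (hno w (w1.trans hiv)).1 w0
          refine ⟨fun hcy => ?_, i, hi, hiv.trans hgf.symm, fun j hj hij y hy => ?_⟩
          · obtain ⟨w, w0, w1, -⟩ := (isCyc_iff hV h.seg).1 hcy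
            have e1 : S.length - 1 = i := by omega
            simp only [e1] at w1
            exact (hno w (w1.trans hiv)).1 w0
          · obtain rfl : j = i := by omega
            exact (hno y (hy.trans hiv)).2
  · -- at the remaining vertices, nothing changes
    rcases h.mem_star_cases hV hd with hst | ⟨-, -, h1⟩ | ⟨h0, hfS⟩ | ⟨-, h1, -⟩
    · obtain ⟨e1, e2⟩ := h.phi_adjoin hV hst (fun hl => hs ((h.north _).1 hl).2)
      rw [e1, e2, newLift, newLift, if_pos hst, if_pos (phi_mem_starSet hst)]
      exact (hf d hst (hc.mono subset_adjoin)).le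
    · exact absurd h1 hs
    · obtain ⟨h3, h4⟩ := hB.down hV hfS h0
      have hst : d.symm ∉ starSet P W := fun h' =>
        h.not_star_of_south hV hfS h0 (by have := starSet_symm h'; rwa [SimpleGraph.Dart.symm_symm] at this)
      rw [h4, v1 d hfS h0, turn_of_not_mem (hB.out d hfS h0), newLift, if_neg hst,
        if_neg (by rw [h3.1]; decide), if_neg (by rw [h3.1]; decide), if_pos h3.1]
      norm_num
    · exact absurd h1 hs

end Attach

/-! ### The central facial cycle around a new segment -/

namespace Attach
variable {l rest : List P.G.Dart}

/-- The new lift increases by exactly the turning, since the total turning of the central face is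
zero. -/
theorem newLift_eq (hV : R.Valid) (h : R.Attach W S l rest) {f : P.G.Dart → ℤ}
    (hf : ∀ d ∈ starSet P W, R.Cen W d → f (phi W d) = f d + R.turn W d)
    (hfd : ∀ e ∈ R.Down W, f e = -1 ∧ f e.symm = 1) {d : P.G.Dart}
    (hd : d ∈ starSet P (adjoin W S)) (hc : R.Cen (adjoin W S) d) :
    newLift R W S f (phi (adjoin W S) d) = newLift R W S f d + R.turn (adjoin W S) d :=
  turn_eq_of_le hV (h.inv.ne.mono subset_adjoin) (h.deg hV) (h.linked hV) h.outer
    (h.newLift_le hV hf hfd) hd hc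

/-- The central face lies below the segment: its boundary does not run west along the segment to a
north edge, which would be a defect of the lift. -/
theorem no_north_of_cen (hV : R.Valid) (h : R.Attach W S l rest) {d : P.G.Dart}
    (hd : R.dir d = 2) (hf : d.fst ∈ S) (hc : R.Cen (adjoin W S) d) (hfar : ¬ R.Far S d.fst)
    (y : P.G.Dart) (hy : y.fst = d.snd) : R.dir y ≠ 3 := by
  intro hy3
  obtain ⟨f, hf1, hf2⟩ := h.inv.lift
  have hs : d.snd ∈ S := isSegment_closed hV h.seg (Or.inr hd) hf
  have hs' : d.snd ∈ adjoin W S := Or.inr hs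
  have h1 := h.newLift_eq hV hf1 hf2 (Or.inr hs') hc
  have h2 : phi (adjoin W S) d = y := phi_eq_of_dir hV hs' hy (j := 1) le_rfl (by norm_num)
    (by rw [hd, hy3]; decide) (fun i hi hi' => by omega)
  have h3 : R.turn (adjoin W S) d = 1 := by
    rcases phi_corner hV hs' with ⟨-, h⟩ | ⟨-, -, h⟩ | ⟨-, -, h⟩
    · exact h
    · exact absurd (by rw [hy3, hd]; decide) (h y hy)
    · exact absurd (by rw [hy3, hd]; decide) (h y hy).1
  have h4 := h.down_of_mem ((h.north y).2 ⟨hy3, hy ▸ hs⟩)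
  rw [h2, h3, newLift, newLift, if_pos (show y ∈ starSet P W from Or.inr h4.2.1), (hf2 y h4).1,
    if_neg (h.not_star_of_hor hV hf (Or.inr hd)), if_neg (by rw [hd]; decide),
    if_neg (by rw [hd]; decide), if_neg (by rw [hd]; decide), if_neg hfar] at h1
  norm_num at h1

theorem phi_west (hV : R.Valid) {d g : P.G.Dart} (hs : d.snd ∈ W) (hd : R.dir d = 2)
    (hno : ∀ y : P.G.Dart, y.fst = d.snd → R.dir y ≠ 3) (hg : g.fst = d.snd) (hg2 : R.dir g = 2) :
    phi W d = g := by
  refine phi_eq_of_dir hV hs hg (j := 2) (by norm_num) (by norm_num) (by rw [hd, hg2]; decide) ?_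
  intro i hi hi' y hy
  obtain rfl : i = 1 := by omega
  rw [hd]; exact hno y hy

theorem exists_west (hV : R.Valid) (hS : R.IsSegment S) {i : ℕ} (hi : i < S.length)
    (h : 0 < i ∨ R.IsCyc S) : ∃ g : P.G.Dart, R.dir g = 2 ∧ g.fst = S[i] := by
  rcases Nat.eq_zero_or_pos i with rfl | hpos
  · obtain ⟨w, w0, -, w2⟩ := (isCyc_iff hV hS).1 (h.resolve_left (lt_irrefl 0))
    exact ⟨w.symm, by rw [dir_symm hV, w0]; rfl, w2⟩
  · obtain ⟨w, w0, -, w2⟩ := isSegment_east hV hS (i := i - 1) (by omega)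
    have e1 : i - 1 + 1 = i := by omega
    simp only [e1] at w2
    exact ⟨w.symm, by rw [dir_symm hV, w0]; rfl, w2⟩

/-- If a west edge of the segment bounds the central face, then so do all further west, and there is
no north edge to the west. -/
theorem west_cen (hV : R.Valid) (h : R.Attach W S l rest) {i : ℕ} (hi : i < S.length)
    {d : P.G.Dart} (hd : R.dir d = 2) (hf : d.fst = S[i]) (hc : R.Cen (adjoin W S) d)
    (hfar : ∀ j ≤ i, ∀ hj : j < S.length, ¬ R.Far S S[j]) :
    (∀ (j : ℕ) (hj : j < i) (y : P.G.Dart), y.fst = S[j] → R.dir y ≠ 3) ∧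
      ∀ g : P.G.Dart, R.dir g = 2 → g.fst = S[0]'(by omega) → R.Cen (adjoin W S) g := by
  induction i generalizing d with
  | zero =>
    refine ⟨fun j hj => absurd hj (Nat.not_lt_zero j), fun g hg hgf => ?_⟩
    rwa [eq_of_dir_eq hV (hgf.trans hf.symm) (hg.trans hd.symm)]
  | succ i ih =>
    have hs : d.snd = S[i] := by
      rcases isSegment_of_west hV h.seg hd hi hf with ⟨_, h'⟩ | ⟨-, h', -⟩
      · exact h'
      · omega
    have hno := h.no_north_of_cen hV hd (by rw [hf]; exact List.getElem_mem _) hc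
      (by rw [hf]; exact hfar _ le_rfl hi)
    have hsW : d.snd ∈ adjoin W S := by rw [hs]; exact Or.inr (List.getElem_mem _)
    by_cases hw : 0 < i ∨ R.IsCyc S
    · obtain ⟨g, hg2, hgf⟩ := exists_west hV h.seg (i := i) (by omega) hw
      have h1 : phi (adjoin W S) d = g := phi_west hV hsW hd hno (hgf.trans hs.symm) hg2
      obtain ⟨h2, h3⟩ := ih (by omega) hg2 hgf (h1 ▸ hc.phi) (fun j hj => hfar j (by omega))
      refine ⟨fun j hj y hy => ?_, h3⟩
      rcases Nat.lt_succ_iff_lt_or_eq.1 hj with h4 | rfl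
      · exact h2 j h4 y hy
      · exact hno y (hy.trans hs.symm)
    · obtain rfl : i = 0 := by omega
      refine ⟨fun j hj y hy => ?_, fun g hg hgf => ?_⟩
      · obtain rfl : j = 0 := by omega
        exact hno y (hy.trans hs.symm)
      · rcases isSegment_of_west hV h.seg hg (by omega) hgf with ⟨h', _⟩ | ⟨h', -⟩
        · omega
        · exact absurd (Or.inr h') hw

/-- The top of a cyclic segment does not bound the central face: otherwise the central facial cycle
would run around it without meeting a north edge. -/
theorem not_cen_west_of_cyc (hV : R.Valid) (h : R.Attach W S l rest) (hcy : R.IsCyc S)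
    {d : P.G.Dart} (hd : R.dir d = 2) (hf : d.fst ∈ S) : ¬ R.Cen (adjoin W S) d := by
  intro hc
  have h2 := h.seg.two_le
  have hfar : ∀ v, ¬ R.Far S v := fun v hv => hv.1 hcy
  obtain ⟨i, hi, hiv⟩ := List.getElem_of_mem hf
  obtain ⟨-, h3⟩ := h.west_cen hV hi hd hiv.symm hc fun j _ hj => hfar _
  obtain ⟨g, hg2, hgf⟩ := exists_west hV h.seg (i := 0) (by omega) (Or.inr hcy)
  have hgc := h3 g hg2 hgf
  have hgs : g.snd = S[S.length - 1] := by
    rcases isSegment_of_west hV h.seg hg2 (by omega) hgf with ⟨h', _⟩ | ⟨-, -, h'⟩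
    · omega
    · exact h'
  have hno := h.no_north_of_cen hV hg2 (by rw [hgf]; exact List.getElem_mem _) hgc (hfar _)
  obtain ⟨g', hg2', hgf'⟩ := exists_west hV h.seg (i := S.length - 1) (by omega) (Or.inr hcy)
  have h4 : phi (adjoin W S) g = g' := phi_west hV (by rw [hgs]; exact Or.inr (List.getElem_mem _))
    hg2 hno (hgf'.trans hgs.symm) hg2'
  obtain ⟨h5, -⟩ := h.west_cen hV (by omega) hg2' hgf' (h4 ▸ hgc.phi) fun j _ hj => hfar _
  obtain ⟨e, -, he3, heS, -⟩ := h.exists_north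
  obtain ⟨k, hk, hek⟩ := List.getElem_of_mem heS
  rcases Nat.lt_or_ge k (S.length - 1) with h6 | h6
  · exact h5 k h6 e hek.symm he3
  · obtain rfl : k = S.length - 1 := by omega
    exact hno e (hek.symm.trans hgs.symm) he3

/-- Along the old part of the central facial cycle, one arrives at the segment. -/
theorem exists_arrival (hV : R.Valid) (h : R.Attach W S l rest) {d : P.G.Dart}
    (hd : d ∈ starSet P W) (hc : R.Cen (adjoin W S) d) :
    ∃ e ∈ l, R.Cen (adjoin W S) e.symm ∧ ∃ m, (phi (adjoin W S))^[m] d = e.symm := by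
  obtain ⟨e, he, -, -, heW⟩ := h.exists_north
  have he' := h.down_of_mem he
  obtain ⟨k, hk⟩ := h.inv.orbit d hd e.symm (Or.inl heW) (hc.mono subset_adjoin)
    ((h.inv.down_cen e he').symm fun h' => he'.2.2 h'.1)
  induction k generalizing d with
  | zero =>
    obtain rfl : d = e.symm := hk
    exact ⟨e, he, hc, 0, rfl⟩
  | succ k ih =>
    by_cases hl : d.symm ∈ l
    · exact ⟨d.symm, hl, by simpa using hc, 0, by simp⟩
    · have h1 := (h.phi_adjoin hV hd hl).1
      obtain ⟨e', he', hc', m, hm⟩ := ih (phi_mem_starSet hd) (h1 ▸ hc.phi) hk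
      refine ⟨e', he', hc', m + 1, ?_⟩
      rw [Function.iterate_succ_apply, h1, hm]

/-- The new south edges are the old ones that do not end at the segment and those of the segment. -/
theorem mem_down_iff (hV : R.Valid) (h : R.Attach W S l rest) {e : P.G.Dart} :
    e ∈ rest ++ R.downs (adjoin W S) S ↔ e ∈ R.Down (adjoin W S) := by
  rw [List.mem_append, mem_downs hV]
  constructor
  · rintro (he | he)
    · have h1 := (h.mem e).1 (List.mem_append_right _ he)
      refine ⟨h1.1, Or.inl h1.2.1, ?_⟩
      rintro (h2 | h2)
      · exact h1.2.2 h2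
      · exact (List.nodup_append.1 h.nodup).2.2 e ((h.north e).2 ⟨h1.1, h2⟩) e he rfl
    · exact he.1
  · intro he
    rcases he.2.1 with h1 | h1
    · left
      have h2 : e ∈ l ++ rest := (h.mem e).2 ⟨he.1, h1, fun h' => he.2.2 (Or.inl h')⟩
      refine (List.mem_append.1 h2).resolve_left fun h3 => ?_
      exact he.2.2 (Or.inr ((h.north e).1 h3).2)
    · exact Or.inr ⟨he, h1⟩

theorem nodup_new (hV : R.Valid) (h : R.Attach W S l rest) :
    (rest ++ R.downs (adjoin W S) S).Nodup := by
  refine List.nodup_append.2 ⟨(List.nodup_append.1 h.nodup).2.1, downs_nodup hV h.seg.nodup, ?_⟩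
  rintro e he _ he' rfl
  have h1 := (h.mem e).1 (List.mem_append_right _ he)
  exact h.disjoint hV ((mem_downs hV).1 he').2 h1.2.1

/-- The outcome of attaching a segment. -/
structure Outcome (R : Rep P) (W' : Set (Fin n)) (S : List (Fin n)) (rest : List P.G.Dart) :
    Prop where
  inv : R.Inv W'
  mem : ∀ e, e ∈ rest ++ R.downs W' S ↔ e ∈ R.Down W'
  nodup : (rest ++ R.downs W' S).Nodup
  tr : ∃ z, Trace (phi W') (R.Down W') z (rest ++ R.downs W' S) z
  cen : ∀ d : P.G.Dart, R.dir d = 0 → d.fst ∈ S → R.Cen W' d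

/-- The outcome follows once the central facial cycle is known to visit all central darts. -/
theorem finish (hV : R.Valid) (h : R.Attach W S l rest) {x : P.G.Dart}
    (htr : Trace (phi (adjoin W S)) (R.Down (adjoin W S)) x (rest ++ R.downs (adjoin W S) S) x)
    (hcx : R.Cen (adjoin W S) x)
    (hE : ∀ d : P.G.Dart, R.dir d = 0 → d.fst ∈ S → ∃ k, (phi (adjoin W S))^[k] x = d)
    (hall : ∀ d ∈ starSet P (adjoin W S), R.Cen (adjoin W S) d →
      ∃ k, (phi (adjoin W S))^[k] x = d) :
    Outcome R (adjoin W S) S rest where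
  inv :=
    { ne := h.inv.ne.mono subset_adjoin
      deg := h.deg hV
      linked := h.linked hV
      outer := h.outer
      closed := h.closed hV
      down_cen := fun e he =>
        hcx.of_orbit (htr.exists_iterate_of_mem ((h.mem_down_iff hV).2 he))
      orbit := orbit_of_reach hall
      lift := by
        obtain ⟨f, hf1, hf2⟩ := h.inv.lift
        refine ⟨newLift R W S f, fun d hd hc => h.newLift_eq hV hf1 hf2 hd hc, fun e he => ?_⟩
        rcases List.mem_append.1 ((h.mem_down_iff hV).2 he) with h1 | h1
        · have h2 := (h.mem e).1 (List.mem_append_right _ h1)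
          rw [newLift, newLift, if_pos (show e ∈ starSet P W from Or.inr h2.2.1),
            if_pos (show e.symm ∈ starSet P W from Or.inl h2.2.1)]
          exact hf2 e h2
        · rw [mem_downs hV] at h1
          have h3 := Down.symm_dir hV he
          have h4 : e.symm ∉ starSet P W := h.not_star_of_south hV h1.2 h3
          have h5 : e ∉ starSet P W := fun h' => h4 (starSet_symm h')
          have e30 : (3 : ZMod 4) ≠ 0 := by decide
          have e31 : (3 : ZMod 4) ≠ 1 := by decide
          have e10 : (1 : ZMod 4) ≠ 0 := by decide
          simp [newLift, h4, h5, he.1, h3, e30, e31, e10] }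
  mem := fun e => h.mem_down_iff hV
  nodup := h.nodup_new hV
  tr := ⟨x, htr⟩
  cen := fun d hd hf => hcx.of_orbit (hE d hd hf)

/-- Attaching a cycle. -/
theorem outcome_cycle (hV : R.Valid) (h : R.Attach W S l rest) (hcy : R.IsCyc S) :
    Outcome R (adjoin W S) S rest := by
  have hrest := h.cyc hcy
  have hB := h.bottom hV
  obtain ⟨x, htr, hcx, -, hE, hall⟩ := hB.cycle_closes hV h.seg hcy (h.inv.ne.mono subset_adjoin)
    (by
      intro d hd hc
      rcases h.mem_star_cases hV hd with hst | ⟨h0 | h0, hfS, -⟩ | ⟨h0, hfS⟩ | ⟨-, -, hdn⟩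
      · exfalso
        -- an old central dart leads to the segment, and there to a west edge on its top
        obtain ⟨e, he, hce, -⟩ := h.exists_arrival hV hst hc
        obtain ⟨he3, heS⟩ := (h.north e).1 he
        obtain ⟨k, hk, hek⟩ := List.getElem_of_mem heS
        obtain ⟨g, hg2, hgf⟩ := exists_west hV h.seg hk (Or.inr hcy)
        have h1 : phi (adjoin W S) e.symm = g := by
          refine phi_eq_of_dir hV (Or.inr heS) (hgf.trans hek) (j := 1) le_rfl (by norm_num) ?_ ?_
          · rw [hg2, dir_symm hV, he3]; decide
          · intro i hi hi'; omega
        exact h.not_cen_west_of_cyc hV hcy hg2 (by rw [hgf]; exact List.getElem_mem _) (h1 ▸ hce.phi)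
      · exact Or.inl ⟨Or.inl h0, hfS⟩
      · exact absurd hc (h.not_cen_west_of_cyc hV hcy h0 hfS)
      · exact Or.inl ⟨Or.inr h0, hfS⟩
      · exact Or.inr hdn)
    (by
      intro e he
      have := (h.mem_down_iff hV).2 he
      rw [hrest, List.nil_append, mem_downs hV] at this
      exact this.2)
  exact h.finish hV (by rwa [hrest, List.nil_append]) hcx hE hall

/-- The old part of the central facial cycle between the last north edge of the segment and the
first one. -/
theorem trace_old (hV : R.Valid) (h : R.Attach W S l rest) {e a : P.G.Dart} {L : List P.G.Dart}
    (he : e ∈ l) (htr : Trace (phi W) (R.Down W) a L e) (ha : a ∈ starSet P W) (hal : a ∉ l)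
    (hL : ∀ x ∈ L, x ∉ l) :
    Trace (phi (adjoin W S)) (R.Down (adjoin W S)) a L e.symm := by
  have hsymm : ∀ a ∈ starSet P W, a.symm ∈ l → phi W a ∈ l := by
    intro a ha hal
    have := phi_symm_down (h.down_of_mem hal)
    rw [SimpleGraph.Dart.symm_symm] at this
    rwa [this]
  have hstep : ∀ a L, a ∈ starSet P W → Trace (phi W) (R.Down W) (phi W a) L e → phi W a ∈ l →
      (∀ x ∈ L, x ∉ l) → a = e.symm ∧ L = [] := by
    intro a L ha htr hl hL
    generalize hb : phi W a = b at htr hl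
    cases htr with
    | nil =>
      refine ⟨phi_injective (W := W) ?_, rfl⟩
      rw [hb, phi_symm_down (h.down_of_mem he)]
    | skip h1 _ => exact absurd (h.down_of_mem hl) h1
    | visit h1 _ => exact absurd hl (hL _ List.mem_cons_self)
  have hdown : ∀ a ∈ starSet P W, a ∉ R.Down W → a ∉ R.Down (adjoin W S) := by
    intro a ha h1 h2
    have h3 : a.fst ∉ W := fun h' => h2.2.2 (Or.inl h')
    exact h1 ⟨h2.1, ha.resolve_left h3, h3⟩
  -- up to `e.symm`, the old and the new successor map agree
  induction htr with
  | nil => exact absurd he hal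
  | @skip a b L h1 h2 ih =>
    by_cases hl : phi W a ∈ l
    · obtain ⟨rfl, rfl⟩ := hstep a L ha h2 hl hL
      exact Trace.nil _
    · refine Trace.skip (hdown a ha h1) ?_
      rw [(h.phi_adjoin hV ha fun h' => hl (hsymm a ha h')).1]
      exact ih he (phi_mem_starSet ha) hl hL hstep
  | @visit a b L h1 h2 ih =>
    have h3 : phi W a ∉ l := by
      intro h'
      exact (h.down_of_mem h').2.2 (phi_down hV h.inv.closed h1).1
    have h4 : a ∈ R.Down (adjoin W S) := (h.mem_down_iff hV).1 (List.mem_append_left _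
      ((List.mem_append.1 ((h.mem a).2 h1)).resolve_left hal))
    refine Trace.visit h4 ?_
    rw [(h.phi_adjoin hV ha fun h' => h3 (hsymm a ha h')).1]
    exact ih he (phi_mem_starSet ha) h3 (fun x hx => hL x (List.mem_cons_of_mem _ hx)) hstep

end Attach

namespace Attach
variable {l rest : List P.G.Dart}

/-- The westernmost and the easternmost north edge of the segment are the first and the last one
of the list. -/
theorem ends (h : R.Attach W S l rest) :
    (∃ e l', l = e :: l' ∧ ∃ (i : ℕ) (hi : i < S.length), e.fst = S[i] ∧
      ∀ (j : ℕ) (hj : j < i) (y : P.G.Dart), y.fst = S[j] → R.dir y ≠ 3) ∧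
    ∃ l' e, l = l' ++ [e] ∧ ∃ (i : ℕ) (hi : i < S.length), e.fst = S[i] ∧
      ∀ (j : ℕ) (hj : j < S.length), i < j → ∀ y : P.G.Dart, y.fst = S[j] → R.dir y ≠ 3 := by
  obtain ⟨f, hf⟩ := List.sublist_iff_exists_fin_orderEmbedding_get_eq.1 h.sub
  have hlen : 0 < l.length := List.length_pos_iff.2 h.ne
  have hlen' : (l.map (fun d => d.fst)).length = l.length := List.length_map _
  have hf' : ∀ (i : ℕ) (hi : i < l.length), (l[i]).fst = S[(f ⟨i, by omega⟩ : ℕ)] := by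
    intro i hi
    have := hf ⟨i, by omega⟩
    simpa using this
  -- every north edge of the segment is one of the list
  have key : ∀ (j : ℕ) (hj : j < S.length) (y : P.G.Dart), y.fst = S[j] → R.dir y = 3 →
      ∃ (i : ℕ) (hi : i < l.length), (f ⟨i, by omega⟩ : ℕ) = j := by
    intro j hj y hy hy3
    have h1 : y ∈ l := (h.north y).2 ⟨hy3, hy ▸ List.getElem_mem _⟩
    obtain ⟨i, hi, rfl⟩ := List.getElem_of_mem h1
    refine ⟨i, hi, ?_⟩
    rw [hf' i hi] at hy
    exact (List.Nodup.getElem_inj_iff h.seg.nodup).1 hy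
  constructor
  · obtain ⟨e, l', rfl⟩ := List.exists_cons_of_ne_nil h.ne
    refine ⟨e, l', rfl, f ⟨0, by omega⟩, (f ⟨0, by omega⟩).2, hf' 0 hlen, ?_⟩
    intro j hj y hy hy3
    obtain ⟨i, hi, hij⟩ := key j (hj.trans (f ⟨0, by omega⟩).2) y hy hy3
    have := f.monotone (show (⟨0, by omega⟩ : Fin _) ≤ ⟨i, by omega⟩ from Nat.zero_le _)
    rw [Fin.le_def] at this
    omega
  · obtain ⟨l', e, rfl⟩ := (List.eq_nil_or_concat' l).resolve_left h.ne
    have he := hf' l'.length (by simp)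
    rw [List.getElem_concat_length (by simp)] at he
    refine ⟨l', e, rfl, _, (f ⟨l'.length, by simp⟩).2, he, ?_⟩
    intro j hj hij y hy hy3
    obtain ⟨i, hi, hik⟩ := key j hj y hy hy3
    have h1 : i ≤ l'.length := by simpa [Nat.lt_succ_iff] using hi
    have := f.monotone (show (⟨i, by omega⟩ : Fin _) ≤ ⟨l'.length, by simp⟩ from h1)
    rw [Fin.le_def] at this
    omega

/-- From the last edge above a path that has no further north edge to the west, the cycle runs
around the western end of the path. -/
theorem trace_west_end (hV : R.Valid) (h : R.Attach W S l rest) (hcy : ¬ R.IsCyc S) {i : ℕ}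
    (hi : i < S.length) (hpos : 0 < i)
    (hno : ∀ (j : ℕ) (hj : j < i) (y : P.G.Dart), y.fst = S[j] → R.dir y ≠ 3)
    {d x : P.G.Dart} (hd : R.dir d = 2) (hf : d.fst = S[i]) (hx : R.dir x = 0)
    (hxf : x.fst = S[0]'(by omega)) :
    Trace (phi (adjoin W S)) (R.Down (adjoin W S)) d (R.downs (adjoin W S) (S.take 1)) x := by
  have hB := h.bottom hV
  obtain ⟨d', h1, -, h3, h4⟩ := hB.trace_west_run hV h.seg hpos hi
    (fun k _ hk => hno k hk) hd hf
  have h5 := hB.trace_to_east hV (d := d') (x := x) (by rw [h3]; exact List.getElem_mem _)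
    (hxf.trans h3.symm) hx (Or.inr (Or.inr ⟨h1, fun y hy => ⟨fun hy2 => ?_, hno 0 hpos y (hy.trans h3)⟩⟩))
  · have h6 : S.take 1 = [d'.snd] := by rw [h3, List.take_one, List.head?_eq_getElem?,
      List.getElem?_eq_getElem (by omega)]; rfl
    rw [h6]
    exact h4.trans h5
  · rcases isSegment_of_west hV h.seg hy2 (by omega) (hy.trans h3) with ⟨h', _⟩ | ⟨h', -⟩
    · omega
    · exact hcy h'

/-- From the first north edge of a path, the cycle runs around the western end of the path. -/
theorem trace_first (hV : R.Valid) (h : R.Attach W S l rest) (hcy : ¬ R.IsCyc S) {e x : P.G.Dart}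
    (he : e ∈ l) {i : ℕ} (hi : i < S.length) (hei : e.fst = S[i])
    (hno : ∀ (j : ℕ) (hj : j < i) (y : P.G.Dart), y.fst = S[j] → R.dir y ≠ 3)
    (hx : R.dir x = 0) (hxf : x.fst = S[0]'(by omega)) :
    Trace (phi (adjoin W S)) (R.Down (adjoin W S)) e.symm
      (R.downs (adjoin W S) (S.take 1)) x := by
  have hB := h.bottom hV
  obtain ⟨he3, heS⟩ := (h.north e).1 he
  have he1 : R.dir e.symm = 1 := by rw [dir_symm hV, he3]; rfl
  rcases Nat.eq_zero_or_pos i with rfl | hpos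
  · have h6 : S.take 1 = [e.symm.snd] := by
      change S.take 1 = [e.fst]
      rw [hei, List.take_one, List.head?_eq_getElem?, List.getElem?_eq_getElem (by omega)]; rfl
    rw [h6]
    refine hB.trace_to_east hV heS (hxf.trans hei.symm) hx (Or.inr (Or.inl ⟨he1, fun y hy hy2 => ?_⟩))
    rcases isSegment_of_west hV h.seg hy2 (by omega) (hy.trans hei) with ⟨h', _⟩ | ⟨h', -⟩
    · omega
    · exact hcy h'
  · obtain ⟨g, hg2, hgf⟩ := exists_west hV h.seg hi (Or.inl hpos)
    refine Trace.skip (not_down_of_dir (by rw [he1]; decide)) ?_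
    rw [phi_eq_of_dir hV (d := e.symm) (x := g) (j := 1) (Or.inr heS) (hgf.trans hei.symm) le_rfl
      (by norm_num) (by rw [hg2, he1]; decide) (fun k hk hk' => by omega)]
    exact h.trace_west_end hV hcy hi hpos hno hg2 hgf hx hxf

/-- At the eastern end of a path, the cycle turns around and runs back to the last north edge. -/
theorem trace_east_end (hV : R.Valid) (h : R.Attach W S l rest) (hcy : ¬ R.IsCyc S)
    {e d : P.G.Dart} (he : e ∈ l) {i : ℕ} (hi : i < S.length) (hei : e.fst = S[i])
    (hno : ∀ (j : ℕ) (hj : j < S.length), i < j → ∀ y : P.G.Dart, y.fst = S[j] → R.dir y ≠ 3)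
    (hd : R.dir d = 0) (hs : d.snd = S[S.length - 1]'(by omega)) :
    Trace (phi (adjoin W S)) (R.Down (adjoin W S)) d (R.downs (adjoin W S) [d.snd]) e := by
  have hB := h.bottom hV
  obtain ⟨he3, heS⟩ := (h.north e).1 he
  have hsS : d.snd ∈ S := by rw [hs]; exact List.getElem_mem _
  have hsW := hB.mem _ hsS
  have hno0 : ∀ y : P.G.Dart, y.fst = d.snd → R.dir y ≠ 0 := fun y hy hy0 =>
    (isSegment_path hV h.seg hcy y hy0).1 (hy.trans hs)
  have h₁ : ∀ g : P.G.Dart, g.fst = d.snd → R.dir g = 1 → phi (adjoin W S) d = g := by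
    intro g hg hg1
    refine phi_eq_of_dir hV hsW hg (j := 1) le_rfl (by norm_num) (by rw [hd, hg1]; decide) ?_
    intro k hk hk'; omega
  rcases Nat.eq_or_lt_of_le (Nat.le_sub_one_of_lt hi) with rfl | hlt
  · have hed : e.fst = d.snd := hei.trans hs.symm
    refine hB.trace_corner hV hsS (by rw [hd]; decide) h₁ ?_ ?_
    · intro hg
      refine phi_eq_of_dir hV hsW hed (j := 3) (by norm_num) (by norm_num)
        (by rw [hd, he3]; decide) ?_
      intro k hk hk' y hy
      rw [hd]
      have : k = 1 ∨ k = 2 := by omega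
      rcases this with rfl | rfl
      · exact hg y hy
      · exact hno0 y hy
    · intro g hg hg3
      refine phi_eq_of_dir hV (by rw [hg]; exact hsW) (hed.trans hg.symm) (j := 2) (by norm_num)
        (by norm_num) (by rw [hg3, he3]; decide) ?_
      intro k hk hk' y hy
      obtain rfl : k = 1 := by omega
      rw [hg3]
      exact hno0 y (hy.trans hg)
  · obtain ⟨g, hg2, hgf⟩ := exists_west hV h.seg (i := S.length - 1) (by omega) (Or.inl (by omega))
    have hgd : g.fst = d.snd := hgf.trans hs.symm
    have hno3 : ∀ y : P.G.Dart, y.fst = d.snd → R.dir y ≠ 3 := fun y hy =>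
      hno _ (by omega) hlt y (hy.trans hs)
    have h1 : Trace (phi (adjoin W S)) (R.Down (adjoin W S)) d (R.downs (adjoin W S) [d.snd]) g := by
      refine hB.trace_corner hV hsS (by rw [hd]; decide) h₁ ?_ ?_
      · intro hg
        refine phi_eq_of_dir hV hsW hgd (j := 4) (by norm_num) (by norm_num)
          (by rw [hd, hg2]; decide) ?_
        intro k hk hk' y hy
        rw [hd]
        have : k = 1 ∨ k = 2 ∨ k = 3 := by omega
        rcases this with rfl | rfl | rfl
        · exact hg y hy
        · exact hno0 y hy
        · exact hno3 y hy
      · intro g' hg' hg3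
        refine phi_eq_of_dir hV (by rw [hg']; exact hsW) (hgd.trans hg'.symm) (j := 3) (by norm_num)
          (by norm_num) (by rw [hg3, hg2]; decide) ?_
        intro k hk hk' y hy
        rw [hg3]
        have : k = 1 ∨ k = 2 := by omega
        rcases this with rfl | rfl
        · exact hno0 y (hy.trans hg')
        · exact hno3 y (hy.trans hg')
    obtain ⟨d', h2, -, h4, h5⟩ := hB.trace_west_run hV h.seg hlt (by omega)
      (fun k hk hk' => hno k (by omega) hk) hg2 hgf
    have h6 : Trace (phi (adjoin W S)) (R.Down (adjoin W S)) d' [] e := by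
      refine Trace.skip (not_down_of_dir (by rw [h2]; decide)) ?_
      rw [phi_eq_of_dir hV (d := d') (x := e) (j := 1) (by rw [h4, ← hei]; exact Or.inr heS)
        (hei.trans h4.symm) le_rfl (by norm_num) (by rw [h2, he3]; decide)
        (fun k hk hk' => by omega)]
      exact Trace.nil _
    have := (h1.trans h5).trans h6
    rwa [List.append_nil, List.append_nil] at this

/-- Attaching a path. -/
theorem outcome_path (hV : R.Valid) (h : R.Attach W S l rest) (hcy : ¬ R.IsCyc S) :
    Outcome R (adjoin W S) S rest := by
  have hB := h.bottom hV
  have h2 := h.seg.two_le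
  obtain ⟨⟨e, l₁, hl₁, i, hi, hei, hino⟩, ⟨l₂, e', hl₂, i', hi', hei', hino'⟩⟩ := h.ends
  have he : e ∈ l := by rw [hl₁]; exact List.mem_cons_self
  have he' : e' ∈ l := by rw [hl₂]; simp
  obtain ⟨he3, heS⟩ := (h.north e).1 he
  obtain ⟨he3', heS'⟩ := (h.north e').1 he'
  obtain ⟨x, hx, hxf, -⟩ := isSegment_east hV h.seg (i := 0) (by omega)
  obtain ⟨y, hy, hyf, hys⟩ := isSegment_east hV h.seg (i := S.length - 2) (by omega)
  have hlen : S.length - 2 + 1 = S.length - 1 := by omega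
  simp only [hlen] at hys
  have hfst := h.trace_first hV hcy he hi hei hino hx hxf
  have heast : ∀ (j : ℕ) (hj : j < S.length) (z : P.G.Dart), R.dir z = 0 → z.fst = S[j] →
      Trace (phi (adjoin W S)) (R.Down (adjoin W S)) e.symm
        (R.downs (adjoin W S) (S.take (j + 1))) z := fun j hj z hz hzf =>
    hB.trace_east_run hV h.seg hx hxf hfst hj hz hzf
  -- the new cycle consists of the way around the path, from `e.symm` to `e'`, and of the old part,
  -- from `e'` to `e.symm`
  have hbot : Trace (phi (adjoin W S)) (R.Down (adjoin W S)) e.symm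
      (R.downs (adjoin W S) S) e' := by
    have h3 := (heast _ _ y hy hyf).trans (h.trace_east_end hV hcy he' hi' hei' hino' hy hys)
    rw [downs, downs, ← List.filterMap_append, hys] at h3
    have h4 : S.take (S.length - 2 + 1) ++ [S[S.length - 1]] = S := by
      rw [hlen, List.take_append_getElem, Nat.sub_add_cancel (by omega), List.take_length]
    rwa [h4] at h3
  have hold : Trace (phi (adjoin W S)) (R.Down (adjoin W S)) e' rest e.symm := by
    obtain ⟨z, hz⟩ := h.tr
    have h3 : Trace (phi W) (R.Down W) (phi W e') rest e := by
      rw [hl₂, List.append_assoc] at hz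
      have h4 := hz.rotate_to
      rcases l₂ with _ | ⟨a, l₂⟩
      · rw [List.nil_append, hl₁] at hl₂
        obtain ⟨rfl, -⟩ := List.cons.inj hl₂
        simpa using h4
      · rw [hl₁] at hl₂
        obtain ⟨rfl, -⟩ := List.cons.inj hl₂
        obtain ⟨c, h5, h6⟩ := h4.of_append
        have := h5.trans h6.of_cons.1
        rwa [List.append_nil] at this
    have h4 := h.down_of_mem he'
    have h5 := phi_down hV h.inv.closed h4
    refine Trace.skip (fun h' => h'.2.2 (Or.inr heS')) ?_
    rw [(h.phi_adjoin hV (Or.inr h4.2.1) fun h' => by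
      have := ((h.north _).1 h').1
      rw [dir_symm hV, he3'] at this
      exact absurd this (by decide)).1]
    refine h.trace_old hV he h3 (Or.inl h5.1) (fun h' => (h.down_of_mem h').2.2 h5.1) ?_
    intro a ha hal
    exact (List.nodup_append.1 h.nodup).2.2 a hal a ha rfl
  have hloop := hold.trans hbot
  have hE : ∀ d : P.G.Dart, R.dir d = 0 → d.fst ∈ S →
      ∃ k, (phi (adjoin W S))^[k] e' = d := by
    intro d hd hdS
    obtain ⟨j, hj, hjd⟩ := List.getElem_of_mem hdS
    exact phi_iterate_trans hold.exists_iterate (heast j hj d hd hjd.symm).exists_iterate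
  have hD : ∀ d ∈ R.Down (adjoin W S), ∃ k, (phi (adjoin W S))^[k] e' = d := fun d hd =>
    hloop.exists_iterate_of_mem ((h.mem_down_iff hV).2 hd)
  -- every central dart is on this cycle
  have hall : ∀ d ∈ starSet P (adjoin W S), R.Cen (adjoin W S) d →
      ∃ k, (phi (adjoin W S))^[k] e' = d := by
    intro d hd hc
    have far : ∀ (k : ℕ) (hk : k < S.length) (z : P.G.Dart), z.fst = S[k] → R.dir z = 3 →
        ∀ j ≤ k, ∀ hj : j < S.length, ¬ R.Far S S[j] := by
      rintro k hk z hz hz3 j hjk hj ⟨-, m, hm, hmj, hno⟩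
      have := (List.Nodup.getElem_inj_iff h.seg.nodup).1 hmj
      exact hno k hk (by omega) z hz hz3
    rcases h.mem_star_cases hV hd with hst | ⟨h0 | h0, hdS, -⟩ | ⟨h0, hdS⟩ | ⟨-, -, hdn⟩
    · obtain ⟨g, hg, hgc, hgk⟩ := h.exists_arrival hV hst hc
      obtain ⟨hg3, hgS⟩ := (h.north g).1 hg
      obtain ⟨k, hk, hkg⟩ := List.getElem_of_mem hgS
      -- the arrival is at the westernmost north edge, since from any other one the cycle would
      -- continue west along the top to a north edge
      have hge : g = e := by
        refine eq_of_dir_eq hV ?_ (hg3.trans he3.symm)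
        rcases Nat.lt_trichotomy k i with h3 | rfl | h3
        · exact absurd hg3 (hino k h3 g hkg.symm)
        · exact hkg.symm.trans hei.symm
        · exfalso
          obtain ⟨w, hw2, hwf⟩ := exists_west hV h.seg hk (Or.inl (by omega))
          have h4 : phi (adjoin W S) g.symm = w := by
            refine phi_eq_of_dir hV (Or.inr hgS) (hwf.trans hkg) (j := 1) le_rfl (by norm_num) ?_ ?_
            · rw [hw2, dir_symm hV, hg3]; decide
            · intro m hm hm'; omega
          exact (h.west_cen hV hk hw2 hwf (h4 ▸ hgc.phi) (far k hk g hkg.symm hg3)).1 i h3 e hei he3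
      subst hge
      exact phi_iterate_trans hold.exists_iterate (phi_iterate_symm hgk)
    · exact hE d h0 hdS
    · obtain ⟨k, hk, hkd⟩ := List.getElem_of_mem hdS
      rcases Nat.lt_or_ge i' k with h3 | h3
      · obtain ⟨d', h4, -, h5, h6⟩ := hB.trace_west_run hV h.seg h3 hk
          (fun m hm hm' => hino' m (by omega) hm) h0 hkd.symm
        refine phi_iterate_symm (phi_iterate_trans h6.exists_iterate ⟨1, ?_⟩)
        exact phi_eq_of_dir hV (by rw [h5, ← hei']; exact Or.inr heS') (hei'.trans h5.symm) (j := 1)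
          le_rfl (by norm_num) (by rw [h4, he3']; decide) (fun m hm hm' => by omega)
      · have hpos : 0 < k := by
          rcases isSegment_of_west hV h.seg h0 hk hkd.symm with ⟨h', _⟩ | ⟨h', -⟩
          · exact h'
          · exact absurd h' hcy
        have h4 := (h.west_cen hV hk h0 hkd.symm hc fun j hj =>
          far i' hi' e' hei' he3' j (by omega)).1
        have h5 := h.trace_west_end hV hcy hk hpos h4 h0 hkd.symm hx hxf
        exact phi_iterate_trans (hE x hx (by rw [hxf]; exact List.getElem_mem _))
          (phi_iterate_symm h5.exists_iterate)
    · obtain ⟨h5, h6⟩ := hB.down hV hdS h0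
      exact phi_iterate_trans (hD _ h5) (phi_iterate_symm ⟨1, h6⟩)
    · exact hD d hdn
  obtain ⟨d, hd, hcd⟩ := exists_cen (R := R) (h.inv.ne.mono (subset_adjoin (S := S)))
  exact h.finish hV hloop (hcd.of_orbit (phi_iterate_symm (hall d hd hcd))) hE hall

theorem outcome (hV : R.Valid) (h : R.Attach W S l rest) : Outcome R (adjoin W S) S rest := by
  by_cases hcy : R.IsCyc S
  · exact h.outcome_cycle hV hcy
  · exact h.outcome_path hV hcy

end Attach

/-! ### Good sequences -/

section first
variable (hV : R.Valid) (hS : R.IsSegment S)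
  (hO : ∀ d : P.G.Dart, (R.East d ∧ d.fst ∈ S) ↔ P.SameFace R.outer d.symm)
include hV hS hO

/-- The outer face has exactly the west edges of the first segment on its boundary. -/
theorem outer_iff (d : P.G.Dart) : P.SameFace R.outer d ↔ R.dir d = 2 ∧ d.fst ∈ S := by
  have h := hO d.symm
  rw [SimpleGraph.Dart.symm_symm, east_iff hV, dir_symm hV] at h
  rw [← h]
  have e : R.dir d + 2 = 0 ↔ R.dir d = 2 := by generalize R.dir d = a; revert a; decide
  rw [e]
  refine and_congr_right fun h2 => ⟨fun h' => ?_, fun h' => isSegment_closed hV hS (Or.inr h2) h'⟩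
  exact isSegment_closed hV hS (d := d.symm) (Or.inl (by rw [dir_symm hV, h2]; rfl)) h'

/-- On the outer face, the west edges of the first segment follow each other: its boundary goes
straight on at every vertex. -/
theorem outer_faceNext {d : P.G.Dart} (hd : R.dir d = 2) (hf : d.fst ∈ S) :
    R.dir (P.faceNext d) = 2 ∧ (P.faceNext d).fst ∈ S := by
  rw [← outer_iff hV hS hO]
  exact ((outer_iff hV hS hO d).2 ⟨hd, hf⟩).trans ⟨1, by simp⟩

theorem first_isCyc : R.IsCyc S := by
  have h2 := hS.two_le
  obtain ⟨d, h0, h1, -⟩ := isSegment_east hV hS (i := 0) (by omega)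
  have hd : R.dir d.symm = 2 := by rw [dir_symm hV, h0]; rfl
  have hf : d.symm.fst ∈ S := isSegment_closed hV hS (Or.inl h0) (by rw [h1]; exact List.getElem_mem _)
  obtain ⟨h3, -⟩ := outer_faceNext hV hS hO hd hf
  rcases isSegment_of_west hV hS h3 (i := 0) (by omega) (by rw [faceNext_fst]; exact h1)
    with ⟨h', _⟩ | ⟨h', -⟩
  · omega
  · exact h'

theorem outer_angle {d : P.G.Dart} (hd : R.dir d = 2) (hf : d.fst ∈ S) : R.angle d.symm = 2 := by
  have h := (outer_faceNext hV hS hO hd hf).1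
  rw [faceNext_apply, dir_rot hV, dir_symm hV, hd] at h
  rcases R.angle_mem d.symm with h' | h' | h'
  · rw [h'] at h; exact absurd h (by decide)
  · exact h'
  · rw [h'] at h; exact absurd h (by decide)

theorem exists_east_first {v : Fin n} (hv : v ∈ S) : ∃ d : P.G.Dart, R.dir d = 0 ∧ d.fst = v := by
  obtain ⟨i, hi, rfl⟩ := List.getElem_of_mem hv
  rcases Nat.lt_or_ge (i + 1) S.length with h | h
  · obtain ⟨d, h0, h1, -⟩ := isSegment_east hV hS h
    exact ⟨d, h0, h1⟩
  · obtain ⟨d, h0, h1, -⟩ := (isCyc_iff hV hS).1 (first_isCyc hV hS hO)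
    refine ⟨d, h0, h1.trans ?_⟩
    congr 1; omega

/-- There are no north edges at the first segment, since the boundary of the outer face goes straight
on above it. -/
theorem first_no_north {y : P.G.Dart} (hy : y.fst ∈ S) : R.dir y ≠ 3 := by
  obtain ⟨d, h0, h1⟩ := exists_east_first hV hS hO hy
  have hd : R.dir d.symm = 2 := by rw [dir_symm hV, h0]; rfl
  have hf : d.symm.fst ∈ S := isSegment_closed hV hS (Or.inl h0) (by rw [h1]; exact hy)
  have h3 := (outer_faceNext hV hS hO hd hf).1
  have hs : d.symm.snd ∈ {v | v ∈ S} := by change d.fst ∈ S; rwa [h1]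
  rcases phi_corner hV hs with ⟨h, -⟩ | ⟨-, -, h⟩ | ⟨h, -⟩
  · rw [phi_of_mem hs, ← faceNext_apply, h3, hd] at h
    exact absurd h (by decide)
  · have := h y h1.symm
    rw [hd] at this
    exact this
  · rw [phi_of_mem hs, ← faceNext_apply, h3, hd] at h
    exact absurd h (by decide)

/-- The outer face is also a face of the graph that consists of the first segment. -/
theorem outer_of_cls {d d' : P.G.Dart} (h : P.Cls (indSet P {v | v ∈ S}) d d') :
    P.SameFace R.outer d ↔ P.SameFace R.outer d' := by
  have hin : ∀ d, P.SameFace R.outer d → d ∈ indSet P {v | v ∈ S} := by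
    intro d hd
    obtain ⟨h1, h2⟩ := (outer_iff hV hS hO d).1 hd
    exact ⟨h2, isSegment_closed hV hS (Or.inr h1) h2⟩
  induction h with
  | rel a b h =>
    rcases h with rfl | ⟨h1, rfl⟩
    · exact ⟨fun h => h.trans ⟨1, by simp⟩, fun h => h.trans ⟨-1, by simp⟩⟩
    · exact ⟨fun h => absurd (hin _ h) h1, fun h => absurd (hin _ h) (isSym_indSet.not_mem h1)⟩
  | refl => rfl
  | symm _ _ _ ih => exact ih.symm
  | trans _ _ _ _ _ ih ih' => exact ih.trans ih'

/-- The central face is not the outer face, because the angle sum of the outer face shows that it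
is just one of both. -/
theorem central_not_outer : ¬ P.SameFace R.outer R.central := by
  classical
  intro h
  have h1 := hV.face_both R.outer h.symm (Equiv.Perm.SameCycle.refl _ _)
  have h2 : R.faceAngleSum R.outer = 2 * faceCorners R.outer := by
    rw [faceAngleSum, faceCorners, Finset.sum_congr rfl (g := fun _ => 2), Finset.sum_const,
      smul_eq_mul, mul_comm]
    intro d hd
    rw [Finset.mem_filter] at hd
    obtain ⟨h3, h4⟩ := (outer_iff hV hS hO d).1 hd.2
    exact outer_angle hV hS hO h3 h4
  omega

/-- The first segment alone: its central face is bounded by its bottom and has all the south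
edges. -/
theorem outcome_first : Attach.Outcome R {v | v ∈ S} S [] := by
  have h2 := hS.two_le
  have hcl : ∀ d : P.G.Dart, d.fst ∈ {v | v ∈ S} → R.dir d ≠ 1 → d.snd ∈ {v | v ∈ S} := by
    intro d hd h1
    rcases dir_cases R d with h | h | h | h
    · exact isSegment_closed hV hS (Or.inl h) hd
    · exact absurd h h1
    · exact isSegment_closed hV hS (Or.inr h) hd
    · exact absurd h (first_no_north hV hS hO hd)
  have hB : R.Bottom {v | v ∈ S} S := by
    refine ⟨fun v hv => hv, fun g hg h1 hs => first_no_north hV hS hO (y := g.symm) hs ?_⟩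
    rw [dir_symm hV, h1]; rfl
  have hne : {v | v ∈ S}.Nonempty := ⟨S[0], List.getElem_mem _⟩
  have hnO : ∀ d, R.Cen {v | v ∈ S} d → ¬ P.SameFace R.outer d := fun d hd h =>
    central_not_outer hV hS hO ((outer_of_cls hV hS hO hd).2 h)
  have hbot : ∀ d ∈ starSet P {v | v ∈ S}, R.Cen {v | v ∈ S} d →
      (R.dir d = 0 ∨ R.dir d = 1) ∧ d.fst ∈ S ∨ d ∈ R.Down {v | v ∈ S} := by
    intro d hd hc
    by_cases hf : d.fst ∈ S
    · left
      rcases dir_cases R d with h | h | h | h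
      · exact ⟨Or.inl h, hf⟩
      · exact ⟨Or.inr h, hf⟩
      · exact absurd ((outer_iff hV hS hO d).2 ⟨h, hf⟩) (hnO d hc)
      · exact absurd h (first_no_north hV hS hO hf)
    · exact Or.inr (mem_down hV hcl (hd.resolve_left hf) hf)
  obtain ⟨x, htr, hcx, hD, hE, hall⟩ := hB.cycle_closes hV hS (first_isCyc hV hS hO) hne hbot
    fun e he => he.2.1
  have hmem : ∀ e, e ∈ [] ++ R.downs {v | v ∈ S} S ↔ e ∈ R.Down {v | v ∈ S} := fun e => by
    rw [List.nil_append, mem_downs hV]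
    exact and_iff_left_of_imp fun h => h.2.1
  refine ⟨⟨hne, fun v hv => deg_segment hV hS (fun _ h => h) hv,
    fun u hu v hv => linked_segment hV hS (fun _ h => h) hu hv,
    fun h => hnO _ h (Equiv.Perm.SameCycle.refl _ _), hcl, fun e he => hcx.of_orbit (hD e he),
    orbit_of_reach hall, ?_⟩, hmem, downs_nodup hV hS.nodup, ⟨x, htr⟩,
    fun d hd hf => hcx.of_orbit (hE d hd hf)⟩
  have e1 : (1 : ZMod 4) ≠ 0 := by decide
  have e2 : (3 : ZMod 4) ≠ 0 := by decide
  have e3 : (3 : ZMod 4) ≠ 1 := by decide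
  -- the cycle runs east, with excursions to the ends of the south edges and back
  refine ⟨fun d => if R.dir d = 0 then 0 else if R.dir d = 1 then 1 else -1, fun d hd hc => ?_,
    fun e he => ?_⟩
  · beta_reduce
    rcases hbot d hd hc with ⟨h | h, hf⟩ | h
    · have hs : d.snd ∈ {v | v ∈ S} := isSegment_closed hV hS (Or.inl h) hf
      rcases phi_corner hV hs with ⟨h3, h4⟩ | ⟨h3, h4, -⟩ | ⟨h3, -⟩
      · rw [h3, h4, h]; simp [e1]
      · rw [h3, h4, h]; simp
      · rw [h] at h3
        exact absurd h3 (first_no_north hV hS hO (by rw [phi_fst]; exact hs))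
    · obtain ⟨h3, h4⟩ := hB.down hV hf h
      rw [h4, h, h3.1, turn_of_not_mem (hB.out d hf h)]
      simp [e1, e2, e3]
    · have hs := h.2.1
      have hy := first_no_north hV hS hO (y := phi {v | v ∈ S} d) (by rw [phi_fst]; exact hs)
      have e4 : (3 + 1 : ZMod 4) = 0 := by decide
      rcases phi_corner hV hs with ⟨h3, h4⟩ | ⟨h3, -⟩ | ⟨-, -, h3⟩
      · rw [h3, h4, h.1]; simp [e2, e3, e4]
      · exact absurd (h3.trans h.1) hy
      · obtain ⟨y, hy0, hyf⟩ := exists_east_first hV hS hO hs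
        refine absurd ?_ (h3 y hyf).1
        rw [hy0, h.1]; rfl
  · simp only [he.1, Down.symm_dir hV he]
    simp [e1, e2, e3]

end first

theorem verts_append {B : List (List (Fin n))} : verts (B ++ [S]) = adjoin (verts B) S := by
  ext v
  simp [verts, adjoin, or_and_right, exists_or]

theorem verts_singleton : verts [S] = {v | v ∈ S} := by
  ext v
  simp [verts]

/-- `s` lists the edges that leave `W` towards the origin in the order in which the central facial
cycle visits them. -/
structure SouthList (R : Rep P) (W : Set (Fin n)) (s : List P.G.Dart) : Prop where
  nodup : s.Nodup
  mem : ∀ d, d ∈ s ↔ d ∈ R.Down W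
  tr : ∃ z, Trace (phi W) (R.Down W) z s z

/-- The order of the south edges is unique up to rotation. -/
theorem SouthList.isRotated {s s' : List P.G.Dart} (h : R.SouthList W s) (h' : R.SouthList W s') :
    s ~r s' := by
  rcases s with _ | ⟨a, s⟩
  · rcases s' with _ | ⟨a, s'⟩
    · exact List.IsRotated.refl _
    · exact absurd ((h.mem a).2 ((h'.mem a).1 List.mem_cons_self)) (by simp)
  · obtain ⟨z, hz⟩ := h.tr
    obtain ⟨z', hz'⟩ := h'.tr
    exact hz.isRotated hz' h.nodup h'.nodup List.mem_cons_self
      ((h'.mem a).2 ((h.mem a).1 List.mem_cons_self))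

theorem Attach.southList {l rest : List P.G.Dart} (h : R.Attach W S l rest) :
    R.SouthList W (l ++ rest) :=
  ⟨h.nodup, h.mem, h.tr⟩

theorem Attach.Outcome.southList {l : List P.G.Dart} (h : Attach.Outcome R W S l) :
    R.SouthList W (l ++ R.downs W S) :=
  ⟨h.nodup, h.mem, h.tr⟩

section sequence
variable {A B B' : List (List (Fin n))}

/-- The contiguity condition on good sequences, in terms of the order of the central facial cycle. -/
theorem IsGood.attach_of_inv (hV : R.Valid) (hA : R.IsGood A) (hAB : A = B ++ S :: B') (hB : B ≠ [])
    (hI : R.Inv (verts B)) : ∃ l rest, R.Attach (verts B) S l rest := by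
  obtain ⟨l, s, hl, hne, hs, hcy, hpa⟩ := hA.later B S B' hAB hB
  have hseg : ∀ T ∈ B, R.IsSegment T := fun T hT => hA.segment T (by rw [hAB]; simp [hT])
  obtain ⟨h1, h2, h3⟩ := isSouthOrder_trace hV hseg hI hs
  have hpre : ∃ rest, s = l ++ rest ∧ (R.IsCyc S → rest = []) := by
    by_cases hc : R.IsCyc S
    · exact ⟨[], by rw [hcy hc, List.append_nil], fun _ => rfl⟩
    · obtain ⟨rest, h⟩ := hpa hc
      exact ⟨rest, h.symm, fun h' => absurd h' hc⟩
  obtain ⟨rest, rfl, hr⟩ := hpre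
  refine ⟨l, rest, hI, hA.segment S (by rw [hAB]; simp), fun d => ?_, hl.2, hne, h1, h3, h2, hr⟩
  rw [hl.1, north_iff hV]

/-- The vertex sets of all prefixes of a good sequence satisfy the invariant: the first segment does
so, and attaching a segment preserves it. -/
theorem IsGood.inv (hV : R.Valid) (hA : R.IsGood A) (hAB : A = B ++ B') (hB : B ≠ []) :
    R.Inv (verts B) := by
  induction B using List.reverseRecOn generalizing B' with
  | nil => exact absurd rfl hB
  | append_singleton B S ih =>
    rw [List.append_assoc, List.singleton_append] at hAB
    rcases eq_or_ne B [] with rfl | hne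
    · obtain ⟨S', B'', h, hO⟩ := hA.first
      rw [hAB, List.nil_append] at h
      obtain ⟨rfl, -⟩ := List.cons.inj h
      rw [List.nil_append, verts_singleton]
      exact (outcome_first hV (hA.segment S (by rw [hAB]; simp)) hO).inv
    · obtain ⟨l, rest, h⟩ := hA.attach_of_inv hV hAB hne (ih hAB hne)
      rw [verts_append]
      exact (h.outcome hV).inv

theorem IsGood.attach (hV : R.Valid) (hA : R.IsGood A) (hAB : A = B ++ S :: B') (hB : B ≠ []) :
    ∃ l rest, R.Attach (verts B) S l rest :=
  hA.attach_of_inv hV hAB hB (hA.inv hV hAB hB)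

theorem IsGood.first_facts (hA : R.IsGood A) :
    ∃ S B, A = S :: B ∧ R.IsSegment S ∧
      ∀ d : P.G.Dart, (R.East d ∧ d.fst ∈ S) ↔ P.SameFace R.outer d.symm := by
  obtain ⟨S, B, h, hO⟩ := hA.first
  exact ⟨S, B, h, hA.segment S (by rw [h]; simp), hO⟩

theorem IsGood.pairwise_disjoint (hV : R.Valid) (hA : R.IsGood A) :
    A.Pairwise (fun S T => ∀ v ∈ S, v ∉ T) := by
  suffices h : ∀ B B', A = B ++ B' → B.Pairwise (fun S T => ∀ v ∈ S, v ∉ T) from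
    h A [] (List.append_nil A).symm
  intro B
  induction B using List.reverseRecOn with
  | nil => exact fun _ _ => List.Pairwise.nil
  | append_singleton B S ih =>
    intro B' hAB
    rw [List.append_assoc, List.singleton_append] at hAB
    refine List.pairwise_append.2 ⟨ih _ hAB, List.pairwise_singleton _ _, ?_⟩
    intro T hT S' hS' v hv hv'
    obtain rfl := List.mem_singleton.1 hS'
    obtain ⟨l, rest, h⟩ := hA.attach hV hAB (List.ne_nil_of_mem hT)
    exact h.disjoint hV hv' ⟨T, hT, hv⟩

end sequence
end Rep

/-! ### Lifts of the angular coordinates -/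

/-- Prescribed values at the indices in `I`, with gaps of at least `t * η`, extend to a sequence
that increases in steps of `η` between the prescribed values and before the first one. -/
theorem exists_steps {t : ℕ} {I : Set ℕ} {σ : ℕ → ℝ} {η : ℝ} (hη : 0 < η) (hI : I.Nonempty)
    (hIt : ∀ m ∈ I, m < t) (h₁ : ∀ m ∈ I, ∀ m' ∈ I, m < m' → σ m + t * η ≤ σ m')
    (h₂ : ∀ m ∈ I, ∀ m' ∈ I, σ m' ≤ σ m + 1 - t * η) :
    ∃ T : ℕ → ℝ, (∀ m ∈ I, T m = σ m) ∧ (∀ q, q + 1 < t → T q + η ≤ T (q + 1)) ∧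
      (∀ q, q + 1 < t → (q + 1 ∉ I ∨ ∀ m ≤ q, m ∉ I) → T (q + 1) = T q + η) ∧
      T (t - 1) + η ≤ T 0 + 1 ∧ (∃ m ∈ I, T (t - 1) + η ≤ σ m + t * η) ∧
      ∃ m ∈ I, σ m - t * η + η ≤ T 0 := by
  classical
  -- `g q` is the prescribed index from which position `q` is measured: the last one up to `q`, or
  -- the first one of all if there is none; the value at `q` will be `σ (g q) + (q - g q) * η`
  have hg : ∀ q, ∃ g ∈ I, (g ≤ q ∧ ∀ m ∈ I, m ≤ q → m ≤ g) ∨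
      ((∀ m ∈ I, q < m) ∧ ∀ m ∈ I, g ≤ m) := by
    intro q
    by_cases h : ∃ m ∈ I, m ≤ q
    · obtain ⟨m, hm, hmq⟩ := h
      exact ⟨Nat.findGreatest (· ∈ I) q, Nat.findGreatest_spec hmq hm,
        Or.inl ⟨Nat.findGreatest_le q, fun m' hm' h' => Nat.le_findGreatest h' hm'⟩⟩
    · push Not at h
      exact ⟨Nat.find hI, Nat.find_spec hI, Or.inr ⟨h, fun m hm => Nat.find_min' hI hm⟩⟩
  choose g hgI hg using hg
  obtain ⟨m₀, hm₀⟩ := hI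
  have ht : 0 < t := (Nat.zero_le _).trans_lt (hIt _ hm₀)
  have mul_le : ∀ a : ℝ, a ≤ t → a * η ≤ t * η := fun a ha => mul_le_mul_of_nonneg_right ha hη.le
  have hstep : ∀ q, q + 1 < t → (q + 1 ∉ I ∨ ∀ m ≤ q, m ∉ I) → g (q + 1) = g q := by
    intro q hq h
    have a1 := hgI q
    have a2 := hgI (q + 1)
    rcases h with h | h
    · have key : ∀ m ∈ I, m ≤ q + 1 → m ≤ q := fun m hm hmq =>
        Nat.lt_succ_iff.1 (lt_of_le_of_ne hmq fun e => h (by rwa [e] at hm))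
      rcases hg q with ⟨b1, b2⟩ | ⟨b1, b2⟩ <;> rcases hg (q + 1) with ⟨c1, c2⟩ | ⟨c1, c2⟩
      · exact le_antisymm (b2 _ a2 (key _ a2 c1)) (c2 _ a1 (by omega))
      · have := c1 _ a1; omega
      · have := b1 _ a2; have := key _ a2 c1; omega
      · exact le_antisymm (c2 _ a1) (b2 _ a2)
    · rcases hg q with ⟨b1, -⟩ | ⟨b1, b2⟩
      · exact absurd a1 (h _ b1)
      · rcases hg (q + 1) with ⟨c1, c2⟩ | ⟨c1, c2⟩
        · have h3 := b1 _ a1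
          have h4 := b1 _ a2
          have h5 := b2 _ a2
          omega
        · exact le_antisymm (c2 _ a1) (b2 _ a2)
  have hfix : ∀ m ∈ I, g m = m := by
    intro m hm
    rcases hg m with ⟨b1, b2⟩ | ⟨b1, -⟩
    · exact le_antisymm b1 (b2 m hm le_rfl)
    · exact absurd (b1 m hm) (lt_irrefl m)
  refine ⟨fun q => σ (g q) + ((q : ℝ) - g q) * η, ?_, ?_, ?_, ?_, ?_, ?_⟩
  · intro m hm
    simp [hfix m hm]
  · intro q hq
    by_cases h : q + 1 ∉ I ∨ ∀ m ≤ q, m ∉ I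
    · simp only [hstep q hq h]
      push_cast
      linarith
    · push Not at h
      obtain ⟨h, m, hmq, hm⟩ := h
      simp only [hfix _ h]
      have h3 : g q ≤ q := by
        rcases hg q with ⟨b1, -⟩ | ⟨b1, -⟩
        · exact b1
        · have := b1 m hm; omega
      have h4 := h₁ _ (hgI q) _ h (by omega)
      have h5 : (q : ℝ) - g q + 1 ≤ t := by
        have : q + 1 ≤ t + g q := by omega
        have : ((q + 1 : ℕ) : ℝ) ≤ ((t + g q : ℕ) : ℝ) := Nat.cast_le.2 this
        push_cast at this
        linarith
      have h6 := mul_le _ h5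
      push_cast
      nlinarith
  · intro q hq h
    simp only [hstep q hq h]
    push_cast
    ring
  · have a1 := hgI 0
    have a2 := hgI (t - 1)
    have hc : ((t - 1 : ℕ) : ℝ) = t - 1 := by rw [Nat.cast_sub ht]; norm_num
    simp only [hc]
    rcases Nat.lt_or_ge (g 0) (g (t - 1)) with h | h
    · have h3 := h₂ _ a1 _ a2
      have h4 : (g 0 : ℝ) ≤ g (t - 1) := Nat.cast_le.2 h.le
      have h5 := mul_le (t - g (t - 1) + g 0) (by linarith)
      push_cast
      nlinarith
    · have h3 : g (t - 1) = g 0 := by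
        refine le_antisymm h ?_
        rcases hg 0 with ⟨b1, -⟩ | ⟨-, b2⟩
        · omega
        · exact b2 _ a2
      have h4 := h₂ _ a1 _ a1
      rw [h3]
      push_cast
      nlinarith
  · refine ⟨_, hgI (t - 1), ?_⟩
    have hc : ((t - 1 : ℕ) : ℝ) = t - 1 := by rw [Nat.cast_sub ht]; norm_num
    have h5 := mul_le (t - g (t - 1)) (by linarith [(Nat.cast_nonneg (g (t - 1)) : (0 : ℝ) ≤ _)])
    simp only [hc]
    nlinarith
  · refine ⟨_, hgI 0, ?_⟩
    have h3 : ((g 0 + 1 : ℕ) : ℝ) ≤ t := Nat.cast_le.2 (hIt _ (hgI 0))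
    push_cast at h3
    have h5 := mul_le _ h3
    push_cast
    nlinarith

namespace Rep
variable {n : ℕ} {P : PlaneGraph n} {R : Rep P} {W : Set (Fin n)} {S : List (Fin n)}

/-- The heads of the edges `s` are met in this order, with gaps of at least `δ`, by one clockwise
turn around the origin; `θ` is the angular coordinate in full turns. -/
def CwOrd (θ : Fin n → ℝ) (δ : ℝ) (s : List P.G.Dart) : Prop :=
  ∃ τ : P.G.Dart → ℝ, (∀ e ∈ s, ∃ z : ℤ, θ e.snd = -τ e + z) ∧
    s.Pairwise (fun e e' => τ e + δ ≤ τ e') ∧ ∀ e ∈ s, ∀ e' ∈ s, τ e' ≤ τ e + 1 - δ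

/-- A clockwise order is circular: the first edge may be put last, one full turn later. -/
theorem CwOrd.rotate_one {θ : Fin n → ℝ} {δ : ℝ} {a : P.G.Dart} {s : List P.G.Dart}
    (ha : a ∉ s) (h : CwOrd θ δ (a :: s)) : CwOrd θ δ (s ++ [a]) := by
  classical
  obtain ⟨τ, h1, h2, h3⟩ := h
  rw [List.pairwise_cons] at h2
  have hne : ∀ e ∈ s, e ≠ a := fun e he h => ha (h ▸ he)
  refine ⟨fun e => if e = a then τ a + 1 else τ e, ?_, ?_, ?_⟩
  · intro e he
    by_cases hea : e = a
    · subst hea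
      obtain ⟨z, hz⟩ := h1 e List.mem_cons_self
      refine ⟨z + 1, ?_⟩
      beta_reduce
      rw [if_pos rfl, hz]; push_cast; ring
    · beta_reduce
      rw [if_neg hea]
      refine h1 e ?_
      simpa [hea] using he
  · rw [List.pairwise_append]
    refine ⟨?_, List.pairwise_singleton _ _, ?_⟩
    · refine h2.2.imp_of_mem fun he he' h => ?_
      beta_reduce
      rwa [if_neg (hne _ he), if_neg (hne _ he')]
    · intro e he e' he'
      obtain rfl := List.mem_singleton.1 he'
      beta_reduce
      rw [if_neg (hne _ he), if_pos rfl]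
      have := h3 e' List.mem_cons_self e (List.mem_cons_of_mem _ he)
      linarith
  · intro e he e' he'
    have h4 : ∀ e ∈ s ++ [a], e ∈ a :: s := by
      intro e he; simpa [or_comm] using he
    have h5 := h3 e (h4 e he) e' (h4 e' he')
    by_cases hea : e = a <;> by_cases hea' : e' = a
    · beta_reduce
      rw [if_pos hea, if_pos hea']
      subst hea hea'
      linarith
    · beta_reduce
      rw [if_pos hea, if_neg hea']
      subst hea
      linarith
    · beta_reduce
      rw [if_neg hea, if_pos hea']
      have h6 : e ∈ s := by simpa [hea] using he
      have := h2.1 e h6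
      linarith
    · beta_reduce
      rwa [if_neg hea, if_neg hea']

theorem CwOrd.of_isRotated {θ : Fin n → ℝ} {δ : ℝ} {s s' : List P.G.Dart} (hs : s.Nodup)
    (h : CwOrd θ δ s) (hr : s ~r s') : CwOrd θ δ s' := by
  obtain ⟨k, rfl⟩ := hr
  induction k generalizing s with
  | zero => simpa using h
  | succ k ih =>
    rcases s with _ | ⟨a, s⟩
    · simpa using h
    · rw [List.rotate_cons_succ]
      exact ih ((List.IsRotated.nodup_iff ⟨1, by simp⟩).1 hs)
        (h.rotate_one (List.nodup_cons.1 hs).1)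

/-- `T` lifts the angular coordinates of the vertices of `S` in clockwise direction, with steps of
at least `η` within one full turn. -/
structure Lift (θ : Fin n → ℝ) (η : ℝ) (S : List (Fin n)) (T : ℕ → ℝ) : Prop where
  step : ∀ q < S.length, T q + η ≤ T (q + 1)
  period : T S.length = T 0 + 1
  ang : ∀ (q : ℕ) (hq : q < S.length), ∃ z : ℤ, θ S[q] = -T q + z

theorem Lift.le {θ : Fin n → ℝ} {η : ℝ} {T : ℕ → ℝ} (h : Lift θ η S T) (hη : 0 < η) {p q : ℕ}
    (hpq : p < q) (hq : q ≤ S.length) : T p + η ≤ T q := by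
  induction q with
  | zero => omega
  | succ q ih =>
    have h1 := h.step q hq
    rcases Nat.lt_or_ge p q with h2 | h2
    · have := ih h2 (by omega); linarith
    · obtain rfl : p = q := by omega
      exact h1

theorem Lift.mono {θ : Fin n → ℝ} {η : ℝ} {T : ℕ → ℝ} (h : Lift θ η S T) (hη : 0 < η) {p q : ℕ}
    (hpq : p ≤ q) (hq : q ≤ S.length) : T p ≤ T q := by
  rcases Nat.eq_or_lt_of_le hpq with rfl | h1
  · exact le_rfl
  · have := h.le hη h1 hq; linarith

theorem pairwise_downs (hV : R.Valid) (hS : S.Nodup) {T : ℕ → ℝ} {η : ℝ}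
    (h : ∀ p q, p < q → q < S.length → T p + η ≤ T q) :
    (R.downs W S).Pairwise fun e e' => T (S.idxOf e.snd) + η ≤ T (S.idxOf e'.snd) := by
  rw [downs, List.pairwise_filterMap]
  refine List.pairwise_iff_getElem.2 ?_
  intro i j hi hj hij e he e' he'
  rw [downAt_eq_some hV] at he he'
  rw [he.2, he'.2, hS.idxOf_getElem, hS.idxOf_getElem]
  exact h i j hij hj

/-- The south edges at a segment that closes up are in clockwise order. -/
theorem Lift.cwOrd (hV : R.Valid) (hS : S.Nodup) {θ : Fin n → ℝ} {η : ℝ} {T : ℕ → ℝ}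
    (h : Lift θ η S T) (hη : 0 < η) : CwOrd θ η (R.downs W S) := by
  refine ⟨fun e => T (S.idxOf e.snd), fun e he => ?_, pairwise_downs hV hS fun p q hpq hq =>
    h.le hη hpq hq.le, fun e he e' he' => ?_⟩
  · have h1 := List.idxOf_lt_length_iff.2 ((mem_downs hV).1 he).2
    obtain ⟨z, hz⟩ := h.ang _ h1
    rw [List.getElem_idxOf] at hz
    exact ⟨z, hz⟩
  · have h1 := List.idxOf_lt_length_iff.2 ((mem_downs hV).1 he).2
    have h2 := List.idxOf_lt_length_iff.2 ((mem_downs hV).1 he').2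
    have h3 := h.le hη h2 le_rfl
    have h4 := h.mono hη (Nat.zero_le _) h1.le
    rw [h.period] at h3
    linarith

/-- The angular coordinates of the segment `S` are prescribed by those of the heads of its north
edges and by steps of `η`. -/
structure Placed (R : Rep P) (θ : Fin n → ℝ) (η : ℝ) (S : List (Fin n)) : Prop where
  north : ∀ d : P.G.Dart, R.dir d = 3 → d.fst ∈ S → θ d.fst = θ d.snd
  step : ∀ (q : ℕ) (hq : q + 1 < S.length), ((∀ y : P.G.Dart, y.fst = S[q + 1] → R.dir y ≠ 3) ∨
    ∀ (m : ℕ) (hm : m ≤ q) (y : P.G.Dart), y.fst = S[m] → R.dir y ≠ 3) → θ S[q + 1] = θ S[q] - η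

/-- The heads of the edges that pass the segment `S` are not on the rays through `S`. -/
def Passes (R : Rep P) (W : Set (Fin n)) (θ : Fin n → ℝ) (S : List (Fin n)) (T : ℕ → ℝ) : Prop :=
  ∀ e ∈ R.Down W, e.snd ∉ S → ¬ R.IsCyc S ∧
    ∀ x, T 0 ≤ x → x ≤ T (S.length - 1) → ∀ z : ℤ, θ e.snd ≠ -x + z

namespace Attach
variable {l rest : List P.G.Dart}

theorem pairwise_north (h : R.Attach W S l rest) {Q : P.G.Dart → P.G.Dart → Prop}
    (hQ : l.Pairwise Q) {e e' : P.G.Dart} (he : e ∈ l) (he' : e' ∈ l) {i j : ℕ} (hij : i < j)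
    (hj : j < S.length) (hei : e.fst = S[i]) (hej : e'.fst = S[j]) : Q e e' := by
  have hS : S.Pairwise (fun u v => S.idxOf u < S.idxOf v) := by
    refine List.pairwise_iff_getElem.2 fun a b ha hb hab => ?_
    rwa [h.seg.nodup.idxOf_getElem, h.seg.nodup.idxOf_getElem]
  have h1 := List.pairwise_map.1 (hS.sublist h.sub)
  obtain ⟨a, ha, rfl⟩ := List.getElem_of_mem he
  obtain ⟨b, hb, rfl⟩ := List.getElem_of_mem he'
  have hi : i < S.length := hij.trans hj
  rcases Nat.lt_trichotomy a b with h2 | rfl | h2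
  · exact List.pairwise_iff_getElem.1 hQ a b ha hb h2
  · rw [hei] at hej
    have := (List.Nodup.getElem_inj_iff h.seg.nodup).1 hej
    omega
  · have := List.pairwise_iff_getElem.1 h1 b a hb ha h2
    rw [hei, hej, h.seg.nodup.idxOf_getElem, h.seg.nodup.idxOf_getElem] at this
    omega

/-- If the old south edges have gaps of `|S| * η`, then there is room for placing `S` with steps of
`η`. The new south edges have gaps of `η`, and those that pass `S` miss the rays through `S`. -/
theorem exists_lift (hV : R.Valid) (h : R.Attach W S l rest) {θ : Fin n → ℝ} {η : ℝ} (hη : 0 < η)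
    (hc : CwOrd θ (S.length * η) (l ++ rest)) (hp : R.Placed θ η S) :
    ∃ T, Lift θ η S T ∧ CwOrd θ η (rest ++ R.downs (adjoin W S) S) ∧
      R.Passes (adjoin W S) θ S T := by
  classical
  have h2 := h.seg.two_le
  obtain ⟨τ, hτ, hτp, hτt⟩ := hc
  set I : Set ℕ := {m | ∃ (hm : m < S.length) (y : P.G.Dart), R.dir y = 3 ∧ y.fst = S[m]} with hI
  have hIl : ∀ m ∈ I, ∃ e ∈ l, ∃ hm : m < S.length, e.fst = S[m] := by
    rintro m ⟨hm, y, hy, hym⟩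
    exact ⟨y, (h.north y).2 ⟨hy, hym ▸ List.getElem_mem _⟩, hm, hym⟩
  have hlI : ∀ e ∈ l, ∃ m ∈ I, ∃ hm : m < S.length, e.fst = S[m] := by
    intro e he
    obtain ⟨h3, h4⟩ := (h.north e).1 he
    obtain ⟨m, hm, hme⟩ := List.getElem_of_mem h4
    exact ⟨m, ⟨hm, e, h3, hme.symm⟩, hm, hme.symm⟩
  have : Inhabited P.G.Dart := ⟨R.ref⟩
  choose! N hNl hNt hNf using hIl
  have hNe : ∀ e ∈ l, ∀ m ∈ I, ∀ hm : m < S.length, e.fst = S[m] → N m = e := by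
    intro e he m hm hmt hem
    exact eq_of_dir_eq hV ((hNf m hm).trans hem.symm)
      (((h.north _).1 (hNl m hm)).1.trans ((h.north _).1 he).1.symm)
  have hτl := (List.pairwise_append.1 hτp).1
  obtain ⟨e₀, he₀⟩ := List.exists_mem_of_ne_nil _ h.ne
  obtain ⟨m₀, hm₀, -⟩ := hlI e₀ he₀
  obtain ⟨T, hT1, hT2, hT3, hT4, ⟨ml, hml, hT5⟩, ⟨mf, hmf, hT6⟩⟩ :=
    exists_steps (t := S.length) (I := I) (σ := fun m => τ (N m)) hη ⟨m₀, hm₀⟩ hNt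
      (fun m hm m' hm' hmm => h.pairwise_north hτl (hNl m hm) (hNl m' hm') hmm (hNt m' hm')
        (hNf m hm) (hNf m' hm'))
      (fun m hm m' hm' => hτt _ (List.mem_append_left _ (hNl m hm)) _
        (List.mem_append_left _ (hNl m' hm')))
  -- `θ + T` is an integer at the north edges and constant along the other steps
  have hang : ∀ (q : ℕ) (hq : q < S.length), ∃ z : ℤ, θ S[q] = -T q + z := by
    have hnorth : ∀ (q : ℕ) (hq : q < S.length), q ∈ I → ∃ z : ℤ, θ S[q] = -T q + z := by
      intro q hq hqI
      obtain ⟨h3, h4⟩ := (h.north _).1 (hNl q hqI)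
      rw [hT1 q hqI, ← hNf q hqI, hp.north _ h3 h4]
      exact hτ _ (List.mem_append_left _ (hNl q hqI))
    have hst : ∀ (q : ℕ) (hq : q + 1 < S.length), (q + 1 ∉ I ∨ ∀ m ≤ q, m ∉ I) →
        θ S[q + 1] + T (q + 1) = θ S[q] + T q := by
      intro q hq hqI
      rw [hT3 q hq hqI, hp.step q hq]
      · ring
      · rcases hqI with hqI | hqI
        · exact Or.inl fun y hy hy3 => hqI ⟨hq, y, hy3, hy⟩
        · exact Or.inr fun m hm y hy hy3 => hqI m hm ⟨by omega, y, hy3, hy⟩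
    have hlow : ∀ k m, m ∈ I → (∀ m' ∈ I, m ≤ m') → ∀ q, q + k = m → ∀ hq : q < S.length,
        ∃ z : ℤ, θ S[q] = -T q + z := by
      intro k
      induction k with
      | zero =>
        rintro m hm - q rfl hq
        exact hnorth q hq hm
      | succ k ih =>
        intro m hm hmin q hqm hq
        have hmt := hNt m hm
        obtain ⟨z, hz⟩ := ih m hm hmin (q + 1) (by omega) (by omega)
        have h3 := hst q (by omega) (Or.inr fun m' hm' hI' => by have := hmin m' hI'; omega)
        exact ⟨z, by linarith⟩
    intro q hq
    induction q with
    | zero =>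
      have := Nat.find_spec (⟨m₀, hm₀⟩ : ∃ m, m ∈ I)
      exact hlow _ _ this (fun m' hm' => Nat.find_min' _ hm') 0 (Nat.zero_add _) hq
    | succ q ih =>
      by_cases hI1 : q + 1 ∈ I
      · exact hnorth _ hq hI1
      · obtain ⟨z, hz⟩ := ih (by omega)
        have h3 := hst q hq (Or.inl hI1)
        exact ⟨z, by linarith⟩
  -- the lift is closed up by a full turn
  set T' : ℕ → ℝ := fun q => if q < S.length then T q else T 0 + 1 with hT'
  have hT'0 : T' 0 = T 0 := if_pos (by omega)
  have hT'l : T' (S.length - 1) = T (S.length - 1) := if_pos (by omega)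
  have hL : Lift θ η S T' := by
    refine ⟨fun q hq => ?_, ?_, fun q hq => ?_⟩
    · rcases Nat.lt_or_ge (q + 1) S.length with h3 | h3
      · simp only [hT', if_pos hq, if_pos h3]; exact hT2 q h3
      · obtain rfl : q = S.length - 1 := by omega
        rw [hT'l]
        simp only [hT', if_neg (not_lt.2 h3)]
        exact hT4
    · simp only [hT', lt_irrefl, if_false, if_pos (show 0 < S.length by omega)]
    · simp only [hT', if_pos hq]; exact hang q hq
  -- the gaps of the old south edges are larger than the new ones
  have hηt : η ≤ S.length * η := by
    have : (1 : ℝ) ≤ S.length := by exact_mod_cast (by omega : 1 ≤ S.length)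
    nlinarith
  have hrS : ∀ e ∈ rest, e.snd ∉ S := fun e he hs =>
    h.disjoint hV hs ((h.mem e).1 (List.mem_append_right _ he)).2.1
  -- the remaining edges are strictly between the last and the first vertex of the segment
  have hr1 : ∀ e ∈ rest, T (S.length - 1) + η ≤ τ e := fun e he =>
    hT5.trans ((List.pairwise_append.1 hτp).2.2 _ (hNl ml hml) e he)
  have hr2 : ∀ e ∈ rest, τ e + η ≤ T 0 + 1 := by
    intro e he
    have := hτt _ (List.mem_append_left _ (hNl mf hmf)) e (List.mem_append_right _ he)
    linarith
  -- the south edges of the segment come after the ones that pass it, hence are lifted one turn later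
  refine ⟨T', hL, ⟨fun e => if e.snd ∈ S then T' (S.idxOf e.snd) + 1 else τ e, ?_, ?_, ?_⟩, ?_⟩
  · intro e he
    rcases List.mem_append.1 he with he | he
    · beta_reduce
      rw [if_neg (hrS e he)]
      exact hτ e (List.mem_append_right _ he)
    · have hs := ((mem_downs hV).1 he).2
      obtain ⟨z, hz⟩ := hL.ang _ (List.idxOf_lt_length_iff.2 hs)
      rw [List.getElem_idxOf] at hz
      refine ⟨z + 1, ?_⟩
      beta_reduce
      rw [if_pos hs, hz]; push_cast; ring
  · refine List.pairwise_append.2 ⟨?_, ?_, ?_⟩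
    · refine (List.pairwise_append.1 hτp).2.1.imp_of_mem fun he he' h => ?_
      beta_reduce
      rw [if_neg (hrS _ he), if_neg (hrS _ he')]
      linarith
    · refine (pairwise_downs hV h.seg.nodup fun p q hpq hq => hL.le hη hpq hq.le).imp_of_mem
        fun he he' h => ?_
      beta_reduce
      rw [if_pos ((mem_downs hV).1 he).2, if_pos ((mem_downs hV).1 he').2]
      linarith
    · intro e he e' he'
      have hs := ((mem_downs hV).1 he').2
      beta_reduce
      rw [if_neg (hrS e he), if_pos hs]
      have h3 := hL.mono hη (Nat.zero_le _) (List.idxOf_lt_length_iff.2 hs).le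
      have h4 := hr2 e he
      linarith
  · have hd1 : ∀ e ∈ R.downs (adjoin W S) S, T 0 ≤ T' (S.idxOf e.snd) ∧
        T' (S.idxOf e.snd) ≤ T (S.length - 1) := by
      intro e he
      have hs := List.idxOf_lt_length_iff.2 ((mem_downs hV).1 he).2
      rw [← hT'0, ← hT'l]
      exact ⟨hL.mono hη (Nat.zero_le _) hs.le, hL.mono hη (by omega) (by omega)⟩
    intro e he e' he'
    rcases List.mem_append.1 he with he | he <;> rcases List.mem_append.1 he' with he' | he'
    · beta_reduce
      rw [if_neg (hrS e he), if_neg (hrS e' he')]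
      have := hτt e (List.mem_append_right _ he) e' (List.mem_append_right _ he')
      linarith
    · beta_reduce
      rw [if_neg (hrS e he), if_pos ((mem_downs hV).1 he').2]
      have := (hd1 e' he').2
      have := hr1 e he
      linarith
    · beta_reduce
      rw [if_pos ((mem_downs hV).1 he).2, if_neg (hrS e' he')]
      have := (hd1 e he).1
      have := hr2 e' he'
      linarith
    · beta_reduce
      rw [if_pos ((mem_downs hV).1 he).2, if_pos ((mem_downs hV).1 he').2]
      have := (hd1 e he).1
      have := (hd1 e' he').2
      linarith
  · intro e he hs
    have hre : e ∈ rest := (List.mem_append.1 ((h.mem_down_iff hV).2 he)).resolve_right fun h' =>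
      hs ((mem_downs hV).1 h').2
    refine ⟨fun hcy => ?_, ?_⟩
    · rw [h.cyc hcy] at hre; simp at hre
    · intro x hx1 hx2 z hz
      obtain ⟨z', hz'⟩ := hτ e (List.mem_append_right _ hre)
      rw [hT'0] at hx1
      rw [hT'l] at hx2
      have h3 := hr1 e hre
      have h4 := hr2 e hre
      -- `τ e` lies between `T (S.length - 1)` and `T 0 + 1`, so it differs from `x` by less than a turn
      have h5 : ((z' - z : ℤ) : ℝ) = τ e - x := by push_cast; linarith
      have h6 : (0 : ℝ) < ((z' - z : ℤ) : ℝ) := by rw [h5]; linarith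
      have h7 : ((z' - z : ℤ) : ℝ) < 1 := by rw [h5]; linarith
      have h8 : 0 < z' - z := by exact_mod_cast h6
      have h9 : z' - z < 1 := by exact_mod_cast h7
      omega

end Attach

/-- The least step between vertices of the last segment of `B`: each segment divides the steps by
its length. -/
def delta (B : List (List (Fin n))) : ℝ := (B.map fun S => (S.length : ℝ)⁻¹).prod

theorem delta_append {B : List (List (Fin n))} : delta (B ++ [S]) = delta B * (S.length : ℝ)⁻¹ := by
  simp [delta]

theorem delta_pos {B : List (List (Fin n))} (h : ∀ S ∈ B, 2 ≤ S.length) : 0 < delta B := by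
  refine List.prod_pos fun a ha => ?_
  obtain ⟨S, hS, rfl⟩ := List.mem_map.1 ha
  have := h S hS
  positivity

section sequence
variable {A : List (List (Fin n))} {θ : Fin n → ℝ}

/-- Each segment of a good sequence has a lift, the edges that pass it miss it, and the south edges of
each prefix are in clockwise order with gaps that the next segment needs. -/
theorem IsGood.exists_lift (hV : R.Valid) (hA : R.IsGood A)
    (hp : ∀ B S B', A = B ++ S :: B' → R.Placed θ (delta (B ++ [S])) S) (B : List (List (Fin n)))
    (S : List (Fin n)) (B' : List (List (Fin n))) (hAB : A = B ++ S :: B') :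
    ∃ T, Lift θ (delta (B ++ [S])) S T ∧ R.Passes (verts (B ++ [S])) θ S T ∧
      (∀ s, R.SouthList (verts (B ++ [S])) s → CwOrd θ (delta (B ++ [S])) s) ∧
      ∀ d : P.G.Dart, R.dir d = 0 → d.fst ∈ S → R.Cen (verts (B ++ [S])) d := by
  have hlen : ∀ T ∈ B ++ [S], 2 ≤ T.length := fun T hT =>
    (hA.segment T (by rw [hAB]; simp at hT ⊢; tauto)).two_le
  have hseg := hA.segment S (by rw [hAB]; simp)
  have hη := delta_pos hlen
  have hpl := hp B S B' hAB
  have hS0 : (0 : ℝ) < S.length := by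
    have := hseg.two_le
    exact_mod_cast (by omega : 0 < S.length)
  induction B using List.reverseRecOn generalizing S B' with
  | nil =>
    obtain ⟨S', B'', h, hO⟩ := hA.first
    rw [hAB, List.nil_append] at h
    obtain ⟨rfl, -⟩ := List.cons.inj h
    have hout := outcome_first hV hseg hO
    rw [List.nil_append] at hη hpl ⊢
    rw [verts_singleton]
    set η := delta [S] with hηd
    -- the steps of the first segment fill a full turn exactly
    have hη1 : S.length * η = 1 := by
      rw [hηd, delta]
      simp only [List.map_cons, List.map_nil, List.prod_cons, List.prod_nil, mul_one]
      exact mul_inv_cancel₀ hS0.ne'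
    have h2 := hseg.two_le
    have hθ : ∀ (q : ℕ) (hq : q < S.length), θ S[q] = θ (S[0]'(by omega)) - q * η := by
      intro q hq
      induction q with
      | zero => simp
      | succ q ih =>
        rw [hpl.step q hq (Or.inl fun y hy => first_no_north hV hseg hO
          (by rw [hy]; exact List.getElem_mem _)), ih (by omega)]
        push_cast; ring
    have hL : Lift θ η S (fun q => -θ (S[0]'(by omega)) + q * η) := by
      refine ⟨fun q _ => ?_, ?_, fun q hq => ⟨0, ?_⟩⟩
      · push_cast; linarith
      · rw [hη1]; simp
      · rw [hθ q hq]; push_cast; ring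
    refine ⟨_, hL, fun e he hs => absurd he.2.1 hs, fun s hs => ?_, hout.cen⟩
    have h3 := hout.southList
    exact (hL.cwOrd hV hseg.nodup hη).of_isRotated h3.nodup (h3.isRotated hs)
  | append_singleton B S' ih =>
    have hAB' : A = B ++ S' :: (S :: B') := by
      rw [hAB, List.append_assoc, List.singleton_append]
    have hne : B ++ [S'] ≠ [] := by simp
    have hlen' : ∀ T ∈ B ++ [S'], 2 ≤ T.length := fun T hT => hlen T (by simp at hT ⊢; tauto)
    have hseg' := hA.segment S' (by rw [hAB']; simp)
    obtain ⟨-, -, -, hcw, -⟩ := ih S' _ hAB' hlen' hseg' (delta_pos hlen') (hp _ _ _ hAB')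
      (by have := hseg'.two_le; exact_mod_cast (by omega : 0 < S'.length))
    obtain ⟨l, rest, hatt⟩ := hA.attach hV hAB hne
    have h1 := hcw _ hatt.southList
    have h3 : delta (B ++ [S']) = S.length * delta (B ++ [S'] ++ [S]) := by
      rw [delta_append (S := S)]
      field_simp
    rw [h3] at h1
    obtain ⟨T, hT1, hT2, hT3⟩ := hatt.exists_lift hV hη h1 hpl
    have hout := hatt.outcome hV
    rw [verts_append]
    refine ⟨T, hT1, hT3, fun s hs => ?_, hout.cen⟩
    have h4 := hout.southList
    exact hT2.of_isRotated h4.nodup (h4.isRotated hs)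

end sequence
end Rep

open PlaneGraph OrthoRadial.Rep

/-! ### The drawing -/

/-- The point at radius `ρ` that is `x` full turns clockwise from the direction of the angle `0`. -/
def cw (ρ x : ℝ) : ℂ := pt (ρ, 2 * Real.pi * -x)

theorem pt_eq_cw (ρ a : ℝ) : pt (ρ, 2 * Real.pi * a) = cw ρ (-a) := by rw [cw, neg_neg]

theorem norm_pt (ρ a : ℝ) : ‖pt (ρ, a)‖ = |ρ| := by
  rw [pt, norm_mul, Complex.norm_exp_ofReal_mul_I, mul_one, Complex.norm_real, Real.norm_eq_abs]

theorem norm_cw {ρ x : ℝ} (h : 0 ≤ ρ) : ‖cw ρ x‖ = ρ := by rw [cw, norm_pt, abs_of_nonneg h]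

theorem cw_eq_iff {ρ ρ' x x' : ℝ} (h : 0 < ρ) (h' : 0 ≤ ρ') :
    cw ρ x = cw ρ' x' ↔ ρ = ρ' ∧ ∃ z : ℤ, x = x' + z := by
  constructor
  · intro he
    have h1 : ρ = ρ' := by rw [← norm_cw (x := x) h.le, he, norm_cw h']
    refine ⟨h1, ?_⟩
    subst h1
    have h2 : (ρ : ℂ) ≠ 0 := by exact_mod_cast h.ne'
    have h3 := mul_left_cancel₀ h2 he
    rw [Complex.exp_eq_exp_iff_exists_int] at h3
    obtain ⟨z, hz⟩ := h3
    have h4 : (2 * Real.pi * -x : ℝ) = 2 * Real.pi * -x' + z * (2 * Real.pi) := by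
      have : (((2 * Real.pi * -x : ℝ) : ℂ) - ((2 * Real.pi * -x' : ℝ) : ℂ) -
          z * (2 * Real.pi)) * Complex.I = 0 := by linear_combination hz
      have := (mul_eq_zero.1 this).resolve_right Complex.I_ne_zero
      have h5 : ((2 * Real.pi * -x - 2 * Real.pi * -x' - z * (2 * Real.pi) : ℝ) : ℂ) = 0 := by
        push_cast at this ⊢
        exact this
      have h6 := Complex.ofReal_eq_zero.1 h5
      linarith
    refine ⟨-z, ?_⟩
    have hpi := Real.pi_pos
    have h5 : 2 * Real.pi * (x - x' + z) = 0 := by linarith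
    have h6 := (mul_eq_zero.1 h5).resolve_left (by positivity)
    push_cast
    linarith
  · rintro ⟨rfl, z, rfl⟩
    rw [cw, cw, pt, pt]
    congr 1
    rw [Complex.exp_eq_exp_iff_exists_int]
    refine ⟨-z, ?_⟩
    push_cast
    ring

/-- The vertices at the radii `r` and the angles `θ`, measured in full turns. -/
def polar {n : ℕ} (r θ : Fin n → ℝ) (v : Fin n) : ℝ × ℝ := (r v, 2 * Real.pi * θ v)

namespace Rep
variable {n : ℕ} {P : PlaneGraph n} {R : Rep P} {A : List (List (Fin n))} {r θ : Fin n → ℝ}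
  {T : ℕ → ℕ → ℝ}

/-- The coordinates `r` and `θ` place the segments of `A` on concentric circles, such that `T i`
lifts the angles of the `i`-th segment, and vertical edges go inward without meeting the segments
that they pass. -/
structure Layout (R : Rep P) (A : List (List (Fin n))) (r θ : Fin n → ℝ) (T : ℕ → ℕ → ℝ) :
    Prop where
  rad : ∀ (i : ℕ) (hi : i < A.length), ∀ v ∈ A[i], r v = A.length - i
  lift : ∀ (i : ℕ) (hi : i < A.length), ∃ η > 0, Lift θ η A[i] (T i)
  pass : ∀ (i : ℕ) (hi : i < A.length) (e : P.G.Dart), R.dir e = 3 → e.snd ∈ verts A →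
    (A.length - i : ℝ) < r e.snd → (e.fst ∉ verts A ∨ r e.fst < A.length - i) →
      ¬ R.IsCyc A[i] ∧ ∀ x, T i 0 ≤ x → x ≤ T i (A[i].length - 1) → ∀ z : ℤ, θ e.snd ≠ -x + z
  north : ∀ e : P.G.Dart, R.dir e = 3 → e.fst ∈ verts A →
    e.snd ∈ verts A ∧ θ e.fst = θ e.snd ∧ r e.fst < r e.snd

theorem exists_index {v : Fin n} (hv : v ∈ verts A) :
    ∃ (i : ℕ) (hi : i < A.length) (q : ℕ) (hq : q < A[i].length), A[i][q] = v := by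
  obtain ⟨S, hS, hvS⟩ := hv
  obtain ⟨i, hi, rfl⟩ := List.getElem_of_mem hS
  obtain ⟨q, hq, rfl⟩ := List.getElem_of_mem hvS
  exact ⟨i, hi, q, hq, rfl⟩

namespace Layout
variable (hV : R.Valid) (hS : ∀ S ∈ A, R.IsSegment S) (hL : R.Layout A r θ T)
include hL

theorem rad_get {i : ℕ} (hi : i < A.length) {q : ℕ} (hq : q < A[i].length) :
    r A[i][q] = A.length - i := hL.rad i hi _ (List.getElem_mem _)

omit hL in
theorem level_pos {i : ℕ} (hi : i < A.length) : (0 : ℝ) < A.length - i :=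
  sub_pos.2 (Nat.cast_lt.2 hi)

theorem rad_pos {v : Fin n} (hv : v ∈ verts A) : 0 < r v := by
  obtain ⟨i, hi, q, hq, rfl⟩ := exists_index hv
  rw [hL.rad_get hi hq]
  exact level_pos hi

theorem pt_get {i : ℕ} (hi : i < A.length) {q : ℕ} (hq : q < A[i].length) :
    pt (polar r θ A[i][q]) = cw (A.length - i) (T i q) := by
  obtain ⟨η, hη, h⟩ := hL.lift i hi
  obtain ⟨z, hz⟩ := h.ang q hq
  rw [polar, hL.rad_get hi hq, pt_eq_cw, cw_eq_iff (level_pos hi) (level_pos hi).le]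
  refine ⟨rfl, -z, ?_⟩
  rw [hz]
  push_cast
  ring

theorem mono {i : ℕ} (hi : i < A.length) {p q : ℕ} (hpq : p ≤ q) (hq : q ≤ A[i].length) :
    T i p ≤ T i q := by
  obtain ⟨η, hη, h⟩ := hL.lift i hi
  exact h.mono hη hpq hq

theorem strict {i : ℕ} (hi : i < A.length) {p q : ℕ} (hpq : p < q) (hq : q ≤ A[i].length) :
    T i p < T i q := by
  obtain ⟨η, hη, h⟩ := hL.lift i hi
  have := h.le hη hpq hq
  linarith

theorem period {i : ℕ} (hi : i < A.length) : T i A[i].length = T i 0 + 1 := by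
  obtain ⟨η, hη, h⟩ := hL.lift i hi
  exact h.period

/-- An arc of a circle meets the vertices on the circle just at its ends. -/
theorem meet {i : ℕ} (hi : i < A.length) {p q : ℕ} (hp : p < A[i].length) (hq : q < A[i].length)
    {x : ℝ} (hx : T i q ≤ x) (hx' : x ≤ T i (q + 1)) {z : ℤ} (h : T i p = x + z) :
    p = q ∨ p = q + 1 ∨ (q + 1 = A[i].length ∧ p = 0) := by
  have h1 := hL.mono hi (Nat.zero_le q) hq.le
  have h2 : T i (q + 1) ≤ T i A[i].length := hL.mono hi hq le_rfl
  have h3 := hL.mono hi (Nat.zero_le p) hp.le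
  have h4 := hL.strict hi hp le_rfl
  rw [hL.period hi] at h2 h4
  have h5 : (z : ℝ) < 1 := by linarith
  have h6 : (-2 : ℝ) < z := by linarith
  have h7 : z < 1 := by exact_mod_cast h5
  have h8 : -2 < z := by exact_mod_cast h6
  obtain rfl | rfl : z = 0 ∨ z = -1 := by omega
  · rw [Int.cast_zero, add_zero] at h
    rcases Nat.lt_trichotomy p q with h9 | h9 | h9
    · have := hL.strict hi h9 hq.le; linarith
    · exact Or.inl h9
    · rcases Nat.eq_or_lt_of_le h9 with h10 | h10
      · exact Or.inr (Or.inl h10.symm)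
      · have := hL.strict hi h10 hp.le; linarith
  · push_cast at h
    right; right
    constructor
    · by_contra hne
      have := hL.strict hi (p := q + 1) (q := A[i].length) (by omega) le_rfl
      rw [hL.period hi] at this
      linarith
    · by_contra hne
      have := hL.strict hi (p := 0) (q := p) (by omega) hp.le
      linarith

/-- Vertices with the same radius and the same angle up to full turns coincide. -/
theorem inj {u v : Fin n} (hu : u ∈ verts A) (hv : v ∈ verts A) (hr : r u = r v)
    {z : ℤ} (hz : θ u = θ v + z) : u = v := by
  obtain ⟨i, hi, q, hq, rfl⟩ := exists_index hu
  obtain ⟨j, hj, p, hp, rfl⟩ := exists_index hv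
  rw [hL.rad_get hi hq, hL.rad_get hj hp] at hr
  obtain rfl : i = j := by exact_mod_cast (by linarith : (i : ℝ) = j)
  obtain ⟨η, hη, h⟩ := hL.lift i hi
  obtain ⟨a, ha⟩ := h.ang q hq
  obtain ⟨b, hb⟩ := h.ang p hp
  have h1 : T i p = T i q + ((z + b - a : ℤ) : ℝ) := by push_cast; linarith
  have h2 := hL.mono hi (Nat.zero_le q) hq.le
  have h3 := hL.mono hi (Nat.zero_le p) hp.le
  have h4 := hL.strict hi hp le_rfl
  have h5 := hL.strict hi hq le_rfl
  rw [hL.period hi] at h4 h5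
  have h6 : ((z + b - a : ℤ) : ℝ) < 1 := by linarith
  have h7 : (-1 : ℝ) < ((z + b - a : ℤ) : ℝ) := by linarith
  have h8 : z + b - a < 1 := by exact_mod_cast h6
  have h9 : -1 < z + b - a := by exact_mod_cast h7
  obtain hz0 : z + b - a = 0 := by omega
  rw [hz0, Int.cast_zero, add_zero] at h1
  rcases Nat.lt_trichotomy p q with h10 | rfl | h10
  · have := hL.strict hi h10 hq.le; linarith
  · rfl
  · have := hL.strict hi h10 hp.le; linarith

include hV hS

/-- Where an east edge is drawn. -/
theorem east_index {d : P.G.Dart} (hd : d.fst ∈ verts A) (h0 : R.dir d = 0) :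
    ∃ (i : ℕ) (hi : i < A.length) (q : ℕ) (hq : q < A[i].length), d.fst = A[i][q] ∧
      ((∃ h : q + 1 < A[i].length, d.snd = A[i][q + 1]) ∨
        (R.IsCyc A[i] ∧ q + 1 = A[i].length ∧ d.snd = A[i][0]'(by omega))) ∧
      ∀ z, z ∈ R.curve (polar r θ) d ↔
        ∃ x, T i q ≤ x ∧ x ≤ T i (q + 1) ∧ z = cw (A.length - i) x := by
  obtain ⟨i, hi, q, hq, hqd⟩ := exists_index hd
  have h1 := isSegment_of_east hV (hS _ (List.getElem_mem hi)) h0 hq hqd.symm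
  refine ⟨i, hi, q, hq, hqd.symm, h1, ?_⟩
  obtain ⟨η, hη, h⟩ := hL.lift i hi
  obtain ⟨a, ha⟩ := h.ang q hq
  have hb : ∃ b : ℤ, θ d.snd = -T i (q + 1) + b := by
    rcases h1 with ⟨h2, h3⟩ | ⟨-, h2, h3⟩
    · rw [h3]; exact h.ang _ h2
    · obtain ⟨b, hb⟩ := h.ang 0 (by omega)
      refine ⟨b + 1, ?_⟩
      rw [h3, hb, h2, h.period]
      push_cast; ring
  obtain ⟨b, hb⟩ := hb
  have h2 := hL.strict hi (Nat.lt_succ_self q) hq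
  have h3 := hL.mono hi (Nat.zero_le q) hq.le
  have h4 := hL.mono hi hq le_rfl
  rw [hL.period hi] at h4
  have hpi := Real.pi_pos
  -- the clockwise gap of the angles, which is in `(0, 2π]`, is the difference of the lifts
  have hgap : cwGap (polar r θ d.fst).2 (polar r θ d.snd).2 =
      2 * Real.pi * (T i (q + 1) - T i q) := by
    rw [cwGap, toIocMod_eq_iff]
    refine ⟨⟨by nlinarith, by nlinarith⟩, a - b, ?_⟩
    rw [polar, polar, ← hqd, ha, hb, zsmul_eq_mul]
    push_cast
    ring
  intro w
  rw [curve, Set.mem_ofPred_eq, hgap, east_iff hV, north_iff hV, h0]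
  have e1 : (0 : ZMod 4) ≠ 3 := by decide
  simp only [true_and, e1, false_and, or_false]
  have key : ∀ x, pt ((polar r θ d.fst).1, (polar r θ d.fst).2 - 2 * Real.pi * (x - T i q)) =
      cw (A.length - i) x := by
    intro x
    rw [polar, ← hqd, hL.rad_get hi hq, ha]
    have : 2 * Real.pi * (-T i q + a) - 2 * Real.pi * (x - T i q) = 2 * Real.pi * -(x - a) := by
      ring
    rw [this, ← cw, cw_eq_iff (level_pos hi) (level_pos hi).le]
    exact ⟨rfl, -a, by push_cast; ring⟩
  constructor
  · rintro ⟨t, ⟨ht0, ht1⟩, rfl⟩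
    refine ⟨T i q + t / (2 * Real.pi), ?_, ?_, ?_⟩
    · have : 0 ≤ t / (2 * Real.pi) := by positivity
      linarith
    · have : t / (2 * Real.pi) ≤ T i (q + 1) - T i q := by
        rw [div_le_iff₀ (by positivity)]; linarith
      linarith
    · rw [← key]
      congr 2
      field_simp
      ring
  · rintro ⟨x, hx, hx', rfl⟩
    exact ⟨2 * Real.pi * (x - T i q), ⟨by nlinarith, by nlinarith⟩, (key x).symm⟩

omit hS hL in
/-- Where a north edge is drawn. -/
theorem mem_curve_north {d : P.G.Dart} (h3 : R.dir d = 3) (z : ℂ) :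
    z ∈ R.curve (polar r θ) d ↔ ∃ ρ, r d.fst ≤ ρ ∧ ρ ≤ r d.snd ∧ z = cw ρ (-θ d.fst) := by
  rw [curve, Set.mem_ofPred_eq, east_iff hV, north_iff hV, h3]
  have e1 : (3 : ZMod 4) ≠ 0 := by decide
  simp only [true_and, e1, false_and, false_or, polar, Set.mem_Icc, cw, neg_neg, and_assoc]

omit hS hL in
theorem dir_of_mem_curve {d : P.G.Dart} {z : ℂ} (hz : z ∈ R.curve (polar r θ) d) :
    R.dir d = 0 ∨ R.dir d = 3 := by
  rcases hz with ⟨h, -⟩ | ⟨h, -⟩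
  · exact Or.inl ((east_iff hV).1 h)
  · exact Or.inr ((north_iff hV).1 h)

/-- A vertex on a horizontal edge is one of its endpoints. -/
theorem vertex_east {d : P.G.Dart} (hd : d.fst ∈ verts A) (h0 : R.dir d = 0) {v : Fin n}
    (hv : v ∈ verts A) (h : pt (polar r θ v) ∈ R.curve (polar r θ) d) : v = d.fst ∨ v = d.snd := by
  obtain ⟨i, hi, q, hq, hqd, hsd, hc⟩ := hL.east_index hV hS hd h0
  obtain ⟨x, hx, hx', hxv⟩ := (hc _).1 h
  obtain ⟨j, hj, p, hp, rfl⟩ := exists_index hv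
  rw [hL.pt_get hj hp, cw_eq_iff (level_pos hj) (level_pos hi).le] at hxv
  obtain ⟨h1, z, hz⟩ := hxv
  obtain rfl : j = i := by exact_mod_cast (by linarith : (j : ℝ) = i)
  rcases hL.meet hj hp hq hx hx' hz with rfl | rfl | ⟨h2, rfl⟩
  · exact Or.inl hqd.symm
  · rcases hsd with ⟨_, h3⟩ | ⟨-, h3, -⟩
    · exact Or.inr h3.symm
    · omega
  · rcases hsd with ⟨h3, -⟩ | ⟨-, -, h3⟩
    · omega
    · exact Or.inr h3.symm

omit hS hV in
/-- A vertical edge does not meet a vertex strictly between its endpoints. -/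
theorem not_between {e : P.G.Dart} (h3 : R.dir e = 3) (he : e.snd ∈ verts A) {v : Fin n}
    (hv : v ∈ verts A) (h1 : e.fst ∉ verts A ∨ r e.fst < r v) (h2 : r v < r e.snd) (z : ℤ) :
    θ e.snd ≠ θ v + z := by
  obtain ⟨j, hj, p, hp, rfl⟩ := exists_index hv
  rw [hL.rad_get hj hp] at h1 h2
  obtain ⟨η, hη, h⟩ := hL.lift j hj
  obtain ⟨b, hb⟩ := h.ang p hp
  have := (hL.pass j hj e h3 he h2 h1).2 (T j p) (hL.mono hj (Nat.zero_le _) hp.le)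
    (hL.mono hj (by omega) (by omega)) (b + z)
  intro h4
  apply this
  rw [h4, hb]; push_cast; ring

/-- A vertical edge does not meet a horizontal edge strictly between its endpoints. -/
theorem not_cross {e d : P.G.Dart} (h3 : R.dir e = 3) (he : e.snd ∈ verts A) (h0 : R.dir d = 0)
    (hd : d.fst ∈ verts A) (h1 : e.fst ∉ verts A ∨ r e.fst < r d.fst) (h2 : r d.fst < r e.snd)
    {ρ : ℝ} (hρ : 0 ≤ ρ) : cw ρ (-θ e.snd) ∉ R.curve (polar r θ) d := by
  intro h
  obtain ⟨i, hi, q, hq, hqd, hsd, hc⟩ := hL.east_index hV hS hd h0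
  obtain ⟨x, hx, hx', hxv⟩ := (hc _).1 h
  rw [hqd, hL.rad_get hi hq] at h1 h2
  obtain ⟨hcy, hno⟩ := hL.pass i hi e h3 he h2 h1
  rw [eq_comm, cw_eq_iff (level_pos hi) hρ] at hxv
  obtain ⟨-, z, hz⟩ := hxv
  have hq1 : q + 1 < A[i].length := by
    rcases hsd with ⟨h4, -⟩ | ⟨h4, -⟩
    · exact h4
    · exact absurd h4 hcy
  refine hno x ((hL.mono hi (Nat.zero_le _) hq.le).trans hx)
    (hx'.trans (hL.mono hi (by omega) (by omega))) z ?_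
  linarith

end Layout
end Rep

namespace Rep
variable {n : ℕ} {P : PlaneGraph n} {R : Rep P} {A : List (List (Fin n))} {r θ : Fin n → ℝ}
  {T : ℕ → ℕ → ℝ}

/-! ### Planarity of the drawing -/

namespace Layout
variable (hV : R.Valid) (hS : ∀ S ∈ A, R.IsSegment S) (hL : R.Layout A r θ T)

theorem pt_polar (v : Fin n) : pt (polar r θ v) = cw (r v) (-θ v) := by
  rw [polar, pt_eq_cw]

include hL

theorem pt_inj {u v : Fin n} (hu : u ∈ verts A) (hv : v ∈ verts A)
    (h : pt (polar r θ u) = pt (polar r θ v)) : u = v := by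
  rw [pt_polar, pt_polar, cw_eq_iff (hL.rad_pos hu) (hL.rad_pos hv).le] at h
  obtain ⟨h1, z, hz⟩ := h
  exact hL.inj hu hv h1 (z := -z) (by push_cast; linarith)

theorem rad_eq {i : ℕ} (hi : i < A.length) {u v : Fin n} (hu : u ∈ A[i]) (hv : v ∈ A[i]) :
    r u = r v := by rw [hL.rad i hi u hu, hL.rad i hi v hv]

include hV hS

theorem rad_east {d : P.G.Dart} (hd : d.fst ∈ verts A) (h0 : R.dir d = 0) : r d.fst = r d.snd := by
  obtain ⟨i, hi, q, hq, hqd⟩ := exists_index hd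
  have h1 : d.fst ∈ A[i] := hqd ▸ List.getElem_mem _
  exact hL.rad_eq hi h1 (isSegment_closed hV (hS _ (List.getElem_mem hi)) (Or.inl h0) h1)

/-- A vertex on an edge is one of its endpoints. -/
theorem vertex_edge {v : Fin n} (hv : v ∈ verts A) {d : P.G.Dart} (hd : d ∈ indSet P (verts A))
    (h : pt (polar r θ v) ∈ R.curve (polar r θ) d) : v = d.fst ∨ v = d.snd := by
  rcases dir_of_mem_curve hV h with h0 | h3
  · exact hL.vertex_east hV hS hd.1 h0 hv h
  · obtain ⟨ρ, h1, h2, he⟩ := (mem_curve_north hV h3 _).1 h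
    have hρ := (hL.rad_pos hd.1).trans_le h1
    rw [pt_polar, cw_eq_iff (hL.rad_pos hv) hρ.le] at he
    obtain ⟨rfl, z, hz⟩ := he
    obtain ⟨-, hth, -⟩ := hL.north d h3 hd.1
    have hz1 : θ v = θ d.fst + ((-z : ℤ) : ℝ) := by push_cast; linarith
    rcases h1.lt_or_eq with h1 | h1
    · rcases h2.lt_or_eq with h2 | h2
      · exact absurd (by linarith) (hL.not_between h3 hd.2 hv (Or.inr h1) h2 z)
      · exact Or.inr (hL.inj hv hd.2 h2 (by rw [← hth]; exact hz1))
    · exact Or.inl (hL.inj hv hd.1 h1.symm hz1)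

omit hV hS in
/-- Two arcs of a circle meet just at common ends. -/
theorem arcs {i : ℕ} (hi : i < A.length) {p q : ℕ} (hpq : p < q) (hq : q < A[i].length)
    {x y : ℝ} (hx : T i p ≤ x) (hx' : x ≤ T i (p + 1)) (hy : T i q ≤ y) (hy' : y ≤ T i (q + 1))
    {z : ℤ} (h : y = x + z) : (q = p + 1 ∧ y = T i q) ∨ (p = 0 ∧ q + 1 = A[i].length ∧ x = T i p) := by
  have h1 := hL.mono hi (show p + 1 ≤ q from hpq) hq.le
  have h2 := hL.mono hi (Nat.zero_le p) (hpq.trans hq).le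
  have h3 : T i (q + 1) ≤ T i A[i].length := hL.mono hi hq le_rfl
  rw [hL.period hi] at h3
  have h4 : (-1 : ℝ) < z := by linarith
  have h5 : (z : ℝ) < 2 := by linarith
  have h6 : -1 < z := by exact_mod_cast h4
  have h7 : z < 2 := by exact_mod_cast h5
  obtain rfl | rfl : z = 0 ∨ z = 1 := by omega
  · rw [Int.cast_zero, add_zero] at h
    left
    refine ⟨?_, by linarith⟩
    by_contra hne
    have := hL.strict hi (p := p + 1) (q := q) (by omega) hq.le
    linarith
  · push_cast at h
    right
    refine ⟨?_, ?_, by linarith⟩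
    · by_contra hne
      have := hL.strict hi (p := 0) (q := p) (by omega) (hpq.trans hq).le
      linarith
    · by_contra hne
      have := hL.strict hi (p := q + 1) (q := A[i].length) (by omega) le_rfl
      rw [hL.period hi] at this
      linarith

/-- Two horizontal edges meet just at common vertices. -/
theorem east_east {d d' : P.G.Dart} (hd : d ∈ indSet P (verts A)) (hd' : d' ∈ indSet P (verts A))
    (h0 : R.dir d = 0) (h0' : R.dir d' = 0) (hne : d ≠ d') {z : ℂ}
    (hz : z ∈ R.curve (polar r θ) d) (hz' : z ∈ R.curve (polar r θ) d') :
    ∃ v, (v = d.fst ∨ v = d.snd) ∧ (v = d'.fst ∨ v = d'.snd) ∧ z = pt (polar r θ v) := by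
  obtain ⟨i, hi, q, hq, hqd, hsd, hc⟩ := hL.east_index hV hS hd.1 h0
  obtain ⟨j, hj, p, hp, hpd, hsd', hc'⟩ := hL.east_index hV hS hd'.1 h0'
  obtain ⟨x, hx, hx', rfl⟩ := (hc _).1 hz
  obtain ⟨y, hy, hy', he⟩ := (hc' _).1 hz'
  have he' := he
  rw [cw_eq_iff (level_pos hi) (level_pos hj).le] at he'
  obtain ⟨h1, m, hm⟩ := he'
  obtain rfl : i = j := by exact_mod_cast (by linarith : (i : ℝ) = j)
  have hpq : p ≠ q := by
    rintro rfl
    exact hne (eq_of_dir_eq hV (hqd.trans hpd.symm) (h0.trans h0'.symm))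
  rcases lt_or_gt_of_ne hpq with hlt | hlt
  · rcases hL.arcs hi hlt hq hy hy' hx hx' hm with ⟨rfl, h2⟩ | ⟨rfl, h2, h3⟩
    · refine ⟨d.fst, Or.inl rfl, Or.inr ?_, ?_⟩
      · rcases hsd' with ⟨_, h4⟩ | ⟨-, h4, -⟩
        · rw [hqd, h4]
        · omega
      · rw [h2, hqd, hL.pt_get hi hq]
    · refine ⟨d'.fst, Or.inr ?_, Or.inl rfl, ?_⟩
      · rcases hsd with ⟨_, h4⟩ | ⟨-, -, h4⟩
        · omega
        · rw [hpd, h4]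
      · rw [he, h3, hpd, hL.pt_get hi hp]
  · rcases hL.arcs hi hlt hp hx hx' hy hy' (z := -m) (by push_cast; linarith) with
      ⟨rfl, h2⟩ | ⟨rfl, h2, h3⟩
    · refine ⟨d'.fst, Or.inr ?_, Or.inl rfl, ?_⟩
      · rcases hsd with ⟨_, h4⟩ | ⟨-, h4, -⟩
        · rw [hpd, h4]
        · omega
      · rw [he, h2, hpd, hL.pt_get hi hp]
    · refine ⟨d.fst, Or.inl rfl, Or.inr ?_, ?_⟩
      · rcases hsd' with ⟨_, h4⟩ | ⟨-, -, h4⟩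
        · omega
        · rw [hqd, h4]
      · rw [h3, hqd, hL.pt_get hi hq]

/-- A horizontal and a vertical edge meet just at common vertices. -/
theorem east_north {d d' : P.G.Dart} (hd : d ∈ indSet P (verts A)) (hd' : d' ∈ indSet P (verts A))
    (h0 : R.dir d = 0) (h3 : R.dir d' = 3) {z : ℂ}
    (hz : z ∈ R.curve (polar r θ) d) (hz' : z ∈ R.curve (polar r θ) d') :
    ∃ v, (v = d.fst ∨ v = d.snd) ∧ (v = d'.fst ∨ v = d'.snd) ∧ z = pt (polar r θ v) := by
  obtain ⟨ρ, h1, h2, rfl⟩ := (mem_curve_north hV h3 _).1 hz'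
  obtain ⟨-, hth, -⟩ := hL.north d' h3 hd'.1
  have hρ := (hL.rad_pos hd'.1).trans_le h1
  have hrad : ρ = r d.fst := by
    obtain ⟨i, hi, q, hq, hqd, -, hc⟩ := hL.east_index hV hS hd.1 h0
    obtain ⟨x, -, -, he⟩ := (hc _).1 hz
    rw [cw_eq_iff hρ (level_pos hi).le] at he
    rw [hqd, hL.rad_get hi hq, he.1]
  rcases h1.lt_or_eq with h1 | h1
  · rcases h2.lt_or_eq with h2 | h2
    · refine absurd hz ?_
      rw [hth]
      exact hL.not_cross hV hS h3 hd'.2 h0 hd.1 (Or.inr (hrad ▸ h1)) (hrad ▸ h2) hρ.le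
    · have he : cw ρ (-θ d'.fst) = pt (polar r θ d'.snd) := by rw [pt_polar, h2, hth]
      rw [he] at hz
      exact ⟨d'.snd, hL.vertex_east hV hS hd.1 h0 hd'.2 hz, Or.inr rfl, he⟩
  · have he : cw ρ (-θ d'.fst) = pt (polar r θ d'.fst) := by rw [pt_polar, h1]
    rw [he] at hz
    exact ⟨d'.fst, hL.vertex_east hV hS hd.1 h0 hd'.1 hz, Or.inl rfl, he⟩

omit hS in
/-- Two vertical edges on the same ray do not overlap, since the tail of one of them would lie inside
the other one. -/
theorem north_north {d d' : P.G.Dart} (hd : d ∈ indSet P (verts A)) (hd' : d' ∈ indSet P (verts A))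
    (h3 : R.dir d = 3) (h3' : R.dir d' = 3) (hne : d ≠ d') (hr : r d.fst ≤ r d'.fst) {z : ℂ}
    (hz : z ∈ R.curve (polar r θ) d) (hz' : z ∈ R.curve (polar r θ) d') :
    ∃ v, (v = d.fst ∨ v = d.snd) ∧ (v = d'.fst ∨ v = d'.snd) ∧ z = pt (polar r θ v) := by
  obtain ⟨ρ, h1, h2, rfl⟩ := (mem_curve_north hV h3 _).1 hz
  obtain ⟨ρ', h1', h2', he⟩ := (mem_curve_north hV h3' _).1 hz'
  have hρ := (hL.rad_pos hd.1).trans_le h1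
  have hρ' := (hL.rad_pos hd'.1).trans_le h1'
  have he' := he
  rw [cw_eq_iff hρ hρ'.le] at he'
  obtain ⟨rfl, m, hm⟩ := he'
  obtain ⟨-, hth, -⟩ := hL.north d h3 hd.1
  have hang : θ d.snd = θ d'.fst + ((-m : ℤ) : ℝ) := by rw [← hth]; push_cast; linarith
  rcases hr.lt_or_eq with hr | hr
  · rcases (h1'.trans h2).lt_or_eq with h4 | h4
    · exact absurd hang (hL.not_between h3 hd.2 hd'.1 (Or.inr hr) h4 (-m))
    · refine ⟨d.snd, Or.inr rfl, Or.inl (hL.inj hd.2 hd'.1 h4.symm hang), ?_⟩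
      rw [pt_polar, hth]
      congr 1
      linarith
  · exact absurd (eq_of_dir_eq hV (hL.inj hd.1 hd'.1 hr (by rw [hth]; exact hang)) (h3.trans h3'.symm)) hne

/-- Two edges meet just at common vertices. -/
theorem edge_edge {d d' : P.G.Dart} (hd : d ∈ indSet P (verts A)) (hd' : d' ∈ indSet P (verts A))
    (hne : d ≠ d') {z : ℂ} (hz : z ∈ R.curve (polar r θ) d) (hz' : z ∈ R.curve (polar r θ) d') :
    ∃ v, (v = d.fst ∨ v = d.snd) ∧ (v = d'.fst ∨ v = d'.snd) ∧ z = pt (polar r θ v) := by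
  rcases dir_of_mem_curve hV hz with h | h <;> rcases dir_of_mem_curve hV hz' with h' | h'
  · exact hL.east_east hV hS hd hd' h h' hne hz hz'
  · exact hL.east_north hV hS hd hd' h h' hz hz'
  · obtain ⟨v, h1, h2, h3⟩ := hL.east_north hV hS hd' hd h' h hz' hz
    exact ⟨v, h2, h1, h3⟩
  · rcases le_total (r d.fst) (r d'.fst) with hr | hr
    · exact hL.north_north hV hd hd' h h' hne hr hz hz'
    · obtain ⟨v, h1, h2, h3⟩ := hL.north_north hV hd' hd h' h hne.symm hr hz' hz
      exact ⟨v, h2, h1, h3⟩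

/-- The radial segment below a vertex with an edge to the south is not used. -/
theorem free_ray {e : P.G.Dart} (he : e ∈ R.Down (verts A)) {ρ : ℝ} (hρ : 0 ≤ ρ)
    (h : ρ < r e.snd) : cw ρ (-θ e.snd) ∉ R.image (polar r θ) (indSet P (verts A)) := by
  rintro ⟨d, hd, hz⟩
  rcases dir_of_mem_curve hV hz with h0 | h3
  · refine hL.not_cross hV hS he.1 he.2.1 h0 hd.1 (Or.inl he.2.2) ?_ hρ hz
    obtain ⟨i, hi, q, hq, hqd, -, hc⟩ := hL.east_index hV hS hd.1 h0
    obtain ⟨x, -, -, hx⟩ := (hc _).1 hz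
    rw [eq_comm, cw_eq_iff (level_pos hi) hρ] at hx
    rw [hqd, hL.rad_get hi hq, hx.1]
    exact h
  · obtain ⟨ρ', h1, -, hx⟩ := (mem_curve_north hV h3 _).1 hz
    rw [eq_comm, cw_eq_iff ((hL.rad_pos hd.1).trans_le h1) hρ] at hx
    obtain ⟨rfl, m, hm⟩ := hx
    exact hL.not_between he.1 he.2.1 hd.1 (Or.inl he.2.2) (h1.trans_lt h) m (by linarith)

/-- All points of the drawing are at distances between `1` and `A.length` from the origin. -/
theorem norm_image {z : ℂ} (hz : z ∈ R.image (polar r θ) (indSet P (verts A))) :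
    1 ≤ ‖z‖ ∧ ‖z‖ ≤ A.length := by
  have hr : ∀ v ∈ verts A, 1 ≤ r v ∧ r v ≤ A.length := by
    intro v hv
    obtain ⟨i, hi, q, hq, rfl⟩ := exists_index hv
    rw [hL.rad_get hi hq]
    have h1 : ((i + 1 : ℕ) : ℝ) ≤ A.length := Nat.cast_le.2 hi
    have h2 : (0 : ℝ) ≤ i := Nat.cast_nonneg i
    push_cast at h1
    exact ⟨by linarith, by linarith⟩
  obtain ⟨d, hd, hz⟩ := hz
  rcases dir_of_mem_curve hV hz with h0 | h3
  · obtain ⟨i, hi, q, hq, hqd, -, hc⟩ := hL.east_index hV hS hd.1 h0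
    obtain ⟨x, -, -, rfl⟩ := (hc _).1 hz
    rw [norm_cw (level_pos hi).le, ← hL.rad_get hi hq, ← hqd]
    exact hr _ hd.1
  · obtain ⟨ρ, h1, h2, rfl⟩ := (mem_curve_north hV h3 _).1 hz
    have h4 := hr _ hd.1
    have h5 := hr _ hd.2
    rw [norm_cw (by linarith)]
    exact ⟨by linarith, by linarith⟩

end Layout

/-! ### Headings and angles -/

/-- The number of quarter turns counter-clockwise from the north to a direction. -/
def quarter (a : ZMod 4) : ℤ := if a = 0 then -1 else if a = 3 then 0 else if a = 2 then 1 else 2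

theorem heading_eq (hV : R.Valid) (d : P.G.Dart) :
    R.heading (polar r θ) d = 2 * Real.pi * θ d.fst + quarter (R.dir d) * (Real.pi / 2) := by
  have e1 : R.dir d + 2 = 0 ↔ R.dir d = 2 := by generalize R.dir d = a; revert a; decide
  rw [heading, east_iff hV, north_iff hV, east_iff hV, dir_symm hV, e1, quarter, polar]
  split_ifs <;> push_cast <;> ring

/-- Turning counter-clockwise by `s` quarter turns changes the direction by `-s` modulo `4`. -/
theorem quarter_sub (a : ZMod 4) (s : ℕ) (h : 1 ≤ s) (h4 : s ≤ 4) :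
    ∃ z : ℤ, quarter (a - s) - quarter a = s + 4 * z := by
  have key : ∀ a : ZMod 4, (quarter (a - 1) - quarter a = 1 ∨ quarter (a - 1) - quarter a = -3) ∧
      (quarter (a - 2) - quarter a = 2 ∨ quarter (a - 2) - quarter a = -2) ∧
      (quarter (a - 3) - quarter a = 3 ∨ quarter (a - 3) - quarter a = -1) := by decide
  obtain ⟨h1, h2, h3⟩ := key a
  have : s = 1 ∨ s = 2 ∨ s = 3 ∨ s = 4 := by omega
  rcases this with rfl | rfl | rfl | rfl
  · rcases h1 with h | h
    · exact ⟨0, by push_cast; linarith⟩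
    · exact ⟨-1, by push_cast; linarith⟩
  · rcases h2 with h | h
    · exact ⟨0, by push_cast; linarith⟩
    · exact ⟨-1, by push_cast; linarith⟩
  · rcases h3 with h | h
    · exact ⟨0, by push_cast; linarith⟩
    · exact ⟨-1, by push_cast; linarith⟩
  · refine ⟨-1, ?_⟩
    have : ((4 : ℕ) : ZMod 4) = 0 := by decide
    rw [this, sub_zero]; norm_num

/-- The angles of the drawing are the prescribed ones. They are positive and at most a full turn, so
it suffices to know them modulo full turns. -/
theorem angle_heading (hV : R.Valid) {H : Set P.G.Dart} {d d' : P.G.Dart} {m : ℕ} (hd : d ∈ H)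
    (h : NextAround H d d' m) :
    toIocMod Real.two_pi_pos 0 (R.heading (polar r θ) d' - R.heading (polar r θ) d) =
      ((∑ i ∈ Finset.range m, R.angle ((P.rot ^ i) d) : ℕ) : ℝ) * (Real.pi / 2) := by
  obtain ⟨h1, h4, hf, hdir⟩ := rsum_of_nextAround hV hd h
  change _ = ((R.rsum d m : ℕ) : ℝ) * (Real.pi / 2)
  rw [heading_eq hV, heading_eq hV, hf, hdir]
  obtain ⟨z, hz⟩ := quarter_sub (R.dir d) (R.rsum d m) h1 h4
  generalize R.rsum d m = s at *
  have hpi := Real.pi_pos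
  have h1' : (1 : ℝ) ≤ s := by exact_mod_cast h1
  have h4' : (s : ℝ) ≤ 4 := by exact_mod_cast h4
  have hz' : (quarter (R.dir d - s) : ℝ) = quarter (R.dir d) + s + 4 * z := by
    have : quarter (R.dir d - s) = quarter (R.dir d) + s + 4 * z := by linarith
    exact_mod_cast this
  rw [toIocMod_eq_iff]
  refine ⟨⟨by positivity, by nlinarith⟩, z, ?_⟩
  rw [hz', zsmul_eq_mul]
  ring

/-! ### Good drawings -/

/-- The open unit disc around the origin is in one region of a drawing at distance at least `1`. -/
theorem joinedIn_origin {s : Set ℂ} (h : ∀ z ∈ s, 1 ≤ ‖z‖) {z : ℂ} (hz : ‖z‖ < 1) :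
    JoinedIn sᶜ z 0 := by
  refine JoinedIn.mono (U := Metric.ball 0 1) ?_ ?_
  · exact ((convex_ball (0 : ℂ) 1).isPathConnected ⟨0, by simp⟩).joinedIn _ (by simpa using hz) _
      (by simp)
  · intro w hw hws
    have := h w hws
    rw [mem_ball_zero_iff] at hw
    linarith

/-- A ray outside of a disc that contains the drawing is in one region of it. -/
theorem joinedIn_ray {s : Set ℂ} {K : ℝ} (hK : 0 ≤ K) (h : ∀ z ∈ s, ‖z‖ ≤ K) {a b α : ℝ}
    (ha : K < a) (hb : K < b) : JoinedIn sᶜ (pt (a, α)) (pt (b, α)) := by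
  have hc : Continuous fun ρ : ℝ => pt (ρ, α) := by
    unfold pt; fun_prop
  refine JoinedIn.mono (U := (fun ρ : ℝ => pt (ρ, α)) '' Set.Ioi K) ?_ ?_
  · exact (((convex_Ioi K).isPathConnected ⟨a, ha⟩).image hc).joinedIn _ ⟨a, ha, rfl⟩ _ ⟨b, hb, rfl⟩
  · rintro _ ⟨ρ, hρ, rfl⟩ hs
    have := h _ hs
    rw [norm_pt, abs_of_pos (hK.trans_lt hρ)] at this
    exact absurd hρ (not_lt.2 this)

/-- A layout is a drawing. The hypothesis `hc` says that the central face is on the right of an edge on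
the innermost circle. -/
theorem Layout.isDrawing (hV : R.Valid) (hA : R.IsGood A) (hL : R.Layout A r θ T)
    (hc : ∃ d : P.G.Dart, R.dir d = 0 ∧ d ∈ indSet P (verts A) ∧ r d.fst = 1 ∧
      R.Cen (verts A) d) :
    R.IsDrawing (polar r θ) (verts A) (indSet P (verts A)) := by
  have hS := hA.segment
  obtain ⟨S, B, hAS, hseg, hO⟩ := hA.first_facts
  have hSA : S ∈ A := by rw [hAS]; simp
  have hSr : ∀ v ∈ S, r v = A.length := by
    subst hAS
    intro v hv
    have := hL.rad 0 (by simp) v hv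
    simpa using this
  have e20 : (2 : ZMod 4) ≠ 0 := by decide
  have e23 : (2 : ZMod 4) ≠ 3 := by decide
  refine
    { radius_pos := fun v hv => hL.rad_pos hv
      inj := fun u hu v hv h => hL.pt_inj hu hv h
      east := fun d hd h0 => hL.rad_east hV hS hd.1 ((east_iff hV).1 h0)
      north := fun d hd h3 => ?_
      vertex_edge := fun v hv d hd h => hL.vertex_edge hV hS hv hd h
      edge_edge := fun d hd d' hd' hne z hz hz' => hL.edge_edge hV hS hd hd' hne hz hz'
      angles := fun d hd d' m h => angle_heading hV hd h
      central := ?_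
      outer := ?_
      ref_outermost := fun v hv => ?_ }
  · obtain ⟨-, h1, h2⟩ := hL.north d ((north_iff hV).1 h3) hd.1
    refine ⟨h2, ?_⟩
    rw [polar, polar, h1]
  · obtain ⟨d, h0, hd, hr, hcen⟩ := hc
    refine ⟨d, hd, hcen, 1, one_pos, fun ε hε hε1 => ?_⟩
    -- the points to the right of an edge on the circle of radius `1` are in the unit disc
    refine joinedIn_origin (fun z hz => (hL.norm_image hV hS hz).1) ?_
    rw [rightPt, if_pos ((east_iff hV).2 h0), norm_pt]
    change |r d.fst - ε| < 1
    rw [hr, abs_of_pos (by linarith)]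
    linarith
  · obtain ⟨e, h0, he, -⟩ := isSegment_east hV hseg (i := 0) (by have := hseg.two_le; omega)
    have heS : e.fst ∈ S := he ▸ List.getElem_mem _
    have heS' := isSegment_closed hV hseg (Or.inl h0) heS
    have h2 : R.dir e.symm = 2 := by rw [dir_symm hV, h0]; rfl
    refine ⟨e.symm, ⟨⟨S, hSA, heS'⟩, ⟨S, hSA, heS⟩⟩, (hO e).1 ⟨(east_iff hV).2 h0, heS⟩, ?_⟩
    intro b
    -- a point further out on the ray through the middle of a west edge of the outermost circle
    refine ⟨pt (A.length + |b| + 1, (polar r θ e.fst).2 -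
      cwGap (polar r θ e.fst).2 (polar r θ e.snd).2 / 2), ?_, 1, one_pos, fun ε hε _ => ?_⟩
    · rw [norm_pt]
      have h3 : (0 : ℝ) ≤ A.length := Nat.cast_nonneg _
      rw [abs_of_pos (by positivity)]
      have := le_abs_self b
      linarith
    · rw [rightPt, east_iff hV, north_iff hV, east_iff hV, h2, if_neg e20, if_neg e23,
        SimpleGraph.Dart.symm_symm, if_pos h0]
      refine joinedIn_ray (Nat.cast_nonneg A.length) (fun z hz => (hL.norm_image hV hS hz).2) ?_ ?_
      · change _ < r e.fst + ε
        rw [hSr _ heS]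
        linarith
      · have := abs_nonneg b
        linarith
  · change r v ≤ r R.ref.fst
    have h1 : R.ref.fst ∈ S := ((hO R.ref).2 hV.ref_outer).2
    rw [hSr _ h1]
    obtain ⟨i, hi, q, hq, rfl⟩ := exists_index hv
    rw [hL.rad_get hi hq]
    have : (0 : ℝ) ≤ i := Nat.cast_nonneg i
    linarith

/-- In a layout, the rays below the south edges are free. -/
theorem Layout.isGoodDrawing (hV : R.Valid) (hA : R.IsGood A) (hL : R.Layout A r θ T)
    (hc : ∃ d : P.G.Dart, R.dir d = 0 ∧ d ∈ indSet P (verts A) ∧ r d.fst = 1 ∧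
      R.Cen (verts A) d) : R.IsGoodDrawing (polar r θ) A := by
  have hS := hA.segment
  have hne : A ≠ [] := by
    obtain ⟨S, B, h, -⟩ := hA.first
    rw [h]; simp
  have hI := hA.inv hV (List.append_nil A).symm hne
  refine ⟨?_, ?_⟩
  · rw [sub_eq hV hS]
    exact hL.isDrawing hV hA hc
  · intro e he ρ hρ h
    rw [sub_eq hV hS]
    rw [south_eq hV hS hI] at he
    change pt (ρ, 2 * Real.pi * θ e.snd) ∉ _
    rw [pt_eq_cw]
    exact hL.free_ray hV hS he hρ h

theorem Layout.concentric (hL : R.Layout A r θ T) : Concentric (polar r θ) A := by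
  constructor
  · intro S hS u hu v hv
    obtain ⟨i, hi, rfl⟩ := List.getElem_of_mem hS
    exact hL.rad_eq hi hu hv
  · rw [List.pairwise_iff_getElem]
    intro i j hi hj hij u hu v hv
    change r v < r u
    rw [hL.rad i hi u hu, hL.rad j hj v hv]
    have : (i : ℝ) < j := Nat.cast_lt.2 hij
    linarith

theorem mem_verts_take {m i : ℕ} (hm : m < A.length) (him : m < i) {v : Fin n} (hv : v ∈ A[m]) :
    v ∈ verts (A.take i) := by
  refine ⟨A[m], ?_, hv⟩
  rw [List.mem_take_iff_getElem]
  exact ⟨m, by omega, rfl⟩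

/-- The radii `A.length - i` and angles as in `Placed` yield a good drawing. -/
theorem IsGood.drawing (hV : R.Valid) (hA : R.IsGood A)
    (hr : ∀ (i : ℕ) (hi : i < A.length), ∀ v ∈ A[i], r v = A.length - i)
    (hp : ∀ B S B', A = B ++ S :: B' → R.Placed θ (delta (B ++ [S])) S) :
    R.IsGoodDrawing (polar r θ) A ∧ Concentric (polar r θ) A := by
  have hsplit : ∀ (i : ℕ) (hi : i < A.length), A = A.take i ++ A[i] :: A.drop (i + 1) := by
    intro i hi
    rw [List.getElem_cons_drop, List.take_append_drop]
  have htake : ∀ (i : ℕ) (hi : i < A.length), A.take i ++ [A[i]] = A.take (i + 1) := fun i hi =>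
    List.take_append_getElem hi
  have hex : ∀ i : ℕ, ∃ T : ℕ → ℝ, ∀ hi : i < A.length,
      Lift θ (delta (A.take (i + 1))) A[i] T ∧ R.Passes (verts (A.take (i + 1))) θ A[i] T := by
    intro i
    by_cases hi : i < A.length
    · obtain ⟨T, h1, h2, -⟩ := hA.exists_lift hV hp _ _ _ (hsplit i hi)
      rw [htake i hi] at h1 h2
      exact ⟨T, fun _ => ⟨h1, h2⟩⟩
    · exact ⟨fun _ => 0, fun h => absurd h hi⟩
  choose T hT using hex
  -- the prefix that contains a vertex is determined by its radius
  have hlt : ∀ (i m : ℕ) (_ : i < A.length) (hm : m < A.length) (v : Fin n), v ∈ A[m] →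
      ((A.length - i : ℝ) < r v ↔ m < i) := by
    intro i m hi hm v hv
    rw [hr m hm v hv, sub_lt_sub_iff_left, Nat.cast_lt]
  have hL : R.Layout A r θ T := by
    refine ⟨hr, fun i hi => ⟨_, ?_, (hT i hi).1⟩, ?_, ?_⟩
    · exact delta_pos fun S hS => (hA.segment S (List.mem_of_mem_take hS)).two_le
    · intro i hi e h3 he hri hf
      obtain ⟨m, hm, p, hpm, hpe⟩ := exists_index he
      have hem : e.snd ∈ A[m] := hpe ▸ List.getElem_mem _
      have hmi := (hlt i m hi hm _ hem).1 hri
      refine (hT i hi).2 e ⟨h3, mem_verts_take hm (by omega) hem, ?_⟩ ?_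
      · rintro ⟨S, hS, hfS⟩
        rw [List.mem_take_iff_getElem] at hS
        obtain ⟨j, hj, rfl⟩ := hS
        rcases hf with hf | hf
        · exact hf ⟨_, List.getElem_mem _, hfS⟩
        · rw [hr j (by omega) _ hfS, sub_lt_sub_iff_left, Nat.cast_lt] at hf
          omega
      · intro hei
        have := (hlt i i hi hi _ hei).1 hri
        omega
    · intro e h3 he
      obtain ⟨j, hj, p, hpj, hpe⟩ := exists_index he
      have hej : e.fst ∈ A[j] := hpe ▸ List.getElem_mem _
      have hth := (hp _ _ _ (hsplit j hj)).north e h3 hej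
      rcases Nat.eq_zero_or_pos j with rfl | hpos
      · obtain ⟨S, B, hAS, hseg, hO⟩ := hA.first_facts
        subst hAS
        exact absurd h3 (first_no_north hV hseg hO hej)
      · have hne : A.take j ≠ [] := by
          rw [Ne, List.take_eq_nil_iff]
          rintro (h | h)
          · omega
          · rw [h] at hj; simp at hj
        obtain ⟨l, rest, hatt⟩ := hA.attach hV (hsplit j hj) hne
        have h4 := (hatt.down_of_mem ((hatt.north e).2 ⟨h3, hej⟩)).2.1
        obtain ⟨S, hS, hsS⟩ := h4
        rw [List.mem_take_iff_getElem] at hS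
        obtain ⟨m, hm, rfl⟩ := hS
        refine ⟨⟨_, List.getElem_mem _, hsS⟩, hth, ?_⟩
        rw [hr j hj _ hej]
        exact (hlt j m hj (by omega) _ hsS).2 (by omega)
  refine ⟨hL.isGoodDrawing hV hA ?_, hL.concentric⟩
  have hk : 0 < A.length := by
    obtain ⟨S, B, h, -⟩ := hA.first
    rw [h]; simp
  have hlast : A.length - 1 < A.length := by omega
  have hseg := hA.segment _ (List.getElem_mem hlast)
  obtain ⟨e, h0, he, -⟩ := isSegment_east hV hseg (i := 0) (by have := hseg.two_le; omega)
  have hel : e.fst ∈ A[A.length - 1] := he ▸ List.getElem_mem _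
  obtain ⟨-, -, -, -, hcen⟩ := hA.exists_lift hV hp _ _ _ (hsplit _ hlast)
  have hfull : A.take (A.length - 1) ++ [A[A.length - 1]] = A := by
    rw [htake _ hlast, Nat.sub_add_cancel hk, List.take_length]
  rw [hfull] at hcen
  refine ⟨e, h0, ⟨⟨_, List.getElem_mem hlast, hel⟩, ⟨_, List.getElem_mem hlast,
    isSegment_closed hV hseg (Or.inl h0) hel⟩⟩, ?_, hcen e h0 hel⟩
  rw [hr _ hlast _ hel, Nat.cast_sub hk]
  push_cast
  ring

end Rep

/-! ### Reasoning about programs -/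

theorem State.setNat_nat_same (s : State) (a i x : ℕ) : (s.setNat a i x).nat a i = x := by
  simp [State.setNat]

theorem State.setNat_nat_ne (s : State) {a b : ℕ} (i x : ℕ) (h : b ≠ a) :
    (s.setNat a i x).nat b = s.nat b := by
  simp [State.setNat, h]

theorem State.setRat_rat_same (s : State) (a i : ℕ) (x : ℚ) : (s.setRat a i x).rat a i = x := by
  simp [State.setRat]

theorem State.setRat_rat_ne (s : State) {a b : ℕ} (i : ℕ) (x : ℚ) (h : b ≠ a) :
    (s.setRat a i x).rat b = s.rat b := by
  simp [State.setRat, h]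

theorem State.setRat_rat_ne_index (s : State) (a : ℕ) {i j : ℕ} (x : ℚ) (h : j ≠ i) :
    (s.setRat a i x).rat a j = s.rat a j := by
  simp [State.setRat, h]

/-- Started in the state `s`, the program `p` halts within `c` steps in a state that satisfies
`Q`. -/
def Runs (p : Prog) (s : State) (Q : State → Prop) (c : ℕ) : Prop :=
  ∃ s' t, Exec p s s' t ∧ Q s' ∧ t ≤ c

/-- A bound for the running time of a program without loops. -/
def Prog.bound : Prog → ℕ
  | .skip => 1
  | .nset _ i e => i.cost + e.cost + 1
  | .qset _ i e => i.cost + e.cost + 1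
  | .seq p q => p.bound + q.bound
  | .cond t p q => t.cost + (p.bound + q.bound)
  | .loop _ _ => 0

/-- The program `p` leads from the state `s` to a state that satisfies `Q`, within the time bound
for programs without loops. -/
def Does (p : Prog) (s : State) (Q : State → Prop) : Prop := Runs p s Q p.bound

section rules
variable {p q : Prog} {s : State} {Q Q' : State → Prop} {c c' : ℕ}

theorem Runs.mono (h : Runs p s Q c) (hc : c ≤ c') (hQ : ∀ s', Q s' → Q' s') : Runs p s Q' c' := by
  obtain ⟨s', t, h1, h2, h3⟩ := h
  exact ⟨s', t, h1, hQ s' h2, h3.trans hc⟩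

theorem Runs.seq (h : Runs p s Q c) (h' : ∀ s', Q s' → Runs q s' Q' c') :
    Runs (.seq p q) s Q' (c + c') := by
  obtain ⟨s', t, h1, h2, h3⟩ := h
  obtain ⟨s'', t', h4, h5, h6⟩ := h' s' h2
  exact ⟨s'', t + t', .seq h1 h4, h5, Nat.add_le_add h3 h6⟩

/-- A loop whose invariant counts down runs within a time given by a potential. -/
theorem Runs.loop {b : Test} {I : ℕ → State → Prop} {Φ : ℕ → ℕ} (h0 : ∀ s, I 0 s → ¬ b.Holds s)
    (hb : b.cost ≤ Φ 0) (hs : ∀ m s, I (m + 1) s → b.Holds s ∧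
      ∃ c, b.cost + c + Φ m ≤ Φ (m + 1) ∧ Runs p s (I m) c) (m : ℕ) {s : State} (h : I m s) :
    Runs (.loop b p) s (I 0) (Φ m) := by
  induction m generalizing s with
  | zero => exact ⟨s, _, .loop_false (h0 s h), h, hb⟩
  | succ m ih =>
    obtain ⟨h1, c, h2, s', t, h3, h4, h5⟩ := hs m s h
    obtain ⟨s'', t', h6, h7, h8⟩ := ih h4
    exact ⟨s'', _, .loop_true h1 h3 h6, h7, by omega⟩

theorem Does.skip (h : Q s) : Does .skip s Q := ⟨s, _, .skip s, h, le_rfl⟩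

theorem Does.nset {a : ℕ} {i e : NExpr} (h : Q (s.setNat a (i.eval s) (e.eval s))) :
    Does (.nset a i e) s Q := ⟨_, _, .nset s a i e, h, le_rfl⟩

theorem Does.qset {a : ℕ} {i : NExpr} {e : QExpr} (h : Q (s.setRat a (i.eval s) (e.eval s))) :
    Does (.qset a i e) s Q := ⟨_, _, .qset s a i e, h, le_rfl⟩

theorem Does.seq (h : Does p s Q) (h' : ∀ s', Q s' → Does q s' Q') : Does (.seq p q) s Q' :=
  Runs.seq h h'

theorem Does.cond {b : Test} (h : b.Holds s → Does p s Q) (h' : ¬ b.Holds s → Does q s Q) :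
    Does (.cond b p q) s Q := by
  by_cases hb : b.Holds s
  · obtain ⟨s', t, h1, h2, h3⟩ := h hb
    exact ⟨s', _, .cond_true hb h1, h2, by simp only [Prog.bound]; omega⟩
  · obtain ⟨s', t, h1, h2, h3⟩ := h' hb
    exact ⟨s', _, .cond_false hb h1, h2, by simp only [Prog.bound]; omega⟩

end rules

/-! ### The program -/

/-- The register `a`, i.e. the first entry of the array `a`. The program uses register 6 for the index
of the current segment, 7 for the position of its first vertex among those of all segments, and 8 for
the position of the current vertex on it. The rational arrays 0 and 1 hold the radii and the angles
of the vertices, and register 2 holds the step between neighbouring vertices. -/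
def reg (a : ℕ) : NExpr := .arr a (.lit 0)

/-- Assign the value of `e` to the register `a`. -/
def setReg (a : ℕ) (e : NExpr) : Prog := .nset a (.lit 0) e

/-- The vertex at position `e` of the current segment, which starts at the position held by
register 7 of the concatenated segments. -/
def vertexAt (e : NExpr) : NExpr := .arr 2 (.add (reg 7) e)

/-- Search one slot further for the neighbour held by register 13, unless the slot held by
register 9 has it. Register 15 holds the position of the first slot. -/
def searchStep : Prog :=
  .cond (.neq (.arr 4 (.add (reg 15) (reg 9))) (reg 13)) .skip (setReg 9 (.add (reg 9) (.lit 1)))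

/-- Turn counter-clockwise to the next slot and add the angle that is passed to register 10. If this
is the angle held by register 14, then the neighbour is found: it is put into register 11, and
register 12 is set to `1`. -/
def turnStep : Prog :=
  .seq (setReg 10 (.add (reg 10) (.arr 5 (.add (reg 15) (reg 9)))))
  (.seq (setReg 9 (.add (reg 9) (.lit 1)))
  (.seq (.cond (.neq (reg 9) (.arr 3 (vertexAt (reg 8)))) (setReg 9 (.lit 0)) .skip)
  (.cond (.neq (reg 10) (reg 14))
    (.seq (setReg 11 (.arr 4 (.add (reg 15) (reg 9)))) (setReg 12 (.lit 1))) .skip)))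

/-- Find the north edge of the vertex at the position held by register 8 of the segment held by
register 6. The edges are searched counter-clockwise from the east edge, which is 90 degrees before
north, or from the west edge at the last vertex of the segment, which is 270 degrees before north. -/
def findNorth : Prog :=
  .seq (setReg 9 (.lit 0))
  (.seq (setReg 10 (.lit 0))
  (.seq (setReg 12 (.lit 0))
  (.seq (setReg 15 (.add (.add (vertexAt (reg 8)) (vertexAt (reg 8)))
    (.add (vertexAt (reg 8)) (vertexAt (reg 8)))))
  (.seq (.cond (.nlt (.add (reg 8) (.lit 1)) (.arr 1 (reg 6)))
    (.seq (setReg 13 (vertexAt (.add (reg 8) (.lit 1)))) (setReg 14 (.lit 1)))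
    (.seq (setReg 13 (vertexAt (.sub (reg 8) (.lit 1)))) (setReg 14 (.lit 3))))
  (.seq searchStep (.seq searchStep (.seq searchStep
  (.seq turnStep (.seq turnStep turnStep)))))))))

/-- Place the vertex at the position held by register 8: below the head of its north edge, or else
one step further than its predecessor. Registers 16 and 17 record the position of the first vertex
with a north edge, and whether there is one. -/
def placeVertex : Prog :=
  .seq findNorth
  (.seq (.qset 0 (vertexAt (reg 8)) (.ofNat (.sub (.arr 0 (.lit 0)) (reg 6))))
  (.seq (.cond (.neq (reg 12) (.lit 1))
    (.seq (.qset 1 (vertexAt (reg 8)) (.arr 1 (reg 11)))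
      (.cond (.neq (reg 17) (.lit 0)) (.seq (setReg 17 (.lit 1)) (setReg 16 (reg 8))) .skip))
    (.cond (.neq (reg 8) (.lit 0)) .skip
      (.qset 1 (vertexAt (reg 8))
        (.sub (.arr 1 (vertexAt (.sub (reg 8) (.lit 1)))) (.arr 2 (.lit 0))))))
  (setReg 8 (.add (reg 8) (.lit 1)))))

/-- Place the vertex before the position held by register 16 one step before its successor. -/
def placeBefore : Prog :=
  .seq (setReg 16 (.sub (reg 16) (.lit 1)))
  (.qset 1 (vertexAt (reg 16))
    (.add (.arr 1 (vertexAt (.add (reg 16) (.lit 1)))) (.arr 2 (.lit 0))))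

/-- Place the vertices of one segment, with steps that are smaller than those of the preceding
segment by a factor of the length of the segment. -/
def placeSegment : Prog :=
  .seq (.seq (.qset 2 (.lit 0) (.div (.arr 2 (.lit 0)) (.ofNat (.arr 1 (reg 6)))))
    (.seq (setReg 8 (.lit 0)) (.seq (setReg 16 (.lit 0)) (setReg 17 (.lit 0)))))
  (.seq (.loop (.nlt (reg 8) (.arr 1 (reg 6))) placeVertex)
  (.seq (.loop (.nlt (.lit 0) (reg 16)) placeBefore)
  (.seq (setReg 7 (.add (reg 7) (.arr 1 (reg 6)))) (setReg 6 (.add (reg 6) (.lit 1))))))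

/-- The program that draws a good sequence. -/
def drawProg : Prog :=
  .seq (.qset 2 (.lit 0) (.lit 1)) (.loop (.nlt (reg 6) (.arr 0 (.lit 0))) placeSegment)

section input
variable {n : ℕ} {P : PlaneGraph n} {R : Rep P} {A : List (List (Fin n))} {s₀ s : State}

/-- The slots of the vertex at the tail of `g`, from the slot of `g` on. -/
theorem Encodes.exists_slot (hV : R.Valid) (hE : Encodes R A s₀) (g : P.G.Dart) :
    ∃ b ≤ 3, b < s₀.nat 3 g.fst ∧ (∀ i < b, s₀.nat 4 (4 * g.fst + i) ≠ g.snd) ∧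
      ∀ j, s₀.nat 4 (4 * g.fst + (b + j) % s₀.nat 3 g.fst) = ((P.rot ^ j) g).snd ∧
        s₀.nat 5 (4 * g.fst + (b + j) % s₀.nat 3 g.fst) = R.angle ((P.rot ^ j) g) := by
  classical
  set v := g.fst with hv
  set k := s₀.nat 3 v with hk
  have hpos : 0 < k := by
    rw [hk, hE.degree, Set.ncard_pos]
    exact ⟨g.snd, g.adj⟩
  have hmod : ∀ i, i % k < k := fun i => Nat.mod_lt _ hpos
  choose D hD1 hD2 hD3 hD4 using fun i : ℕ => hE.neighbours v (i % k) (hmod i)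
  have hrot : ∀ i j, D (i + j) = (P.rot ^ j) (D i) := by
    intro i j
    induction j with
    | zero => rfl
    | succ j ih =>
      rw [pow_succ', Equiv.Perm.mul_apply, ← ih]
      refine SimpleGraph.Dart.ext _ _ (Prod.ext ?_ (Fin.ext ?_))
      · rw [P.rot_fst, hD1, hD1]
      · rw [← hD4, ← hD2, Nat.mod_add_mod, Nat.add_assoc]
  obtain ⟨m, hm, hmg⟩ := exists_rot_pow (d := D 0) (d' := g) (by rw [hD1])
  -- each of the turns up to `g` is at least 90 degrees, and they sum up to less than 360
  have hm3 : m ≤ 3 := by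
    have := rsum_lt hV hm
    have := le_rsum (R := R) (D 0) m
    omega
  have hex : ∃ b, s₀.nat 4 (4 * v + b % k) = g.snd := ⟨m, by rw [hD2, ← Nat.zero_add m, hrot, hmg]⟩
  have hb := Nat.find_spec hex
  have hbm : Nat.find hex ≤ m := Nat.find_min' hex (by rw [hD2, ← Nat.zero_add m, hrot, hmg])
  have hbk : Nat.find hex < k := by
    have h1 := Nat.find_min' hex (m := Nat.find hex % k) (by rw [Nat.mod_mod]; exact hb)
    exact h1.trans_lt (hmod _)
  have hDb : D (Nat.find hex) = g := by
    refine SimpleGraph.Dart.ext _ _ (Prod.ext (hD1 _) (Fin.ext ?_))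
    rw [← hD2]; exact hb
  refine ⟨Nat.find hex, hbm.trans hm3, hbk, fun i hi h => ?_, fun j => ?_⟩
  · exact Nat.find_min hex hi (by rwa [Nat.mod_eq_of_lt (hi.trans hbk)])
  · rw [hD2, hD3, hrot, hDb]
    exact ⟨rfl, rfl⟩

/-- Where the entries of the lists are found in the concatenation. -/
theorem getElem_flatten (A : List (List (Fin n))) (i : ℕ) (hi : i < A.length) (q : ℕ)
    (hq : q < A[i].length) : ∃ h : (A.take i).flatten.length + q < A.flatten.length,
      A.flatten[(A.take i).flatten.length + q] = A[i][q] := by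
  have h0 : A.take i ++ A[i] :: A.drop (i + 1) = A := by
    rw [List.getElem_cons_drop, List.take_append_drop]
  have h : A.flatten = (A.take i).flatten ++ (A[i] ++ (A.drop (i + 1)).flatten) := by
    rw [← List.flatten_cons, ← List.flatten_append, h0]
  have h1 : (A.take i).flatten.length + q < A.flatten.length := by
    rw [h]; simp; omega
  refine ⟨h1, ?_⟩
  simp only [h]
  rw [List.getElem_append_right (by omega), List.getElem_append_left (by omega)]
  simp

theorem Encodes.vertex (hE : Encodes R A s₀) {i : ℕ} (hi : i < A.length) {q : ℕ}
    (hq : q < A[i].length) : s₀.nat 2 ((A.take i).flatten.length + q) = A[i][q] := by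
  obtain ⟨h, h'⟩ := getElem_flatten A i hi q hq
  rw [hE.segments _ h, h']

end input

/-! ### Finding the north edge -/

/-- The states agree except for the registers 9 to 15. -/
def Keeps (s s' : State) : Prop := s'.rat = s.rat ∧ ∀ a, a < 9 ∨ 15 < a → s'.nat a = s.nat a

theorem Keeps.refl (s : State) : Keeps s s := ⟨rfl, fun _ _ => rfl⟩

theorem Keeps.setNat {s s' : State} (h : Keeps s s') {a : ℕ} (i x : ℕ) (ha : 9 ≤ a)
    (ha' : a ≤ 15) : Keeps s (s'.setNat a i x) :=
  ⟨h.1, fun b hb => by rw [State.setNat_nat_ne _ _ _ (by omega), h.2 b hb]⟩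

section north
variable {n : ℕ} {P : PlaneGraph n} {R : Rep P} {A : List (List (Fin n))} {s₀ s s' : State}

/-- The state holds the input of the state `s₀`. -/
def SameInput (s₀ s : State) : Prop := ∀ a < 6, s.nat a = s₀.nat a

/-- The state `s'` is reached from `s` while the slot of the dart `g` is searched, which is `90 · tg`
degrees before the north edge. -/
structure Searching (s : State) (g : P.G.Dart) (tg b : ℕ) (s' : State) : Prop where
  keeps : Keeps s s'
  first : s'.nat 15 0 = 4 * g.fst
  target : s'.nat 14 0 = tg
  sum : s'.nat 10 0 = 0
  found : s'.nat 12 0 = 0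
  nbr : s'.nat 13 0 = g.snd
  slot : s'.nat 9 0 = b

/-- The state `s'` is reached from `s` after `j` of the turns that start at the dart `g` in
slot `b`. -/
structure Turning (R : Rep P) (s : State) (g : P.G.Dart) (tg b j : ℕ) (s' : State) : Prop where
  keeps : Keeps s s'
  first : s'.nat 15 0 = 4 * g.fst
  target : s'.nat 14 0 = tg
  sum : s'.nat 10 0 = R.rsum g j
  slot : s'.nat 9 0 = (b + j) % s.nat 3 g.fst
  found : (s'.nat 12 0 = 1 ∧ ∃ i, R.rsum g i = tg ∧ s'.nat 11 0 = ((P.rot ^ i) g).snd) ∨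
    (s'.nat 12 0 = 0 ∧ ∀ i, 1 ≤ i → i ≤ j → R.rsum g i ≠ tg)

/-- After `m` steps of the search, slot `m` is reached, or the slot `b` of the dart `g` if it comes
first. -/
theorem Searching.step {g : P.G.Dart} {tg b m : ℕ} (hI : SameInput s₀ s)
    (h : Searching s g tg (min m b) s') (hb : ∀ i < b, s₀.nat 4 (4 * g.fst + i) ≠ g.snd)
    (hb' : s₀.nat 4 (4 * g.fst + b) = g.snd) :
    Does searchStep s' (Searching s g tg (min (m + 1) b)) := by
  have h4 : s'.nat 4 = s₀.nat 4 := by rw [h.keeps.2 4 (by omega), hI 4 (by omega)]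
  refine Does.cond (fun ht => Does.skip ?_) (fun ht => Does.nset ?_)
  all_goals simp only [Test.Holds, NExpr.eval, reg, h4, h.first, h.slot, h.nbr] at ht
  · have : b ≤ m := by
      by_contra hlt
      rw [min_eq_left (by omega)] at ht
      exact hb m (by omega) ht
    rw [min_eq_right (by omega)]
    rw [min_eq_right this] at h
    exact h
  · have : m < b := by
      by_contra hlt
      rw [min_eq_right (by omega)] at ht
      exact ht hb'
    rw [min_eq_left (by omega)]
    rw [min_eq_left (by omega)] at h
    have hk := fun a x (ha : a ≠ 9) => congrFun (State.setNat_nat_ne s' 0 x ha) 0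
    simp only [NExpr.eval, reg, h.slot]
    exact ⟨h.keeps.setNat _ _ (by omega) (by omega), by rw [hk _ _ (by omega), h.first],
      by rw [hk _ _ (by omega), h.target], by rw [hk _ _ (by omega), h.sum],
      by rw [hk _ _ (by omega), h.found], by rw [hk _ _ (by omega), h.nbr],
      State.setNat_nat_same _ _ _ _⟩

/-- One turn leads to the next edge around the vertex; the slot wraps around at the degree. -/
theorem Turning.step {g : P.G.Dart} {tg b j : ℕ} (hI : SameInput s₀ s)
    (h : Turning R s g tg b j s') (hv : s.nat 2 (s.nat 7 0 + s.nat 8 0) = g.fst)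
    (hd : 0 < s₀.nat 3 g.fst)
    (hb : ∀ j, s₀.nat 4 (4 * g.fst + (b + j) % s₀.nat 3 g.fst) = ((P.rot ^ j) g).snd ∧
        s₀.nat 5 (4 * g.fst + (b + j) % s₀.nat 3 g.fst) = R.angle ((P.rot ^ j) g)) :
    Does turnStep s' (Turning R s g tg b (j + 1)) := by
  have h3 : s.nat 3 = s₀.nat 3 := hI 3 (by omega)
  have h4 : s'.nat 4 = s₀.nat 4 := by rw [h.keeps.2 4 (by omega), hI 4 (by omega)]
  have h5 : s'.nat 5 = s₀.nat 5 := by rw [h.keeps.2 5 (by omega), hI 5 (by omega)]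
  have hslot := h.slot
  rw [h3] at hslot
  have hsum : R.rsum g (j + 1) = R.rsum g j + R.angle ((P.rot ^ j) g) := Finset.sum_range_succ _ _
  -- the four parts of the program: add the angle, advance, wrap around, compare
  refine Does.seq (Q := fun t => Keeps s t ∧ t.nat 15 0 = 4 * g.fst ∧ t.nat 14 0 = tg ∧
    t.nat 10 0 = R.rsum g (j + 1) ∧ t.nat 9 0 = s'.nat 9 0 ∧ t.nat 12 = s'.nat 12 ∧
    t.nat 11 = s'.nat 11) (Does.nset ?_) fun t ⟨k1, k2, k3, k4, k5, k6, k7⟩ => ?_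
  · have hk := fun a x (ha : a ≠ 10) => State.setNat_nat_ne s' 0 x ha
    refine ⟨h.keeps.setNat _ _ (by omega) (by omega), ?_, ?_, ?_, ?_, ?_, ?_⟩
    · rw [NExpr.eval, hk _ _ (by omega), h.first]
    · rw [NExpr.eval, hk _ _ (by omega), h.target]
    · rw [NExpr.eval, State.setNat_nat_same]
      simp only [NExpr.eval, reg, h5, h.first, hslot, h.sum, (hb j).2, hsum]
    · rw [NExpr.eval, hk _ _ (by omega)]
    · rw [NExpr.eval, hk _ _ (by omega)]
    · rw [NExpr.eval, hk _ _ (by omega)]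
  refine Does.seq (Q := fun u => Keeps s u ∧ u.nat 15 0 = 4 * g.fst ∧ u.nat 14 0 = tg ∧
    u.nat 10 0 = R.rsum g (j + 1) ∧ u.nat 9 0 = s'.nat 9 0 + 1 ∧ u.nat 12 = s'.nat 12 ∧
    u.nat 11 = s'.nat 11) (Does.nset ?_) fun u ⟨l1, l2, l3, l4, l5, l6, l7⟩ => ?_
  · have hk := fun a x (ha : a ≠ 9) => State.setNat_nat_ne t 0 x ha
    refine ⟨k1.setNat _ _ (by omega) (by omega), ?_, ?_, ?_, ?_, ?_, ?_⟩
    · rw [NExpr.eval, hk _ _ (by omega), k2]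
    · rw [NExpr.eval, hk _ _ (by omega), k3]
    · rw [NExpr.eval, hk _ _ (by omega), k4]
    · rw [NExpr.eval, State.setNat_nat_same]
      simp only [NExpr.eval, reg, k5]
    · rw [NExpr.eval, hk _ _ (by omega), k6]
    · rw [NExpr.eval, hk _ _ (by omega), k7]
  refine Does.seq (Q := fun w => Keeps s w ∧ w.nat 15 0 = 4 * g.fst ∧ w.nat 14 0 = tg ∧
    w.nat 10 0 = R.rsum g (j + 1) ∧ w.nat 9 0 = (b + (j + 1)) % s₀.nat 3 g.fst ∧
    w.nat 12 = s'.nat 12 ∧ w.nat 11 = s'.nat 11) (Does.cond (fun ht => Does.nset ?_)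
    (fun ht => Does.skip ?_)) fun w ⟨m1, m2, m3, m4, m5, m6, m7⟩ => ?_
  · have hk := fun a x (ha : a ≠ 9) => State.setNat_nat_ne u 0 x ha
    simp only [Test.Holds, NExpr.eval, reg, vertexAt, l1.2 3 (by omega), l1.2 2 (by omega),
      l1.2 7 (by omega), l1.2 8 (by omega), hv, l5, h3] at ht
    refine ⟨l1.setNat _ _ (by omega) (by omega), ?_, ?_, ?_, ?_, ?_, ?_⟩
    · rw [NExpr.eval, hk _ _ (by omega), l2]
    · rw [NExpr.eval, hk _ _ (by omega), l3]
    · rw [NExpr.eval, hk _ _ (by omega), l4]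
    · rw [NExpr.eval, State.setNat_nat_same, ← Nat.add_assoc, ← Nat.mod_add_mod,
        ← hslot, ht, Nat.mod_self]
    · rw [NExpr.eval, hk _ _ (by omega), l6]
    · rw [NExpr.eval, hk _ _ (by omega), l7]
  · simp only [Test.Holds, NExpr.eval, reg, vertexAt, l1.2 3 (by omega), l1.2 2 (by omega),
      l1.2 7 (by omega), l1.2 8 (by omega), hv, l5, h3] at ht
    refine ⟨l1, l2, l3, l4, ?_, l6, l7⟩
    have hlt : s'.nat 9 0 < s₀.nat 3 g.fst := by rw [hslot]; exact Nat.mod_lt _ hd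
    rw [l5, ← Nat.add_assoc, ← Nat.mod_add_mod, ← hslot, Nat.mod_eq_of_lt (by omega)]
  refine Does.cond (fun ht => ?_) (fun ht => Does.skip ?_)
  · simp only [Test.Holds, NExpr.eval, reg, m3, m4] at ht
    have w4 : w.nat 4 = s₀.nat 4 := by rw [m1.2 4 (by omega), hI 4 (by omega)]
    refine Does.seq (Q := fun x => Keeps s x ∧ x.nat 15 0 = 4 * g.fst ∧ x.nat 14 0 = tg ∧
      x.nat 10 0 = R.rsum g (j + 1) ∧ x.nat 9 0 = (b + (j + 1)) % s₀.nat 3 g.fst ∧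
      x.nat 11 0 = ((P.rot ^ (j + 1)) g).snd) (Does.nset ?_)
      fun x ⟨o1, o2, o3, o4, o5, o6⟩ => Does.nset ?_
    · have hk := fun a x (ha : a ≠ 11) => State.setNat_nat_ne w 0 x ha
      refine ⟨m1.setNat _ _ (by omega) (by omega), ?_, ?_, ?_, ?_, ?_⟩
      · rw [NExpr.eval, hk _ _ (by omega), m2]
      · rw [NExpr.eval, hk _ _ (by omega), m3]
      · rw [NExpr.eval, hk _ _ (by omega), m4]
      · rw [NExpr.eval, hk _ _ (by omega), m5]
      · rw [NExpr.eval, State.setNat_nat_same]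
        simp only [NExpr.eval, reg, w4, m2, m5, (hb (j + 1)).1]
    · have hk := fun a y (ha : a ≠ 12) => State.setNat_nat_ne x 0 y ha
      refine ⟨o1.setNat _ _ (by omega) (by omega), ?_, ?_, ?_, ?_, Or.inl ⟨?_, j + 1, ht, ?_⟩⟩
      · rw [NExpr.eval, hk _ _ (by omega), o2]
      · rw [NExpr.eval, hk _ _ (by omega), o3]
      · rw [NExpr.eval, hk _ _ (by omega), o4]
      · rw [NExpr.eval, hk _ _ (by omega), o5, h3]
      · rw [NExpr.eval, State.setNat_nat_same, NExpr.eval]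
      · rw [NExpr.eval, hk _ _ (by omega), o6]
  · simp only [Test.Holds, NExpr.eval, reg, m3, m4] at ht
    refine ⟨m1, m2, m3, m4, by rw [m5, h3], ?_⟩
    rw [m6, m7]
    refine h.found.imp id fun ⟨h1, h2⟩ => ⟨h1, fun i hi hij => ?_⟩
    rcases Nat.lt_or_eq_of_le hij with hlt | rfl
    · exact h2 i hi (by omega)
    · exact ht

/-- Registers 11 and 12 hold the head of the north edge at the vertex `v` and whether it exists. -/
def NorthOf (R : Rep P) (v : Fin n) (s' : State) : Prop :=
  (s'.nat 12 0 = 1 ∧ ∃ d : P.G.Dart, d.fst = v ∧ R.dir d = 3 ∧ s'.nat 11 0 = d.snd) ∨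
    (s'.nat 12 0 = 0 ∧ ∀ d : P.G.Dart, d.fst = v → R.dir d ≠ 3)

/-- The search for the north edge at the tail of `g`, where `g` is the east edge to the next vertex or
the west edge to the preceding one. Three steps suffice to find the slot of `g`, and three turns to
reach all other edges, since the degree is at most four. -/
theorem does_findNorth (hV : R.Valid) (hE : Encodes R A s₀) (hI : SameInput s₀ s) (g : P.G.Dart)
    (hv : s.nat 2 (s.nat 7 0 + s.nat 8 0) = g.fst)
    (hg : (s.nat 8 0 + 1 < s.nat 1 (s.nat 6 0) ∧ s.nat 2 (s.nat 7 0 + (s.nat 8 0 + 1)) = g.snd ∧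
      R.dir g = 0) ∨ (¬ s.nat 8 0 + 1 < s.nat 1 (s.nat 6 0) ∧
      s.nat 2 (s.nat 7 0 + (s.nat 8 0 - 1)) = g.snd ∧ R.dir g = 2)) :
    Does findNorth s (fun s' => Keeps s s' ∧ NorthOf R g.fst s') := by
  obtain ⟨b, hb3, hbd, hb1, hb2⟩ := hE.exists_slot hV g
  have hb0 : s₀.nat 4 (4 * g.fst + b) = g.snd := by
    have := (hb2 0).1
    rwa [Nat.add_zero, Nat.mod_eq_of_lt hbd] at this
  -- the angle from `g` to the north edge
  obtain ⟨tg, htg, htg0⟩ : ∃ tg : ℕ, (∀ i, (R.rsum g i = tg → R.dir ((P.rot ^ i) g) = 3) ∧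
      (R.rsum g i < 4 → R.dir ((P.rot ^ i) g) = 3 → R.rsum g i = tg)) ∧
      ((s.nat 8 0 + 1 < s.nat 1 (s.nat 6 0) ∧ s.nat 2 (s.nat 7 0 + (s.nat 8 0 + 1)) = g.snd ∧
      tg = 1) ∨ (¬ s.nat 8 0 + 1 < s.nat 1 (s.nat 6 0) ∧
      s.nat 2 (s.nat 7 0 + (s.nat 8 0 - 1)) = g.snd ∧ tg = 3)) := by
    rcases hg with ⟨h1, h2, h3⟩ | ⟨h1, h2, h3⟩
    · refine ⟨1, fun i => ?_, Or.inl ⟨h1, h2, rfl⟩⟩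
      rw [dir_rot_pow hV, h3]
      generalize R.rsum g i = x
      refine ⟨fun h => by rw [h]; rfl, fun hx => ?_⟩
      interval_cases x <;> decide
    · refine ⟨3, fun i => ?_, Or.inr ⟨h1, h2, rfl⟩⟩
      rw [dir_rot_pow hV, h3]
      generalize R.rsum g i = x
      refine ⟨fun h => by rw [h]; rfl, fun hx => ?_⟩
      interval_cases x <;> decide
  have htg1 : 1 ≤ tg := by omega
  unfold findNorth
  refine Does.seq (Q := fun t => Keeps s t ∧ t.nat 9 0 = 0) (Does.nset
    ⟨(Keeps.refl s).setNat _ _ (by omega) (by omega), State.setNat_nat_same _ _ _ _⟩)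
    fun t ⟨k1, k2⟩ => ?_
  clear hg
  refine Does.seq (Q := fun t => Keeps s t ∧ t.nat 9 0 = 0 ∧ t.nat 10 0 = 0) (Does.nset
    ⟨k1.setNat _ _ (by omega) (by omega), ?_, State.setNat_nat_same _ _ _ _⟩)
    fun t ⟨k1, k2, k3⟩ => ?_
  · rw [State.setNat_nat_ne _ _ _ (by omega), k2]
  refine Does.seq (Q := fun t => Keeps s t ∧ t.nat 9 0 = 0 ∧ t.nat 10 0 = 0 ∧ t.nat 12 0 = 0)
    (Does.nset ⟨k1.setNat _ _ (by omega) (by omega), ?_, ?_, State.setNat_nat_same _ _ _ _⟩)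
    fun t ⟨k1, k2, k3, k4⟩ => ?_
  · rw [State.setNat_nat_ne _ _ _ (by omega), k2]
  · rw [State.setNat_nat_ne _ _ _ (by omega), k3]
  refine Does.seq (Q := fun t => Keeps s t ∧ t.nat 9 0 = 0 ∧ t.nat 10 0 = 0 ∧ t.nat 12 0 = 0 ∧
    t.nat 15 0 = 4 * g.fst)
    (Does.nset ⟨k1.setNat _ _ (by omega) (by omega), ?_, ?_, ?_, ?_⟩)
    fun t ⟨k1, k2, k3, k4, k5⟩ => ?_
  · rw [State.setNat_nat_ne _ _ _ (by omega), k2]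
  · rw [State.setNat_nat_ne _ _ _ (by omega), k3]
  · rw [State.setNat_nat_ne _ _ _ (by omega), k4]
  · rw [NExpr.eval, State.setNat_nat_same]
    simp only [NExpr.eval, reg, vertexAt, k1.2 2 (by omega), k1.2 7 (by omega), k1.2 8 (by omega),
      hv]
    omega
  refine Does.seq (Q := Searching s g tg (min 0 b)) (Does.cond (fun ht => ?_) fun ht => ?_)
    fun t ht => ?_
  · simp only [Test.Holds, NExpr.eval, reg, k1.2 1 (by omega), k1.2 6 (by omega),
      k1.2 8 (by omega)] at ht
    refine Does.seq (Q := fun t => Keeps s t ∧ t.nat 9 0 = 0 ∧ t.nat 10 0 = 0 ∧ t.nat 12 0 = 0 ∧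
      t.nat 15 0 = 4 * g.fst ∧ t.nat 13 0 = g.snd) (Does.nset
      ⟨k1.setNat _ _ (by omega) (by omega), ?_, ?_, ?_, ?_, ?_⟩)
      fun t ⟨k1, k2, k3, k4, k5, k6⟩ => Does.nset
      ⟨k1.setNat _ _ (by omega) (by omega), ?_, ?_, ?_, ?_, ?_, ?_⟩
    · rw [State.setNat_nat_ne _ _ _ (by omega), k2]
    · rw [State.setNat_nat_ne _ _ _ (by omega), k3]
    · rw [State.setNat_nat_ne _ _ _ (by omega), k4]
    · rw [State.setNat_nat_ne _ _ _ (by omega), k5]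
    · rw [NExpr.eval, State.setNat_nat_same]
      simp only [NExpr.eval, reg, vertexAt, k1.2 2 (by omega), k1.2 7 (by omega),
        k1.2 8 (by omega)]
      omega
    · rw [State.setNat_nat_ne _ _ _ (by omega), k5]
    · rw [NExpr.eval, State.setNat_nat_same, NExpr.eval]
      omega
    · rw [State.setNat_nat_ne _ _ _ (by omega), k3]
    · rw [State.setNat_nat_ne _ _ _ (by omega), k4]
    · rw [State.setNat_nat_ne _ _ _ (by omega), k6]
    · rw [State.setNat_nat_ne _ _ _ (by omega), k2, Nat.zero_min]
  · simp only [Test.Holds, NExpr.eval, reg, k1.2 1 (by omega), k1.2 6 (by omega),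
      k1.2 8 (by omega)] at ht
    refine Does.seq (Q := fun t => Keeps s t ∧ t.nat 9 0 = 0 ∧ t.nat 10 0 = 0 ∧ t.nat 12 0 = 0 ∧
      t.nat 15 0 = 4 * g.fst ∧ t.nat 13 0 = g.snd) (Does.nset
      ⟨k1.setNat _ _ (by omega) (by omega), ?_, ?_, ?_, ?_, ?_⟩)
      fun t ⟨k1, k2, k3, k4, k5, k6⟩ => Does.nset
      ⟨k1.setNat _ _ (by omega) (by omega), ?_, ?_, ?_, ?_, ?_, ?_⟩
    · rw [State.setNat_nat_ne _ _ _ (by omega), k2]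
    · rw [State.setNat_nat_ne _ _ _ (by omega), k3]
    · rw [State.setNat_nat_ne _ _ _ (by omega), k4]
    · rw [State.setNat_nat_ne _ _ _ (by omega), k5]
    · rw [NExpr.eval, State.setNat_nat_same]
      simp only [NExpr.eval, reg, vertexAt, k1.2 2 (by omega), k1.2 7 (by omega),
        k1.2 8 (by omega)]
      omega
    · rw [State.setNat_nat_ne _ _ _ (by omega), k5]
    · rw [NExpr.eval, State.setNat_nat_same, NExpr.eval]
      omega
    · rw [State.setNat_nat_ne _ _ _ (by omega), k3]
    · rw [State.setNat_nat_ne _ _ _ (by omega), k4]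
    · rw [State.setNat_nat_ne _ _ _ (by omega), k6]
    · rw [State.setNat_nat_ne _ _ _ (by omega), k2, Nat.zero_min]
  refine Does.seq (ht.step hI hb1 hb0) fun t ht => ?_
  refine Does.seq (ht.step hI hb1 hb0) fun t ht => ?_
  refine Does.seq (Q := Turning R s g tg b 0) (Runs.mono (ht.step hI hb1 hb0) le_rfl
    fun t ht => ?_) fun t ht => ?_
  · refine ⟨ht.keeps, ht.first, ht.target, ht.sum, ?_, Or.inr ⟨ht.found, fun i _ _ => by omega⟩⟩
    rw [ht.slot, hI 3 (by omega), Nat.add_zero b, Nat.mod_eq_of_lt hbd, min_eq_right hb3]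
  have hd : 0 < s₀.nat 3 g.fst := by omega
  refine Does.seq (ht.step hI hv hd hb2) fun t ht => ?_
  refine Does.seq (ht.step hI hv hd hb2) fun t ht => ?_
  refine Runs.mono (ht.step hI hv hd hb2) le_rfl fun t ht => ⟨ht.keeps, ?_⟩
  refine ht.found.imp (fun ⟨h1, i, h2, h3⟩ => ⟨h1, _, rot_pow_fst g i, (htg i).1 h2, h3⟩)
    fun ⟨h1, h2⟩ => ⟨h1, fun d hd hd3 => ?_⟩
  obtain ⟨i, hi, rfl⟩ := exists_rot_pow hd
  have h4 := rsum_lt hV hi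
  have h5 := (htg i).2 h4 hd3
  have h6 := le_rsum (R := R) g i
  refine h2 i (Nat.pos_of_ne_zero ?_) (by omega) h5
  rintro rfl
  simp [rsum] at h5
  omega

end north

/-! ### Placing a segment -/

section segment
variable {n : ℕ} {P : PlaneGraph n} {R : Rep P} {A : List (List (Fin n))} {s₀ s s' : State}
  {S : List (Fin n)} {i o k : ℕ} {η : ℚ}

/-- No north edge starts at the vertex `v`. -/
def NoNorth (R : Rep P) (v : Fin n) : Prop := ∀ d : P.G.Dart, d.fst = v → R.dir d ≠ 3

/-- The effect of placing the vertex `v` with predecessor `u` on the segment. -/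
structure VertexPlaced (R : Rep P) (v : Fin n) (u : ℕ) (s s' : State) : Prop where
  nat : ∀ a < 8, s'.nat a = s.nat a
  pos : s'.nat 8 0 = s.nat 8 0 + 1
  radius : s'.rat 0 v = (s.nat 0 0 - s.nat 6 0 : ℕ)
  radius_ne : ∀ j ≠ (v : ℕ), s'.rat 0 j = s.rat 0 j
  step : s'.rat 2 = s.rat 2
  angle_ne : ∀ j ≠ (v : ℕ), s'.rat 1 j = s.rat 1 j
  north : ∀ d : P.G.Dart, d.fst = v → R.dir d = 3 → s'.rat 1 v = s.rat 1 d.snd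
  next : NoNorth R v → s.nat 8 0 ≠ 0 → s'.rat 1 v = s.rat 1 u - s.rat 2 0
  first : (NoNorth R v ∧ s'.nat 17 0 = s.nat 17 0 ∧ s'.nat 16 0 = s.nat 16 0) ∨
    ((∃ d : P.G.Dart, d.fst = v ∧ R.dir d = 3) ∧
      ((s.nat 17 0 = 0 ∧ s'.nat 17 0 = 1 ∧ s'.nat 16 0 = s.nat 8 0) ∨
        (s.nat 17 0 ≠ 0 ∧ s'.nat 17 0 = s.nat 17 0 ∧ s'.nat 16 0 = s.nat 16 0)))

/-- The vertex is placed below the head of its north edge, or one step east of its predecessor. The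
angle of the first vertex is left open if it has no north edge. -/
theorem does_placeVertex (hV : R.Valid) (hE : Encodes R A s₀) (hI : SameInput s₀ s) (g : P.G.Dart)
    (hv : s.nat 2 (s.nat 7 0 + s.nat 8 0) = g.fst)
    (hg : (s.nat 8 0 + 1 < s.nat 1 (s.nat 6 0) ∧ s.nat 2 (s.nat 7 0 + (s.nat 8 0 + 1)) = g.snd ∧
      R.dir g = 0) ∨ (¬ s.nat 8 0 + 1 < s.nat 1 (s.nat 6 0) ∧
      s.nat 2 (s.nat 7 0 + (s.nat 8 0 - 1)) = g.snd ∧ R.dir g = 2)) :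
    Does placeVertex s (VertexPlaced R g.fst (s.nat 2 (s.nat 7 0 + (s.nat 8 0 - 1))) s) := by
  refine Does.seq (does_findNorth hV hE hI g hv hg) fun t ⟨k1, k2⟩ => ?_
  clear hg
  have hvt : (vertexAt (reg 8)).eval t = g.fst := by
    simp only [NExpr.eval, reg, vertexAt, k1.2 2 (by omega), k1.2 7 (by omega), k1.2 8 (by omega),
      hv]
  refine Does.seq (Q := fun x => x = t.setRat 0 g.fst (s.nat 0 0 - s.nat 6 0 : ℕ))
    (Does.qset ?_) fun x hx => ?_
  · rw [hvt]
    simp only [QExpr.eval, NExpr.eval, reg, k1.2 0 (by omega), k1.2 6 (by omega)]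
  have hnat : x.nat = t.nat := by rw [hx]; rfl
  have hvx : (vertexAt (reg 8)).eval x = g.fst := by
    simpa only [NExpr.eval, reg, vertexAt, hnat] using hvt
  have hr0 : x.rat 0 g.fst = (s.nat 0 0 - s.nat 6 0 : ℕ) := by rw [hx, State.setRat_rat_same]
  have hr0' : ∀ j ≠ (g.fst : ℕ), x.rat 0 j = s.rat 0 j := fun j hj => by
    rw [hx, State.setRat_rat_ne_index _ _ _ hj, k1.1]
  have hr1 : x.rat 1 = s.rat 1 := by rw [hx, State.setRat_rat_ne _ _ _ (by omega), k1.1]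
  have hr2 : x.rat 2 = s.rat 2 := by rw [hx, State.setRat_rat_ne _ _ _ (by omega), k1.1]
  refine Does.seq (Q := fun y => (∀ a < 8, y.nat a = s.nat a) ∧ y.nat 8 0 = s.nat 8 0 ∧
    y.rat 0 = x.rat 0 ∧ y.rat 2 = s.rat 2 ∧ (∀ j ≠ (g.fst : ℕ), y.rat 1 j = s.rat 1 j) ∧
    (∀ d : P.G.Dart, d.fst = g.fst → R.dir d = 3 → y.rat 1 g.fst = s.rat 1 d.snd) ∧
    (NoNorth R g.fst → s.nat 8 0 ≠ 0 →
      y.rat 1 g.fst = s.rat 1 (s.nat 2 (s.nat 7 0 + (s.nat 8 0 - 1))) - s.rat 2 0) ∧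
    ((NoNorth R g.fst ∧ y.nat 17 0 = s.nat 17 0 ∧ y.nat 16 0 = s.nat 16 0) ∨
    ((∃ d : P.G.Dart, d.fst = g.fst ∧ R.dir d = 3) ∧
      ((s.nat 17 0 = 0 ∧ y.nat 17 0 = 1 ∧ y.nat 16 0 = s.nat 8 0) ∨
        (s.nat 17 0 ≠ 0 ∧ y.nat 17 0 = s.nat 17 0 ∧ y.nat 16 0 = s.nat 16 0)))))
    (Does.cond (fun ht => ?_) (fun ht => ?_)) fun y ⟨l1, l2, l3, l4, l5, l6, l7, l8⟩ => Does.nset ?_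
  · simp only [Test.Holds, NExpr.eval, reg, hnat] at ht
    obtain ⟨d, hd, hd3, hd11⟩ : ∃ d : P.G.Dart, d.fst = g.fst ∧ R.dir d = 3 ∧
        t.nat 11 0 = d.snd := by
      rcases k2 with ⟨-, h⟩ | ⟨h, -⟩
      · exact h
      · omega
    refine Does.seq (Q := fun y => y = x.setRat 1 g.fst (s.rat 1 d.snd)) (Does.qset ?_)
      fun y hy => ?_
    · rw [hvx]
      simp only [QExpr.eval, NExpr.eval, reg, hnat, hd11, hr1]
    have hyn : y.nat = t.nat := by rw [hy, ← hnat]; rfl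
    have hy0 : y.rat 0 = x.rat 0 := by rw [hy, State.setRat_rat_ne _ _ _ (by omega)]
    have hy2 : y.rat 2 = s.rat 2 := by rw [hy, State.setRat_rat_ne _ _ _ (by omega), hr2]
    have hy1 : ∀ j ≠ (g.fst : ℕ), y.rat 1 j = s.rat 1 j := fun j hj => by
      rw [hy, State.setRat_rat_ne_index _ _ _ hj, hr1]
    have hyN : ∀ d : P.G.Dart, d.fst = g.fst → R.dir d = 3 → y.rat 1 g.fst = s.rat 1 d.snd := by
      intro e he he3
      rw [hy, State.setRat_rat_same, eq_of_dir_eq hV (he.trans hd.symm) (he3.trans hd3.symm)]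
    have hno : ¬ NoNorth R g.fst := fun h => h d hd hd3
    refine Does.cond (fun hc => ?_) (fun hc => Does.skip ?_)
    · simp only [Test.Holds, NExpr.eval, reg, hyn, k1.2 17 (by omega)] at hc
      refine Does.seq (Q := fun z => z.rat = y.rat ∧ z.nat 17 0 = 1 ∧ ∀ a < 9, z.nat a = s.nat a)
        (Does.nset ⟨rfl, State.setNat_nat_same _ _ _ _, fun a ha => ?_⟩)
        fun z ⟨hz1, hz2, hz3⟩ => Does.nset ?_
      · rw [State.setNat_nat_ne _ _ _ (by omega), hyn, k1.2 a (by omega)]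
      · refine ⟨fun a ha => ?_, ?_, ?_, ?_, ?_, ?_, fun h => absurd h hno,
          Or.inr ⟨⟨d, hd, hd3⟩, Or.inl ⟨hc, ?_, ?_⟩⟩⟩
        · rw [State.setNat_nat_ne _ _ _ (by omega), hz3 a (by omega)]
        · rw [State.setNat_nat_ne _ _ _ (by omega), hz3 8 (by omega)]
        · rw [← hy0, ← hz1]; rfl
        · rw [← hy2, ← hz1]; rfl
        · rw [← hz1] at hy1; exact hy1
        · rw [← hz1] at hyN; exact hyN
        · rw [State.setNat_nat_ne _ _ _ (by omega), hz2]
        · rw [NExpr.eval, State.setNat_nat_same]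
          simp only [NExpr.eval, reg, hz3 8 (by omega)]
    · simp only [Test.Holds, NExpr.eval, reg, hyn, k1.2 17 (by omega)] at hc
      refine ⟨fun a ha => by rw [hyn, k1.2 a (by omega)], by rw [hyn, k1.2 8 (by omega)], hy0, hy2,
        hy1, hyN, fun h => absurd h hno, Or.inr ⟨⟨d, hd, hd3⟩, Or.inr ⟨hc, ?_, ?_⟩⟩⟩
      · rw [hyn, k1.2 17 (by omega)]
      · rw [hyn, k1.2 16 (by omega)]
  · simp only [Test.Holds, NExpr.eval, reg, hnat] at ht
    have hno : NoNorth R g.fst := by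
      rcases k2 with ⟨h, -⟩ | ⟨-, h⟩
      · exact absurd h ht
      · exact h
    refine Does.cond (fun hc => Does.skip ?_) (fun hc => Does.qset ?_)
    · simp only [Test.Holds, NExpr.eval, reg, hnat, k1.2 8 (by omega)] at hc
      refine ⟨fun a ha => by rw [hnat, k1.2 a (by omega)], by rw [hnat, k1.2 8 (by omega)], rfl, hr2,
        fun j _ => by rw [hr1], fun d hd hd3 => absurd hd3 (hno d hd), fun _ h => absurd hc h,
        Or.inl ⟨hno, ?_, ?_⟩⟩
      · rw [hnat, k1.2 17 (by omega)]
      · rw [hnat, k1.2 16 (by omega)]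
    · rw [hvx]
      refine ⟨fun a ha => ?_, ?_, ?_, ?_, fun j hj => ?_, fun d hd hd3 => absurd hd3 (hno d hd),
        fun _ _ => ?_, Or.inl ⟨hno, ?_, ?_⟩⟩
      · rw [← k1.2 a (by omega), ← hnat]; rfl
      · rw [← k1.2 8 (by omega), ← hnat]; rfl
      · rw [State.setRat_rat_ne _ _ _ (by omega)]
      · rw [State.setRat_rat_ne _ _ _ (by omega), hr2]
      · rw [State.setRat_rat_ne_index _ _ _ hj, hr1]
      · rw [State.setRat_rat_same]
        simp only [QExpr.eval, NExpr.eval, reg, vertexAt, hnat, k1.2 2 (by omega),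
          k1.2 7 (by omega), k1.2 8 (by omega), hr1, hr2]
      · rw [← k1.2 17 (by omega), ← hnat]; rfl
      · rw [← k1.2 16 (by omega), ← hnat]; rfl
  · refine ⟨fun a ha => ?_, ?_, ?_, fun j hj => ?_, l4, l5, l6, l7, ?_⟩
    · rw [State.setNat_nat_ne _ _ _ (by omega), l1 a ha]
    · rw [NExpr.eval, State.setNat_nat_same]
      simp only [NExpr.eval, reg, l2]
    · rw [← hr0, ← l3]; rfl
    · rw [← hr0' j hj, ← l3]; rfl
    · rw [State.setNat_nat_ne _ _ _ (by omega), State.setNat_nat_ne _ _ _ (by omega)]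
      exact l8

/-- The loop over the segment `S` has placed its first `q` vertices, starting in the state `s`. -/
structure Forward (R : Rep P) (S : List (Fin n)) (s : State) (q : ℕ) (s' : State) : Prop where
  nat : ∀ a < 8, s'.nat a = s.nat a
  pos : s'.nat 8 0 = q
  step : s'.rat 2 = s.rat 2
  radius_ne : ∀ j, (∀ v ∈ S, j ≠ (v : ℕ)) → s'.rat 0 j = s.rat 0 j
  angle_ne : ∀ j, (∀ v ∈ S, j ≠ (v : ℕ)) → s'.rat 1 j = s.rat 1 j
  radius : ∀ (p : ℕ) (hp : p < S.length), p < q → s'.rat 0 S[p] = (s.nat 0 0 - s.nat 6 0 : ℕ)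
  north : ∀ (p : ℕ) (hp : p < S.length), p < q → ∀ d : P.G.Dart, d.fst = S[p] → R.dir d = 3 →
    s'.rat 1 S[p] = s.rat 1 d.snd
  next : ∀ (p : ℕ) (hp : p + 1 < S.length), p + 1 < q → NoNorth R S[p + 1] →
    s'.rat 1 S[p + 1] = s'.rat 1 S[p] - s.rat 2 0
  first : (s'.nat 17 0 = 0 ∧ s'.nat 16 0 = 0 ∧ ∀ (p : ℕ) (hp : p < S.length), p < q →
      NoNorth R S[p]) ∨
    (s'.nat 17 0 ≠ 0 ∧ s'.nat 16 0 < q ∧ (∀ hp : s'.nat 16 0 < S.length, ¬ NoNorth R S[s'.nat 16 0])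
      ∧ ∀ (p : ℕ) (hp : p < S.length), p < s'.nat 16 0 → NoNorth R S[p])

/-- Placing the next vertex does not interfere with the others: the heads of north edges are not on
the segment. -/
theorem Forward.succ {q : ℕ} {s'' : State} (hS : S.Nodup)
    (hn : ∀ d : P.G.Dart, R.dir d = 3 → d.fst ∈ S → d.snd ∉ S) (h : Forward R S s q s')
    (hq : q < S.length) {u : ℕ} (hu : ∀ p (hp : p + 1 = q), u = S[p])
    (h' : VertexPlaced R S[q] u s' s'') : Forward R S s (q + 1) s'' := by
  have hne : ∀ p (hp : p < S.length), p ≠ q → (S[p] : ℕ) ≠ S[q] := fun p hp hpq he =>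
    hpq ((hS.getElem_inj_iff).1 (Fin.ext he))
  refine ⟨fun a ha => by rw [h'.nat a ha, h.nat a ha], by rw [h'.pos, h.pos], h'.step.trans h.step,
    fun j hj => ?_, fun j hj => ?_, fun p hp hpq => ?_, fun p hp hpq d hd hd3 => ?_,
    fun p hp hpq hno => ?_, ?_⟩
  · rw [h'.radius_ne j (hj _ (List.getElem_mem hq)), h.radius_ne j hj]
  · rw [h'.angle_ne j (hj _ (List.getElem_mem hq)), h.angle_ne j hj]
  · rcases Nat.lt_succ_iff_lt_or_eq.1 hpq with hlt | rfl
    · rw [h'.radius_ne _ (hne p hp hlt.ne), h.radius p hp hlt]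
    · rw [h'.radius, h.nat 0 (by omega), h.nat 6 (by omega)]
  · rcases Nat.lt_succ_iff_lt_or_eq.1 hpq with hlt | rfl
    · rw [h'.angle_ne _ (hne p hp hlt.ne), h.north p hp hlt d hd hd3]
    · rw [h'.north d hd hd3]
      refine h.angle_ne _ fun v hv he => hn d hd3 (by rw [hd]; exact List.getElem_mem hp) ?_
      rwa [Fin.ext he]
  · rcases Nat.lt_succ_iff_lt_or_eq.1 hpq with hlt | rfl
    · rw [h'.angle_ne _ (hne _ hp hlt.ne), h'.angle_ne _ (hne p (by omega) (by omega)),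
        h.next p hp hlt hno]
    · rw [h'.next hno (by rw [h.pos]; omega), h'.angle_ne _ (hne p (by omega) (by omega)),
        hu p rfl, h.step]
  · rcases h'.first with ⟨h1, h2, h3⟩ | ⟨⟨d, hd, hd3⟩, h1⟩
    · rw [h2, h3]
      refine h.first.imp (fun ⟨h4, h5, h6⟩ => ⟨h4, h5, fun p hp hpq => ?_⟩)
        fun ⟨h4, h5, h6⟩ => ⟨h4, by omega, h6⟩
      rcases Nat.lt_succ_iff_lt_or_eq.1 hpq with hlt | rfl
      · exact h6 p hp hlt
      · exact h1
    · refine Or.inr ?_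
      rcases h1 with ⟨h1, h2, h3⟩ | ⟨h1, h2, h3⟩
      · rw [h2, h3, h.pos]
        refine ⟨by omega, by omega, fun _ hc => hc d hd hd3, fun p hp hpq => ?_⟩
        rcases h.first with ⟨-, -, h4⟩ | ⟨h4, -⟩
        · exact h4 p hp hpq
        · exact absurd h1 h4
      · rw [h2, h3]
        rcases h.first with ⟨h4, -⟩ | ⟨h4, h5, h6⟩
        · exact absurd h4 h1
        · exact ⟨h4, by omega, h6⟩

/-- The segment `S` has been placed, starting in the state `s`, except for the vertices before
position `f`. -/
structure Backward (R : Rep P) (S : List (Fin n)) (s : State) (f : ℕ) (s' : State) : Prop where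
  nat : ∀ a < 8, s'.nat a = s.nat a
  pos : s'.nat 16 0 = f
  lt : f < S.length
  step : s'.rat 2 = s.rat 2
  radius_ne : ∀ j, (∀ v ∈ S, j ≠ (v : ℕ)) → s'.rat 0 j = s.rat 0 j
  angle_ne : ∀ j, (∀ v ∈ S, j ≠ (v : ℕ)) → s'.rat 1 j = s.rat 1 j
  radius : ∀ v ∈ S, s'.rat 0 v = (s.nat 0 0 - s.nat 6 0 : ℕ)
  north : ∀ d : P.G.Dart, d.fst ∈ S → R.dir d = 3 → s'.rat 1 d.fst = s.rat 1 d.snd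
  next : ∀ (p : ℕ) (hp : p + 1 < S.length), f ≤ p → (NoNorth R S[p + 1] ∨
    ∀ (m : ℕ) (hm : m ≤ p), NoNorth R S[m]) → s'.rat 1 S[p + 1] = s'.rat 1 S[p] - s.rat 2 0
  before : ∀ (p : ℕ) (hp : p < S.length), p < f → NoNorth R S[p]

/-- The vertices that have been placed by the loop over the segment stay in place, except for those
before the first north edge. -/
theorem Forward.backward (h : Forward R S s S.length s') (hS : 0 < S.length) :
    Backward R S s (s'.nat 16 0) s' := by
  refine ⟨h.nat, rfl, ?_, h.step, h.radius_ne, h.angle_ne, fun v hv => ?_, fun d hd hd3 => ?_,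
    fun p hp hf hno => ?_, fun p hp hpf => ?_⟩
  · rcases h.first with ⟨-, h1, -⟩ | ⟨-, h1, -⟩ <;> omega
  · obtain ⟨p, hp, rfl⟩ := List.getElem_of_mem hv
    exact h.radius p hp hp
  · obtain ⟨p, hp, hpd⟩ := List.getElem_of_mem hd
    rw [← hpd]
    exact h.north p hp hp d hpd.symm hd3
  · refine h.next p hp hp (hno.elim id fun hno => ?_)
    rcases h.first with ⟨-, -, h1⟩ | ⟨-, h1, h2, -⟩
    · exact h1 _ hp hp
    · exact absurd (hno _ hf) (h2 h1)
  · rcases h.first with ⟨-, h1, -⟩ | ⟨-, -, -, h1⟩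
    · omega
    · exact h1 p hp hpf

/-- Before the first north edge, each vertex is placed one step west of its successor. -/
theorem Backward.step_down {f : ℕ} (hS : S.Nodup) (h : Backward R S s (f + 1) s')
    (hv : ∀ q (hq : q < S.length), s.nat 2 (s.nat 7 0 + q) = S[q]) :
    Does placeBefore s' (Backward R S s f) := by
  have hlt := h.lt
  refine Does.seq (Q := fun t => t.rat = s'.rat ∧ (∀ a < 8, t.nat a = s.nat a) ∧ t.nat 16 0 = f)
    (Does.nset ⟨rfl, fun a ha => ?_, ?_⟩) fun t ⟨h1, h2, h3⟩ => Does.qset ?_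
  · rw [State.setNat_nat_ne _ _ _ (by omega), h.nat a ha]
  · rw [NExpr.eval, State.setNat_nat_same]
    simp only [NExpr.eval, reg, h.pos]
    omega
  have hf : (vertexAt (reg 16)).eval t = S[f] := by
    simp only [NExpr.eval, reg, vertexAt, h2 2 (by omega), h2 7 (by omega), h3, hv f (by omega)]
  have hx : QExpr.eval t (.add (.arr 1 (vertexAt (.add (reg 16) (.lit 1)))) (.arr 2 (.lit 0))) =
      s'.rat 1 S[f + 1] + s.rat 2 0 := by
    simp only [QExpr.eval, NExpr.eval, reg, vertexAt, h2 2 (by omega), h2 7 (by omega), h3,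
      hv (f + 1) hlt, h1, h.step]
  rw [hf, hx]
  have hne : ∀ p (hp : p < S.length), p ≠ f → (S[p] : ℕ) ≠ S[f] := fun p hp hpq he =>
    hpq ((hS.getElem_inj_iff).1 (Fin.ext he))
  refine ⟨fun a ha => h2 a ha, h3, by omega, ?_, fun j hj => ?_, fun j hj => ?_, fun v hv => ?_,
    fun d hd hd3 => ?_, fun p hp hfp hno => ?_, fun p hp hpf => h.before p hp (by omega)⟩
  · rw [State.setRat_rat_ne _ _ _ (by omega), h1, h.step]
  · rw [State.setRat_rat_ne _ _ _ (by omega), h1, h.radius_ne j hj]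
  · rw [State.setRat_rat_ne_index _ _ _ (hj _ (List.getElem_mem _)), h1, h.angle_ne j hj]
  · rw [State.setRat_rat_ne _ _ _ (by omega), h1, h.radius v hv]
  · rw [State.setRat_rat_ne_index, h1, h.north d hd hd3]
    intro he
    exact h.before f (by omega) (by omega) d (Fin.ext he) hd3
  · rcases Nat.lt_or_eq_of_le hfp with hlt' | rfl
    · rw [State.setRat_rat_ne_index _ _ _ (hne _ hp (by omega)),
        State.setRat_rat_ne_index _ _ _ (hne _ (by omega) (by omega)), h1,
        h.next p hp hlt' hno]
    · rw [State.setRat_rat_ne_index _ _ _ (hne _ hp (by omega)), State.setRat_rat_same, h1]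
      ring

end segment

section segment
variable {n : ℕ} {P : PlaneGraph n} {R : Rep P} {A : List (List (Fin n))} {s₀ s s' : State}
  {S : List (Fin n)} {i : ℕ}

/-- At each vertex of a segment there is a reference dart: the east dart to the next vertex, or the
west dart to the preceding vertex at the end of the segment. -/
theorem exists_reference (hV : R.Valid) (hS : R.IsSegment S) {q : ℕ} (hq : q < S.length) :
    ∃ g : P.G.Dart, g.fst = S[q] ∧
      ((∃ h : q + 1 < S.length, g.snd = S[q + 1] ∧ R.dir g = 0) ∨
        (¬ q + 1 < S.length ∧ g.snd = S[q - 1] ∧ R.dir g = 2)) := by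
  by_cases h : q + 1 < S.length
  · obtain ⟨d, h0, h1, h2⟩ := isSegment_east hV hS h
    exact ⟨d, h1, Or.inl ⟨h, h2, h0⟩⟩
  · have h2 := hS.two_le
    have hq1 : q - 1 + 1 < S.length := by omega
    obtain ⟨d, h0, h1, h2⟩ := isSegment_east hV hS hq1
    refine ⟨d.symm, ?_, Or.inr ⟨h, h1, by rw [dir_symm hV, h0]; rfl⟩⟩
    rw [show d.symm.fst = d.snd from rfl, h2]
    congr 1
    omega

/-- The effect of placing the segment `S`. -/
structure SegmentPlaced (R : Rep P) (S : List (Fin n)) (s s' : State) : Prop where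
  nat : ∀ a < 6, s'.nat a = s.nat a
  index : s'.nat 6 0 = s.nat 6 0 + 1
  offset : s'.nat 7 0 = s.nat 7 0 + S.length
  step : s'.rat 2 0 = s.rat 2 0 / S.length
  radius_ne : ∀ j, (∀ v ∈ S, j ≠ (v : ℕ)) → s'.rat 0 j = s.rat 0 j
  angle_ne : ∀ j, (∀ v ∈ S, j ≠ (v : ℕ)) → s'.rat 1 j = s.rat 1 j
  radius : ∀ v ∈ S, s'.rat 0 v = (s.nat 0 0 - s.nat 6 0 : ℕ)
  north : ∀ d : P.G.Dart, d.fst ∈ S → R.dir d = 3 → s'.rat 1 d.fst = s.rat 1 d.snd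
  next : ∀ (p : ℕ) (hp : p + 1 < S.length), (NoNorth R S[p + 1] ∨
    ∀ (m : ℕ) (hm : m ≤ p), NoNorth R S[m]) → s'.rat 1 S[p + 1] = s'.rat 1 S[p] - s'.rat 2 0

/-- The loop over the segment. Each vertex takes `6` for the test and at most `333` for the body, which
is `placeVertex.bound`. -/
theorem runs_forward (hV : R.Valid) (hE : Encodes R A s₀) (hI : SameInput s₀ s)
    (hS : R.IsSegment S) (hlen : s.nat 1 (s.nat 6 0) = S.length)
    (hv : ∀ q (hq : q < S.length), s.nat 2 (s.nat 7 0 + q) = S[q])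
    (hn : ∀ d : P.G.Dart, R.dir d = 3 → d.fst ∈ S → d.snd ∉ S) (h : Forward R S s 0 s) :
    Runs (.loop (.nlt (reg 8) (.arr 1 (reg 6))) placeVertex) s (Forward R S s S.length)
      (6 + 339 * S.length) := by
  have key := Runs.loop (b := .nlt (reg 8) (.arr 1 (reg 6))) (p := placeVertex)
    (I := fun m s' => m ≤ S.length ∧ Forward R S s (S.length - m) s')
    (Φ := fun m => 6 + 339 * m) (fun t ⟨_, ht⟩ => ?_) (Nat.le_refl 6)
    (fun m t ⟨hm, ht⟩ => ?_) S.length (s := s) ⟨le_rfl, by rwa [Nat.sub_self]⟩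
  · exact Runs.mono key le_rfl fun t ht => ht.2
  · simp only [Test.Holds, NExpr.eval, reg, ht.pos, ht.nat 1 (by omega), ht.nat 6 (by omega), hlen]
    omega
  · have hq : S.length - (m + 1) < S.length := by omega
    have hq1 : S.length - m = S.length - (m + 1) + 1 := by omega
    rw [hq1]
    generalize S.length - (m + 1) = q at *
    have hpos := ht.pos
    refine ⟨?_, placeVertex.bound, ?_, ?_⟩
    · simp only [Test.Holds, NExpr.eval, reg, hpos, ht.nat 1 (by omega), ht.nat 6 (by omega), hlen]
      exact hq
    · change 6 + 333 + (6 + 339 * m) ≤ 6 + 339 * (m + 1)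
      omega
    · obtain ⟨g, hg, hg'⟩ := exists_reference hV hS hq
      refine Runs.mono (does_placeVertex (s := t) hV hE (fun a ha => ?_) g ?_ ?_) le_rfl
        fun u hu => ⟨by omega, ht.succ hS.nodup hn hq ?_ (hg ▸ hu)⟩
      · rw [ht.nat a (by omega), hI a ha]
      · rw [ht.nat 2 (by omega), ht.nat 7 (by omega), hpos, hv q hq, hg]
      · rw [ht.nat 2 (by omega), ht.nat 7 (by omega), ht.nat 1 (by omega), ht.nat 6 (by omega),
          hpos, hlen]
        refine hg'.imp (fun ⟨h1, h2, h3⟩ => ⟨h1, ?_, h3⟩) fun ⟨h1, h2, h3⟩ => ⟨h1, ?_, h3⟩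
        · rw [hv _ h1, h2]
        · rw [hv (q - 1) (by omega), h2]
      · intro p hp
        rw [ht.nat 2 (by omega), ht.nat 7 (by omega), hpos, show q - 1 = p by omega,
          hv p (by omega)]

/-- The loop back from the first north edge. Each vertex takes `4` for the test and at most `25` for
the body, which is `placeBefore.bound`. -/
theorem runs_backward (hS : S.Nodup)
    (hv : ∀ q (hq : q < S.length), s.nat 2 (s.nat 7 0 + q) = S[q]) {f : ℕ}
    (h : Backward R S s f s') :
    Runs (.loop (.nlt (.lit 0) (reg 16)) placeBefore) s' (Backward R S s 0) (4 + 29 * f) := by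
  refine Runs.loop (b := .nlt (.lit 0) (reg 16)) (I := Backward R S s) (Φ := fun m => 4 + 29 * m) (fun t ht => ?_)
    (Nat.le_refl 4) (fun m t ht => ⟨?_, placeBefore.bound, ?_,
    ht.step_down hS hv⟩) f h
  · simp only [Test.Holds, NExpr.eval, reg, ht.pos]
    omega
  · simp only [Test.Holds, NExpr.eval, reg, ht.pos]
    omega
  · change 4 + 25 + (4 + 29 * m) ≤ 4 + 29 * (m + 1)
    omega

/-- Placing a segment takes time linear in its length: the constant costs of the initialization and of
the advance to the next segment are absorbed, as a segment is not empty. -/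
theorem runs_placeSegment (hV : R.Valid) (hE : Encodes R A s₀) (hI : SameInput s₀ s)
    (hS : R.IsSegment S) (hlen : s.nat 1 (s.nat 6 0) = S.length)
    (hv : ∀ q (hq : q < S.length), s.nat 2 (s.nat 7 0 + q) = S[q])
    (hn : ∀ d : P.G.Dart, R.dir d = 3 → d.fst ∈ S → d.snd ∉ S) :
    Runs placeSegment s (SegmentPlaced R S s) (410 * S.length) := by
  have h2 := hS.two_le
  -- the costs of the four parts; the loop back runs over less than the whole segment
  suffices h : Runs placeSegment s (SegmentPlaced R S s)
      (18 + ((6 + 339 * S.length) + ((4 + 29 * S.length) + 14))) from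
    Runs.mono h (by omega) fun _ h => h
  refine Runs.seq (Q := fun t => (∀ a < 8, t.nat a = s.nat a) ∧ t.rat 0 = s.rat 0 ∧
    t.rat 1 = s.rat 1 ∧ t.rat 2 0 = s.rat 2 0 / S.length ∧ t.nat 8 0 = 0 ∧ t.nat 16 0 = 0 ∧
    t.nat 17 0 = 0) (Does.seq (Q := fun t => t.nat = s.nat ∧ t.rat 0 = s.rat 0 ∧
    t.rat 1 = s.rat 1 ∧ t.rat 2 0 = s.rat 2 0 / S.length) (Does.qset ⟨rfl, ?_, ?_, ?_⟩)
    fun t ⟨h1, h2, h3, h4⟩ => Does.seq (Q := fun u => (∀ a < 8, u.nat a = s.nat a) ∧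
    u.rat = t.rat ∧ u.nat 8 0 = 0) (Does.nset ⟨fun a ha => ?_, rfl, State.setNat_nat_same _ _ _ _⟩)
    fun u ⟨k1, k2, k3⟩ => Does.seq (Q := fun w => (∀ a < 8, w.nat a = s.nat a) ∧
    w.rat = t.rat ∧ w.nat 8 0 = 0 ∧ w.nat 16 0 = 0) (Does.nset ⟨fun a ha => ?_, k2, ?_,
    State.setNat_nat_same _ _ _ _⟩) fun w ⟨l1, l2, l3, l4⟩ => Does.nset ⟨fun a ha => ?_, ?_, ?_,
    ?_, ?_, ?_, State.setNat_nat_same _ _ _ _⟩) fun t ⟨h1, h2, h3, h4, h5, h6, h7⟩ => ?_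
  · rw [State.setRat_rat_ne _ _ _ (by omega)]
  · rw [State.setRat_rat_ne _ _ _ (by omega)]
  · rw [NExpr.eval, State.setRat_rat_same]
    simp only [QExpr.eval, NExpr.eval, reg, hlen]
  · rw [State.setNat_nat_ne _ _ _ (by omega), h1]
  · rw [State.setNat_nat_ne _ _ _ (by omega), k1 a ha]
  · rw [State.setNat_nat_ne _ _ _ (by omega), k3]
  · rw [State.setNat_nat_ne _ _ _ (by omega), l1 a ha]
  · rw [← h2, ← l2]; rfl
  · rw [← h3, ← l2]; rfl
  · rw [← h4, ← l2]; rfl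
  · rw [State.setNat_nat_ne _ _ _ (by omega), l3]
  · rw [State.setNat_nat_ne _ _ _ (by omega), l4]
  have hvt : ∀ q (hq : q < S.length), t.nat 2 (t.nat 7 0 + q) = S[q] := fun q hq => by
    rw [h1 2 (by omega), h1 7 (by omega), hv q hq]
  refine Runs.seq (runs_forward hV hE (fun a ha => ?_) hS ?_ hvt hn ?_) fun u hu => ?_
  · rw [h1 a (by omega), hI a ha]
  · rw [h1 1 (by omega), h1 6 (by omega), hlen]
  · exact ⟨fun _ _ => rfl, h5, rfl, fun _ _ => rfl, fun _ _ => rfl,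
      fun p hp h => absurd h (Nat.not_lt_zero p), fun p hp h => absurd h (Nat.not_lt_zero p),
      fun p hp h => absurd h (Nat.not_lt_zero _), Or.inl ⟨h7, h6,
      fun p hp h => absurd h (Nat.not_lt_zero p)⟩⟩
  have hub := hu.backward (by omega)
  refine Runs.seq (Runs.mono (runs_backward hS.nodup hvt hub) (by have := hub.lt; omega)
    fun _ h => h) fun w hw => ?_
  refine Does.seq (Q := fun x => x.rat = w.rat ∧ (∀ a < 7, x.nat a = s.nat a) ∧
    x.nat 7 0 = s.nat 7 0 + S.length) (Does.nset ⟨rfl, fun a ha => ?_, ?_⟩)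
    fun x ⟨k1, k2, k3⟩ => Does.nset ?_
  · rw [State.setNat_nat_ne _ _ _ (by omega), hw.nat a (by omega), h1 a (by omega)]
  · rw [NExpr.eval, State.setNat_nat_same]
    simp only [NExpr.eval, reg, hw.nat 7 (by omega), hw.nat 1 (by omega), hw.nat 6 (by omega),
      h1 7 (by omega), h1 1 (by omega), h1 6 (by omega), hlen]
  · have hr : ∀ e y, (x.setNat 6 e y).rat = w.rat := fun _ _ => k1
    have hst : w.rat 2 0 = s.rat 2 0 / S.length := by rw [hw.step, h4]
    refine ⟨fun a ha => ?_, ?_, ?_, ?_, fun j hj => ?_, fun j hj => ?_, fun v hv => ?_,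
      fun d hd hd3 => ?_, fun p hp hno => ?_⟩
    · rw [State.setNat_nat_ne _ _ _ (by omega), k2 a (by omega)]
    · rw [NExpr.eval, State.setNat_nat_same]
      simp only [NExpr.eval, reg, k2 6 (by omega)]
    · rw [State.setNat_nat_ne _ _ _ (by omega), k3]
    · rw [hr, hst]
    · rw [hr, hw.radius_ne j hj, h2]
    · rw [hr, hw.angle_ne j hj, h3]
    · rw [hr, hw.radius v hv, h1 0 (by omega), h1 6 (by omega)]
    · rw [hr, hw.north d hd hd3, h3]
    · rw [hr, hw.next p hp (Nat.zero_le p) hno, hst, h4]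

end segment

/-! ### The correctness of the program -/

section correct
variable {n : ℕ} {P : PlaneGraph n} {R : Rep P} {A : List (List (Fin n))} {s₀ s s' : State}

/-- North edges of a segment of a good sequence lead to earlier segments. -/
theorem Rep.IsGood.north_snd (hV : R.Valid) (hA : R.IsGood A) {i : ℕ} (hi : i < A.length)
    {d : P.G.Dart} (hd : R.dir d = 3) (hdi : d.fst ∈ A[i]) : d.snd ∈ verts (A.take i) := by
  rcases Nat.eq_zero_or_pos i with rfl | hpos
  · obtain ⟨S, B, rfl, hS, hO⟩ := hA.first_facts
    exact absurd hd (first_no_north hV hS hO hdi)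
  · have hAB : A = A.take i ++ A[i] :: A.drop (i + 1) := by
      rw [List.getElem_cons_drop, List.take_append_drop]
    have hne : A.take i ≠ [] := by
      rw [Ne, List.take_eq_nil_iff]
      rintro (h | rfl)
      · omega
      · simp at hi
    obtain ⟨l, rest, h⟩ := hA.attach hV hAB hne
    exact (h.down_of_mem ((h.north d).2 ⟨hd, hdi⟩)).2.1

theorem Rep.IsGood.not_mem_verts_take (hV : R.Valid) (hA : R.IsGood A) {i : ℕ} (hi : i < A.length)
    {v : Fin n} (hv : v ∈ verts (A.take i)) : v ∉ A[i] := by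
  obtain ⟨S, hS, hvS⟩ := hv
  rw [List.mem_take_iff_getElem] at hS
  obtain ⟨j, hj, rfl⟩ := hS
  exact List.pairwise_iff_getElem.1 (hA.pairwise_disjoint hV) j i (by omega) hi (by omega) v hvS

/-- The first `i` segments of `A` have been placed. -/
structure Progress (R : Rep P) (A : List (List (Fin n))) (s₀ : State) (i : ℕ) (s : State) :
    Prop where
  input : SameInput s₀ s
  index : s.nat 6 0 = i
  offset : s.nat 7 0 = (A.take i).flatten.length
  step : (s.rat 2 0 : ℝ) = delta (A.take i)
  radius : ∀ (j : ℕ) (hj : j < A.length), j < i → ∀ v ∈ A[j], s.rat 0 v = (A.length - j : ℕ)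
  placed : ∀ (j : ℕ) (hj : j < A.length), j < i →
    R.Placed (fun v => (s.rat 1 v : ℝ)) (delta (A.take (j + 1))) A[j]

/-- Placing the next segment extends the progress. It leaves the earlier segments in place, and the
steps agree with the factors of `delta`. -/
theorem Progress.succ (hV : R.Valid) (hA : R.IsGood A) (hE : Encodes R A s₀) {i : ℕ}
    (hi : i < A.length) (h : Progress R A s₀ i s) (h' : SegmentPlaced R A[i] s s') :
    Progress R A s₀ (i + 1) s' := by
  have htake : A.take (i + 1) = A.take i ++ [A[i]] := (List.take_append_getElem hi).symm
  have hdelta : (s'.rat 2 0 : ℝ) = delta (A.take (i + 1)) := by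
    rw [h'.step, htake, delta_append, ← h.step]
    push_cast
    rw [div_eq_mul_inv]
  have hold : ∀ v ∈ verts (A.take i), s'.rat 1 v = s.rat 1 v := fun v hv =>
    h'.angle_ne v fun w hw he => hA.not_mem_verts_take hV hi hv (by rwa [Fin.ext he])
  refine ⟨fun a ha => ?_, by rw [h'.index, h.index], ?_, hdelta, fun j hj hji v hv => ?_,
    fun j hj hji => ?_⟩
  · rw [h'.nat a ha, h.input a ha]
  · rw [h'.offset, h.offset, htake, List.flatten_append, List.length_append,
      List.flatten_singleton]
  · rcases Nat.lt_succ_iff_lt_or_eq.1 hji with hlt | rfl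
    · rw [h'.radius_ne v fun w hw he => hA.not_mem_verts_take hV hi
        (mem_verts_take hj hlt hv) (by rwa [Fin.ext he]), h.radius j hj hlt v hv]
    · rw [h'.radius v hv, h.input 0 (by omega), hE.length, h.index]
  · rcases Nat.lt_succ_iff_lt_or_eq.1 hji with hlt | rfl
    · have hp := h.placed j hj hlt
      have hmem : ∀ v ∈ A[j], s'.rat 1 v = s.rat 1 v := fun v hv =>
        hold v (mem_verts_take hj hlt hv)
      refine ⟨fun d hd hdj => ?_, fun q hq hno => ?_⟩
      · obtain ⟨S, hS, hdS⟩ := hA.north_snd hV hj hd hdj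
        have := hp.north d hd hdj
        beta_reduce at this ⊢
        rw [hmem _ hdj, hold d.snd ⟨S, List.take_subset_take_left A hlt.le hS, hdS⟩, this]
      · have := hp.step q hq hno
        beta_reduce at this ⊢
        rw [hmem _ (List.getElem_mem _), hmem _ (List.getElem_mem _), this]
    · refine ⟨fun d hd hdj => ?_, fun q hq hno => ?_⟩
      · rw [h'.north d hdj hd, hold _ (hA.north_snd hV hj hd hdj)]
      · rw [← hdelta, h'.next q hq hno]
        push_cast
        rfl

/-- The program places all segments in linear time. -/
theorem runs_drawProg (hV : R.Valid) (hA : R.IsGood A) (hE : Encodes R A s₀) :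
    Runs drawProg s₀ (Progress R A s₀ A.length) (423 * (A.map List.length).sum) := by
  have h2 : ∀ i (hi : i < A.length), 2 ≤ A[i].length := fun i hi =>
    (hA.segment _ (List.getElem_mem hi)).two_le
  have hpos : 1 ≤ (A.map List.length).sum := by
    obtain ⟨S, B, rfl, hS, -⟩ := hA.first_facts
    have := hS.two_le
    simp only [List.map_cons, List.sum_cons]
    omega
  have hsum : ∀ i (hi : i < A.length), ((A.drop i).map List.length).sum =
      A[i].length + ((A.drop (i + 1)).map List.length).sum := fun i hi => by
    rw [← List.getElem_cons_drop hi, List.map_cons, List.sum_cons]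
  -- the test of the loop costs `5`, which each segment and the final test add to the total
  suffices h : Runs drawProg s₀ (Progress R A s₀ A.length)
      (3 + (5 + 415 * ((A.drop (A.length - A.length)).map List.length).sum)) by
    refine Runs.mono h ?_ fun _ h => h
    rw [Nat.sub_self, List.drop_zero]
    omega
  refine Runs.seq (Q := Progress R A s₀ 0) (Does.qset ?_) fun s hs => ?_
  · refine ⟨fun a _ => rfl, hE.nat_zero 6 0 le_rfl, ?_, ?_, fun j _ h => absurd h (Nat.not_lt_zero j),
      fun j _ h => absurd h (Nat.not_lt_zero j)⟩
    · rw [List.take_zero]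
      exact hE.nat_zero 7 0 (by omega)
    · rw [NExpr.eval, State.setRat_rat_same]
      simp [QExpr.eval, delta]
  · have key := Runs.loop (b := .nlt (reg 6) (.arr 0 (.lit 0))) (p := placeSegment)
      (I := fun m s' => m ≤ A.length ∧ Progress R A s₀ (A.length - m) s')
      (Φ := fun m => 5 + 415 * ((A.drop (A.length - m)).map List.length).sum)
      (fun t ⟨_, ht⟩ => ?_) (Nat.le_add_right 5 _)
      (fun m t ⟨hm, ht⟩ => ?_) A.length (s := s) ⟨le_rfl, by rwa [Nat.sub_self]⟩
    · exact Runs.mono key le_rfl fun t ht => ht.2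
    · simp only [Test.Holds, NExpr.eval, reg, ht.index, ht.input 0 (by omega), hE.length]
      omega
    · have hq : A.length - (m + 1) < A.length := by omega
      have hq1 : A.length - m = A.length - (m + 1) + 1 := by omega
      rw [hq1]
      generalize A.length - (m + 1) = i at *
      refine ⟨?_, 410 * A[i].length, ?_, Runs.mono (runs_placeSegment (s := t) hV hE ht.input
        (hA.segment _ (List.getElem_mem hq)) ?_ (fun q hqi => ?_) fun d hd hdi =>
        hA.not_mem_verts_take hV hq (hA.north_snd hV hq hd hdi)) le_rfl
        fun u hu => ⟨by omega, ht.succ hV hA hE hq hu⟩⟩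
      · simp only [Test.Holds, NExpr.eval, reg, ht.index, ht.input 0 (by omega), hE.length]
        exact hq
      · change 5 + 410 * A[i].length + (5 + 415 * _) ≤ 5 + 415 * _
        have := h2 i hq
        rw [hsum i hq]
        omega
      · rw [ht.input 1 (by omega), ht.index, hE.lengths i hq]
      · rw [ht.input 2 (by omega), ht.offset, hE.vertex hq hqi]

end correct

end OrthoRadial
end

theorem mainTheorem3 :
    ∃ (prog : OrthoRadial.Prog) (C : ℕ), ∀ (n : ℕ) (P : OrthoRadial.PlaneGraph n)
      (R : OrthoRadial.Rep P) (A : List (List (Fin n))) (s : OrthoRadial.State),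
      P.Biconnected → R.Valid → R.IsGood A → OrthoRadial.Encodes R A s →
      ∃ (s' : OrthoRadial.State) (t : ℕ), OrthoRadial.Exec prog s s' t ∧
        t ≤ C * (A.map List.length).sum ∧
        R.IsGoodDrawing (s'.output n) A ∧ OrthoRadial.Concentric (s'.output n) A := by
  refine ⟨OrthoRadial.drawProg, 423, fun n P R A s _ hV hA hE => ?_⟩
  obtain ⟨s', t, hex, hs', ht⟩ := OrthoRadial.runs_drawProg hV hA hE
  refine ⟨s', t, hex, ht, ?_⟩
  exact hA.drawing (r := fun v => (s'.rat 0 v : ℝ)) (θ := fun v => (s'.rat 1 v : ℝ)) hV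
    (fun i hi v hv => by rw [hs'.radius i hi hi v hv]; push_cast [Nat.cast_sub hi.le]; rfl)
    fun B S B' hAB => by
      have hB : B.length < A.length := by rw [hAB]; simp
      have h := hs'.placed B.length hB hB
      have h1 : A.take (B.length + 1) = B ++ [S] := by rw [hAB, List.take_append]; simp
      have h2 : A[B.length] = S := by simp [hAB]
      rwa [h1, h2] at h
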